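/- Let $n\ge 1$ and $S<T$ be given. For $\nu\in\mathbb R^n\setminus\{0\}$ put $p_\nu(\tau,\xi)=-\tau-|\xi|^2+2i\,\nu\cdot\xi$, the symbol of $i\partial_t+\Delta+2\nu\cdot\nabla$, and for Schwartz functions $f$ on $\mathbb R\times\mathbb R^n$ let $$S_\nu f(t,x)=\frac1{(2\pi)^{(n+1)/2}}\int_{\mathbb R\times\mathbb R^n}e^{i(t\tau+x\cdot\xi)}\frac1{p_\nu(\tau,\xi)}\widehat f(\tau,\xi)\,d(\tau,\xi),\qquad \widehat f(\tau,\xi)=\frac1{(2\pi)^{(n+1)/2}}\int_{\mathbb R\times\mathbb R^n} e^{-i(t\tau+x\cdot\xi)}f(t,x)\,d(t,x).$$ Let $(a,b)\in[1,\infty]\times[1,\infty]$ satisfy $$2-\frac2a=\frac nb,\qquad (n,a,b)\ne(2,\infty,1).$$ Let $q,r\in[1,2]$ be given by $\frac2q-1=\frac1a$ and $\frac2r-1=\frac1b$, with conjugate exponents $q',r'$, and let $S_\nu$ also denote its extension by density to an operator from $L^q(\mathbb R;L^r(\mathbb R^n))$ to $L^{q'}(\mathbb R;L^{r'}(\mathbb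 R^n))$. For a unit vector $\omega$ and $s\in\mathbb R$ let $H_{\omega,s}=\{x\in\mathbb R^n:\omega\cdot x=s\}$, with its $(n-1)$-dimensional Lebesgue measure, and let $M_W$ denote multiplication by $W$. Let $W_1,W_2:\mathbb R\times\mathbb R^n\to\mathbb C$ be measurable functions supported in $[S,T]\times\mathbb R^n$ such that, for $j\in\{1,2\}$: (a) $|W_j|^2\in L^a(\mathbb R;L^b(\mathbb R^n))$; (b) there is $R_j>0$ such that $$\sup_{|\omega|=1}\int_{\mathbb R}\big\|\mathbf 1_{\{|x|>R_j\}}|W_j|^2\big\|_{L^\infty(\mathbb R\times H_{\omega,s})}\,ds<\infty,$$ and, if $n\ge3$ and $(a,b)=(\infty,n/2)$, also $\mathbf 1_{\{|x|\le R_j\}}W_j\in C(\mathbb R;L^n(\mathbb R^n))$. Then, for every $\nu\in\mathbb R^n\setminus\{0\}$, $M_{W_1}\circ S_\nu\circ M_{W_2}$ is a well-defined bounded operator on $L^2(\mathbb R\times\mathbb R^n)$, and $$\lim_{|\nu|\to\infty}\big\|M_{W_1}\circ S_\nu\circ M_{W_2}\big\|_{\mathcal L[L^2(\mathbb R\times\mathbb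 R^n)]}=0.$$ -/

import Mathlib

open MeasureTheory Filter Topology
open scoped ENNReal SchwartzMap

noncomputable section

namespace BirmanSchwinger

/-- The space `ℝⁿ` with its Euclidean structure and Lebesgue measure. -/
abbrev Space (n : ℕ) : Type := EuclideanSpace ℝ (Fin n)

/-- The space-time `ℝ × ℝⁿ`; its `volume` is Lebesgue measure. -/
abbrev SpaceTime (n : ℕ) : Type := ℝ × Space n

/-- The mixed norm of `L^q(ℝ; L^r(ℝⁿ))`, with values in `[0, ∞]`. -/
def mixedNorm {n : ℕ} {F : Type*} [NormedAddCommGroup F]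
    (q r : ℝ≥0∞) (f : SpaceTime n → F) : ℝ≥0∞ :=
  eLpNorm (fun t : ℝ => eLpNorm (fun x : Space n => f (t, x)) r volume) q volume

/-- Membership in the mixed-norm Lebesgue space `L^q(ℝ; L^r(ℝⁿ))`. -/
def MemMixed {n : ℕ} {F : Type*} [NormedAddCommGroup F]
    (q r : ℝ≥0∞) (f : SpaceTime n → F) : Prop :=
  AEStronglyMeasurable f volume ∧ mixedNorm q r f < ∞

/-- The Fourier transform on `ℝ × ℝⁿ`, in the unitary normalisation with angular frequencies:
`(2π)^{-(n+1)/2} ∫ e^{-i(tτ + x·ξ)} f(t, x) d(t, x)`. -/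
def fourier {n : ℕ} (f : SpaceTime n → ℂ) (ζ : SpaceTime n) : ℂ :=
  (((2 * Real.pi) ^ (-((n : ℝ) + 1) / 2) : ℝ) : ℂ) *
    ∫ z : SpaceTime n, Complex.exp (-Complex.I * ((z.1 * ζ.1 + inner ℝ z.2 ζ.2 : ℝ) : ℂ)) * f z

/-- The symbol `p_ν(τ, ξ) = -τ - |ξ|² + 2i ν·ξ` of `i∂ₜ + Δ + 2ν·∇`. -/
def symbol {n : ℕ} (ν : Space n) (ζ : SpaceTime n) : ℂ :=
  -(ζ.1 : ℂ) - ((‖ζ.2‖ ^ 2 : ℝ) : ℂ) + 2 * Complex.I * ((inner ℝ ν ζ.2 : ℝ) : ℂ)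

/-- The Fourier multiplier `S_ν` with symbol `1 / p_ν`, on Schwartz functions. For `ν ≠ 0` the
function `1 / p_ν` is locally integrable, its zero set `{p_ν = 0}` being a null set. -/
def schwartzS {n : ℕ} (ν : Space n) (f : 𝓢(SpaceTime n, ℂ)) (z : SpaceTime n) : ℂ :=
  (((2 * Real.pi) ^ (-((n : ℝ) + 1) / 2) : ℝ) : ℂ) *
    ∫ ζ : SpaceTime n, Complex.exp (Complex.I * ((z.1 * ζ.1 + inner ℝ z.2 ζ.2 : ℝ) : ℂ)) *
      ((symbol ν ζ)⁻¹ * fourier f ζ)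

/-- `IsS ν q r F G` says that `G = S_ν F`, where `S_ν` is extended by density from Schwartz
functions to an operator from `L^q(ℝ; L^r(ℝⁿ))` to `L^{q'}(ℝ; L^{r'}(ℝⁿ))`, with `q'`, `r'` the
conjugate exponents: some Schwartz functions `f k` converge to `F` in the first space while
`S_ν (f k)` converges to `G` in the second one. -/
def IsS {n : ℕ} (ν : Space n) (q r : ℝ≥0∞) (F G : SpaceTime n → ℂ) : Prop :=
  AEStronglyMeasurable F volume ∧ AEStronglyMeasurable G volume ∧
    ∃ f : ℕ → 𝓢(SpaceTime n, ℂ),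
      Tendsto (fun k => mixedNorm q r (fun z => f k z - F z)) atTop (𝓝 0) ∧
      Tendsto (fun k => mixedNorm q.conjExponent r.conjExponent
        (fun z => schwartzS ν (f k) z - G z)) atTop (𝓝 0)

/-- The exponent `q ∈ [1, 2]` with `2 / q - 1 = 1 / a`, that is `1 / q - 1 / q' = 1 / a`. -/
def lowerExponent (a : ℝ≥0∞) : ℝ≥0∞ := 2 / (1 + a⁻¹)

/-- The bounded operator `B` on `L²(ℝ × ℝⁿ)` is `M_{W₁} ∘ S_ν ∘ M_{W₂}`, for `|W_j|²` in
`L^a(ℝ; L^b(ℝⁿ))`: for every `u`, the function `S_ν (W₂ u)` exists, and `B u = W₁ S_ν (W₂ u)`. -/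
def IsMSM {n : ℕ} (a b : ℝ≥0∞) (W₁ W₂ : SpaceTime n → ℂ) (ν : Space n)
    (B : Lp ℂ 2 (volume : Measure (SpaceTime n)) →L[ℂ]
      Lp ℂ 2 (volume : Measure (SpaceTime n))) : Prop :=
  ∀ u : Lp ℂ 2 (volume : Measure (SpaceTime n)),
    (∃ G, IsS ν (lowerExponent a) (lowerExponent b) (fun z => W₂ z * u z) G) ∧
    ∀ G, IsS ν (lowerExponent a) (lowerExponent b) (fun z => W₂ z * u z) G →
      B u =ᵐ[volume] fun z => W₁ z * G z

/-- The natural `(n-1)`-dimensional Lebesgue measure on the hyperplane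
`{x : ω·x = s}`, for a unit vector `ω`: the push-forward of Lebesgue measure on `ω^⊥`
under `y ↦ y + s ω`. -/
def hyperplaneMeasure {n : ℕ} (ω : Space n) (s : ℝ) : Measure (Space n) :=
  (volume : Measure (ℝ ∙ ω)ᗮ).map (fun y : (ℝ ∙ ω)ᗮ => (y : Space n) + s • ω)

/-- The quantity
`sup_{|ω| = 1} ∫ ‖1_{|x| > R} |W|²‖_{L^∞(ℝ × {x : ω·x = s})} ds`. -/
def decayQuantity {n : ℕ} (R : ℝ) (W : SpaceTime n → ℂ) : ℝ≥0∞ :=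
  ⨆ ω : Metric.sphere (0 : Space n) 1, ∫⁻ s : ℝ,
    eLpNorm ({z : SpaceTime n | R < ‖z.2‖}.indicator (fun z => ‖W z‖ ^ 2)) ∞
      ((volume : Measure ℝ).prod (hyperplaneMeasure (ω : Space n) s))

/-- `1_{|x| ≤ R} W ∈ C(ℝ; L^p(ℝⁿ))`: for almost every `t` the function `1_{|x| ≤ R} W(t, ·)`
is `g t`, for some continuous `g : ℝ → L^p(ℝⁿ)`. -/
def ContinuousInTime {n : ℕ} (p : ℝ≥0∞) (R : ℝ) (W : SpaceTime n → ℂ) : Prop :=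
  ∃ g : ℝ → Space n → ℂ, (∀ t, MemLp (g t) p volume) ∧
    (∀ t, Tendsto (fun s => eLpNorm (g s - g t) p volume) (𝓝 t) (𝓝 0)) ∧
    ∀ᵐ t : ℝ, {x : Space n | ‖x‖ ≤ R}.indicator (fun x => W (t, x)) =ᵐ[volume] g t

end BirmanSchwinger

end

/-!
The operator `S_ν` is studied through the bilinear form
`(f, g) ↦ ∫ f̂(-ζ) ĝ(ζ) / p_ν(ζ) dζ`, with a Gaussian cut-off `e^{-ε(τ² + |ξ|²)}` that makes all
integrals absolutely convergent (`form`). Two bounds of this form are proved, both independent of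
`ε`.

The first is uniform in `ν` (`exists_form_le`). On the half-space `ν·ξ > 0`,
`1 / p_ν = -i ∫₀^∞ e^{-iu(τ + |ξ|²) - 2u ν·ξ} du`, so the form is an average over time translates
of the form `evol` of a damped Schrödinger evolution; the other half-space follows by complex
conjugation. At a fixed time the evolution satisfies the `L²` bound and the dispersive bound
`|t|^{-n/2}` with constants independent of `ν`: in the direction of `ν` only the monotonicity of
the damping enters, in van der Corput's estimate, and the orthogonal directions contribute a
Gaussian integral (`norm_kern_le_dispersive`, `exists_kern_decay`). The fixed-time bounds give the
mixed-norm bound by the Hardy–Littlewood–Sobolev inequality in time (`exists_evol_le_of_lt`), and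
at the endpoint `a = ∞`, `n ≥ 3`, by the argument of Keel and Tao (`exists_evol_le_endpoint`): the
form is cut dyadically in the time difference, the off-diagonal bounds of the pieces come from
`T*T`, and the sum over the pieces converges after `f` and `g` are cut into level sets. The
interpolation and the Hardy–Littlewood–Sobolev inequality are proved by the same decomposition
into level sets.

The second bound decays in `ν` (`enorm_form_le_waveNorm`). For `ν = aω` with `|ω| = 1`, the symbol
is a quadratic polynomial in `ω·ξ`, and one of its two roots lies at distance at least `a` from the
real line. Hence the inverse Fourier transform of `1 / p_ν` in this variable is bounded by `1 / a`,
up to a constant, and the form is `O(1 / a)` in the norm `waveNorm`, the integral over `s` of the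
`L²` norms on `{ω·x = s}`.

Letting `ε → 0`, by duality and by density of Schwartz functions, the first bound extends `S_ν` to
mixed-norm spaces (`FormBound.exists_isS`, `FormBound.isS_unique`) and makes `M_{W₁} S_ν M_{W₂}` a
bounded operator (`FormBound.exists_isMSM`); the second bound passes to the extension
(`FormBound.enorm_integral_isS_mul_le_waveNorm`).

For the limit, each potential is written as `W = V + Z`, where `Z` is the part of `W` in
`{|x| ≤ R, |W| > M}` (`exists_splitting`). For large `M`, `Z` is small in its mixed norm: by
dominated convergence if `a < ∞`, and by continuity in time and compactness of `[S, T]` if `a = ∞`.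
The suprema of `V` over the hyperplanes `{ω·x = s}` are square integrable in `s`, uniformly in `ω`.
In the expansion of the form of the operator all terms with a factor `Z` are small by the first
bound, and the term with `V₁` and `V₂` is `O(1 / |ν|)` by the second
(`FormBound.enorm_integral_split_le`).
-/

noncomputable section

namespace BirmanSchwinger

/-! ### Dyadic sums -/

lemma tsum_int_two_rpow_ne_top {c : ℝ} (hc : 0 < c) :
    ∑' k : ℤ, (2 : ℝ≥0∞) ^ (-c * |(k : ℝ)|) ≠ ∞ := by
  have hs : Summable (fun k : ℤ => (2 : ℝ) ^ (-c * |(k : ℝ)|)) := by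
    have hr : (2 : ℝ) ^ (-c) < 1 := Real.rpow_lt_one_of_one_lt_of_neg (by norm_num) (by linarith)
    have hg := summable_geometric_of_lt_one (r := (2 : ℝ) ^ (-c)) (by positivity) hr
    have hg' : Summable (fun k : ℕ => (2 : ℝ) ^ (-c * (k : ℝ))) := by
      refine hg.congr fun k => ?_
      rw [← Real.rpow_natCast, ← Real.rpow_mul (by norm_num)]
    refine Summable.of_nat_of_neg ?_ ?_ <;> simpa using hg'
  have : ∀ k : ℤ, (2 : ℝ≥0∞) ^ (-c * |(k : ℝ)|) = ENNReal.ofReal ((2 : ℝ) ^ (-c * |(k : ℝ)|)) := by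
    intro k
    rw [← ENNReal.ofReal_rpow_of_pos (by norm_num)]
    simp
  simp_rw [this]
  exact hs.tsum_ofReal_ne_top

/-- Sums of `2 ^ (-ε |x|)` over an arithmetic progression are bounded uniformly in its offset. -/
lemma exists_tsum_two_rpow_neg_abs_le {ε p : ℝ} (hε : 0 < ε) (hp : 0 < p) :
    ∃ C : ℝ≥0∞, C ≠ ∞ ∧ ∀ c : ℝ, ∑' k : ℤ, (2 : ℝ≥0∞) ^ (-ε * |k * p + c|) ≤ C := by
  refine ⟨(2 : ℝ≥0∞) ^ (ε * p) * ∑' k : ℤ, (2 : ℝ≥0∞) ^ (-(ε * p) * |(k : ℝ)|),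
    ENNReal.mul_ne_top (by simp) (tsum_int_two_rpow_ne_top (by positivity)), fun c => ?_⟩
  set m : ℤ := ⌊c / p⌋ with hm
  have h1 : (m : ℝ) * p ≤ c := by
    have := Int.floor_le (c / p)
    rwa [le_div_iff₀ hp] at this
  have h2 : c < ((m : ℝ) + 1) * p := by
    have := Int.lt_floor_add_one (c / p)
    rwa [div_lt_iff₀ hp] at this
  rw [← (Equiv.subRight m).tsum_eq, ← ENNReal.tsum_mul_left]
  refine ENNReal.tsum_le_tsum fun k => ?_
  rw [← ENNReal.rpow_add _ _ (by simp) (by simp)]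
  refine ENNReal.rpow_le_rpow_of_exponent_le (by norm_num) ?_
  have h3 : |(k : ℝ)| * p - p ≤ |((Equiv.subRight m k : ℤ) : ℝ) * p + c| := by
    simp only [Equiv.subRight_apply, Int.cast_sub]
    rcases abs_cases (k : ℝ) with ⟨h, _⟩ | ⟨h, _⟩ <;> rw [h]
    · refine le_trans ?_ (le_abs_self _); nlinarith
    · refine le_trans ?_ (neg_le_abs _); nlinarith
  nlinarith

lemma tsum_mul_mul_le_sqrt {ι : Type*} [Countable ι] (w x y : ι → ℝ≥0∞) :
    ∑' i, w i * x i * y i ≤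
      (∑' i, w i * x i ^ (2 : ℝ)) ^ (1 / 2 : ℝ) * (∑' i, w i * y i ^ (2 : ℝ)) ^ (1 / 2 : ℝ) := by
  let _ : MeasurableSpace ι := ⊤
  have h := ENNReal.lintegral_mul_le_Lp_mul_Lq (μ := (Measure.count : Measure ι))
    (p := 2) (q := 2) (Real.HolderConjugate.two_two)
    (f := fun i => w i ^ (1 / 2 : ℝ) * x i) (g := fun i => w i ^ (1 / 2 : ℝ) * y i)
    (measurable_from_top.aemeasurable) (measurable_from_top.aemeasurable)
  simp only [Pi.mul_apply, lintegral_count] at h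
  have h2 : ∀ i, (w i ^ (1 / 2 : ℝ)) * (w i ^ (1 / 2 : ℝ)) = w i := by
    intro i
    rw [← ENNReal.rpow_add_of_nonneg _ _ (by norm_num) (by norm_num)]; norm_num
  have h3 : ∀ (z : ι → ℝ≥0∞) i, (w i ^ (1 / 2 : ℝ) * z i) ^ (2 : ℝ) = w i * z i ^ (2 : ℝ) := by
    intro z i
    rw [ENNReal.mul_rpow_of_nonneg _ _ (by norm_num), ← ENNReal.rpow_mul]; norm_num
  simp_rw [h3] at h
  refine le_trans (le_of_eq (tsum_congr fun i => ?_)) h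
  calc w i * x i * y i = ((w i ^ (1 / 2 : ℝ)) * (w i ^ (1 / 2 : ℝ))) * x i * y i := by rw [h2]
    _ = _ := by ring

/-- Schur's test for sums over three indices. -/
lemma tsum_mul_mul_le_of_schur {ι κ l : Type*} [Countable ι] [Countable κ] [Countable l]
    (w : ι → κ → l → ℝ≥0∞) (x : κ → ℝ≥0∞) (y : l → ℝ≥0∞) {D : ℝ≥0∞}
    (h₁ : ∀ b, ∑' a, ∑' c, w a b c ≤ D) (h₂ : ∀ c, ∑' a, ∑' b, w a b c ≤ D) :
    ∑' i : ι × κ × l, w i.1 i.2.1 i.2.2 * x i.2.1 * y i.2.2 ≤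
      D * (∑' b, x b ^ (2 : ℝ)) ^ (1 / 2 : ℝ) * (∑' c, y c ^ (2 : ℝ)) ^ (1 / 2 : ℝ) := by
  refine (tsum_mul_mul_le_sqrt (fun i : ι × κ × l => w i.1 i.2.1 i.2.2) (fun i => x i.2.1)
    (fun i => y i.2.2)).trans ?_
  have hD : D = D ^ (1 / 2 : ℝ) * D ^ (1 / 2 : ℝ) := by
    rw [← ENNReal.rpow_add_of_nonneg _ _ (by norm_num) (by norm_num)]; norm_num
  have e1 : ∑' i : ι × κ × l, w i.1 i.2.1 i.2.2 * x i.2.1 ^ (2 : ℝ) ≤ D * ∑' b, x b ^ (2 : ℝ) := by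
    rw [ENNReal.tsum_prod']
    simp_rw [ENNReal.tsum_prod', ENNReal.tsum_mul_right]
    rw [ENNReal.tsum_comm]
    simp_rw [ENNReal.tsum_mul_right]
    rw [← ENNReal.tsum_mul_left]
    exact ENNReal.tsum_le_tsum fun b => mul_le_mul_left (h₁ b) _
  have e2 : ∑' i : ι × κ × l, w i.1 i.2.1 i.2.2 * y i.2.2 ^ (2 : ℝ) ≤ D * ∑' c, y c ^ (2 : ℝ) := by
    rw [ENNReal.tsum_prod']
    simp_rw [ENNReal.tsum_prod']
    have : ∀ a, ∑' b, ∑' c, w a b c * y c ^ (2 : ℝ) = ∑' c, (∑' b, w a b c) * y c ^ (2 : ℝ) := by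
      intro a
      rw [ENNReal.tsum_comm]
      simp_rw [ENNReal.tsum_mul_right]
    simp_rw [this]
    rw [ENNReal.tsum_comm]
    simp_rw [ENNReal.tsum_mul_right]
    rw [← ENNReal.tsum_mul_left]
    exact ENNReal.tsum_le_tsum fun b => mul_le_mul_left (h₂ b) _
  calc _ ≤ (D * ∑' b, x b ^ (2 : ℝ)) ^ (1 / 2 : ℝ) * (D * ∑' c, y c ^ (2 : ℝ)) ^ (1 / 2 : ℝ) := by
        gcongr
    _ = _ := by
        rw [ENNReal.mul_rpow_of_nonneg _ _ (by norm_num),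
          ENNReal.mul_rpow_of_nonneg _ _ (by norm_num)]
        nth_rewrite 3 [hD]
        ring

/-- The bilinear sum that closes the endpoint argument: decay in two independent linear
combinations of three dyadic indices leaves an `ℓ²`-bounded form. -/
lemma exists_tsum_dyadic_le {ε p s : ℝ} (hε : 0 < ε) (hp : 0 < p) (hs : 0 < s) :
    ∃ D : ℝ≥0∞, D ≠ ∞ ∧ ∀ x y : ℤ → ℝ≥0∞,
      ∑' i : ℤ × ℤ × ℤ, (2 : ℝ≥0∞) ^ (-ε * (|i.2.1 * p + i.1 * s| + |i.2.2 * p + i.1 * s|)) *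
          x i.2.1 * y i.2.2 ≤
        D * (∑' b, x b ^ (2 : ℝ)) ^ (1 / 2 : ℝ) * (∑' c, y c ^ (2 : ℝ)) ^ (1 / 2 : ℝ) := by
  obtain ⟨C, hC, hCp⟩ := exists_tsum_two_rpow_neg_abs_le hε hp
  obtain ⟨C', hC', hCs⟩ := exists_tsum_two_rpow_neg_abs_le hε hs
  refine ⟨C' * C, ENNReal.mul_ne_top hC' hC, fun x y => ?_⟩
  have hsplit : ∀ u v : ℝ, (2 : ℝ≥0∞) ^ (-ε * (|u| + |v|)) =
      (2 : ℝ≥0∞) ^ (-ε * |u|) * (2 : ℝ≥0∞) ^ (-ε * |v|) := by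
    intro u v
    rw [mul_add, ENNReal.rpow_add _ _ (by simp) (by simp)]
  refine tsum_mul_mul_le_of_schur
    (fun a b c : ℤ => (2 : ℝ≥0∞) ^ (-ε * (|b * p + a * s| + |c * p + a * s|))) x y ?_ ?_
  · intro b
    simp_rw [hsplit, ENNReal.tsum_mul_left]
    calc _ ≤ ∑' a : ℤ, (2 : ℝ≥0∞) ^ (-ε * |b * p + a * s|) * C := by
          refine ENNReal.tsum_le_tsum fun a => ?_
          gcongr
          exact hCp _
      _ ≤ _ := by
          rw [ENNReal.tsum_mul_right]
          gcongr
          simp_rw [add_comm ((b : ℝ) * p)]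
          exact hCs _
  · intro c
    simp_rw [hsplit, ENNReal.tsum_mul_right]
    calc _ ≤ ∑' a : ℤ, C * (2 : ℝ≥0∞) ^ (-ε * |c * p + a * s|) := by
          refine ENNReal.tsum_le_tsum fun a => ?_
          gcongr
          exact hCp _
      _ ≤ _ := by
          rw [ENNReal.tsum_mul_left, mul_comm]
          gcongr
          simp_rw [add_comm ((c : ℝ) * p)]
          exact hCs _

/-- The variant for a form of a single parameter, whose weight decays in the sum of the indices. -/
lemma exists_tsum_dyadic_add_le {ε : ℝ} (hε : 0 < ε) :
    ∃ D : ℝ≥0∞, D ≠ ∞ ∧ ∀ (c : ℝ) (x y : ℤ → ℝ≥0∞),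
      ∑' i : ℤ × ℤ, (2 : ℝ≥0∞) ^ (-ε * |i.1 + i.2 + c|) * x i.1 * y i.2 ≤
        D * (∑' b, x b ^ (2 : ℝ)) ^ (1 / 2 : ℝ) * (∑' c, y c ^ (2 : ℝ)) ^ (1 / 2 : ℝ) := by
  obtain ⟨C, hC, hCp⟩ := exists_tsum_two_rpow_neg_abs_le hε one_pos
  refine ⟨C, hC, fun c x y => ?_⟩
  have := tsum_mul_mul_le_of_schur
    (fun (_ : Unit) (k l : ℤ) => (2 : ℝ≥0∞) ^ (-ε * |k + l + c|)) x y (D := C) ?_ ?_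
  · rw [ENNReal.tsum_prod'] at this
    simpa using this
  · intro b
    simp only [tsum_fintype, Finset.univ_unique, Finset.sum_singleton]
    refine le_trans (le_of_eq (tsum_congr fun k => ?_)) (hCp (b + c))
    ring_nf
  · intro b
    simp only [tsum_fintype, Finset.univ_unique, Finset.sum_singleton]
    refine le_trans (le_of_eq (tsum_congr fun k => ?_)) (hCp (b + c))
    ring_nf

/-! ### Dyadic level sets and bilinear interpolation -/

section Band

variable {α : Type*}

/-- The `k`-th dyadic level set of `φ`, heights being measured in units of `N`, which may vary
from point to point. -/
def band (φ N : α → ℝ≥0∞) (k : ℤ) : Set α :=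
  {x | (2 : ℝ≥0∞) ^ k * N x ≤ φ x ∧ φ x < (2 : ℝ≥0∞) ^ (k + 1) * N x}

lemma pairwise_disjoint_band (φ N : α → ℝ≥0∞) : Pairwise (Function.onFun Disjoint (band φ N)) := by
  have key : ∀ k l : ℤ, k < l → Disjoint (band φ N k) (band φ N l) := by
    intro k l hkl
    refine Set.disjoint_left.2 fun x hx hy => ?_
    have h1 : (2 : ℝ≥0∞) ^ (k + 1) * N x ≤ (2 : ℝ≥0∞) ^ l * N x := by
      gcongr
      · norm_num
      · omega
    exact absurd (hx.2.trans_le (h1.trans hy.1)) (lt_irrefl _)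
  intro k l hkl
  rcases lt_or_gt_of_ne hkl with h | h
  · exact key k l h
  · exact (key l k h).symm

lemma exists_mem_band {φ N : α → ℝ≥0∞} {x : α} (h0 : φ x ≠ 0) (h1 : φ x ≠ ∞) (hN0 : N x ≠ 0)
    (hN1 : N x ≠ ∞) : ∃ k, x ∈ band φ N k := by
  obtain ⟨k, hk1, hk2⟩ := ENNReal.exists_mem_Ico_zpow (x := φ x / N x) (y := 2)
    (ENNReal.div_ne_zero.2 ⟨h0, hN1⟩) (ENNReal.div_ne_top h1 hN0) (by norm_num) (by simp)
  refine ⟨k, ?_, ?_⟩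
  · exact (ENNReal.le_div_iff_mul_le (Or.inl hN0) (Or.inl hN1)).1 hk1
  · exact (ENNReal.div_lt_iff (Or.inl hN0) (Or.inl hN1)).1 hk2

variable [MeasurableSpace α]

/-- The `k`-th coefficient of a function with `Lᵖ` norm `N` and modulus `φ`. For `p ≤ 2` these
coefficients are square-summable, and they control the `L^{p₁}` norms of the restrictions to the
level sets for all `p₁ ∈ [1, 2]` at the same time. -/
def bandCoeff (μ : Measure α) (p : ℝ) (φ : α → ℝ≥0∞) (N : ℝ≥0∞) (k : ℤ) : ℝ≥0∞ :=
  N * ((2 : ℝ≥0∞) ^ ((k : ℝ) * p) * μ (band φ (fun _ => N) k)) ^ (1 / 2 : ℝ)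

lemma measurableSet_band {φ N : α → ℝ≥0∞} (hφ : Measurable φ) (hN : Measurable N) (k : ℤ) :
    MeasurableSet (band φ N k) :=
  (measurableSet_le (hN.const_mul _) hφ).inter (measurableSet_lt hφ (hN.const_mul _))

lemma tsum_measure_band_le {μ : Measure α} {p : ℝ} (hp : 0 < p) {φ : α → ℝ≥0∞} (hφ : Measurable φ)
    {N : ℝ≥0∞} (hN0 : N ≠ 0) (hN1 : N ≠ ∞) (hN : ∫⁻ x, φ x ^ p ∂μ ≤ N ^ p) :
    ∑' k : ℤ, (2 : ℝ≥0∞) ^ ((k : ℝ) * p) * μ (band φ (fun _ => N) k) ≤ 1 := by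
  have hNp0 : N ^ p ≠ 0 := by simp [hN0, hN1]
  have hNp1 : N ^ p ≠ ∞ := ENNReal.rpow_ne_top_of_nonneg hp.le hN1
  have hm : ∀ k, MeasurableSet (band φ (fun _ => N) k) :=
    measurableSet_band hφ measurable_const
  rw [← ENNReal.mul_le_mul_iff_right hNp0 hNp1, mul_one, ← ENNReal.tsum_mul_left]
  calc _ ≤ ∑' k : ℤ, ∫⁻ x in band φ (fun _ => N) k, φ x ^ p ∂μ := by
        refine ENNReal.tsum_le_tsum fun k => ?_
        calc _ = ∫⁻ x in band φ (fun _ => N) k, ((2 : ℝ≥0∞) ^ k * N) ^ p ∂μ := by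
              rw [setLIntegral_const, ENNReal.mul_rpow_of_nonneg _ _ hp.le, ENNReal.rpow_mul,
                ENNReal.rpow_intCast]
              ring
          _ ≤ _ := by
              refine setLIntegral_mono' (hm k) fun x hx => ?_
              gcongr
              exact hx.1
    _ = ∫⁻ x in ⋃ k, band φ (fun _ => N) k, φ x ^ p ∂μ :=
        (lintegral_iUnion hm (pairwise_disjoint_band _ _) _).symm
    _ ≤ ∫⁻ x, φ x ^ p ∂μ := setLIntegral_le_lintegral _ _
    _ ≤ N ^ p := hN

lemma tsum_bandCoeff_sq_le {μ : Measure α} {p : ℝ} (hp : 0 < p) {φ : α → ℝ≥0∞} (hφ : Measurable φ)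
    {N : ℝ≥0∞} (hN : ∫⁻ x, φ x ^ p ∂μ ≤ N ^ p) :
    ∑' k : ℤ, bandCoeff μ p φ N k ^ (2 : ℝ) ≤ N ^ (2 : ℝ) := by
  by_cases hN0 : N = 0
  · simp [bandCoeff, hN0]
  by_cases hN1 : N = ∞
  · simp [hN1]
  calc _ = N ^ (2 : ℝ) * ∑' k : ℤ, (2 : ℝ≥0∞) ^ ((k : ℝ) * p) * μ (band φ (fun _ => N) k) := by
        rw [← ENNReal.tsum_mul_left]
        refine tsum_congr fun k => ?_
        rw [bandCoeff, ENNReal.mul_rpow_of_nonneg _ _ (by norm_num), ← ENNReal.rpow_mul]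
        norm_num
    _ ≤ N ^ (2 : ℝ) * 1 := by
        gcongr
        exact tsum_measure_band_le hp hφ hN0 hN1 hN
    _ = _ := mul_one _

/-- A function is comparable to `2ᵏ N` on its `k`-th level set, so that all its `Lᵖ¹` norms there
are determined by the measure of that set. For `N = 0` and `N = ∞` the level sets are empty. -/
lemma eLpNorm_band_indicator_le {ε : Type*} [TopologicalSpace ε] [ESeminormedAddMonoid ε]
    {μ : Measure α} {p p₁ : ℝ} (hp : 0 < p) (h₁ : 1 ≤ p₁) (h₂ : p₁ ≤ 2) {f : α → ε}
    (hφ : Measurable fun x => ‖f x‖ₑ) {N : ℝ≥0∞} (hN : ∫⁻ x, ‖f x‖ₑ ^ p ∂μ ≤ N ^ p) (k : ℤ) :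
    eLpNorm ((band (fun x => ‖f x‖ₑ) (fun _ => N) k).indicator f) (ENNReal.ofReal p₁) μ ≤
      2 * (2 : ℝ≥0∞) ^ ((k : ℝ) * (1 - p / p₁)) * bandCoeff μ p (fun x => ‖f x‖ₑ) N k := by
  set E := band (fun x => ‖f x‖ₑ) (fun _ => N) k with hE
  by_cases hN0 : N = 0
  · have : E = ∅ := by ext x; simp [hE, band, hN0]
    simp [this]
  by_cases hN1 : N = ∞
  · have : E = ∅ := by
      ext x
      simp only [hE, band, hN1, Set.mem_ofPred_eq, Set.mem_empty_iff_false, iff_false, not_and,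
        not_lt]
      intro hx
      rw [ENNReal.mul_top (by
        simp [(ENNReal.zpow_pos (by norm_num : (2:ℝ≥0∞) ≠ 0) (by simp) k).ne'])] at hx
      exact le_trans le_top hx
    simp [this]
  have hp0 : 0 < p₁ := by linarith
  set m := (2 : ℝ≥0∞) ^ ((k : ℝ) * p) * μ E with hm
  have hm1 : m ≤ 1 := (ENNReal.le_tsum k).trans (tsum_measure_band_le hp hφ hN0 hN1 hN)
  have hEm : μ E = (2 : ℝ≥0∞) ^ (-((k : ℝ) * p)) * m := by
    rw [hm, ← mul_assoc, ← ENNReal.rpow_add _ _ (by simp) (by simp)]; simp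
  calc eLpNorm (E.indicator f) (ENNReal.ofReal p₁) μ
      ≤ eLpNorm (E.indicator fun _ => (2 : ℝ≥0∞) ^ (k + 1) * N) (ENNReal.ofReal p₁) μ := by
        refine eLpNorm_mono_enorm fun x => ?_
        by_cases hx : x ∈ E
        · simpa [hx] using hx.2.le
        · simp [hx]
    _ ≤ ((2 : ℝ≥0∞) ^ (k + 1) * N) * μ E ^ (1 / p₁) := by
        refine (eLpNorm_indicator_const_le _ _).trans ?_
        rw [ENNReal.toReal_ofReal hp0.le]; simp
    _ = ((2 : ℝ≥0∞) ^ (k + 1) * N) * ((2 : ℝ≥0∞) ^ (-((k : ℝ) * p) / p₁) * m ^ (1 / p₁)) := by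
        rw [hEm, ENNReal.mul_rpow_of_nonneg _ _ (by positivity), ← ENNReal.rpow_mul]
        ring_nf
    -- As `m ≤ 1`, the exponent may be lowered to the one for which the coefficients are in `ℓ²`.
    _ ≤ ((2 : ℝ≥0∞) ^ (k + 1) * N) * ((2 : ℝ≥0∞) ^ (-((k : ℝ) * p) / p₁) * m ^ (1 / 2 : ℝ)) := by
        gcongr _ * (_ * ?_)
        refine ENNReal.rpow_le_rpow_of_exponent_ge hm1 ?_
        exact one_div_le_one_div_of_le hp0 h₂
    _ = _ := by
        have e1 : (2 : ℝ≥0∞) ^ (k + 1) = 2 * (2 : ℝ≥0∞) ^ (k : ℝ) := by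
          rw [ENNReal.rpow_intCast, ENNReal.zpow_add (by simp) (by simp)]
          simp [mul_comm]
        have e2 : (2 : ℝ≥0∞) ^ ((k : ℝ) * (1 - p / p₁)) =
            (2 : ℝ≥0∞) ^ (k : ℝ) * (2 : ℝ≥0∞) ^ (-((k : ℝ) * p) / p₁) := by
          rw [← ENNReal.rpow_add _ _ (by simp) (by simp)]
          congr 1; ring
        rw [e1, e2, bandCoeff, ← hE, ← hm]
        ring

/-- The norm of an integral is at most the sum of the norms of the integrals over the pieces of a
countable partition. -/
lemma enorm_integral_le_tsum {ι : Type*} [Countable ι] {μ : Measure α} {F : α → ℂ}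
    (hF : Integrable F μ) {A : ι → Set α} (hA : ∀ i, MeasurableSet (A i))
    (hd : Pairwise (Function.onFun Disjoint A)) (hc : ∀ᵐ x ∂μ, F x ≠ 0 → ∃ i, x ∈ A i) :
    ‖∫ x, F x ∂μ‖ₑ ≤ ∑' i, ‖∫ x in A i, F x ∂μ‖ₑ := by
  have h1 : ∫ x, F x ∂μ = ∫ x in ⋃ i, A i, F x ∂μ := by
    rw [← integral_indicator (MeasurableSet.iUnion hA)]
    refine integral_congr_ae ?_
    filter_upwards [hc] with x hx
    by_cases h : x ∈ ⋃ i, A i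
    · simp [h]
    · rw [Set.indicator_of_notMem h]
      by_contra h0
      exact h (Set.mem_iUnion.2 (hx h0))
  rw [h1, integral_iUnion hA hd hF.integrableOn]
  exact enorm_tsum_le_tsum_enorm

end Band

/-- The test functions: measurable, integrable and bounded. -/
structure Nice {α : Type*} [MeasurableSpace α] (μ : Measure α) (f : α → ℂ) : Prop where
  meas : Measurable f
  int : Integrable f μ
  bdd : ∃ M : ℝ, ∀ x, ‖f x‖ ≤ M

section Nice

variable {α : Type*} [MeasurableSpace α] {μ : Measure α} {f : α → ℂ}

lemma Nice.indicator (hf : Nice μ f) {A : Set α} (hA : MeasurableSet A) :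
    Nice μ (A.indicator f) := by
  obtain ⟨M, hM⟩ := hf.bdd
  exact ⟨hf.meas.indicator hA, hf.int.indicator hA, M, fun x =>
    (norm_indicator_le_norm_self _ _).trans (hM x)⟩

lemma Nice.memLp (hf : Nice μ f) {p : ℝ≥0∞} (hp : 1 ≤ p) : MemLp f p μ := by
  obtain ⟨M, hM⟩ := hf.bdd
  rcases eq_or_ne p ∞ with rfl | hpt
  · exact memLp_top_of_bound hf.meas.aestronglyMeasurable M (ae_of_all _ hM)
  have hp1 : 1 ≤ p.toReal := by
    rw [← ENNReal.toReal_one]; exact ENNReal.toReal_mono hpt hp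
  have hp0 : p ≠ 0 := (zero_lt_one.trans_le hp).ne'
  refine ⟨hf.meas.aestronglyMeasurable, ?_⟩
  rw [eLpNorm_lt_top_iff_lintegral_rpow_enorm_lt_top hp0 hpt]
  calc ∫⁻ x, ‖f x‖ₑ ^ p.toReal ∂μ ≤ ∫⁻ x, ENNReal.ofReal M ^ (p.toReal - 1) * ‖f x‖ₑ ∂μ := by
        refine lintegral_mono fun x => ?_
        have h1 : ‖f x‖ₑ ^ p.toReal = ‖f x‖ₑ ^ (p.toReal - 1) * ‖f x‖ₑ := by
          nth_rewrite 3 [← ENNReal.rpow_one ‖f x‖ₑ]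
          rw [← ENNReal.rpow_add_of_nonneg _ _ (by linarith) zero_le_one]
          ring_nf
        rw [h1]
        gcongr
        rw [← ofReal_norm]
        exact ENNReal.ofReal_le_ofReal (hM x)
    _ < ∞ := by
        rw [lintegral_const_mul _ hf.meas.enorm]
        exact ENNReal.mul_lt_top (ENNReal.rpow_lt_top_of_nonneg (by linarith) (by simp))
          hf.int.hasFiniteIntegral

end Nice

lemma lintegral_enorm_rpow_eq_eLpNorm {α ε : Type*} [MeasurableSpace α] [ENorm ε] {μ : Measure α}
    {p : ℝ} (hp : 0 < p) (f : α → ε) :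
    ∫⁻ x, ‖f x‖ₑ ^ p ∂μ = eLpNorm f (ENNReal.ofReal p) μ ^ p := by
  rw [eLpNorm_eq_lintegral_rpow_enorm_toReal (by simpa using hp) (by simp),
    ENNReal.toReal_ofReal hp.le, ← ENNReal.rpow_mul]
  field_simp
  simp

/-- Interpolation between an `L¹` and an `L²` bound of a bilinear form with bounded kernel. -/
theorem exists_interpolation {α : Type*} [MeasurableSpace α] (μ : Measure α) [SFinite μ]
    {p : ℝ} (hp₁ : 1 ≤ p) (hp₂ : p ≤ 2) :
    ∃ C : ℝ≥0∞, C ≠ ∞ ∧ ∀ (K : α → α → ℂ), Measurable (Function.uncurry K) →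
      (∃ M : ℝ, ∀ x y, ‖K x y‖ ≤ M) → ∀ (M : ℝ≥0∞) (ρ : ℝ),
      (∀ f g : α → ℂ, Nice μ f → Nice μ g →
        ‖∫ z : α × α, K z.1 z.2 * (f z.2 * g z.1) ∂(μ.prod μ)‖ₑ ≤
          M * (2 : ℝ≥0∞) ^ ρ * eLpNorm f 1 μ * eLpNorm g 1 μ) →
      (∀ f g : α → ℂ, Nice μ f → Nice μ g →
        ‖∫ z : α × α, K z.1 z.2 * (f z.2 * g z.1) ∂(μ.prod μ)‖ₑ ≤
          M * eLpNorm f 2 μ * eLpNorm g 2 μ) →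
      ∀ f g : α → ℂ, Nice μ f → Nice μ g →
        ‖∫ z : α × α, K z.1 z.2 * (f z.2 * g z.1) ∂(μ.prod μ)‖ₑ ≤
          C * (M * (2 : ℝ≥0∞) ^ (ρ * (2 / p - 1))) *
            eLpNorm f (ENNReal.ofReal p) μ * eLpNorm g (ENNReal.ofReal p) μ := by
  -- For `p = 1` and `p = 2` the claim is one of the two hypotheses.
  rcases eq_or_lt_of_le hp₁ with rfl | hp₁
  · refine ⟨1, by simp, fun K _ _ M ρ h1 _ f g hf hg => ?_⟩
    refine (h1 f g hf hg).trans (le_of_eq ?_)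
    norm_num
  rcases eq_or_lt_of_le hp₂ with rfl | hp₂
  · refine ⟨1, by simp, fun K _ _ M ρ _ h2 f g hf hg => ?_⟩
    refine (h2 f g hf hg).trans (le_of_eq ?_)
    norm_num
  set ε := min (p - 1) (1 - p / 2) with hε
  have hε0 : 0 < ε := lt_min (by linarith) (by linarith)
  obtain ⟨D, hD, hDs⟩ := exists_tsum_dyadic_add_le hε0
  refine ⟨4 * D, ENNReal.mul_ne_top (by simp) hD, fun K hK ⟨B, hB⟩ M ρ h1 h2 f g hf hg => ?_⟩
  have hp0 : 0 < p := by linarith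
  set Nf := eLpNorm f (ENNReal.ofReal p) μ
  set Ng := eLpNorm g (ENNReal.ofReal p) μ
  have hNf : ∫⁻ x, ‖f x‖ₑ ^ p ∂μ ≤ Nf ^ p := (lintegral_enorm_rpow_eq_eLpNorm hp0 f).le
  have hNg : ∫⁻ x, ‖g x‖ₑ ^ p ∂μ ≤ Ng ^ p := (lintegral_enorm_rpow_eq_eLpNorm hp0 g).le
  have hNft : Nf ≠ ∞ := (hf.memLp (by simpa using hp₁.le)).eLpNorm_ne_top
  have hNgt : Ng ≠ ∞ := (hg.memLp (by simpa using hp₁.le)).eLpNorm_ne_top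
  have hp' : ENNReal.ofReal p ≠ 0 := by simpa using hp0
  by_cases hNf0 : Nf = 0
  · have hf0 : f =ᵐ[μ] 0 := (eLpNorm_eq_zero_iff hf.meas.aestronglyMeasurable hp').1 hNf0
    have := h2 f g hf hg
    rw [eLpNorm_congr_ae hf0] at this
    simp at this
    simp [this]
  by_cases hNg0 : Ng = 0
  · have hf0 : g =ᵐ[μ] 0 := (eLpNorm_eq_zero_iff hg.meas.aestronglyMeasurable hp').1 hNg0
    have := h2 f g hf hg
    rw [eLpNorm_congr_ae hf0] at this
    simp at this
    simp [this]
  -- Both functions are cut into their dyadic level sets.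
  set E := band (fun x => ‖f x‖ₑ) (fun _ => Nf) with hE
  set G := band (fun x => ‖g x‖ₑ) (fun _ => Ng) with hG
  set e := bandCoeff μ p (fun x => ‖f x‖ₑ) Nf with he
  set e' := bandCoeff μ p (fun x => ‖g x‖ₑ) Ng with he'
  have hEm : ∀ k, MeasurableSet (E k) := measurableSet_band hf.meas.enorm measurable_const
  have hGm : ∀ k, MeasurableSet (G k) := measurableSet_band hg.meas.enorm measurable_const
  have hFint : Integrable (fun z : α × α => K z.1 z.2 * (f z.2 * g z.1)) (μ.prod μ) := by
    refine Integrable.bdd_mul (c := B) ?_ (by exact hK.aestronglyMeasurable)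
      (ae_of_all _ fun z => hB _ _)
    simpa [mul_comm] using hg.int.mul_prod hf.int
  have key : ∀ k l : ℤ, ‖∫ z in (G l) ×ˢ (E k), K z.1 z.2 * (f z.2 * g z.1) ∂(μ.prod μ)‖ₑ ≤
      4 * (M * (2 : ℝ≥0∞) ^ (ρ * (2 / p - 1))) *
        ((2 : ℝ≥0∞) ^ (-ε * |k + l + (-2 * ρ / p)|) * e k * e' l) := by
    intro k l
    have hrw : ∫ z in (G l) ×ˢ (E k), K z.1 z.2 * (f z.2 * g z.1) ∂(μ.prod μ) =
        ∫ z : α × α, K z.1 z.2 * ((E k).indicator f z.2 * (G l).indicator g z.1) ∂(μ.prod μ) := by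
      rw [← integral_indicator ((hGm l).prod (hEm k))]
      refine integral_congr_ae (ae_of_all _ fun z => ?_)
      by_cases ha : z.1 ∈ G l <;> by_cases hb : z.2 ∈ E k <;> simp [Set.indicator, ha, hb]
    rw [hrw]
    have hfk := hf.indicator (hEm k)
    have hgl := hg.indicator (hGm l)
    -- The two available bounds decay in `k + l - 2ρ/p` in opposite directions.
    have b1 : ‖∫ z : α × α, K z.1 z.2 * ((E k).indicator f z.2 * (G l).indicator g z.1)
        ∂(μ.prod μ)‖ₑ ≤ 4 * (M * (2 : ℝ≥0∞) ^ (ρ * (2 / p - 1))) *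
        ((2 : ℝ≥0∞) ^ (-(p - 1) * (k + l + (-2 * ρ / p))) * e k * e' l) := by
      refine (h1 _ _ hfk hgl).trans ?_
      have i1 := eLpNorm_band_indicator_le (μ := μ) hp0 le_rfl one_le_two hf.meas.enorm hNf k
      have i2 := eLpNorm_band_indicator_le (μ := μ) hp0 le_rfl one_le_two hg.meas.enorm hNg l
      rw [ENNReal.ofReal_one] at i1 i2
      calc _ ≤ M * (2 : ℝ≥0∞) ^ ρ * (2 * (2 : ℝ≥0∞) ^ ((k : ℝ) * (1 - p / 1)) * e k) *
            (2 * (2 : ℝ≥0∞) ^ ((l : ℝ) * (1 - p / 1)) * e' l) := by gcongr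
        _ = 4 * M * ((2 : ℝ≥0∞) ^ ρ * (2 : ℝ≥0∞) ^ ((k : ℝ) * (1 - p / 1)) *
              (2 : ℝ≥0∞) ^ ((l : ℝ) * (1 - p / 1))) * (e k * e' l) := by ring
        _ = 4 * M * ((2 : ℝ≥0∞) ^ (ρ * (2 / p - 1)) *
              (2 : ℝ≥0∞) ^ (-(p - 1) * (k + l + (-2 * ρ / p)))) * (e k * e' l) := by
            simp_rw [← ENNReal.rpow_add _ _ (two_ne_zero : (2 : ℝ≥0∞) ≠ 0) (ENNReal.ofNat_ne_top)]
            congr 3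
            field_simp
            ring
        _ = _ := by ring
    have b2 : ‖∫ z : α × α, K z.1 z.2 * ((E k).indicator f z.2 * (G l).indicator g z.1)
        ∂(μ.prod μ)‖ₑ ≤ 4 * (M * (2 : ℝ≥0∞) ^ (ρ * (2 / p - 1))) *
        ((2 : ℝ≥0∞) ^ ((1 - p / 2) * (k + l + (-2 * ρ / p))) * e k * e' l) := by
      refine (h2 _ _ hfk hgl).trans ?_
      have i1 := eLpNorm_band_indicator_le (μ := μ) hp0 one_le_two le_rfl hf.meas.enorm hNf k
      have i2 := eLpNorm_band_indicator_le (μ := μ) hp0 one_le_two le_rfl hg.meas.enorm hNg l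
      rw [ENNReal.ofReal_ofNat] at i1 i2
      calc _ ≤ M * (2 * (2 : ℝ≥0∞) ^ ((k : ℝ) * (1 - p / 2)) * e k) *
            (2 * (2 : ℝ≥0∞) ^ ((l : ℝ) * (1 - p / 2)) * e' l) := by gcongr
        _ = 4 * M * ((2 : ℝ≥0∞) ^ ((k : ℝ) * (1 - p / 2)) *
              (2 : ℝ≥0∞) ^ ((l : ℝ) * (1 - p / 2))) * (e k * e' l) := by ring
        _ = 4 * M * ((2 : ℝ≥0∞) ^ (ρ * (2 / p - 1)) *
              (2 : ℝ≥0∞) ^ ((1 - p / 2) * (k + l + (-2 * ρ / p)))) * (e k * e' l) := by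
            simp_rw [← ENNReal.rpow_add _ _ (two_ne_zero : (2 : ℝ≥0∞) ≠ 0) (ENNReal.ofNat_ne_top)]
            congr 3
            field_simp
            ring
        _ = _ := by ring
    have hmono : ∀ {a b : ℝ}, a ≤ b → (2 : ℝ≥0∞) ^ a ≤ (2 : ℝ≥0∞) ^ b := fun h =>
      ENNReal.rpow_le_rpow_of_exponent_le (by norm_num) h
    -- The `L¹` bound is used for large values of the functions and the `L²` bound for small ones.
    rcases le_total 0 ((k : ℝ) + l + (-2 * ρ / p)) with hZ | hZ
    · refine b1.trans ?_
      refine mul_le_mul_right (mul_le_mul_left (mul_le_mul_left (hmono ?_) _) _) _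
      rw [abs_of_nonneg hZ]
      exact mul_le_mul_of_nonneg_right (neg_le_neg (min_le_left _ _)) hZ
    · refine b2.trans ?_
      refine mul_le_mul_right (mul_le_mul_left (mul_le_mul_left (hmono ?_) _) _) _
      rw [abs_of_nonpos hZ]
      have := mul_le_mul_of_nonpos_right (min_le_right (p - 1) (1 - p / 2)) hZ
      linarith
  have hpart := enorm_integral_le_tsum (μ := μ.prod μ) hFint
    (A := fun i : ℤ × ℤ => (G i.2) ×ˢ (E i.1)) (fun i => (hGm _).prod (hEm _)) ?_ ?_
  · refine hpart.trans ?_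
    calc _ ≤ ∑' i : ℤ × ℤ, 4 * (M * (2 : ℝ≥0∞) ^ (ρ * (2 / p - 1))) *
        ((2 : ℝ≥0∞) ^ (-ε * |i.1 + i.2 + (-2 * ρ / p)|) * e i.1 * e' i.2) :=
          ENNReal.tsum_le_tsum fun i => key i.1 i.2
      _ ≤ 4 * (M * (2 : ℝ≥0∞) ^ (ρ * (2 / p - 1))) *
          (D * (Nf ^ (2 : ℝ)) ^ (1 / 2 : ℝ) * (Ng ^ (2 : ℝ)) ^ (1 / 2 : ℝ)) := by
          rw [ENNReal.tsum_mul_left]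
          gcongr
          refine (hDs _ e e').trans ?_
          gcongr
          · exact tsum_bandCoeff_sq_le hp0 hf.meas.enorm hNf
          · exact tsum_bandCoeff_sq_le hp0 hg.meas.enorm hNg
      _ = _ := by
          rw [← ENNReal.rpow_mul, ← ENNReal.rpow_mul]
          norm_num
          ring
  · rintro ⟨k, l⟩ ⟨k', l'⟩ h
    refine Set.disjoint_left.2 fun z hz hz' => h ?_
    have e1 : k = k' := by
      by_contra hne
      exact Set.disjoint_left.1 (pairwise_disjoint_band _ _ hne) hz.2 hz'.2
    have e2 : l = l' := by
      by_contra hne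
      exact Set.disjoint_left.1 (pairwise_disjoint_band _ _ hne) hz.1 hz'.1
    rw [e1, e2]
  · refine ae_of_all _ fun z hz => ?_
    have hfz : f z.2 ≠ 0 := fun h => hz (by simp [h])
    have hgz : g z.1 ≠ 0 := fun h => hz (by simp [h])
    obtain ⟨k, hk⟩ := exists_mem_band (φ := fun x => ‖f x‖ₑ) (N := fun _ => Nf) (x := z.2)
      (by simpa using hfz) (by simp) hNf0 hNft
    obtain ⟨l, hl⟩ := exists_mem_band (φ := fun x => ‖g x‖ₑ) (N := fun _ => Ng) (x := z.1)
      (by simpa using hgz) (by simp) hNg0 hNgt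
    exact ⟨(k, l), hl, hk⟩

/-! ### Convolution inequalities on the line -/

/-- The dyadic interval `[2ʲ, 2ʲ⁺¹)`. -/
def dyad (j : ℤ) : Set ℝ := Set.Ico ((2 : ℝ) ^ j) ((2 : ℝ) ^ (j + 1))

lemma measurableSet_dyad (j : ℤ) : MeasurableSet (dyad j) := measurableSet_Ico

lemma volume_dyad (j : ℤ) : volume (dyad j) = (2 : ℝ≥0∞) ^ (j : ℝ) := by
  rw [dyad, Real.volume_Ico, zpow_add₀ (by norm_num), zpow_one, mul_two, add_sub_cancel_right,
    ← Real.rpow_intCast, ← ENNReal.ofReal_rpow_of_pos (by norm_num)]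
  simp

lemma pairwise_disjoint_dyad : Pairwise (Function.onFun Disjoint dyad) := by
  have key : ∀ k l : ℤ, k < l → Disjoint (dyad k) (dyad l) := by
    intro k l hkl
    refine Set.disjoint_left.2 fun x hx hy => ?_
    have h1 : (2 : ℝ) ^ (k + 1) ≤ (2 : ℝ) ^ l := zpow_le_zpow_right₀ (by norm_num) (by omega)
    exact absurd (hx.2.trans_le (h1.trans hy.1)) (lt_irrefl _)
  intro k l hkl
  rcases lt_or_gt_of_ne hkl with h | h
  · exact key k l h
  · exact (key l k h).symm

lemma exists_mem_dyad {w : ℝ} (hw : 0 < w) : ∃ j, w ∈ dyad j :=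
  exists_mem_Ico_zpow hw (by norm_num)

lemma measurable_indicator_dyad_sub (j : ℤ) :
    Measurable fun z : ℝ × ℝ => (dyad j).indicator (1 : ℝ → ℝ≥0∞) (z.1 - z.2) :=
  (measurable_one.indicator (measurableSet_dyad j)).comp (measurable_fst.sub measurable_snd)

lemma eLpNorm_two_eq {α : Type*} [MeasurableSpace α] {μ : Measure α} (φ : α → ℝ≥0∞) :
    eLpNorm φ 2 μ = (∫⁻ x, φ x ^ (2 : ℝ) ∂μ) ^ (1 / 2 : ℝ) := by
  rw [eLpNorm_eq_lintegral_rpow_enorm_toReal (by simp) (by simp)]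
  simp

lemma lintegral_mul_le_two {α : Type*} [MeasurableSpace α] {μ : Measure α} {φ ψ : α → ℝ≥0∞}
    (hφ : AEMeasurable φ μ) (hψ : AEMeasurable ψ μ) :
    ∫⁻ x, φ x * ψ x ∂μ ≤ eLpNorm φ 2 μ * eLpNorm ψ 2 μ := by
  rw [eLpNorm_two_eq, eLpNorm_two_eq]
  exact ENNReal.lintegral_mul_le_Lp_mul_Lq μ Real.HolderConjugate.two_two hφ hψ

/-- Schur's test. -/
lemma lintegral_schur_le {α β : Type*} [MeasurableSpace α] [MeasurableSpace β] {μ : Measure α}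
    {ν : Measure β} [SFinite μ] [SFinite ν] {k : α × β → ℝ≥0∞} {φ : β → ℝ≥0∞} {ψ : α → ℝ≥0∞}
    (hk : Measurable k) (hφ : Measurable φ) (hψ : Measurable ψ) {C : ℝ≥0∞}
    (h₁ : ∀ y, ∫⁻ x, k (x, y) ∂μ ≤ C) (h₂ : ∀ x, ∫⁻ y, k (x, y) ∂ν ≤ C) :
    ∫⁻ z, k z * (φ z.2 * ψ z.1) ∂(μ.prod ν) ≤ C * eLpNorm φ 2 ν * eLpNorm ψ 2 μ := by
  have hh : ∀ a : ℝ≥0∞, a = a ^ (1 / 2 : ℝ) * a ^ (1 / 2 : ℝ) := fun a => by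
    rw [← ENNReal.rpow_add_of_nonneg _ _ (by norm_num) (by norm_num)]; norm_num
  have hsq : ∀ a b : ℝ≥0∞, (a ^ (1 / 2 : ℝ) * b) ^ (2 : ℝ) = a * b ^ (2 : ℝ) := fun a b => by
    rw [ENNReal.mul_rpow_of_nonneg _ _ (by norm_num), ← ENNReal.rpow_mul]; norm_num
  have h := lintegral_mul_le_two (μ := μ.prod ν)
    (φ := fun z => k z ^ (1 / 2 : ℝ) * φ z.2)
    (ψ := fun z => k z ^ (1 / 2 : ℝ) * ψ z.1)
    ((hk.pow_const _).mul (hφ.comp measurable_snd)).aemeasurable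
    ((hk.pow_const _).mul (hψ.comp measurable_fst)).aemeasurable
  rw [eLpNorm_two_eq, eLpNorm_two_eq] at h
  simp_rw [hsq] at h
  rw [lintegral_prod_symm (fun z : α × β => k z * φ z.2 ^ (2 : ℝ))
      (hk.mul ((hφ.comp measurable_snd).pow_const _)).aemeasurable,
    lintegral_prod (fun z : α × β => k z * ψ z.1 ^ (2 : ℝ))
      (hk.mul ((hψ.comp measurable_fst).pow_const _)).aemeasurable] at h
  have e1 : ∫⁻ y, ∫⁻ x, k (x, y) * φ y ^ (2 : ℝ) ∂μ ∂ν ≤ C * ∫⁻ y, φ y ^ (2 : ℝ) ∂ν := by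
    rw [← lintegral_const_mul _ (hφ.pow_const _)]
    refine lintegral_mono fun y => ?_
    rw [lintegral_mul_const _ (by fun_prop)]
    gcongr
    exact h₁ y
  have e2 : ∫⁻ x, ∫⁻ y, k (x, y) * ψ x ^ (2 : ℝ) ∂ν ∂μ ≤ C * ∫⁻ x, ψ x ^ (2 : ℝ) ∂μ := by
    rw [← lintegral_const_mul _ (hψ.pow_const _)]
    refine lintegral_mono fun x => ?_
    rw [lintegral_mul_const _ (by fun_prop)]
    gcongr
    exact h₂ x
  rw [eLpNorm_two_eq, eLpNorm_two_eq]
  calc _ = ∫⁻ z : α × β, (k z ^ (1 / 2 : ℝ) * φ z.2) *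
        (k z ^ (1 / 2 : ℝ) * ψ z.1) ∂(μ.prod ν) := by
        refine lintegral_congr fun z => ?_
        nth_rewrite 1 [hh (k z)]
        ring
    _ ≤ _ := h
    _ ≤ (C * ∫⁻ y, φ y ^ (2 : ℝ) ∂ν) ^ (1 / 2 : ℝ) *
        (C * ∫⁻ x, ψ x ^ (2 : ℝ) ∂μ) ^ (1 / 2 : ℝ) := by
        gcongr
    _ = _ := by
        rw [ENNReal.mul_rpow_of_nonneg _ _ (by norm_num),
          ENNReal.mul_rpow_of_nonneg _ _ (by norm_num)]
        nth_rewrite 3 [hh C]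
        ring

/-- Young's inequality `L¹ * L² ⊆ L²`, in bilinear form. -/
lemma lintegral_convolution_le {k φ ψ : ℝ → ℝ≥0∞} (hk : Measurable k) (hφ : Measurable φ)
    (hψ : Measurable ψ) :
    ∫⁻ z : ℝ × ℝ, k (z.1 - z.2) * (φ z.2 * ψ z.1) ≤
      (∫⁻ w, k w) * eLpNorm φ 2 volume * eLpNorm ψ 2 volume :=
  lintegral_schur_le (k := fun z : ℝ × ℝ => k (z.1 - z.2)) (by fun_prop) hφ hψ
    (fun y => (lintegral_sub_right_eq_self k y).le) fun x => (lintegral_sub_left_eq_self k x).le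

/-- The part of a convolution form where the difference of the times lies in a dyadic interval. -/
def dyadForm (j : ℤ) (φ ψ : ℝ → ℝ≥0∞) : ℝ≥0∞ :=
  ∫⁻ z : ℝ × ℝ, (dyad j).indicator 1 (z.1 - z.2) * (φ z.2 * ψ z.1)

lemma dyadForm_le_two_two (j : ℤ) {φ ψ : ℝ → ℝ≥0∞} (hφ : Measurable φ) (hψ : Measurable ψ) :
    dyadForm j φ ψ ≤ (2 : ℝ≥0∞) ^ (j : ℝ) * eLpNorm φ 2 volume * eLpNorm ψ 2 volume := by
  refine (lintegral_convolution_le (measurable_one.indicator (measurableSet_dyad j)) hφ hψ).trans ?_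
  rw [lintegral_indicator_one (measurableSet_dyad j), volume_dyad]

lemma lintegral_dyad_mul_le (j : ℤ) {φ : ℝ → ℝ≥0∞} (hφ : Measurable φ) (u : ℝ → ℝ)
    (hu : MeasurePreserving u) :
    ∫⁻ s, (dyad j).indicator 1 (u s) * φ s ≤ (2 : ℝ≥0∞) ^ ((j : ℝ) / 2) * eLpNorm φ 2 volume := by
  have hm : Measurable ((dyad j).indicator (1 : ℝ → ℝ≥0∞)) :=
    measurable_one.indicator (measurableSet_dyad j)
  refine (lintegral_mul_le_two (φ := fun s => (dyad j).indicator 1 (u s))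
    (hm.comp hu.measurable).aemeasurable hφ.aemeasurable).trans (le_of_eq ?_)
  congr 1
  rw [eLpNorm_two_eq]
  have : ∀ s, (dyad j).indicator (1 : ℝ → ℝ≥0∞) (u s) ^ (2 : ℝ) = (dyad j).indicator 1 (u s) := by
    intro s
    by_cases h : u s ∈ dyad j <;> simp [h]
  simp_rw [this]
  rw [hu.lintegral_comp hm, lintegral_indicator_one (measurableSet_dyad j), volume_dyad,
    ← ENNReal.rpow_mul]
  ring_nf

lemma measurePreserving_sub_left_real (t : ℝ) : MeasurePreserving fun s : ℝ => t - s :=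
  Measure.measurePreserving_sub_left volume t

lemma dyadForm_le_two_one (j : ℤ) {φ ψ : ℝ → ℝ≥0∞} (hφ : Measurable φ) (hψ : Measurable ψ) :
    dyadForm j φ ψ ≤ (2 : ℝ≥0∞) ^ ((j : ℝ) / 2) * eLpNorm φ 2 volume * eLpNorm ψ 1 volume := by
  have hm : Measurable fun z : ℝ × ℝ => (dyad j).indicator (1 : ℝ → ℝ≥0∞) (z.1 - z.2) *
      (φ z.2 * ψ z.1) :=
    (measurable_indicator_dyad_sub j).mul ((hφ.comp measurable_snd).mul (hψ.comp measurable_fst))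
  rw [dyadForm, Measure.volume_eq_prod, lintegral_prod _ hm.aemeasurable,
    eLpNorm_one_eq_lintegral_enorm, ← lintegral_const_mul _ hψ.enorm]
  refine lintegral_mono fun t => ?_
  calc _ = (∫⁻ s, (dyad j).indicator 1 (t - s) * φ s) * ψ t := by
        rw [← lintegral_mul_const]
        · simp only [mul_assoc]
        · exact ((measurable_one.indicator (measurableSet_dyad j)).comp
            (measurable_const.sub measurable_id)).mul hφ
    _ ≤ _ := by
        gcongr
        · exact lintegral_dyad_mul_le j hφ _ (measurePreserving_sub_left_real t)
        · simp

lemma dyadForm_le_one_two (j : ℤ) {φ ψ : ℝ → ℝ≥0∞} (hφ : Measurable φ) (hψ : Measurable ψ) :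
    dyadForm j φ ψ ≤ (2 : ℝ≥0∞) ^ ((j : ℝ) / 2) * eLpNorm φ 1 volume * eLpNorm ψ 2 volume := by
  have hm : Measurable fun z : ℝ × ℝ => (dyad j).indicator (1 : ℝ → ℝ≥0∞) (z.1 - z.2) *
      (φ z.2 * ψ z.1) :=
    (measurable_indicator_dyad_sub j).mul ((hφ.comp measurable_snd).mul (hψ.comp measurable_fst))
  rw [dyadForm, Measure.volume_eq_prod, lintegral_prod_symm _ hm.aemeasurable,
    eLpNorm_one_eq_lintegral_enorm, mul_right_comm, ← lintegral_const_mul _ hφ.enorm]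
  refine lintegral_mono fun s => ?_
  calc _ = (∫⁻ t, (dyad j).indicator 1 (t - s) * ψ t) * φ s := by
        rw [← lintegral_mul_const]
        · refine lintegral_congr fun t => ?_
          ring
        · exact ((measurable_one.indicator (measurableSet_dyad j)).comp
            (measurable_id.sub_const s)).mul hψ
    _ ≤ (2 : ℝ≥0∞) ^ ((j : ℝ) / 2) * eLpNorm ψ 2 volume * φ s := by
        gcongr
        exact lintegral_dyad_mul_le j hψ _ (measurePreserving_sub_right volume s)
    _ = _ := by simp

lemma dyadForm_le_one_one (j : ℤ) {φ ψ : ℝ → ℝ≥0∞} (hφ : Measurable φ) (hψ : Measurable ψ) :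
    dyadForm j φ ψ ≤ eLpNorm φ 1 volume * eLpNorm ψ 1 volume := by
  have : ∫⁻ z : ℝ × ℝ, φ z.2 * ψ z.1 = eLpNorm φ 1 volume * eLpNorm ψ 1 volume := by
    simp_rw [mul_comm (φ _)]
    rw [Measure.volume_eq_prod, lintegral_prod_mul hψ.aemeasurable hφ.aemeasurable, mul_comm]
    simp [eLpNorm_one_eq_lintegral_enorm]
  rw [← this]
  refine lintegral_mono fun z => ?_
  by_cases h : z.1 - z.2 ∈ dyad j <;> simp [h]

lemma dyadForm_le (j : ℤ) {φ ψ : ℝ → ℝ≥0∞} (hφ : Measurable φ) (hψ : Measurable ψ) {p₁ p₂ : ℝ}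
    (h₁ : p₁ = 1 ∨ p₁ = 2) (h₂ : p₂ = 1 ∨ p₂ = 2) :
    dyadForm j φ ψ ≤ (2 : ℝ≥0∞) ^ ((j : ℝ) * (2 - 1 / p₁ - 1 / p₂)) *
      eLpNorm φ (ENNReal.ofReal p₁) volume * eLpNorm ψ (ENNReal.ofReal p₂) volume := by
  rcases h₁ with rfl | rfl <;> rcases h₂ with rfl | rfl
  · refine (dyadForm_le_one_one j hφ hψ).trans (le_of_eq ?_)
    norm_num
  · refine (dyadForm_le_one_two j hφ hψ).trans (le_of_eq ?_)
    rw [ENNReal.ofReal_one, ENNReal.ofReal_ofNat]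
    congr 3; ring
  · refine (dyadForm_le_two_one j hφ hψ).trans (le_of_eq ?_)
    rw [ENNReal.ofReal_one, ENNReal.ofReal_ofNat]
    congr 3; ring
  · refine (dyadForm_le_two_two j hφ hψ).trans (le_of_eq ?_)
    rw [ENNReal.ofReal_ofNat]
    congr 3; ring

/-- The Hardy-Littlewood-Sobolev inequality on the line, in bilinear form. -/
theorem exists_hardy_littlewood_sobolev {q : ℝ} (hq₁ : 1 < q) (hq₂ : q < 2) :
    ∃ C : ℝ≥0∞, C ≠ ∞ ∧ ∀ φ ψ : ℝ → ℝ≥0∞, Measurable φ → Measurable ψ →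
      ∫⁻ z in {z : ℝ × ℝ | z.2 < z.1},
          ENNReal.ofReal (z.1 - z.2) ^ (-(2 - 2 / q)) * (φ z.2 * ψ z.1) ≤
        C * eLpNorm φ (ENNReal.ofReal q) volume * eLpNorm ψ (ENNReal.ofReal q) volume := by
  have hq0 : 0 < q := by linarith
  set ε := min (1 - 1 / q) (1 / q - 1 / 2) with hε
  have hε1 : 0 < 1 - 1 / q := by
    rw [sub_pos, div_lt_one hq0]; exact hq₁
  have hε2 : 0 < 1 / q - 1 / 2 := by
    rw [sub_pos]; exact one_div_lt_one_div_of_lt hq0 hq₂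
  have hε0 : 0 < ε := lt_min hε1 hε2
  obtain ⟨D, hD, hDs⟩ := exists_tsum_dyadic_le hε0 hq0 one_pos
  refine ⟨4 * D, ENNReal.mul_ne_top (by simp) hD, fun φ ψ hφ hψ => ?_⟩
  set Nf := eLpNorm φ (ENNReal.ofReal q) volume
  set Ng := eLpNorm ψ (ENNReal.ofReal q) volume
  have hNf : ∫⁻ x, ‖φ x‖ₑ ^ q ≤ Nf ^ q := (lintegral_enorm_rpow_eq_eLpNorm hq0 φ).le
  have hNg : ∫⁻ x, ‖ψ x‖ₑ ^ q ≤ Ng ^ q := (lintegral_enorm_rpow_eq_eLpNorm hq0 ψ).le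
  have hq' : ENNReal.ofReal q ≠ 0 := by simpa using hq0
  have hqmp1 : Measure.QuasiMeasurePreserving (Prod.fst : ℝ × ℝ → ℝ) :=
    Measure.quasiMeasurePreserving_fst
  have hqmp2 : Measure.QuasiMeasurePreserving (Prod.snd : ℝ × ℝ → ℝ) :=
    Measure.quasiMeasurePreserving_snd
  by_cases hNf0 : Nf = 0
  · have hf0 : φ =ᵐ[volume] 0 := (eLpNorm_eq_zero_iff hφ.aestronglyMeasurable hq').1 hNf0
    have : ∫⁻ z in {z : ℝ × ℝ | z.2 < z.1},
        ENNReal.ofReal (z.1 - z.2) ^ (-(2 - 2 / q)) * (φ z.2 * ψ z.1) = ∫⁻ z : ℝ × ℝ in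
          {z : ℝ × ℝ | z.2 < z.1}, 0 := by
      refine lintegral_congr_ae (ae_restrict_of_ae ?_)
      filter_upwards [hqmp2.ae hf0] with z hz
      simp [hz]
    rw [this]; simp
  by_cases hNg0 : Ng = 0
  · have hf0 : ψ =ᵐ[volume] 0 := (eLpNorm_eq_zero_iff hψ.aestronglyMeasurable hq').1 hNg0
    have : ∫⁻ z in {z : ℝ × ℝ | z.2 < z.1},
        ENNReal.ofReal (z.1 - z.2) ^ (-(2 - 2 / q)) * (φ z.2 * ψ z.1) = ∫⁻ z : ℝ × ℝ in
          {z : ℝ × ℝ | z.2 < z.1}, 0 := by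
      refine lintegral_congr_ae (ae_restrict_of_ae ?_)
      filter_upwards [hqmp1.ae hf0] with z hz
      simp [hz]
    rw [this]; simp
  -- `D ≠ 0` is needed because `0 * ∞ = 0`.
  by_cases hD0 : 4 * D = 0
  · exfalso
    have hD0 : D = 0 := by simpa using hD0
    have := hDs (fun _ => 1) (fun _ => 1)
    rw [hD0, zero_mul, zero_mul, nonpos_iff_eq_zero, ENNReal.tsum_eq_zero] at this
    simpa using this (0, 0, 0)
  by_cases hNft : Nf = ∞
  · rw [hNft, ENNReal.mul_top hD0, ENNReal.top_mul hNg0]; exact le_top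
  by_cases hNgt : Ng = ∞
  · rw [hNgt, ENNReal.mul_top (mul_ne_zero hD0 hNf0)]; exact le_top
  set E := band (fun x => ‖φ x‖ₑ) (fun _ => Nf) with hE
  set G := band (fun x => ‖ψ x‖ₑ) (fun _ => Ng) with hG
  set e := bandCoeff volume q (fun x => ‖φ x‖ₑ) Nf with he
  set e' := bandCoeff volume q (fun x => ‖ψ x‖ₑ) Ng with he'
  have hEm : ∀ k, MeasurableSet (E k) := measurableSet_band hφ.enorm measurable_const
  have hGm : ∀ k, MeasurableSet (G k) := measurableSet_band hψ.enorm measurable_const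
  have hft : ∀ᵐ x, φ x < ∞ := by
    have : ∫⁻ x, φ x ^ q ≠ ∞ := (hNf.trans_lt (ENNReal.rpow_lt_top_of_nonneg hq0.le hNft)).ne
    filter_upwards [ae_lt_top (hφ.pow_const q) this] with x hx
    exact (ENNReal.rpow_lt_top_iff_of_pos hq0).1 hx
  have hgt : ∀ᵐ x, ψ x < ∞ := by
    have : ∫⁻ x, ψ x ^ q ≠ ∞ := (hNg.trans_lt (ENNReal.rpow_lt_top_of_nonneg hq0.le hNgt)).ne
    filter_upwards [ae_lt_top (hψ.pow_const q) this] with x hx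
    exact (ENNReal.rpow_lt_top_iff_of_pos hq0).1 hx
  -- For each pair of levels the exponents can be chosen so that the bound decays in both indices.
  have key : ∀ j k l : ℤ, (2 : ℝ≥0∞) ^ (-((j : ℝ) * (2 - 2 / q))) *
      dyadForm j ((E k).indicator φ) ((G l).indicator ψ) ≤
        4 * ((2 : ℝ≥0∞) ^ (-ε * (|k * q + j * 1| + |l * q + j * 1|)) * e k * e' l) := by
    intro j k l
    have choice : ∀ X : ℝ, ∃ p : ℝ, (p = 1 ∨ p = 2) ∧ -(1 / p - 1 / q) * X ≤ -ε * |X| := by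
      intro X
      rcases le_total 0 X with hX | hX
      · refine ⟨1, Or.inl rfl, ?_⟩
        rw [abs_of_nonneg hX]
        have := mul_le_mul_of_nonneg_right (min_le_left (1 - 1 / q) (1 / q - 1 / 2)) hX
        rw [← hε] at this
        linarith
      · refine ⟨2, Or.inr rfl, ?_⟩
        rw [abs_of_nonpos hX]
        have := mul_le_mul_of_nonpos_right (min_le_right (1 - 1 / q) (1 / q - 1 / 2)) hX
        rw [← hε] at this
        linarith
    obtain ⟨p₁, hp₁, hX⟩ := choice (k * q + j * 1)
    obtain ⟨p₂, hp₂, hY⟩ := choice (l * q + j * 1)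
    have i1 := eLpNorm_band_indicator_le (μ := volume) (p₁ := p₁) hq0
      (by rcases hp₁ with h | h <;> norm_num [h]) (by rcases hp₁ with h | h <;> norm_num [h])
      hφ.enorm hNf k
    have i2 := eLpNorm_band_indicator_le (μ := volume) (p₁ := p₂) hq0
      (by rcases hp₂ with h | h <;> norm_num [h]) (by rcases hp₂ with h | h <;> norm_num [h])
      hψ.enorm hNg l
    have i3 := dyadForm_le j (hφ.indicator (hEm k)) (hψ.indicator (hGm l)) hp₁ hp₂
    have h10 : p₁ ≠ 0 := by rcases hp₁ with h | h <;> norm_num [h]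
    have h20 : p₂ ≠ 0 := by rcases hp₂ with h | h <;> norm_num [h]
    calc _ ≤ (2 : ℝ≥0∞) ^ (-((j : ℝ) * (2 - 2 / q))) *
          ((2 : ℝ≥0∞) ^ ((j : ℝ) * (2 - 1 / p₁ - 1 / p₂)) *
          (2 * (2 : ℝ≥0∞) ^ ((k : ℝ) * (1 - q / p₁)) * e k) *
          (2 * (2 : ℝ≥0∞) ^ ((l : ℝ) * (1 - q / p₂)) * e' l)) := by
          gcongr
          refine i3.trans ?_
          gcongr
      _ = 4 * (((2 : ℝ≥0∞) ^ (-((j : ℝ) * (2 - 2 / q))) *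
          (2 : ℝ≥0∞) ^ ((j : ℝ) * (2 - 1 / p₁ - 1 / p₂)) *
          (2 : ℝ≥0∞) ^ ((k : ℝ) * (1 - q / p₁)) *
          (2 : ℝ≥0∞) ^ ((l : ℝ) * (1 - q / p₂))) * e k * e' l) := by ring
      _ = 4 * ((2 : ℝ≥0∞) ^ (-(1 / p₁ - 1 / q) * (k * q + j * 1) +
            -(1 / p₂ - 1 / q) * (l * q + j * 1)) * e k * e' l) := by
          simp_rw [← ENNReal.rpow_add _ _ (two_ne_zero : (2 : ℝ≥0∞) ≠ 0) (ENNReal.ofNat_ne_top)]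
          congr 4
          field_simp
          ring
      _ ≤ _ := by
          refine mul_le_mul_right (mul_le_mul_left (mul_le_mul_left
            (ENNReal.rpow_le_rpow_of_exponent_le (by norm_num) ?_) _) _) _
          linarith
  set A : ℤ × ℤ × ℤ → Set (ℝ × ℝ) := fun i =>
    (fun z : ℝ × ℝ => z.1 - z.2) ⁻¹' (dyad i.1) ∩ (G i.2.2) ×ˢ (E i.2.1) with hA
  have hAm : ∀ i, MeasurableSet (A i) := fun i =>
    ((measurable_fst.sub measurable_snd) (measurableSet_dyad i.1)).inter ((hGm _).prod (hEm _))
  set F : ℝ × ℝ → ℝ≥0∞ := fun z => ENNReal.ofReal (z.1 - z.2) ^ (-(2 - 2 / q)) * (φ z.2 * ψ z.1)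
    with hF
  calc ∫⁻ z in {z : ℝ × ℝ | z.2 < z.1}, F z ≤ ∫⁻ z in ⋃ i, A i, F z := by
        rw [← lintegral_indicator (measurableSet_lt measurable_snd measurable_fst),
          ← lintegral_indicator (MeasurableSet.iUnion hAm)]
        refine lintegral_mono_ae ?_
        filter_upwards [hqmp2.ae hft, hqmp1.ae hgt] with z h1 h2
        by_cases hz : z.2 < z.1
        · by_cases hφ0 : φ z.2 = 0
          · simp [hF, Set.indicator, hφ0]
          by_cases hψ0 : ψ z.1 = 0
          · simp [hF, Set.indicator, hψ0]
          obtain ⟨j, hj⟩ := exists_mem_dyad (sub_pos.2 hz)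
          obtain ⟨k, hk⟩ := exists_mem_band (φ := fun x => ‖φ x‖ₑ) (N := fun _ => Nf) (x := z.2)
            (by simpa using hφ0) (by simpa using h1.ne) hNf0 hNft
          obtain ⟨l, hl⟩ := exists_mem_band (φ := fun x => ‖ψ x‖ₑ) (N := fun _ => Ng) (x := z.1)
            (by simpa using hψ0) (by simpa using h2.ne) hNg0 hNgt
          have hzA : z ∈ ⋃ i, A i := Set.mem_iUnion.2 ⟨(j, k, l), hj, hl, hk⟩
          rw [Set.indicator_of_mem hzA]
          exact Set.indicator_le_self _ _ _
        · rw [Set.indicator_of_notMem (by simpa using hz)]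
          exact zero_le
    _ ≤ ∑' i, ∫⁻ z in A i, F z := lintegral_iUnion_le _ _
    _ ≤ ∑' i : ℤ × ℤ × ℤ, 4 * ((2 : ℝ≥0∞) ^ (-ε * (|i.2.1 * q + i.1 * 1| + |i.2.2 * q + i.1 * 1|)) *
          e i.2.1 * e' i.2.2) := by
        refine ENNReal.tsum_le_tsum fun i => ?_
        refine le_trans ?_ (key i.1 i.2.1 i.2.2)
        rw [dyadForm, ← lintegral_const_mul _ (by
          exact (measurable_indicator_dyad_sub _).mul
            (((hφ.indicator (hEm _)).comp measurable_snd).mul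
              ((hψ.indicator (hGm _)).comp measurable_fst))), ← lintegral_indicator (hAm i)]
        refine lintegral_mono fun z => ?_
        by_cases hz : z ∈ A i
        · obtain ⟨h1, h2, h3⟩ := hz
          have h1' : z.1 - z.2 ∈ dyad i.1 := h1
          rw [Set.indicator_of_mem (show z ∈ A i from ⟨h1, h2, h3⟩)]
          simp only [hF, Set.indicator_of_mem h1', Set.indicator_of_mem h2,
            Set.indicator_of_mem h3, Pi.one_apply, one_mul]
          gcongr
          have hγ : 0 ≤ 2 - 2 / q := by
            have : 2 / q = 2 * (1 / q) := by ring
            rw [this]; linarith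
          rw [← mul_neg, ENNReal.rpow_mul]
          rw [ENNReal.rpow_neg, ENNReal.rpow_neg, ENNReal.inv_le_inv]
          refine ENNReal.rpow_le_rpow ?_ hγ
          rw [ENNReal.rpow_intCast]
          have : (2 : ℝ≥0∞) ^ i.1 = ENNReal.ofReal ((2 : ℝ) ^ i.1) := by
            rw [← ENNReal.rpow_intCast, ← Real.rpow_intCast,
              ← ENNReal.ofReal_rpow_of_pos (by norm_num)]
            simp
          rw [this]
          exact ENNReal.ofReal_le_ofReal h1'.1
        · rw [Set.indicator_of_notMem hz]; exact zero_le
    _ ≤ 4 * (D * (Nf ^ (2 : ℝ)) ^ (1 / 2 : ℝ) * (Ng ^ (2 : ℝ)) ^ (1 / 2 : ℝ)) := by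
        rw [ENNReal.tsum_mul_left]
        gcongr
        refine (hDs e e').trans ?_
        gcongr
        · exact tsum_bandCoeff_sq_le hq0 hφ.enorm hNf
        · exact tsum_bandCoeff_sq_le hq0 hψ.enorm hNg
    _ = _ := by
        rw [← ENNReal.rpow_mul, ← ENNReal.rpow_mul]
        norm_num
        ring

/-! ### The van der Corput estimate on the half-line -/

section VanDerCorput

open Complex

/-- Van der Corput's estimate away from the stationary point, by one integration by parts. The two
boundary terms contribute `1 / μ` each, and the variation of the amplitude contributes `3 / μ`. -/
lemma norm_integral_phase_le {a τ ε κ μ α β : ℝ} (hε : 0 ≤ ε) (hκ : 0 ≤ κ) (hμ : 0 < μ)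
    (hτ : τ ≠ 0) (hα : 0 ≤ α) (hαβ : α ≤ β) (h : ∀ s ∈ Set.Icc α β, μ ≤ |a - 2 * τ * s|) :
    ‖∫ s in α..β, cexp (((a * s - τ * s ^ 2 : ℝ) : ℂ) * I) *
      (Real.exp (-ε * s ^ 2 - κ * s) : ℂ)‖ ≤ 5 / μ := by
  set φ' : ℝ → ℝ := fun s => a - 2 * τ * s with hφ'
  set hh : ℝ → ℝ := fun s => Real.exp (-ε * s ^ 2 - κ * s) with hhh
  set P : ℝ → ℂ := fun s => cexp (((a * s - τ * s ^ 2 : ℝ) : ℂ) * I) with hP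
  have huI : Set.uIcc α β = Set.Icc α β := Set.uIcc_of_le hαβ
  have hne : ∀ s ∈ Set.Icc α β, φ' s ≠ 0 := fun s hs h0 => by
    have := h s hs
    simp only [hφ'] at h0
    rw [h0, abs_zero] at this
    linarith
  have hP1 : ∀ s, ‖P s‖ = 1 := fun s => Complex.norm_exp_ofReal_mul_I _
  have hh0 : ∀ s, 0 < hh s := fun s => Real.exp_pos _
  have hh1 : ∀ s, 0 ≤ s → hh s ≤ 1 := fun s hs => by
    refine Real.exp_le_one_iff.2 ?_
    nlinarith [mul_nonneg hε (sq_nonneg s), mul_nonneg hκ hs]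
  have dφ : ∀ s, HasDerivAt φ' (-2 * τ) s := fun s => by
    simpa using ((hasDerivAt_id s).const_mul (2 * τ)).const_sub a
  have dh : ∀ s, HasDerivAt hh (-(2 * ε * s + κ) * hh s) s := fun s => by
    have : HasDerivAt (fun s : ℝ => -ε * s ^ 2 - κ * s) (-(2 * ε * s + κ)) s := by
      convert! ((hasDerivAt_pow 2 s).const_mul (-ε)).sub ((hasDerivAt_id s).const_mul κ) using 1
      simp; ring
    convert! this.exp using 1
    simp only [hhh]; ring
  have dP : ∀ s, HasDerivAt P (P s * ((φ' s : ℝ) * I)) s := fun s => by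
    have h1 : HasDerivAt (fun s : ℝ => a * s - τ * s ^ 2) (φ' s) s := by
      convert! ((hasDerivAt_id s).const_mul a).sub ((hasDerivAt_pow 2 s).const_mul τ) using 1
      simp [hφ']; ring
    exact (h1.ofReal_comp.mul_const I).cexp
  -- the amplitude after one integration by parts, and a function dominating its variation
  set b : ℝ → ℝ := fun s => hh s / φ' s with hb
  set b' : ℝ → ℝ := fun s => (-(2 * ε * s + κ) * hh s * φ' s - hh s * (-2 * τ)) / φ' s ^ 2 with hb'
  have db : ∀ s ∈ Set.Icc α β, HasDerivAt b (b' s) s := fun s hs => (dh s).div (dφ s) (hne s hs)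
  set Q : ℝ → ℝ := fun s => -hh s / μ + |τ| / τ / φ' s with hQ
  set Q' : ℝ → ℝ := fun s => (2 * ε * s + κ) * hh s / μ + |τ| / τ * (2 * τ / φ' s ^ 2) with hQ'
  have dQ : ∀ s ∈ Set.Icc α β, HasDerivAt Q (Q' s) s := fun s hs => by
    have h1 := ((dh s).neg.div_const μ).add (((dφ s).inv (hne s hs)).const_mul (|τ| / τ))
    convert! h1 using 1
    simp only [hQ']; ring
  have cφ : Continuous φ' := by fun_prop
  have ch : Continuous hh := by fun_prop
  have cP : Continuous P := by fun_prop
  have cb' : ContinuousOn b' (Set.Icc α β) := by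
    refine ContinuousOn.div (by fun_prop) (by fun_prop) fun s hs => pow_ne_zero 2 (hne s hs)
  have cQ' : ContinuousOn Q' (Set.Icc α β) := by
    refine ContinuousOn.add (by fun_prop) (continuousOn_const.mul ?_)
    exact ContinuousOn.div (by fun_prop) (by fun_prop) fun s hs => pow_ne_zero 2 (hne s hs)
  have hbQ : ∀ s ∈ Set.Icc α β, |b' s| ≤ Q' s := by
    intro s hs
    have h0 : 0 < |φ' s| := abs_pos.2 (hne s hs)
    have hs0 : 0 ≤ s := hα.trans hs.1
    have e1 : b' s = -((2 * ε * s + κ) * hh s) / φ' s + hh s * (2 * τ / φ' s ^ 2) := by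
      simp only [hb']
      field_simp [hne s hs]
      ring
    have e2 : |τ| / τ * (2 * τ / φ' s ^ 2) = 2 * |τ| / φ' s ^ 2 := by field_simp
    rw [e1]
    refine (abs_add_le _ _).trans (add_le_add ?_ ?_)
    · rw [abs_div, abs_neg, abs_of_nonneg (by have := (hh0 s).le; positivity)]
      have := (hh0 s).le
      gcongr
      exact h s hs
    · rw [e2, abs_mul, abs_of_pos (hh0 s), abs_div, abs_mul, abs_two,
        abs_of_nonneg (sq_nonneg (φ' s))]
      exact mul_le_of_le_one_left (by positivity) (hh1 s hs0)
  have ibp : ∫ s in α..β, (P s * (hh s : ℂ) + P s * (-I * (b' s : ℂ))) =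
      P β * (-I * (b β : ℂ)) - P α * (-I * (b α : ℂ)) := by
    refine intervalIntegral.integral_eq_sub_of_hasDerivAt
      (f := fun s => P s * (-I * (b s : ℂ))) ?_ ?_
    · intro s hs
      rw [huI] at hs
      convert! (dP s).mul (((db s hs).ofReal_comp).const_mul (-I)) using 1
      have := hne s hs
      have h2 : (φ' s : ℂ) ≠ 0 := by exact_mod_cast this
      simp only [hb, ofReal_div]
      field_simp
      linear_combination (P s * (hh s : ℂ)) * I_sq
    · refine ContinuousOn.intervalIntegrable ?_
      rw [huI]
      have : ContinuousOn (fun s => (b' s : ℂ)) (Set.Icc α β) :=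
        continuous_ofReal.comp_continuousOn cb'
      fun_prop
  have i1 : IntervalIntegrable (fun s => P s * (hh s : ℂ)) volume α β :=
    (by fun_prop : Continuous fun s => P s * (hh s : ℂ)).intervalIntegrable _ _
  have i2 : IntervalIntegrable (fun s => P s * (-I * (b' s : ℂ))) volume α β := by
    refine ContinuousOn.intervalIntegrable ?_
    rw [huI]
    have : ContinuousOn (fun s => (b' s : ℂ)) (Set.Icc α β) :=
      continuous_ofReal.comp_continuousOn cb'
    fun_prop
  have i3 : IntervalIntegrable Q' volume α β :=
    ContinuousOn.intervalIntegrable (by rw [huI]; exact cQ')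
  rw [intervalIntegral.integral_add i1 i2] at ibp
  have hα' : α ∈ Set.Icc α β := ⟨le_rfl, hαβ⟩
  have hβ' : β ∈ Set.Icc α β := ⟨hαβ, le_rfl⟩
  have hbb : ∀ s ∈ Set.Icc α β, |b s| ≤ 1 / μ := by
    intro s hs
    rw [hb, abs_div, abs_of_pos (hh0 s)]
    exact div_le_div₀ zero_le_one (hh1 s (hα.trans hs.1)) hμ (h s hs)
  have hq : ∀ s ∈ Set.Icc α β, |(|τ| / τ / φ' s)| ≤ 1 / μ := by
    intro s hs
    rw [abs_div, abs_div, abs_abs, div_self (abs_pos.2 hτ).ne']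
    exact one_div_le_one_div_of_le hμ (h s hs)
  have hint : ‖∫ s in α..β, P s * (-I * (b' s : ℂ))‖ ≤ 3 / μ := by
    calc _ ≤ ∫ s in α..β, Q' s := by
          refine intervalIntegral.norm_integral_le_of_norm_le hαβ ?_ i3
          refine ae_of_all _ fun s hs => ?_
          rw [norm_mul, hP1, norm_mul, norm_neg, norm_I, one_mul, one_mul, norm_real]
          exact hbQ s ⟨hs.1.le, hs.2⟩
      _ = Q β - Q α := intervalIntegral.integral_eq_sub_of_hasDerivAt
          (fun s hs => dQ s (huI ▸ hs)) i3
      _ ≤ _ := by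
          have e1 := abs_le.1 (hq α hα')
          have e2 := abs_le.1 (hq β hβ')
          have e3 : hh α / μ ≤ 1 / μ := by
            gcongr
            exact hh1 α hα
          have e4 : 0 ≤ hh β / μ := by have := (hh0 β).le; positivity
          have e5 : 3 / μ = 1 / μ + 1 / μ + 1 / μ := by ring
          simp only [hQ, neg_div]
          linarith [e1.1, e2.2]
  have hbd : ∀ s ∈ Set.Icc α β, ‖P s * (-I * (b s : ℂ))‖ ≤ 1 / μ := by
    intro s hs
    rw [norm_mul, hP1, norm_mul, norm_neg, norm_I, one_mul, one_mul, norm_real]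
    exact hbb s hs
  have : ∫ s in α..β, P s * (hh s : ℂ) = P β * (-I * (b β : ℂ)) - P α * (-I * (b α : ℂ)) -
      ∫ s in α..β, P s * (-I * (b' s : ℂ)) := by
    rw [← ibp]; ring
  rw [this]
  calc _ ≤ 1 / μ + 1 / μ + 3 / μ := by
        refine (norm_sub_le _ _).trans (add_le_add ((norm_sub_le _ _).trans
          (add_le_add (hbd β hβ') (hbd α hα'))) hint)
    _ = _ := by ring

/-- The one-dimensional dispersive estimate. The damping may be arbitrarily strong or weak: only
its monotonicity enters. -/
lemma norm_integral_Ioi_phase_le {a τ ε κ : ℝ} (hε : 0 < ε) (hκ : 0 ≤ κ) (hτ : τ ≠ 0) :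
    ‖∫ s in Set.Ioi (0 : ℝ), cexp (((a * s - τ * s ^ 2 : ℝ) : ℂ) * I) *
      (Real.exp (-ε * s ^ 2 - κ * s) : ℂ)‖ ≤ 7 * |τ| ^ (-(1 / 2) : ℝ) := by
  set F : ℝ → ℂ := fun s => cexp (((a * s - τ * s ^ 2 : ℝ) : ℂ) * I) *
      (Real.exp (-ε * s ^ 2 - κ * s) : ℂ) with hF
  have hFc : Continuous F := by fun_prop
  have hFn : ∀ s, ‖F s‖ = Real.exp (-ε * s ^ 2 - κ * s) := fun s => by
    rw [hF, norm_mul, Complex.norm_exp_ofReal_mul_I, one_mul, norm_real, Real.norm_eq_abs,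
      abs_of_pos (Real.exp_pos _)]
  have hF1 : ∀ s, 0 ≤ s → ‖F s‖ ≤ 1 := fun s hs => by
    rw [hFn]
    refine Real.exp_le_one_iff.2 ?_
    nlinarith [mul_nonneg hε.le (sq_nonneg s), mul_nonneg hκ hs]
  have hFi : IntegrableOn F (Set.Ioi 0) := by
    refine Integrable.mono' (integrable_exp_neg_mul_sq hε).integrableOn hFc.aestronglyMeasurable ?_
    filter_upwards [ae_restrict_mem measurableSet_Ioi] with s hs
    rw [hFn]
    refine Real.exp_le_exp.2 ?_
    have : 0 ≤ κ * s := mul_nonneg hκ (le_of_lt hs)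
    linarith
  -- The half-line is split at distance `δ` from the stationary point `s₀`. Outside the window the
  -- derivative of the phase is at least `2|τ|δ`; the window itself has length at most `2δ`.
  set δ := |τ| ^ (-(1 / 2) : ℝ) with hδ
  have hτ0 : 0 < |τ| := abs_pos.2 hτ
  have hδ0 : 0 < δ := Real.rpow_pos_of_pos hτ0 _
  have hδτ : |τ| * δ * δ = 1 := by
    rw [hδ, mul_assoc, ← Real.rpow_add hτ0]
    norm_num
    rw [Real.rpow_neg_one, mul_inv_cancel₀ hτ0.ne']
  set s₀ := a / (2 * τ) with hs₀
  have hphase : ∀ s, |a - 2 * τ * s| = 2 * |τ| * |s - s₀| := fun s => by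
    have : a - 2 * τ * s = -(2 * τ * (s - s₀)) := by rw [hs₀]; field_simp; ring
    rw [this, abs_neg, abs_mul, abs_mul, abs_two]
  have htend := intervalIntegral_tendsto_integral_Ioi 0 hFi tendsto_id
  refine le_of_tendsto htend.norm ?_
  filter_upwards [eventually_ge_atTop 0] with N hN
  simp only [id]
  set p := max 0 (min N (s₀ - δ)) with hp
  set q := max 0 (min N (s₀ + δ)) with hq
  have hp0 : 0 ≤ p := le_max_left _ _
  have hpN : p ≤ N := max_le hN (min_le_left _ _)
  have hqN : q ≤ N := max_le hN (min_le_left _ _)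
  have hpq : p ≤ q := max_le_max le_rfl (min_le_min le_rfl (by linarith))
  have hqp : q - p ≤ 2 * δ := by
    rw [hp, hq]
    rcases max_cases 0 (min N (s₀ + δ)) with ⟨h1, h1'⟩ | ⟨h1, h1'⟩ <;>
    rcases max_cases 0 (min N (s₀ - δ)) with ⟨h2, h2'⟩ | ⟨h2, h2'⟩ <;>
    rcases min_cases N (s₀ + δ) with ⟨h3, h3'⟩ | ⟨h3, h3'⟩ <;>
    rcases min_cases N (s₀ - δ) with ⟨h4, h4'⟩ | ⟨h4, h4'⟩ <;> rw [h1, h2] <;> linarith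
  have hint : ∀ x y, IntervalIntegrable F volume x y := fun x y => hFc.intervalIntegrable _ _
  have hsplit : ∫ s in (0:ℝ)..N, F s = (∫ s in (0:ℝ)..p, F s) + (∫ s in p..q, F s) +
      ∫ s in q..N, F s := by
    rw [intervalIntegral.integral_add_adjacent_intervals (hint _ _) (hint _ _),
      intervalIntegral.integral_add_adjacent_intervals (hint _ _) (hint _ _)]
  have hμ : 5 / (2 * |τ| * δ) ≤ 5 / 2 * δ := by
    rw [div_le_iff₀ (by positivity)]
    nlinarith
  have h1 : ‖∫ s in (0:ℝ)..p, F s‖ ≤ 5 / 2 * δ := by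
    rcases eq_or_lt_of_le hp0 with h0 | h0
    · rw [← h0]; simp; positivity
    · refine (norm_integral_phase_le hε.le hκ (μ := 2 * |τ| * δ) (by positivity) hτ le_rfl hp0
        fun s hs => ?_).trans hμ
      rw [hphase]
      gcongr
      have : p ≤ s₀ - δ := by
        rw [hp] at h0 ⊢
        rcases max_cases 0 (min N (s₀ - δ)) with ⟨h2, h2'⟩ | ⟨h2, h2'⟩
        · rw [h2] at h0; exact absurd h0 (lt_irrefl _)
        · rw [h2]; exact min_le_right _ _
      rw [abs_sub_comm]
      refine le_trans ?_ (le_abs_self _)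
      linarith [hs.2]
  have h2 : ‖∫ s in p..q, F s‖ ≤ 2 * δ := by
    refine (intervalIntegral.norm_integral_le_of_norm_le_const (C := 1) fun s hs => ?_).trans ?_
    · rw [Set.uIoc_of_le hpq] at hs
      exact hF1 s (hp0.trans hs.1.le)
    · rw [one_mul, abs_of_nonneg (sub_nonneg.2 hpq)]
      exact hqp
  have h3 : ‖∫ s in q..N, F s‖ ≤ 5 / 2 * δ := by
    rcases eq_or_lt_of_le hqN with h0 | h0
    · rw [← h0]; simp; positivity
    · refine (norm_integral_phase_le hε.le hκ (μ := 2 * |τ| * δ) (by positivity) hτ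
        (le_max_left _ _) hqN fun s hs => ?_).trans hμ
      rw [hphase]
      gcongr
      have : s₀ + δ ≤ q := by
        rw [hq] at h0 ⊢
        rcases min_cases N (s₀ + δ) with ⟨h2, h2'⟩ | ⟨h2, h2'⟩
        · rw [h2] at h0
          exact absurd ((le_max_right _ _).trans_lt h0) (lt_irrefl _)
        · rw [h2]; exact le_max_right _ _
      refine le_trans ?_ (le_abs_self _)
      linarith [hs.1]
  rw [hsplit]
  calc _ ≤ 5 / 2 * δ + 2 * δ + 5 / 2 * δ :=
        (norm_add_le _ _).trans (add_le_add ((norm_add_le _ _).trans (add_le_add h1 h2)) h3)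
    _ = _ := by ring

end VanDerCorput

/-! ### Orthogonal coordinates along a line -/

section Coordinates

variable {E : Type*} [NormedAddCommGroup E] [InnerProductSpace ℝ E]

lemma inner_self_orthogonal_eq_zero (ω : E) (y : (ℝ ∙ ω)ᗮ) : inner ℝ ω (y : E) = 0 :=
  Submodule.mem_orthogonal_singleton_iff_inner_right.1 y.2

variable [FiniteDimensional ℝ E] [MeasurableSpace E] [BorelSpace E]

/-- The coordinates `(s, y) ↦ s ω + y` with `y ⟂ ω`, for a unit vector `ω`. -/
def lineEquiv (ω : E) (hω : ‖ω‖ = 1) : ℝ × (ℝ ∙ ω)ᗮ ≃ᵐ E :=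
  (((LinearIsometryEquiv.toSpanUnitSingleton (𝕜 := ℝ) ω hω).toHomeomorph.toMeasurableEquiv.prodCongr
    (MeasurableEquiv.refl _)).trans (MeasurableEquiv.toLp 2 _)).trans
      (ℝ ∙ ω).orthogonalDecomposition.symm.toHomeomorph.toMeasurableEquiv

lemma lineEquiv_apply (ω : E) (hω : ‖ω‖ = 1) (p : ℝ × (ℝ ∙ ω)ᗮ) :
    lineEquiv ω hω p = p.1 • ω + p.2 := by
  have : ((lineEquiv ω hω p : E)) = ((LinearIsometryEquiv.toSpanUnitSingleton (𝕜 := ℝ) ω hω p.1 :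
      ↥(ℝ ∙ ω)) : E) + (p.2 : E) := by
    simp only [lineEquiv, MeasurableEquiv.trans_apply]
    rfl
  rw [this]
  simp

lemma measurePreserving_lineEquiv (ω : E) (hω : ‖ω‖ = 1) :
    MeasurePreserving (lineEquiv ω hω) := by
  have h1 : MeasurePreserving (Prod.map (LinearIsometryEquiv.toSpanUnitSingleton (𝕜 := ℝ) ω hω)
      (id : (ℝ ∙ ω)ᗮ → (ℝ ∙ ω)ᗮ)) (volume.prod volume) (volume.prod volume) :=
    (LinearIsometryEquiv.toSpanUnitSingleton (𝕜 := ℝ) ω hω).measurePreserving.prod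
      (MeasurePreserving.id _)
  exact ((ℝ ∙ ω).orthogonalDecomposition.symm.measurePreserving.comp
    (WithLp.volume_preserving_toLp _ _)).comp h1

lemma inner_lineEquiv (ω : E) (hω : ‖ω‖ = 1) (x : E) (p : ℝ × (ℝ ∙ ω)ᗮ) :
    inner ℝ x (lineEquiv ω hω p) =
      p.1 * inner ℝ x ω + inner ℝ ((ℝ ∙ ω)ᗮ.orthogonalProjectionOnto x) p.2 := by
  rw [lineEquiv_apply, inner_add_right, inner_smul_right]
  congr 1
  exact (Submodule.inner_orthogonalProjectionOnto_eq_of_mem_right p.2 x).symm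

lemma norm_sq_lineEquiv (ω : E) (hω : ‖ω‖ = 1) (p : ℝ × (ℝ ∙ ω)ᗮ) :
    ‖lineEquiv ω hω p‖ ^ 2 = p.1 ^ 2 + ‖p.2‖ ^ 2 := by
  rw [lineEquiv_apply, norm_add_sq_real, inner_smul_left, inner_self_orthogonal_eq_zero, norm_smul,
    hω]
  simp

lemma inner_smul_lineEquiv (ω : E) (hω : ‖ω‖ = 1) (p : ℝ × (ℝ ∙ ω)ᗮ) :
    inner ℝ ω (lineEquiv ω hω p) = p.1 := by
  rw [lineEquiv_apply, inner_add_right, inner_smul_right, inner_self_orthogonal_eq_zero,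
    real_inner_self_eq_norm_sq, hω]
  simp

end Coordinates

/-! ### Bessel inequalities with a Gaussian weight -/

lemma lintegral_weight_mul_le {α : Type*} [MeasurableSpace α] {μ : Measure α} {w a b : α → ℝ≥0∞}
    (hw : Measurable w) (ha : Measurable a) (hb : Measurable b) :
    ∫⁻ x, w x * (a x * b x) ∂μ ≤
      (∫⁻ x, w x * a x ^ 2 ∂μ) ^ (1 / 2 : ℝ) * (∫⁻ x, w x * b x ^ 2 ∂μ) ^ (1 / 2 : ℝ) := by
  have hh : ∀ a : ℝ≥0∞, a = a ^ (1 / 2 : ℝ) * a ^ (1 / 2 : ℝ) := fun a => by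
    rw [← ENNReal.rpow_add_of_nonneg _ _ (by norm_num) (by norm_num)]; norm_num
  have hsq : ∀ a b : ℝ≥0∞, (a ^ (1 / 2 : ℝ) * b) ^ (2 : ℝ) = a * b ^ 2 := fun a b => by
    rw [ENNReal.mul_rpow_of_nonneg _ _ (by norm_num), ← ENNReal.rpow_mul]; norm_num
  have h := lintegral_mul_le_two (μ := μ) (φ := fun x => w x ^ (1 / 2 : ℝ) * a x)
    (ψ := fun x => w x ^ (1 / 2 : ℝ) * b x) (by fun_prop) (by fun_prop)
  rw [eLpNorm_two_eq, eLpNorm_two_eq] at h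
  simp_rw [hsq] at h
  refine le_trans (le_of_eq (lintegral_congr fun x => ?_)) h
  nth_rewrite 1 [hh (w x)]
  ring

/-- A Bessel inequality for a family of bounded functions that is almost orthogonal with respect to
the weight `w`, by Schur's test for the Gram kernel. -/
lemma lintegral_bessel_le {X Ξ : Type*} [MeasurableSpace X] [MeasurableSpace Ξ] {μ : Measure X}
    {κ : Measure Ξ} [SFinite μ] [SFinite κ] {e : X → Ξ → ℂ} (he : Measurable (Function.uncurry e))
    (he1 : ∀ x ξ, ‖e x ξ‖ ≤ 1) {w : Ξ → ℝ} (hw : Measurable w) (hw0 : ∀ ξ, 0 ≤ w ξ)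
    (hwi : Integrable w κ) {C : ℝ≥0∞}
    (h₁ : ∀ y, ∫⁻ x, ‖∫ ξ, (w ξ : ℂ) * (e y ξ * starRingEnd ℂ (e x ξ)) ∂κ‖ₑ ∂μ ≤ C)
    (h₂ : ∀ x, ∫⁻ y, ‖∫ ξ, (w ξ : ℂ) * (e y ξ * starRingEnd ℂ (e x ξ)) ∂κ‖ₑ ∂μ ≤ C)
    {f : X → ℂ} (hf : Measurable f) (hfi : Integrable f μ) :
    ∫⁻ ξ, ENNReal.ofReal (w ξ) * ‖∫ x, e x ξ * f x ∂μ‖ₑ ^ 2 ∂κ ≤ C * eLpNorm f 2 μ ^ 2 := by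
  set F : Ξ → ℂ := fun ξ => ∫ x, e x ξ * f x ∂μ with hF
  have hesw : Measurable fun p : Ξ × X => e p.2 p.1 * f p.2 :=
    (show Measurable fun p : Ξ × X => e p.2 p.1 from
      he.comp (measurable_snd.prodMk measurable_fst)).mul (hf.comp measurable_snd)
  have hFm : Measurable F := (hesw.stronglyMeasurable.integral_prod_right (ν := μ)).measurable
  have hFb : ∀ ξ, ‖F ξ‖ ≤ ∫ x, ‖f x‖ ∂μ := fun ξ => by
    refine norm_integral_le_of_norm_le hfi.norm (ae_of_all _ fun x => ?_)
    rw [norm_mul]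
    exact mul_le_of_le_one_left (norm_nonneg _) (he1 x ξ)
  set Γ : X × X → ℂ := fun z => ∫ ξ, (w ξ : ℂ) * (e z.2 ξ * starRingEnd ℂ (e z.1 ξ)) ∂κ with hΓ
  have hc : Measurable (starRingEnd ℂ) := Complex.continuous_conj.measurable
  have hGm : Measurable fun p : (X × X) × Ξ =>
      (w p.2 : ℂ) * (e p.1.2 p.2 * starRingEnd ℂ (e p.1.1 p.2)) := by
    have h1 : Measurable fun p : (X × X) × Ξ => e p.1.2 p.2 :=
      he.comp ((measurable_snd.comp measurable_fst).prodMk measurable_snd)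
    have h2 : Measurable fun p : (X × X) × Ξ => e p.1.1 p.2 :=
      he.comp ((measurable_fst.comp measurable_fst).prodMk measurable_snd)
    exact (Complex.measurable_ofReal.comp (hw.comp measurable_snd)).mul (h1.mul (hc.comp h2))
  have hΓm : Measurable Γ := (hGm.stronglyMeasurable.integral_prod_right (ν := κ)).measurable
  have hint1 : Integrable (fun ξ => w ξ * ‖F ξ‖ ^ 2) κ := by
    have : Integrable (fun ξ => ‖F ξ‖ ^ 2 * w ξ) κ := by
      refine hwi.bdd_mul (c := (∫ x, ‖f x‖ ∂μ) ^ 2) (by fun_prop) (ae_of_all _ fun ξ => ?_)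
      rw [Real.norm_of_nonneg (by positivity)]
      gcongr
      exact hFb ξ
    simpa [mul_comm] using this
  have hff : Integrable (fun z : X × X => f z.2 * starRingEnd ℂ (f z.1)) (μ.prod μ) := by
    have h1 : Integrable (fun x => starRingEnd ℂ (f x)) μ :=
      (integrable_norm_iff (hc.comp hf).aestronglyMeasurable).1 (by simpa using hfi.norm)
    simpa [mul_comm] using h1.mul_prod hfi
  have hbig : Integrable (fun p : Ξ × (X × X) => ((w p.1 : ℂ) * (e p.2.2 p.1 *
      starRingEnd ℂ (e p.2.1 p.1))) * (f p.2.2 * starRingEnd ℂ (f p.2.1))) (κ.prod (μ.prod μ)) := by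
    have h0 : Integrable (fun p : Ξ × (X × X) => (w p.1 : ℂ) * (f p.2.2 * starRingEnd ℂ (f p.2.1)))
      (κ.prod (μ.prod μ)) := hwi.ofReal.mul_prod hff
    have hm : Measurable fun p : Ξ × (X × X) => e p.2.2 p.1 * starRingEnd ℂ (e p.2.1 p.1) := by
      have h1 : Measurable fun p : Ξ × (X × X) => e p.2.2 p.1 :=
        he.comp ((measurable_snd.comp measurable_snd).prodMk measurable_fst)
      have h2 : Measurable fun p : Ξ × (X × X) => e p.2.1 p.1 :=
        he.comp ((measurable_fst.comp measurable_snd).prodMk measurable_fst)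
      exact h1.mul (hc.comp h2)
    have := h0.bdd_mul (c := 1) hm.aestronglyMeasurable (ae_of_all _ fun p => by
      rw [norm_mul, RCLike.norm_conj]
      exact mul_le_one₀ (he1 _ _) (norm_nonneg _) (he1 _ _))
    refine this.congr (ae_of_all _ fun p => ?_)
    simp only
    ring
  -- Expanding the square and exchanging the integrals produces the Gram kernel `Γ`.
  have hid : ((∫ ξ, w ξ * ‖F ξ‖ ^ 2 ∂κ : ℝ) : ℂ) =
      ∫ z, Γ z * (f z.2 * starRingEnd ℂ (f z.1)) ∂(μ.prod μ) := by
    rw [← integral_complex_ofReal]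
    calc _ = ∫ ξ, ∫ z : X × X, ((w ξ : ℂ) * (e z.2 ξ * starRingEnd ℂ (e z.1 ξ))) *
          (f z.2 * starRingEnd ℂ (f z.1)) ∂(μ.prod μ) ∂κ := by
          refine integral_congr_ae (ae_of_all _ fun ξ => ?_)
          have h1 : ((w ξ * ‖F ξ‖ ^ 2 : ℝ) : ℂ) = (w ξ : ℂ) * (starRingEnd ℂ (F ξ) * F ξ) := by
            push_cast
            rw [mul_comm (starRingEnd ℂ (F ξ)), Complex.mul_conj']
          have h2 : starRingEnd ℂ (F ξ) = ∫ x, starRingEnd ℂ (e x ξ * f x) ∂μ := integral_conj.symm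
          simp only
          rw [h1, h2, hF]
          simp only
          rw [← integral_prod_mul, ← integral_const_mul]
          refine integral_congr_ae (ae_of_all _ fun z => ?_)
          simp only [map_mul]
          ring
      _ = ∫ z : X × X, ∫ ξ, ((w ξ : ℂ) * (e z.2 ξ * starRingEnd ℂ (e z.1 ξ))) *
          (f z.2 * starRingEnd ℂ (f z.1)) ∂κ ∂(μ.prod μ) := integral_integral_swap hbig
      _ = _ := by
          refine integral_congr_ae (ae_of_all _ fun z => ?_)
          simp only [hΓ]
          rw [integral_mul_const]
  calc _ = ∫⁻ ξ, ENNReal.ofReal (w ξ * ‖F ξ‖ ^ 2) ∂κ := by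
        refine lintegral_congr fun ξ => ?_
        rw [ENNReal.ofReal_mul (hw0 ξ), ENNReal.ofReal_pow (norm_nonneg _), ofReal_norm]
    _ = ENNReal.ofReal (∫ ξ, w ξ * ‖F ξ‖ ^ 2 ∂κ) :=
        (ofReal_integral_eq_lintegral_ofReal hint1
          (ae_of_all _ fun ξ => mul_nonneg (hw0 ξ) (sq_nonneg _))).symm
    _ ≤ ‖∫ z, Γ z * (f z.2 * starRingEnd ℂ (f z.1)) ∂(μ.prod μ)‖ₑ := by
        rw [← hid, ← ofReal_norm]
        refine ENNReal.ofReal_le_ofReal ?_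
        rw [Complex.norm_real]
        exact le_abs_self _
    _ ≤ ∫⁻ z, ‖Γ z‖ₑ * (‖f z.2‖ₑ * ‖f z.1‖ₑ) ∂(μ.prod μ) := by
        refine (enorm_integral_le_lintegral_enorm _).trans (le_of_eq (lintegral_congr fun z => ?_))
        rw [enorm_mul, enorm_mul]
        congr 2
        rw [← ofReal_norm, ← ofReal_norm, RCLike.norm_conj]
    _ ≤ C * eLpNorm (fun x => ‖f x‖ₑ) 2 μ * eLpNorm (fun x => ‖f x‖ₑ) 2 μ :=
        lintegral_schur_le (k := fun z => ‖Γ z‖ₑ) hΓm.enorm hf.enorm hf.enorm h₁ h₂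
    _ = _ := by
        rw [eLpNorm_enorm]; ring

section Gauss

open Complex

variable {E : Type*} [NormedAddCommGroup E] [InnerProductSpace ℝ E]

/-- The character `e^{i⟨x, ξ⟩}`. -/
def chr (x ξ : E) : ℂ := cexp ((inner ℝ x ξ : ℝ) * I)

lemma norm_chr (x ξ : E) : ‖chr x ξ‖ = 1 := norm_exp_ofReal_mul_I _

lemma continuous_chr : Continuous fun p : E × E => chr p.1 p.2 := by
  unfold chr; fun_prop

lemma conj_chr (x ξ : E) : starRingEnd ℂ (chr x ξ) = chr (-x) ξ := by
  simp [chr, ← exp_conj]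

lemma chr_add (x y ξ : E) : chr (x + y) ξ = chr x ξ * chr y ξ := by
  rw [chr, chr, chr, inner_add_left, ← exp_add]
  push_cast
  ring_nf

lemma chr_sub (x y ξ : E) : chr (x - y) ξ = chr x ξ * chr (-y) ξ := by
  rw [sub_eq_add_neg, chr_add]

variable [FiniteDimensional ℝ E] [MeasurableSpace E] [BorelSpace E]

lemma integrable_gauss {ε : ℝ} (hε : 0 < ε) :
    Integrable fun ξ : E => Real.exp (-ε * ‖ξ‖ ^ 2) := by
  have h := GaussianFourier.integrable_cexp_neg_mul_sq_norm_add (V := E) (b := ε)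
    (by simpa using hε) 0 0
  refine h.norm.congr (ae_of_all _ fun ξ => ?_)
  simp only [norm_exp]
  congr 1
  simp [← ofReal_pow]

lemma integral_gauss_mul_chr {ε : ℝ} (hε : 0 < ε) (x : E) :
    ∫ ξ, (Real.exp (-ε * ‖ξ‖ ^ 2) : ℂ) * chr x ξ =
      (((Real.pi / ε) ^ (Module.finrank ℝ E / 2 : ℝ) *
        Real.exp (-(1 / (4 * ε)) * ‖x‖ ^ 2) : ℝ) : ℂ) := by
  have h := GaussianFourier.integral_cexp_neg_mul_sq_norm_add (V := E) (b := ε)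
    (by simpa using hε) I x
  have e1 : ∀ ξ : E, (Real.exp (-ε * ‖ξ‖ ^ 2) : ℂ) * chr x ξ =
      cexp (-ε * ‖ξ‖ ^ 2 + I * inner ℝ x ξ) := by
    intro ξ
    rw [chr, ofReal_exp, ← exp_add]
    push_cast
    ring_nf
  simp_rw [e1]
  rw [h]
  push_cast
  rw [ofReal_cpow (by positivity)]
  push_cast
  congr 2
  rw [I_sq]
  have : (ε : ℂ) ≠ 0 := by exact_mod_cast hε.ne'
  field_simp

lemma lintegral_gauss {ε : ℝ} (hε : 0 < ε) :
    ∫⁻ x : E, ‖∫ ξ : E, (Real.exp (-ε * ‖ξ‖ ^ 2) : ℂ) * chr x ξ‖ₑ =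
      ENNReal.ofReal ((2 * Real.pi) ^ (Module.finrank ℝ E : ℝ)) := by
  have hδ : 0 < 1 / (4 * ε) := by positivity
  have h0 : ∫ ξ : E, Real.exp (-(1 / (4 * ε)) * ‖ξ‖ ^ 2) =
      (Real.pi / (1 / (4 * ε))) ^ (Module.finrank ℝ E / 2 : ℝ) := by
    have h := integral_gauss_mul_chr (E := E) hδ 0
    simp only [chr, inner_zero_left, ofReal_zero, zero_mul, exp_zero, mul_one, norm_zero, ne_eq,
      OfNat.ofNat_ne_zero, not_false_eq_true, zero_pow, mul_zero, Real.exp_zero] at h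
    rw [integral_complex_ofReal] at h
    exact_mod_cast h
  simp_rw [integral_gauss_mul_chr hε]
  have e1 : ∀ x : E, ‖(((Real.pi / ε) ^ (Module.finrank ℝ E / 2 : ℝ) *
      Real.exp (-(1 / (4 * ε)) * ‖x‖ ^ 2) : ℝ) : ℂ)‖ₑ =
      ENNReal.ofReal ((Real.pi / ε) ^ (Module.finrank ℝ E / 2 : ℝ) *
        Real.exp (-(1 / (4 * ε)) * ‖x‖ ^ 2)) := by
    intro x
    rw [← ofReal_norm, norm_real, Real.norm_of_nonneg (by positivity)]
  simp_rw [e1]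
  rw [← ofReal_integral_eq_lintegral_ofReal ((integrable_gauss hδ).const_mul _)
    (ae_of_all _ fun x => by positivity), integral_const_mul, h0,
    ← Real.mul_rpow (by positivity) (by positivity)]
  congr 1
  have : Real.pi / ε * (Real.pi / (1 / (4 * ε))) = (2 * Real.pi) ^ (2 : ℝ) := by
    rw [Real.rpow_two]
    field_simp
    ring
  rw [this, ← Real.rpow_mul (by positivity)]
  congr 1
  ring

lemma lintegral_gauss_fourier_le {ε : ℝ} (hε : 0 < ε) {f : E → ℂ} (hf : Measurable f)
    (hfi : Integrable f) :
    ∫⁻ ξ, ENNReal.ofReal (Real.exp (-ε * ‖ξ‖ ^ 2)) * ‖∫ x, chr x ξ * f x‖ₑ ^ 2 ≤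
      ENNReal.ofReal ((2 * Real.pi) ^ (Module.finrank ℝ E : ℝ)) * eLpNorm f 2 volume ^ 2 := by
  have e1 : ∀ x y : E, ∫ ξ, (Real.exp (-ε * ‖ξ‖ ^ 2) : ℂ) * (chr y ξ * starRingEnd ℂ (chr x ξ)) =
      ∫ ξ, (Real.exp (-ε * ‖ξ‖ ^ 2) : ℂ) * chr (y - x) ξ := by
    intro x y
    simp_rw [conj_chr, chr_sub]
  refine lintegral_bessel_le (e := chr) (continuous_chr (E := E)).measurable
    (fun x ξ => (norm_chr x ξ).le) (by fun_prop) (fun ξ => (Real.exp_pos _).le)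
    (integrable_gauss hε) (fun y => ?_) (fun x => ?_) hf hfi
  · simp_rw [e1]
    rw [lintegral_sub_left_eq_self
      (fun x : E => ‖∫ ξ, (Real.exp (-ε * ‖ξ‖ ^ 2) : ℂ) * chr x ξ‖ₑ), lintegral_gauss hε]
  · simp_rw [e1]
    rw [lintegral_sub_right_eq_self
      (fun x : E => ‖∫ ξ, (Real.exp (-ε * ‖ξ‖ ^ 2) : ℂ) * chr x ξ‖ₑ), lintegral_gauss hε]

end Gauss

/-! ### The damped Schrödinger kernel and its dispersive estimates -/

lemma Nice.conj {α : Type*} [MeasurableSpace α] {μ : Measure α} {f : α → ℂ} (hf : Nice μ f) :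
    Nice μ fun x => starRingEnd ℂ (f x) := by
  have hc : Measurable (starRingEnd ℂ) := Complex.continuous_conj.measurable
  refine ⟨hc.comp hf.meas, ?_, ?_⟩
  · exact (integrable_norm_iff (hc.comp hf.meas).aestronglyMeasurable).1
      (by simpa using hf.int.norm)
  · obtain ⟨M, hM⟩ := hf.bdd
    exact ⟨M, fun x => by simpa using hM x⟩

section Kernel

open Complex

variable {E : Type*} [NormedAddCommGroup E] [InnerProductSpace ℝ E]

/-- The multiplier `e^{-iτ|ξ|² - 2σ ν·ξ}` on the half-space `ν·ξ > 0`, extended by zero. The two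
parameters `τ` and `σ` coincide in the evolution itself; they separate in `T*T` arguments. -/
def damp (ν : E) (τ σ : ℝ) (ξ : E) : ℂ :=
  {ξ : E | 0 < inner ℝ ν ξ}.indicator
    (fun ξ => cexp (((-(τ * ‖ξ‖ ^ 2) : ℝ) : ℂ) * I) * (Real.exp (-(2 * σ * inner ℝ ν ξ)) : ℂ)) ξ

lemma norm_damp_le (ν : E) (τ : ℝ) {σ : ℝ} (hσ : 0 ≤ σ) (ξ : E) : ‖damp ν τ σ ξ‖ ≤ 1 := by
  unfold damp
  by_cases h : ξ ∈ {ξ : E | 0 < inner ℝ ν ξ}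
  · rw [Set.indicator_of_mem h, norm_mul, norm_exp_ofReal_mul_I, one_mul, norm_real,
      Real.norm_of_nonneg (Real.exp_pos _).le]
    refine Real.exp_le_one_iff.2 ?_
    have h' : 0 < inner ℝ ν ξ := h
    have : 0 ≤ σ * inner ℝ ν ξ := by positivity
    linarith
  · rw [Set.indicator_of_notMem h]; simp

lemma damp_mul_conj_damp (ν : E) (τ σ τ' σ' : ℝ) (ξ : E) :
    damp ν τ σ ξ * starRingEnd ℂ (damp ν τ' σ' ξ) = damp ν (τ - τ') (σ + σ') ξ := by
  unfold damp
  by_cases h : ξ ∈ {ξ : E | 0 < inner ℝ ν ξ}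
  · simp only [Set.indicator_of_mem h, map_mul, conj_ofReal]
    rw [← exp_conj, map_mul, conj_ofReal, conj_I]
    simp only [ofReal_exp, ← exp_add]
    congr 1
    push_cast
    ring
  · simp [Set.indicator_of_notMem h]

lemma norm_kern_integrand_le (ν : E) (ε τ : ℝ) {σ : ℝ} (hσ : 0 ≤ σ) (x ξ : E) :
    ‖(Real.exp (-ε * ‖ξ‖ ^ 2) : ℂ) * (damp ν τ σ ξ * chr x ξ)‖ ≤ Real.exp (-ε * ‖ξ‖ ^ 2) := by
  rw [norm_mul, norm_mul, norm_chr, mul_one, norm_real, Real.norm_of_nonneg (Real.exp_pos _).le]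
  exact mul_le_of_le_one_right (Real.exp_pos _).le (norm_damp_le ν τ hσ ξ)

variable [FiniteDimensional ℝ E] [MeasurableSpace E] [BorelSpace E]

@[fun_prop]
lemma measurable_damp {α : Type*} [MeasurableSpace α] (ν : E) {t s : α → ℝ} {x : α → E}
    (ht : Measurable t) (hs : Measurable s) (hx : Measurable x) :
    Measurable fun a => damp ν (t a) (s a) (x a) := by
  have hm : MeasurableSet {a | 0 < inner ℝ ν (x a)} :=
    measurableSet_lt measurable_const (by fun_prop)
  have : (fun a => damp ν (t a) (s a) (x a)) = {a | 0 < inner ℝ ν (x a)}.indicator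
      (fun a => cexp (((-(t a * ‖x a‖ ^ 2) : ℝ) : ℂ) * I) *
        (Real.exp (-(2 * s a * inner ℝ ν (x a))) : ℂ)) := by
    ext a
    simp [damp, Set.indicator]
  rw [this]
  exact Measurable.indicator (by fun_prop) hm

@[fun_prop]
lemma measurable_chr {α : Type*} [MeasurableSpace α] {x y : α → E} (hx : Measurable x)
    (hy : Measurable y) : Measurable fun a => chr (x a) (y a) := by
  unfold chr; fun_prop

/-- The convolution kernel of the damped Schrödinger multiplier with a Gaussian cut-off. -/
def kern (ν : E) (ε τ σ : ℝ) (x : E) : ℂ :=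
  ∫ ξ, (Real.exp (-ε * ‖ξ‖ ^ 2) : ℂ) * (damp ν τ σ ξ * chr x ξ)

lemma measurable_kern_uncurry (ν : E) (ε : ℝ) :
    Measurable fun p : (ℝ × ℝ) × E => kern ν ε p.1.1 p.1.2 p.2 := by
  have : Measurable fun p : ((ℝ × ℝ) × E) × E => (Real.exp (-ε * ‖p.2‖ ^ 2) : ℂ) *
      (damp ν p.1.1.1 p.1.1.2 p.2 * chr p.1.2 p.2) := by fun_prop
  exact (this.stronglyMeasurable.integral_prod_right (ν := volume)).measurable

@[fun_prop]
lemma measurable_kern {α : Type*} [MeasurableSpace α] (ν : E) (ε : ℝ) {t s : α → ℝ} {x : α → E}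
    (ht : Measurable t) (hs : Measurable s) (hx : Measurable x) :
    Measurable fun a => kern ν ε (t a) (s a) (x a) := by
  have h : Measurable fun a => ((t a, s a), x a) := by fun_prop
  have := (measurable_kern_uncurry ν ε).comp h
  exact this

lemma norm_kern_le (ν : E) {ε : ℝ} (hε : 0 < ε) (τ : ℝ) {σ : ℝ} (hσ : 0 ≤ σ) (x : E) :
    ‖kern ν ε τ σ x‖ ≤ ∫ ξ : E, Real.exp (-ε * ‖ξ‖ ^ 2) :=
  norm_integral_le_of_norm_le (integrable_gauss hε)
    (ae_of_all _ fun ξ => norm_kern_integrand_le ν ε τ hσ x ξ)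

/-- The dispersive bound of the Schrödinger kernel without damping, independent of the cut-off. It
is used on the orthogonal complement of `ν`. -/
lemma norm_integral_cexp_gauss_le {ε τ : ℝ} (hε : 0 < ε) (hτ : τ ≠ 0) (w : E) :
    ‖∫ v : E, cexp (-((ε : ℂ) + τ * I) * ‖v‖ ^ 2 + I * (inner ℝ w v : ℝ))‖ ≤
      (Real.pi / |τ|) ^ (Module.finrank ℝ E / 2 : ℝ) := by
  set b : ℂ := (ε : ℂ) + τ * I with hb
  have hbre : b.re = ε := by simp [hb]
  have hbim : b.im = τ := by simp [hb]
  rw [GaussianFourier.integral_cexp_neg_mul_sq_norm_add (by rw [hbre]; exact hε), norm_mul]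
  have e1 : ((Module.finrank ℝ E / 2 : ℂ)) = ((Module.finrank ℝ E / 2 : ℝ) : ℂ) := by push_cast; rfl
  have hτb : |τ| ≤ ‖b‖ := by rw [← hbim]; exact abs_im_le_norm b
  have hτ0 : 0 < |τ| := abs_pos.2 hτ
  have h2 : ‖cexp (I ^ 2 * ‖w‖ ^ 2 / (4 * b))‖ ≤ 1 := by
    rw [norm_exp]
    refine Real.exp_le_one_iff.2 ?_
    have : I ^ 2 * (‖w‖ : ℂ) ^ 2 / (4 * b) = ((-(‖w‖ ^ 2 / 4) : ℝ) : ℂ) * b⁻¹ := by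
      rw [I_sq]; push_cast
      rw [div_eq_mul_inv, mul_inv]; ring
    rw [this, re_ofReal_mul, inv_re, hbre]
    have : 0 ≤ ‖w‖ ^ 2 / 4 * (ε / normSq b) := by
      have := normSq_nonneg b; positivity
    linarith
  rw [e1, norm_cpow_real, norm_div, norm_real, Real.norm_of_nonneg Real.pi_pos.le]
  calc _ ≤ (Real.pi / |τ|) ^ (Module.finrank ℝ E / 2 : ℝ) * 1 := by
        gcongr
    _ = _ := mul_one _

/-- The dispersive estimate, uniform in `ν`, in the damping and in the cut-off. -/
lemma norm_kern_le_dispersive {ν : E} (hν : ν ≠ 0) {ε τ σ : ℝ} (hε : 0 < ε) (hτ : τ ≠ 0)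
    (hσ : 0 ≤ σ) (x : E) :
    ‖kern ν ε τ σ x‖ ≤ 7 * Real.pi ^ (((Module.finrank ℝ E : ℝ) - 1) / 2) *
      |τ| ^ (-(Module.finrank ℝ E : ℝ) / 2) := by
  have hν0 : 0 < ‖ν‖ := norm_pos_iff.2 hν
  have hτ0 : 0 < |τ| := abs_pos.2 hτ
  set ω : E := ‖ν‖⁻¹ • ν with hω'
  have hω : ‖ω‖ = 1 := norm_smul_inv_norm hν
  have hνω : ν = ‖ν‖ • ω := by rw [hω', smul_smul, mul_inv_cancel₀ hν0.ne', one_smul]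
  have hinner : ∀ p, inner ℝ ν (lineEquiv ω hω p) = ‖ν‖ * p.1 := fun p => by
    nth_rewrite 1 [hνω]
    rw [inner_smul_left, inner_smul_lineEquiv]
    simp
  set w := (ℝ ∙ ω)ᗮ.orthogonalProjectionOnto x with hw
  set a := inner ℝ x ω with ha
  have hfin : (Module.finrank ℝ (ℝ ∙ ω)ᗮ : ℝ) = (Module.finrank ℝ E : ℝ) - 1 := by
    have h1 := Submodule.finrank_add_finrank_orthogonal (ℝ ∙ ω)
    have h2 : Module.finrank ℝ (ℝ ∙ ω) = 1 := finrank_span_singleton (by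
      intro h; rw [h] at hω; simp at hω)
    rw [h2] at h1
    have : (1 : ℝ) + Module.finrank ℝ (ℝ ∙ ω)ᗮ = Module.finrank ℝ E := by exact_mod_cast h1
    linarith
  -- The damping depends only on the coordinate along `ν`, so the kernel factorises.
  have hkern : kern ν ε τ σ x = (∫ s in Set.Ioi (0 : ℝ), cexp (((a * s - τ * s ^ 2 : ℝ) : ℂ) * I) *
      (Real.exp (-ε * s ^ 2 - (2 * σ * ‖ν‖) * s) : ℂ)) *
      ∫ v : (ℝ ∙ ω)ᗮ, cexp (-((ε : ℂ) + τ * I) * ‖v‖ ^ 2 + I * (inner ℝ w v : ℝ)) := by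
    rw [kern,
      ← (measurePreserving_lineEquiv ω hω).integral_comp (lineEquiv ω hω).measurableEmbedding,
      ← integral_indicator measurableSet_Ioi, ← integral_prod_mul]
    refine integral_congr_ae (ae_of_all _ fun p => ?_)
    simp only [damp, chr]
    by_cases h : 0 < p.1
    · rw [Set.indicator_of_mem (show p.1 ∈ Set.Ioi (0:ℝ) from h), Set.indicator_of_mem (by
        rw [Set.mem_ofPred_eq, hinner]; positivity)]
      rw [norm_sq_lineEquiv, hinner, inner_lineEquiv]
      simp only [ofReal_exp, ← exp_add]
      congr 1
      push_cast
      ring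
    · rw [Set.indicator_of_notMem (show p.1 ∉ Set.Ioi (0:ℝ) from h), Set.indicator_of_notMem (by
        rw [Set.mem_ofPred_eq, hinner, not_lt]
        exact mul_nonpos_of_nonneg_of_nonpos hν0.le (not_lt.1 h))]
      simp
  rw [hkern, norm_mul]
  calc _ ≤ (7 * |τ| ^ (-(1 / 2) : ℝ)) * (Real.pi / |τ|) ^ (Module.finrank ℝ (ℝ ∙ ω)ᗮ / 2 : ℝ) := by
        gcongr
        · exact norm_integral_Ioi_phase_le hε (by positivity) hτ
        · exact norm_integral_cexp_gauss_le hε hτ w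
    _ = _ := by
        rw [hfin, Real.div_rpow Real.pi_pos.le hτ0.le,
          div_eq_mul_inv (Real.pi ^ (((Module.finrank ℝ E : ℝ) - 1) / 2)), ← Real.rpow_neg hτ0.le]
        have : |τ| ^ (-(Module.finrank ℝ E : ℝ) / 2) =
            |τ| ^ (-(1 / 2) : ℝ) * |τ| ^ (-(((Module.finrank ℝ E : ℝ) - 1) / 2)) := by
          rw [← Real.rpow_add hτ0]
          congr 1; ring
        rw [this]; ring

/-- The form of the damped evolution, on the Fourier side. -/
lemma integral_kern_mul_eq (ν : E) {ε τ σ : ℝ} (hε : 0 < ε) (hσ : 0 ≤ σ) {f g : E → ℂ}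
    (hfi : Integrable f) (hgi : Integrable g) :
    ∫ z : E × E, kern ν ε τ σ (z.1 - z.2) * (f z.2 * g z.1) =
      ∫ ξ, (Real.exp (-ε * ‖ξ‖ ^ 2) : ℂ) * (damp ν τ σ ξ *
        ((∫ x, chr x ξ * g x) * ∫ y, chr y (-ξ) * f y)) := by
  have hgf : Integrable (fun z : E × E => f z.2 * g z.1) := by
    rw [Measure.volume_eq_prod]
    simpa [mul_comm] using hgi.mul_prod hfi
  have hbig : Integrable (fun p : (E × E) × E => ((Real.exp (-ε * ‖p.2‖ ^ 2) : ℂ) *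
      (damp ν τ σ p.2 * chr (p.1.1 - p.1.2) p.2)) * (f p.1.2 * g p.1.1)) (volume.prod volume) := by
    have h0 : Integrable (fun p : (E × E) × E => (f p.1.2 * g p.1.1) *
        (Real.exp (-ε * ‖p.2‖ ^ 2) : ℂ)) (volume.prod volume) :=
      hgf.mul_prod (integrable_gauss hε).ofReal
    have hm : Measurable fun p : (E × E) × E => damp ν τ σ p.2 * chr (p.1.1 - p.1.2) p.2 := by
      fun_prop
    refine (h0.bdd_mul (c := 1) hm.aestronglyMeasurable (ae_of_all _ fun p => ?_)).congr
      (ae_of_all _ fun p => ?_)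
    · rw [norm_mul, norm_chr, mul_one]
      exact norm_damp_le ν τ hσ _
    · simp only; ring
  calc _ = ∫ z : E × E, ∫ ξ, ((Real.exp (-ε * ‖ξ‖ ^ 2) : ℂ) *
      (damp ν τ σ ξ * chr (z.1 - z.2) ξ)) * (f z.2 * g z.1) := by
        refine integral_congr_ae (ae_of_all _ fun z => ?_)
        simp only [kern]
        rw [integral_mul_const]
    _ = ∫ ξ, ∫ z : E × E, ((Real.exp (-ε * ‖ξ‖ ^ 2) : ℂ) *
      (damp ν τ σ ξ * chr (z.1 - z.2) ξ)) * (f z.2 * g z.1) := integral_integral_swap hbig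
    _ = _ := by
        refine integral_congr_ae (ae_of_all _ fun ξ => ?_)
        simp only
        rw [← integral_prod_mul, ← integral_const_mul, ← integral_const_mul]
        refine integral_congr_ae (ae_of_all _ fun z => ?_)
        have : chr (-z.2) ξ = chr z.2 (-ξ) := by simp [chr]
        simp only [chr_sub, this]
        ring

lemma lintegral_gauss_fourier_neg_le {ε : ℝ} (hε : 0 < ε) {f : E → ℂ} (hf : Measurable f)
    (hfi : Integrable f) :
    ∫⁻ ξ, ENNReal.ofReal (Real.exp (-ε * ‖ξ‖ ^ 2)) * ‖∫ x, chr x (-ξ) * f x‖ₑ ^ 2 ≤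
      ENNReal.ofReal ((2 * Real.pi) ^ (Module.finrank ℝ E : ℝ)) * eLpNorm f 2 volume ^ 2 := by
  rw [← lintegral_neg_eq_self]
  simpa using lintegral_gauss_fourier_le hε hf hfi

lemma measurable_fourier_chr {f : E → ℂ} (hf : Measurable f) :
    Measurable fun ξ => ∫ x, chr x ξ * f x := by
  have : Measurable fun p : E × E => chr p.2 p.1 * f p.2 := by fun_prop
  exact (this.stronglyMeasurable.integral_prod_right (ν := volume)).measurable

/-- The energy estimate for the damped evolution. -/
lemma enorm_integral_kern_mul_le (ν : E) {ε τ σ : ℝ} (hε : 0 < ε) (hσ : 0 ≤ σ) {f g : E → ℂ}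
    (hf : Measurable f) (hfi : Integrable f) (hg : Measurable g) (hgi : Integrable g) :
    ‖∫ z : E × E, kern ν ε τ σ (z.1 - z.2) * (f z.2 * g z.1)‖ₑ ≤
      ENNReal.ofReal ((2 * Real.pi) ^ (Module.finrank ℝ E : ℝ)) *
        eLpNorm f 2 volume * eLpNorm g 2 volume := by
  rw [integral_kern_mul_eq ν hε hσ hfi hgi]
  set D := ENNReal.ofReal ((2 * Real.pi) ^ (Module.finrank ℝ E : ℝ))
  have hm1 := (measurable_fourier_chr hg).enorm
  have hm2 : Measurable fun ξ : E => ‖∫ y, chr y (-ξ) * f y‖ₑ :=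
    ((measurable_fourier_chr hf).comp measurable_neg).enorm
  calc _ ≤ ∫⁻ ξ, ENNReal.ofReal (Real.exp (-ε * ‖ξ‖ ^ 2)) *
        (‖∫ x, chr x ξ * g x‖ₑ * ‖∫ y, chr y (-ξ) * f y‖ₑ) := by
        refine (enorm_integral_le_lintegral_enorm _).trans (lintegral_mono fun ξ => ?_)
        rw [enorm_mul, enorm_mul, enorm_mul]
        have h1 : ‖(Real.exp (-ε * ‖ξ‖ ^ 2) : ℂ)‖ₑ = ENNReal.ofReal (Real.exp (-ε * ‖ξ‖ ^ 2)) := by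
          rw [← ofReal_norm, norm_real, Real.norm_of_nonneg (Real.exp_pos _).le]
        rw [h1]
        refine mul_le_mul_right ?_ _
        have h2 : ‖damp ν τ σ ξ‖ₑ ≤ 1 := by
          rw [← ofReal_norm]
          exact ENNReal.ofReal_le_one.2 (norm_damp_le ν τ hσ ξ)
        calc _ ≤ 1 * (‖∫ x, chr x ξ * g x‖ₑ * ‖∫ y, chr y (-ξ) * f y‖ₑ) := by gcongr
          _ = _ := one_mul _
    _ ≤ _ := lintegral_weight_mul_le (by fun_prop) hm1 hm2
    _ ≤ (D * eLpNorm g 2 volume ^ 2) ^ (1 / 2 : ℝ) *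
        (D * eLpNorm f 2 volume ^ 2) ^ (1 / 2 : ℝ) := by
        gcongr
        · exact lintegral_gauss_fourier_le hε hg hgi
        · exact lintegral_gauss_fourier_neg_le hε hf hfi
    _ = _ := by
        rw [ENNReal.mul_rpow_of_nonneg _ _ (by norm_num),
          ENNReal.mul_rpow_of_nonneg _ _ (by norm_num)]
        have h2 : D = D ^ (1 / 2 : ℝ) * D ^ (1 / 2 : ℝ) := by
          rw [← ENNReal.rpow_add_of_nonneg _ _ (by norm_num) (by norm_num)]; norm_num
        have h3 : ∀ a : ℝ≥0∞, (a ^ 2) ^ (1 / 2 : ℝ) = a := fun a => by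
          rw [← ENNReal.rpow_natCast, ← ENNReal.rpow_mul]; norm_num
        rw [h3, h3]
        nth_rewrite 3 [h2]
        ring

/-- The fixed-time `Lᵖ → Lᵖ'` estimate of the damped evolution, in bilinear form. -/
theorem exists_kern_decay {p : ℝ} (hp₁ : 1 ≤ p) (hp₂ : p ≤ 2) :
    ∃ C : ℝ≥0∞, C ≠ ∞ ∧ ∀ ν : E, ν ≠ 0 → ∀ ε τ σ : ℝ, 0 < ε → τ ≠ 0 → 0 ≤ σ →
      ∀ f g : E → ℂ, Nice volume f → Nice volume g →
        ‖∫ z : E × E, kern ν ε τ σ (z.1 - z.2) * (f z.2 * g z.1)‖ₑ ≤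
          C * ENNReal.ofReal |τ| ^ (-((Module.finrank ℝ E : ℝ) * (1 / p - 1 / 2))) *
            eLpNorm f (ENNReal.ofReal p) volume * eLpNorm g (ENNReal.ofReal p) volume := by
  obtain ⟨C, hC, hCi⟩ := exists_interpolation (volume : Measure E) hp₁ hp₂
  set n : ℝ := (Module.finrank ℝ E : ℝ) with hn
  set M : ℝ≥0∞ := ENNReal.ofReal ((2 * Real.pi) ^ n) + ENNReal.ofReal (7 * Real.pi ^ ((n - 1) / 2))
  refine ⟨C * M, ENNReal.mul_ne_top hC
    (ENNReal.add_ne_top.2 ⟨ENNReal.ofReal_ne_top, ENNReal.ofReal_ne_top⟩), ?_⟩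
  intro ν hν ε τ σ hε hτ hσ f g hf hg
  have hτ0 : 0 < |τ| := abs_pos.2 hτ
  -- `2 ^ ρ = |τ| ^ (-n / 2)`, the rate of dispersive decay
  set ρ : ℝ := -(n / 2) * Real.logb 2 |τ| with hρ
  have h2ρ : ∀ c : ℝ, (2 : ℝ≥0∞) ^ (ρ * c) = ENNReal.ofReal |τ| ^ (-(n / 2) * c) := by
    intro c
    have : (2 : ℝ≥0∞) ^ (Real.logb 2 |τ|) = ENNReal.ofReal |τ| := by
      have h := Real.rpow_logb (b := 2) (x := |τ|) (by norm_num) (by norm_num) hτ0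
      nth_rewrite 2 [← h]
      rw [← ENNReal.ofReal_rpow_of_pos (by norm_num)]
      simp
    rw [← this, ← ENNReal.rpow_mul, hρ]
    congr 1; ring
  have key := hCi (fun x y => kern ν ε τ σ (x - y)) (by
    unfold Function.uncurry; fun_prop)
    ⟨_, fun x y => norm_kern_le ν hε τ hσ (x - y)⟩ M ρ ?_ ?_ f g hf hg
  · refine key.trans (le_of_eq ?_)
    rw [h2ρ]
    have : -(n / 2) * (2 / p - 1) = -(n * (1 / p - 1 / 2)) := by ring
    rw [this]
    ring
  -- the dispersive estimate, from `L¹`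
  · intro f g hf hg
    have hρ1 : (2 : ℝ≥0∞) ^ ρ = ENNReal.ofReal |τ| ^ (-(n / 2)) := by
      have := h2ρ 1
      simpa using this
    have hk : ∀ x, ‖kern ν ε τ σ x‖ₑ ≤ M * (2 : ℝ≥0∞) ^ ρ := by
      intro x
      rw [← ofReal_norm, hρ1, ENNReal.ofReal_rpow_of_pos hτ0]
      refine (ENNReal.ofReal_le_ofReal (norm_kern_le_dispersive hν hε hτ hσ x)).trans ?_
      rw [ENNReal.ofReal_mul (by positivity), neg_div]
      gcongr
      exact le_add_left le_rfl
    calc _ ≤ ∫⁻ z : E × E, M * (2 : ℝ≥0∞) ^ ρ * (‖g z.1‖ₑ * ‖f z.2‖ₑ) := by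
          refine (enorm_integral_le_lintegral_enorm _).trans (lintegral_mono fun z => ?_)
          rw [enorm_mul, enorm_mul, mul_comm ‖f z.2‖ₑ]
          gcongr
          exact hk _
      _ = _ := by
          have h1 : Measurable fun x => ‖f x‖ₑ := hf.meas.enorm
          have h2 : Measurable fun x => ‖g x‖ₑ := hg.meas.enorm
          have h12 : Measurable fun z : E × E => ‖g z.1‖ₑ * ‖f z.2‖ₑ :=
            (h2.comp measurable_fst).mul (h1.comp measurable_snd)
          rw [lintegral_const_mul _ h12, Measure.volume_eq_prod,
            lintegral_prod_mul h2.aemeasurable h1.aemeasurable,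
            eLpNorm_one_eq_lintegral_enorm, eLpNorm_one_eq_lintegral_enorm]
          ring
  -- the energy estimate, on `L²`
  · intro f g hf hg
    refine (enorm_integral_kern_mul_le ν hε hσ hf.meas hf.int hg.meas hg.int).trans ?_
    gcongr
    exact le_add_right le_rfl

end Kernel

/-! ### Mixed norms -/

/-- The norms of the slices of a jointly measurable function depend measurably on the slice; this
includes the essential suprema. -/
lemma measurable_eLpNorm_prod {α β : Type*} [MeasurableSpace α] [MeasurableSpace β] {μ : Measure β}
    [SFinite μ] {φ : α × β → ℝ≥0∞} (hφ : Measurable φ) (p : ℝ≥0∞) :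
    Measurable fun t => eLpNorm (fun x => φ (t, x)) p μ := by
  rcases eq_or_ne p 0 with rfl | h0
  · simp
  rcases eq_or_ne p ∞ with rfl | ht
  · refine measurable_of_Ioi fun a => ?_
    have : (fun t => eLpNorm (fun x => φ (t, x)) ∞ μ) ⁻¹' Set.Ioi a =
        {t | 0 < μ {x | a < φ (t, x)}} := by
      ext t
      simp only [Set.mem_preimage, Set.mem_Ioi, Set.mem_ofPred_eq, eLpNorm_exponent_top,
        eLpNormEssSup, enorm_eq_self]
      rw [← not_iff_not, not_lt, not_lt, nonpos_iff_eq_zero]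
      constructor
      · intro h
        have h1 := ENNReal.ae_le_essSup (μ := μ) (fun x => φ (t, x))
        rw [← nonpos_iff_eq_zero]
        refine (measure_mono fun x hx => ?_).trans (ae_iff.1 h1).le
        exact not_le.2 (h.trans_lt hx)
      · intro h
        refine essSup_le_of_ae_le a (ae_iff.2 ?_)
        simpa using h
    rw [this]
    have hm : MeasurableSet {z : α × β | a < φ z} := measurableSet_lt measurable_const hφ
    exact measurableSet_lt measurable_const (measurable_measure_prodMk_left hm)
  · simp_rw [eLpNorm_eq_lintegral_rpow_enorm_toReal h0 ht, enorm_eq_self]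
    exact ((hφ.pow_const _).lintegral_prod_right' (ν := μ)).pow_const _

section Mixed

variable {n : ℕ} {F : Type*} [NormedAddCommGroup F]

lemma measurable_eLpNorm_slice {f : SpaceTime n → F} (hf : Measurable fun z => ‖f z‖ₑ) (p : ℝ≥0∞) :
    Measurable fun t => eLpNorm (fun x => f (t, x)) p volume := by
  have := measurable_eLpNorm_prod (μ := (volume : Measure (Space n))) hf p
  simpa only [eLpNorm_enorm] using this

lemma ae_slice_of_ae {P : SpaceTime n → Prop} (h : ∀ᵐ z : SpaceTime n, P z) :
    ∀ᵐ t : ℝ, ∀ᵐ x : Space n, P (t, x) := Measure.ae_ae_of_ae_prod h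

lemma mixedNorm_congr_ae {q r : ℝ≥0∞} {G : Type*} [NormedAddCommGroup G] {f : SpaceTime n → F}
    {g : SpaceTime n → G} (h : ∀ᵐ z : SpaceTime n, ‖f z‖ = ‖g z‖) :
    mixedNorm q r f = mixedNorm q r g := by
  refine eLpNorm_congr_enorm_ae ?_
  filter_upwards [ae_slice_of_ae h] with t ht
  rw [eLpNorm_congr_norm_ae ht]

lemma mixedNorm_mono_ae {q r : ℝ≥0∞} {G : Type*} [NormedAddCommGroup G] {f : SpaceTime n → F}
    {g : SpaceTime n → G} (h : ∀ᵐ z : SpaceTime n, ‖f z‖ ≤ ‖g z‖) :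
    mixedNorm q r f ≤ mixedNorm q r g := by
  refine eLpNorm_mono_enorm_ae ?_
  filter_upwards [ae_slice_of_ae h] with t ht
  simpa using eLpNorm_mono_ae ht

lemma Nice.ae_slice {f : SpaceTime n → ℂ} (hf : Nice volume f) :
    ∀ᵐ t : ℝ, Nice volume fun x => f (t, x) := by
  have h : ∀ᵐ t : ℝ, Integrable (fun x => f (t, x)) := by
    have := hf.int
    rw [Measure.volume_eq_prod] at this
    exact this.prod_right_ae
  obtain ⟨M, hM⟩ := hf.bdd
  filter_upwards [h] with t ht
  exact ⟨hf.meas.comp measurable_prodMk_left, ht, M, fun x => hM _⟩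

end Mixed

/-! ### The space-time form of the damped evolution -/

section Evolution

open Complex

variable {n : ℕ}

/-- The bilinear form of the damped evolution, restricted to time differences in `D`. -/
def evol (D : Set ℝ) (ν : Space n) (ε : ℝ) (f g : SpaceTime n → ℂ) : ℂ :=
  ∫ w : (ℝ × ℝ) × (Space n × Space n), D.indicator (fun _ => (1 : ℂ)) (w.1.1 - w.1.2) *
    (kern ν ε (w.1.1 - w.1.2) (w.1.1 - w.1.2) (w.2.1 - w.2.2) *
      (f (w.1.2, w.2.2) * g (w.1.1, w.2.1)))

lemma lintegral_pair_mul {φ ψ : SpaceTime n → ℝ≥0∞} (hφ : Measurable φ) (hψ : Measurable ψ)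
    {χ : ℝ × ℝ → ℝ≥0∞} (hχ : Measurable χ) :
    ∫⁻ w : (ℝ × ℝ) × (Space n × Space n), χ w.1 * (φ (w.1.2, w.2.2) * ψ (w.1.1, w.2.1)) =
      ∫⁻ p : ℝ × ℝ, χ p * ((∫⁻ y, φ (p.2, y)) * ∫⁻ x, ψ (p.1, x)) := by
  have hm : Measurable fun w : (ℝ × ℝ) × (Space n × Space n) =>
      χ w.1 * (φ (w.1.2, w.2.2) * ψ (w.1.1, w.2.1)) := by fun_prop
  rw [Measure.volume_eq_prod (ℝ × ℝ), lintegral_prod _ hm.aemeasurable]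
  refine lintegral_congr fun p => ?_
  have h1 : Measurable fun x => ψ (p.1, x) := by fun_prop
  have h2 : Measurable fun x => φ (p.2, x) := by fun_prop
  have h3 : Measurable fun z : Space n × Space n => φ (p.2, z.2) * ψ (p.1, z.1) := by fun_prop
  simp only
  rw [lintegral_const_mul _ h3]
  congr 1
  simp_rw [mul_comm (φ _)]
  rw [Measure.volume_eq_prod, lintegral_prod_mul h1.aemeasurable h2.aemeasurable, mul_comm]

lemma integrable_pair_mul {f g : SpaceTime n → ℂ} (hf : Nice volume f) (hg : Nice volume g) :
    Integrable fun w : (ℝ × ℝ) × (Space n × Space n) => f (w.1.2, w.2.2) * g (w.1.1, w.2.1) := by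
  have hfm := hf.meas
  have hgm := hg.meas
  refine ⟨by fun_prop, ?_⟩
  have h1 := lintegral_pair_mul (hfm.enorm) (hgm.enorm) (χ := fun _ => 1) measurable_const
  rw [hasFiniteIntegral_iff_enorm]
  simp only [one_mul] at h1
  simp_rw [enorm_mul]
  rw [h1]
  have h2 : Measurable fun t => ∫⁻ y, ‖f (t, y)‖ₑ := hfm.enorm.lintegral_prod_right'
  have h3 : Measurable fun t => ∫⁻ y, ‖g (t, y)‖ₑ := hgm.enorm.lintegral_prod_right'
  simp_rw [mul_comm (∫⁻ y, ‖f (_, y)‖ₑ)]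
  rw [Measure.volume_eq_prod, lintegral_prod_mul h3.aemeasurable h2.aemeasurable,
    ← lintegral_prod _ hgm.enorm.aemeasurable, ← lintegral_prod _ hfm.enorm.aemeasurable]
  exact ENNReal.mul_lt_top hg.int.hasFiniteIntegral hf.int.hasFiniteIntegral

variable {D : Set ℝ}

@[fun_prop]
lemma measurable_indicator_one_comp {α : Type*} [MeasurableSpace α] {β : Type*} [MeasurableSpace β]
    [One β] [Zero β] (hD : MeasurableSet D) {u : α → ℝ} (hu : Measurable u) :
    Measurable fun a => D.indicator (fun _ => (1 : β)) (u a) :=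
  (measurable_const.indicator hD).comp hu

lemma integrable_evol (hD : MeasurableSet D) (hD0 : ∀ t ∈ D, 0 < t) (ν : Space n) {ε : ℝ}
    (hε : 0 < ε) {f g : SpaceTime n → ℂ} (hf : Nice volume f) (hg : Nice volume g) :
    Integrable fun w : (ℝ × ℝ) × (Space n × Space n) =>
      D.indicator (fun _ => (1 : ℂ)) (w.1.1 - w.1.2) *
      (kern ν ε (w.1.1 - w.1.2) (w.1.1 - w.1.2) (w.2.1 - w.2.2) *
        (f (w.1.2, w.2.2) * g (w.1.1, w.2.1))) := by
  have hi : Measurable fun w : (ℝ × ℝ) × (Space n × Space n) =>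
      D.indicator (fun _ => (1 : ℂ)) (w.1.1 - w.1.2) :=
    measurable_indicator_one_comp hD (by fun_prop)
  have h := (integrable_pair_mul hf hg).bdd_mul (c := ∫ ξ : Space n, Real.exp (-ε * ‖ξ‖ ^ 2))
    (f := fun w => D.indicator (fun _ => (1 : ℂ)) (w.1.1 - w.1.2) *
      kern ν ε (w.1.1 - w.1.2) (w.1.1 - w.1.2) (w.2.1 - w.2.2)) (by fun_prop)
    (ae_of_all _ fun w => ?_)
  · simpa only [mul_assoc] using h
  · by_cases hw : w.1.1 - w.1.2 ∈ D
    · simp only [Set.indicator_of_mem hw, one_mul]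
      exact norm_kern_le ν hε _ (hD0 _ hw).le _
    · simp only [Set.indicator_of_notMem hw, zero_mul, norm_zero]
      positivity

lemma evol_eq (hD : MeasurableSet D) (hD0 : ∀ t ∈ D, 0 < t) (ν : Space n) {ε : ℝ}
    (hε : 0 < ε) {f g : SpaceTime n → ℂ} (hf : Nice volume f) (hg : Nice volume g) :
    evol D ν ε f g = ∫ p : ℝ × ℝ, D.indicator (fun _ => (1 : ℂ)) (p.1 - p.2) *
      ∫ z : Space n × Space n, kern ν ε (p.1 - p.2) (p.1 - p.2) (z.1 - z.2) *
        (f (p.2, z.2) * g (p.1, z.1)) := by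
  have h := integrable_evol hD hD0 ν hε hf hg
  rw [Measure.volume_eq_prod] at h
  rw [evol, Measure.volume_eq_prod (ℝ × ℝ), integral_prod _ h]
  refine integral_congr_ae (ae_of_all _ fun p => ?_)
  simp only
  rw [integral_const_mul]

lemma ae_pair_of_ae {P Q : ℝ → Prop} (hP : ∀ᵐ t : ℝ, P t) (hQ : ∀ᵐ t : ℝ, Q t) :
    ∀ᵐ p : ℝ × ℝ, P p.1 ∧ Q p.2 := by
  have h1 : ∀ᵐ p : ℝ × ℝ, P p.1 :=
    Measure.quasiMeasurePreserving_fst.ae hP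
  have h2 : ∀ᵐ p : ℝ × ℝ, Q p.2 :=
    Measure.quasiMeasurePreserving_snd.ae hQ
  exact h1.and h2

lemma ae_times_ne : ∀ᵐ p : ℝ × ℝ, p.1 ≠ p.2 := by
  rw [Measure.volume_eq_prod]
  have : MeasurableSet {p : ℝ × ℝ | p.1 ≠ p.2} :=
    (measurableSet_eq_fun measurable_fst measurable_snd).compl
  rw [Measure.ae_prod_iff_ae_ae this]
  refine ae_of_all _ fun t => ?_
  have := Measure.ae_ne (volume : Measure ℝ) t
  filter_upwards [this] with s hs using hs.symm

/-- The bound of the form that results from the fixed-time estimates. -/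
lemma enorm_evol_le_lintegral {p : ℝ} (hp₁ : 1 ≤ p) (hp₂ : p ≤ 2) :
    ∃ C : ℝ≥0∞, C ≠ ∞ ∧ ∀ D : Set ℝ, MeasurableSet D → (∀ t ∈ D, 0 < t) → ∀ ν : Space n, ν ≠ 0 →
      ∀ ε : ℝ, 0 < ε → ∀ f g : SpaceTime n → ℂ, Nice volume f → Nice volume g →
        ‖evol D ν ε f g‖ₑ ≤ C * ∫⁻ z : ℝ × ℝ, D.indicator (fun _ => (1 : ℝ≥0∞)) (z.1 - z.2) *
          (ENNReal.ofReal (z.1 - z.2) ^ (-((n : ℝ) * (1 / p - 1 / 2))) *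
            (eLpNorm (fun x => f (z.2, x)) (ENNReal.ofReal p) volume *
              eLpNorm (fun x => g (z.1, x)) (ENNReal.ofReal p) volume)) := by
  obtain ⟨C, hC, h⟩ := exists_kern_decay (E := Space n) hp₁ hp₂
  refine ⟨C, hC, fun D hD hD0 ν hν ε hε f g hf hg => ?_⟩
  rw [evol_eq hD hD0 ν hε hf hg, ← lintegral_const_mul' _ _ hC]
  refine (enorm_integral_le_lintegral_enorm _).trans (lintegral_mono_ae ?_)
  filter_upwards [ae_pair_of_ae hg.ae_slice hf.ae_slice] with z ⟨hgz, hfz⟩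
  by_cases hz : z.1 - z.2 ∈ D
  · have h0 := hD0 _ hz
    have := h ν hν ε (z.1 - z.2) (z.1 - z.2) hε h0.ne' h0.le _ _ hfz hgz
    rw [finrank_euclideanSpace_fin, abs_of_pos h0] at this
    simp only [Set.indicator_of_mem hz, one_mul]
    refine this.trans (le_of_eq ?_)
    ring
  · simp [Set.indicator_of_notMem hz]

lemma ofReal_rpow_neg_le_of_mem_dyad {j : ℤ} {u γ : ℝ} (hγ : 0 ≤ γ) (hu : u ∈ dyad j) :
    ENNReal.ofReal u ^ (-γ) ≤ (2 : ℝ≥0∞) ^ (-((j : ℝ) * γ)) := by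
  have : (2 : ℝ≥0∞) ^ (j : ℝ) ≤ ENNReal.ofReal u := by
    have h := ENNReal.ofReal_le_ofReal hu.1
    rw [← Real.rpow_intCast, ← ENNReal.ofReal_rpow_of_pos (by norm_num)] at h
    simpa using h
  rw [← mul_neg, ENNReal.rpow_mul, ENNReal.rpow_neg, ENNReal.rpow_neg]
  gcongr

/-- The estimate away from the endpoint: the fixed-time estimates and the
Hardy–Littlewood–Sobolev inequality in time. -/
theorem exists_evol_le_of_lt {q r : ℝ} (hq₁ : 1 ≤ q) (hq₂ : q < 2) (hr₁ : 1 ≤ r) (hr₂ : r ≤ 2)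
    (hqr : (n : ℝ) * (1 / r - 1 / 2) = 2 - 2 / q) :
    ∃ C : ℝ≥0∞, C ≠ ∞ ∧ ∀ ν : Space n, ν ≠ 0 → ∀ ε : ℝ, 0 < ε → ∀ f g : SpaceTime n → ℂ,
      Nice volume f → Nice volume g → ‖evol (Set.Ioi 0) ν ε f g‖ₑ ≤
        C * mixedNorm (ENNReal.ofReal q) (ENNReal.ofReal r) f *
          mixedNorm (ENNReal.ofReal q) (ENNReal.ofReal r) g := by
  obtain ⟨C, hC, h⟩ := enorm_evol_le_lintegral (n := n) hr₁ hr₂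
  rw [hqr] at h
  have key : ∃ C' : ℝ≥0∞, C' ≠ ∞ ∧ ∀ φ ψ : ℝ → ℝ≥0∞, Measurable φ → Measurable ψ →
      ∫⁻ z : ℝ × ℝ, (Set.Ioi 0).indicator (fun _ => (1 : ℝ≥0∞)) (z.1 - z.2) *
        (ENNReal.ofReal (z.1 - z.2) ^ (-(2 - 2 / q)) * (φ z.2 * ψ z.1)) ≤
        C' * eLpNorm φ (ENNReal.ofReal q) volume * eLpNorm ψ (ENNReal.ofReal q) volume := by
    -- For `q = 1` the exponent of the kernel in time vanishes.
    rcases eq_or_lt_of_le hq₁ with rfl | hq₁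
    · refine ⟨1, by simp, fun φ ψ hφ hψ => ?_⟩
      have : ∫⁻ z : ℝ × ℝ, φ z.2 * ψ z.1 = eLpNorm φ 1 volume * eLpNorm ψ 1 volume := by
        simp_rw [mul_comm (φ _)]
        rw [Measure.volume_eq_prod, lintegral_prod_mul hψ.aemeasurable hφ.aemeasurable, mul_comm]
        simp [eLpNorm_one_eq_lintegral_enorm]
      rw [ENNReal.ofReal_one, one_mul, ← this]
      refine lintegral_mono fun z => ?_
      by_cases hz : z.1 - z.2 ∈ Set.Ioi (0 : ℝ)
      · simp only [Set.indicator_of_mem hz]; norm_num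
      · simp [Set.indicator_of_notMem hz]
    · obtain ⟨C', hC', h'⟩ := exists_hardy_littlewood_sobolev hq₁ hq₂
      refine ⟨C', hC', fun φ ψ hφ hψ => le_trans (le_of_eq ?_) (h' φ ψ hφ hψ)⟩
      have hm : MeasurableSet {z : ℝ × ℝ | z.2 < z.1} :=
        measurableSet_lt measurable_snd measurable_fst
      rw [← lintegral_indicator hm]
      refine lintegral_congr fun z => ?_
      by_cases hz : z.2 < z.1
      · rw [Set.indicator_of_mem (show z.1 - z.2 ∈ Set.Ioi (0 : ℝ) from sub_pos.2 hz),
          Set.indicator_of_mem (show z ∈ {z : ℝ × ℝ | z.2 < z.1} from hz), one_mul]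
      · rw [Set.indicator_of_notMem (show z.1 - z.2 ∉ Set.Ioi (0 : ℝ) by simpa using hz),
          Set.indicator_of_notMem (show z ∉ {z : ℝ × ℝ | z.2 < z.1} from hz), zero_mul]
  obtain ⟨C', hC', h'⟩ := key
  refine ⟨C * C', ENNReal.mul_ne_top hC hC', fun ν hν ε hε f g hf hg => ?_⟩
  refine (h _ measurableSet_Ioi (fun t ht => ht) ν hν ε hε f g hf hg).trans ?_
  rw [mul_assoc C, mul_assoc C]
  refine mul_le_mul_right ?_ _
  exact h' _ _ (measurable_eLpNorm_slice hf.meas.enorm _) (measurable_eLpNorm_slice hg.meas.enorm _)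

end Evolution

/-! ### The endpoint: the dyadic pieces of the evolution -/

section Endpoint

open Complex

variable {n : ℕ}

lemma lintegral_Ioo_rpow_neg_half (j : ℤ) :
    ∫⁻ u, (Set.Ioo 0 ((2 : ℝ) ^ j)).indicator (fun u => ENNReal.ofReal u ^ (-(1 / 2 : ℝ))) u =
      2 * (2 : ℝ≥0∞) ^ ((j : ℝ) / 2) := by
  have ha : (0 : ℝ) < 2 ^ j := by positivity
  rw [lintegral_indicator measurableSet_Ioo]
  have h1 : ∫⁻ u in Set.Ioo 0 ((2 : ℝ) ^ j), ENNReal.ofReal u ^ (-(1 / 2 : ℝ)) =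
      ∫⁻ u in Set.Ioo 0 ((2 : ℝ) ^ j), ENNReal.ofReal (u ^ (-(1 / 2 : ℝ))) := by
    refine setLIntegral_congr_fun measurableSet_Ioo fun u hu => ?_
    rw [← ENNReal.ofReal_rpow_of_pos hu.1]
  have hi := intervalIntegral.intervalIntegrable_rpow' (a := 0) (b := (2 : ℝ) ^ j)
    (r := -(1 / 2)) (by norm_num)
  rw [intervalIntegrable_iff_integrableOn_Ioo_of_le ha.le] at hi
  rw [h1, ← ofReal_integral_eq_lintegral_ofReal hi
    ((ae_restrict_mem measurableSet_Ioo).mono fun u hu => Real.rpow_nonneg hu.1.le _),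
    ← integral_Ioc_eq_integral_Ioo, ← intervalIntegral.integral_of_le ha.le,
    integral_rpow (Or.inl (by norm_num)), ← Real.rpow_intCast, ← Real.rpow_mul (by norm_num)]
  have : ((2 : ℝ) ^ ((j : ℝ) * (-(1 / 2) + 1)) - 0 ^ (-(1 / 2 : ℝ) + 1)) / (-(1 / 2) + 1) =
      2 * 2 ^ ((j : ℝ) / 2) := by
    norm_num
    ring_nf
  rw [this, ENNReal.ofReal_mul (by norm_num), ENNReal.ofReal_ofNat,
    ← ENNReal.ofReal_rpow_of_pos (by norm_num)]
  simp

/-- The space Fourier transform of a slice. -/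
def sliceFourier (f : SpaceTime n → ℂ) (t : ℝ) (ξ : Space n) : ℂ :=
  ∫ x, chr x ξ * f (t, x)

lemma measurable_sliceFourier_uncurry {f : SpaceTime n → ℂ} (hf : Measurable f) :
    Measurable fun p : ℝ × Space n => sliceFourier f p.1 p.2 := by
  have : Measurable fun p : (ℝ × Space n) × Space n => chr p.2 p.1.2 * f (p.1.1, p.2) := by
    fun_prop
  exact (this.stronglyMeasurable.integral_prod_right (ν := volume)).measurable

@[fun_prop]
lemma measurable_sliceFourier {α : Type*} [MeasurableSpace α] {f : SpaceTime n → ℂ}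
    (hf : Measurable f) {t : α → ℝ} {ξ : α → Space n} (ht : Measurable t) (hξ : Measurable ξ) :
    Measurable fun a => sliceFourier f (t a) (ξ a) := by
  have h : Measurable fun a => (t a, ξ a) := ht.prodMk hξ
  have := (measurable_sliceFourier_uncurry hf).comp h
  exact this

lemma norm_sliceFourier_le (f : SpaceTime n → ℂ) (t : ℝ) (ξ : Space n) :
    ‖sliceFourier f t ξ‖ ≤ ∫ x, ‖f (t, x)‖ := by
  refine (norm_integral_le_integral_norm _).trans (le_of_eq ?_)
  simp [norm_chr]

lemma Nice.integrable_slice_norm {f : SpaceTime n → ℂ} (hf : Nice volume f) :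
    Integrable fun t : ℝ => ∫ x, ‖f (t, x)‖ := by
  have := hf.int
  rw [Measure.volume_eq_prod] at this
  exact this.integral_norm_prod_left

/-- The amplitude at time `t` of the dyadic piece of the evolution, on the Fourier side. -/
def dyadAmp (j : ℤ) (ν : Space n) (f : SpaceTime n → ℂ) (t : ℝ) (ξ : Space n) : ℂ :=
  ∫ s, (dyad j).indicator (fun _ => (1 : ℂ)) (t - s) *
    (damp ν (t - s) (t - s) ξ * sliceFourier f s (-ξ))

lemma pos_of_mem_dyad {j : ℤ} {u : ℝ} (hu : u ∈ dyad j) : 0 < u :=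
  lt_of_lt_of_le (by positivity) hu.1

lemma norm_indicator_mul_damp_le (j : ℤ) (ν ξ : Space n) (u : ℝ) :
    ‖(dyad j).indicator (fun _ => (1 : ℂ)) u * damp ν u u ξ‖ ≤ 1 := by
  by_cases hu : u ∈ dyad j
  · rw [Set.indicator_of_mem hu, one_mul]
    exact norm_damp_le ν u (pos_of_mem_dyad hu).le ξ
  · simp [Set.indicator_of_notMem hu]

lemma measurable_dyadAmp_uncurry (j : ℤ) (ν : Space n) {f : SpaceTime n → ℂ} (hf : Measurable f) :
    Measurable fun p : ℝ × Space n => dyadAmp j ν f p.1 p.2 := by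
  have hD := measurableSet_dyad j
  have : Measurable fun p : (ℝ × Space n) × ℝ =>
      (dyad j).indicator (fun _ => (1 : ℂ)) (p.1.1 - p.2) *
        (damp ν (p.1.1 - p.2) (p.1.1 - p.2) p.1.2 * sliceFourier f p.2 (-p.1.2)) := by
    fun_prop
  exact (this.stronglyMeasurable.integral_prod_right (ν := volume)).measurable

lemma norm_dyadAmp_le (j : ℤ) (ν : Space n) {f : SpaceTime n → ℂ} (hf : Nice volume f) (t : ℝ)
    (ξ : Space n) : ‖dyadAmp j ν f t ξ‖ ≤ ∫ s, ∫ x, ‖f (s, x)‖ := by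
  refine norm_integral_le_of_norm_le hf.integrable_slice_norm (ae_of_all _ fun s => ?_)
  rw [← mul_assoc, norm_mul]
  exact (mul_le_of_le_one_left (norm_nonneg _) (norm_indicator_mul_damp_le j ν ξ _)).trans
    (norm_sliceFourier_le f s _)

/-- On the Fourier side the integral over the earlier time is carried out first; it gives the
amplitude. -/
lemma enorm_evol_dyad_le_amp (j : ℤ) (ν : Space n) {ε : ℝ} (hε : 0 < ε) {f g : SpaceTime n → ℂ}
    (hf : Nice volume f) (hg : Nice volume g) :
    ‖evol (dyad j) ν ε f g‖ₑ ≤ ∫⁻ t, ∫⁻ ξ, ENNReal.ofReal (Real.exp (-ε * ‖ξ‖ ^ 2)) *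
      (‖sliceFourier g t ξ‖ₑ * ‖dyadAmp j ν f t ξ‖ₑ) := by
  have hfm := hf.meas
  have hgm := hg.meas
  have hD := measurableSet_dyad j
  set H : (ℝ × ℝ) × Space n → ℂ := fun p =>
    (dyad j).indicator (fun _ => (1 : ℂ)) (p.1.1 - p.1.2) * ((Real.exp (-ε * ‖p.2‖ ^ 2) : ℂ) *
      (damp ν (p.1.1 - p.1.2) (p.1.1 - p.1.2) p.2 *
        (sliceFourier g p.1.1 p.2 * sliceFourier f p.1.2 (-p.2)))) with hH
  have hHm : Measurable H := by
    simp only [hH]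
    fun_prop
  have hHi : Integrable H (volume.prod volume) := by
    have h0 : Integrable (fun p : (ℝ × ℝ) × Space n =>
        ((∫ x, ‖g (p.1.1, x)‖) * ∫ x, ‖f (p.1.2, x)‖) * Real.exp (-ε * ‖p.2‖ ^ 2))
        (volume.prod volume) :=
      (hg.integrable_slice_norm.mul_prod hf.integrable_slice_norm).mul_prod (integrable_gauss hε)
    refine h0.mono' hHm.aestronglyMeasurable (ae_of_all _ fun p => ?_)
    have h1 : ‖H p‖ = ‖(dyad j).indicator (fun _ => (1 : ℂ)) (p.1.1 - p.1.2) *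
        damp ν (p.1.1 - p.1.2) (p.1.1 - p.1.2) p.2‖ * (‖sliceFourier g p.1.1 p.2‖ *
        ‖sliceFourier f p.1.2 (-p.2)‖ * Real.exp (-ε * ‖p.2‖ ^ 2)) := by
      simp only [hH, norm_mul, norm_real, Real.norm_of_nonneg (Real.exp_pos _).le]
      ring
    rw [h1]
    refine (mul_le_of_le_one_left (by positivity) (norm_indicator_mul_damp_le j ν _ _)).trans ?_
    gcongr
    · exact norm_sliceFourier_le g _ _
    · exact norm_sliceFourier_le f _ _
  have hassoc : Integrable (fun q : ℝ × (ℝ × Space n) => H ((q.1, q.2.1), q.2.2))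
      (volume.prod (volume.prod volume)) :=
    ((measurePreserving_prodAssoc volume volume volume).symm MeasurableEquiv.prodAssoc).integrable_comp
      hHi.aestronglyMeasurable |>.2 hHi
  have h1 : evol (dyad j) ν ε f g = ∫ p : ℝ × ℝ, ∫ ξ, H (p, ξ) := by
    rw [evol_eq (measurableSet_dyad j) (fun _ => pos_of_mem_dyad) ν hε hf hg]
    refine integral_congr_ae ?_
    filter_upwards [ae_pair_of_ae hg.ae_slice hf.ae_slice] with p ⟨hgp, hfp⟩
    simp only [hH]
    rw [integral_const_mul]
    by_cases hp : p.1 - p.2 ∈ dyad j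
    · rw [integral_kern_mul_eq ν hε (pos_of_mem_dyad hp).le hfp.int hgp.int]
      rfl
    · simp [Set.indicator_of_notMem hp]
  have h2 : ∫ p : ℝ × ℝ, ∫ ξ, H (p, ξ) = ∫ t, ∫ ξ, ∫ s, H ((t, s), ξ) := by
    refine (integral_integral (f := fun p ξ => H (p, ξ)) hHi).trans ?_
    refine Eq.trans ((measurePreserving_prodAssoc volume volume volume).symm
      MeasurableEquiv.prodAssoc |>.integral_comp' (g := H)).symm ?_
    refine (integral_prod _ hassoc).trans (integral_congr_ae ?_)
    filter_upwards [hassoc.prod_right_ae] with t ht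
    exact integral_prod_symm _ ht
  rw [h1, h2]
  refine (enorm_integral_le_lintegral_enorm _).trans (lintegral_mono fun t => ?_)
  refine (enorm_integral_le_lintegral_enorm _).trans (lintegral_mono fun ξ => le_of_eq ?_)
  have h3 : ∫ s, H ((t, s), ξ) = (Real.exp (-ε * ‖ξ‖ ^ 2) : ℂ) *
      (sliceFourier g t ξ * dyadAmp j ν f t ξ) := by
    rw [dyadAmp, ← integral_const_mul, ← integral_const_mul]
    refine integral_congr_ae (ae_of_all _ fun s => ?_)
    simp only [hH]
    ring
  rw [h3, enorm_mul, enorm_mul]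
  congr 1
  rw [← ofReal_norm, norm_real, Real.norm_of_nonneg (Real.exp_pos _).le]

/-- The square of the amplitude expands into the form of the damped evolution, the damping
parameter of which differs from the time. -/
lemma lintegral_dyadAmp_sq_le {p : ℝ} (hp₁ : 1 ≤ p) (hp₂ : p ≤ 2) :
    ∃ C : ℝ≥0∞, C ≠ ∞ ∧ ∀ j : ℤ, ∀ ν : Space n, ν ≠ 0 → ∀ ε : ℝ, 0 < ε →
      ∀ f : SpaceTime n → ℂ, Nice volume f → ∀ t : ℝ,
        ∫⁻ ξ, ENNReal.ofReal (Real.exp (-ε * ‖ξ‖ ^ 2)) * ‖dyadAmp j ν f t ξ‖ₑ ^ 2 ≤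
          C * ∫⁻ z : ℝ × ℝ, (dyad j).indicator (fun _ => (1 : ℝ≥0∞)) (t - z.1) *
            (dyad j).indicator (fun _ => (1 : ℝ≥0∞)) (t - z.2) *
            (ENNReal.ofReal |z.2 - z.1| ^ (-((n : ℝ) * (1 / p - 1 / 2))) *
              (eLpNorm (fun x => f (z.1, x)) (ENNReal.ofReal p) volume *
                eLpNorm (fun x => f (z.2, x)) (ENNReal.ofReal p) volume)) := by
  obtain ⟨C, hC, h⟩ := exists_kern_decay (E := Space n) hp₁ hp₂
  refine ⟨C, hC, fun j ν hν ε hε f hf t => ?_⟩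
  have hfm := hf.meas
  have hc : Measurable (starRingEnd ℂ) := Complex.continuous_conj.measurable
  have hAm : Measurable fun ξ => dyadAmp j ν f t ξ :=
    (measurable_dyadAmp_uncurry j ν hfm).comp measurable_prodMk_left
  set M := ∫ s, ∫ x, ‖f (s, x)‖ with hM
  set a : ℝ → Space n → ℂ := fun s ξ => (dyad j).indicator (fun _ => (1 : ℂ)) (t - s) *
      (damp ν (t - s) (t - s) ξ * sliceFourier f s (-ξ)) with ha
  have hale : ∀ s ξ, ‖a s ξ‖ ≤ ∫ x, ‖f (s, x)‖ := fun s ξ => by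
    simp only [ha]
    rw [← mul_assoc, norm_mul]
    exact (mul_le_of_le_one_left (norm_nonneg _) (norm_indicator_mul_damp_le j ν ξ _)).trans
      (norm_sliceFourier_le f s _)
  have hint1 : Integrable (fun ξ => Real.exp (-ε * ‖ξ‖ ^ 2) * ‖dyadAmp j ν f t ξ‖ ^ 2) := by
    have : Integrable (fun ξ => ‖dyadAmp j ν f t ξ‖ ^ 2 * Real.exp (-ε * ‖ξ‖ ^ 2)) := by
      refine (integrable_gauss hε).bdd_mul (c := M ^ 2) (by fun_prop) (ae_of_all _ fun ξ => ?_)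
      rw [Real.norm_of_nonneg (by positivity)]
      gcongr
      exact norm_dyadAmp_le j ν hf t ξ
    simpa [mul_comm] using this
  have hbig : Integrable (fun p : Space n × (ℝ × ℝ) => (Real.exp (-ε * ‖p.1‖ ^ 2) : ℂ) *
      (a p.2.1 p.1 * starRingEnd ℂ (a p.2.2 p.1))) (volume.prod volume) := by
    have h00 : Integrable (fun z : ℝ × ℝ => (∫ x, ‖f (z.1, x)‖) * ∫ x, ‖f (z.2, x)‖) volume :=
      hf.integrable_slice_norm.mul_prod hf.integrable_slice_norm
    have h0 : Integrable (fun p : Space n × (ℝ × ℝ) => Real.exp (-ε * ‖p.1‖ ^ 2) *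
        ((∫ x, ‖f (p.2.1, x)‖) * ∫ x, ‖f (p.2.2, x)‖)) (volume.prod volume) :=
      Integrable.mul_prod (f := fun ξ : Space n => Real.exp (-ε * ‖ξ‖ ^ 2))
        (g := fun z : ℝ × ℝ => (∫ x, ‖f (z.1, x)‖) * ∫ x, ‖f (z.2, x)‖) (integrable_gauss hε) h00
    have hD := measurableSet_dyad j
    have hm1 : Measurable fun p : Space n × (ℝ × ℝ) => a p.2.1 p.1 := by
      simp only [ha]
      fun_prop
    have hm2 : Measurable fun p : Space n × (ℝ × ℝ) => a p.2.2 p.1 := by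
      simp only [ha]
      fun_prop
    have hm3 : Measurable fun p : Space n × (ℝ × ℝ) => (Real.exp (-ε * ‖p.1‖ ^ 2) : ℂ) := by
      fun_prop
    refine h0.mono' (hm3.mul (hm1.mul (hc.comp hm2))).aestronglyMeasurable (ae_of_all _ fun p => ?_)
    rw [norm_mul, norm_mul, norm_real, Real.norm_of_nonneg (Real.exp_pos _).le, RCLike.norm_conj]
    gcongr
    · exact hale _ _
    · exact hale _ _
  -- Expanding the square and exchanging the integrals produces the kernels of the evolution.
  have hid : ((∫ ξ, Real.exp (-ε * ‖ξ‖ ^ 2) * ‖dyadAmp j ν f t ξ‖ ^ 2 : ℝ) : ℂ) =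
      ∫ z : ℝ × ℝ, ∫ ξ, (Real.exp (-ε * ‖ξ‖ ^ 2) : ℂ) *
        (a z.1 ξ * starRingEnd ℂ (a z.2 ξ)) := by
    rw [← integral_complex_ofReal, ← integral_integral_swap hbig]
    refine integral_congr_ae (ae_of_all _ fun ξ => ?_)
    simp only
    rw [integral_const_mul]
    have h2 : starRingEnd ℂ (dyadAmp j ν f t ξ) = ∫ s, starRingEnd ℂ (a s ξ) := integral_conj.symm
    rw [Measure.volume_eq_prod, integral_prod_mul (fun s => a s ξ) (fun s => starRingEnd ℂ (a s ξ)),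
      ← h2]
    push_cast
    rw [← Complex.mul_conj']
    rfl
  calc _ = ∫⁻ ξ, ENNReal.ofReal (Real.exp (-ε * ‖ξ‖ ^ 2) * ‖dyadAmp j ν f t ξ‖ ^ 2) := by
        refine lintegral_congr fun ξ => ?_
        rw [ENNReal.ofReal_mul (Real.exp_pos _).le, ENNReal.ofReal_pow (norm_nonneg _), ofReal_norm]
    _ = ENNReal.ofReal (∫ ξ, Real.exp (-ε * ‖ξ‖ ^ 2) * ‖dyadAmp j ν f t ξ‖ ^ 2) :=
        (ofReal_integral_eq_lintegral_ofReal hint1 (ae_of_all _ fun ξ => by positivity)).symm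
    _ ≤ ‖∫ z : ℝ × ℝ, ∫ ξ, (Real.exp (-ε * ‖ξ‖ ^ 2) : ℂ) *
        (a z.1 ξ * starRingEnd ℂ (a z.2 ξ))‖ₑ := by
        rw [← hid, ← ofReal_norm]
        refine ENNReal.ofReal_le_ofReal ?_
        rw [Complex.norm_real]
        exact le_abs_self _
    _ ≤ _ := by
        rw [← lintegral_const_mul' _ _ hC]
        refine (enorm_integral_le_lintegral_enorm _).trans (lintegral_mono_ae ?_)
        filter_upwards [ae_pair_of_ae hf.ae_slice hf.ae_slice, ae_times_ne] with z ⟨h1, h2⟩ hne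
        by_cases hz1 : t - z.1 ∈ dyad j
        swap
        · simp [ha, Set.indicator_of_notMem hz1]
        by_cases hz2 : t - z.2 ∈ dyad j
        swap
        · simp [ha, Set.indicator_of_notMem hz2]
        have hσ : 0 ≤ (t - z.1) + (t - z.2) :=
          (add_pos (pos_of_mem_dyad hz1) (pos_of_mem_dyad hz2)).le
        have hτ : (t - z.1) - (t - z.2) ≠ 0 := by
          rw [sub_sub_sub_cancel_left, sub_ne_zero]; exact hne.symm
        have key := h ν hν ε _ _ hε hτ hσ _ _ h1 h2.conj
        rw [integral_kern_mul_eq ν hε hσ h1.int h2.conj.int] at key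
        simp only [Set.indicator_of_mem hz1, Set.indicator_of_mem hz2, one_mul, mul_one]
        -- The times of the two dampings are subtracted, and their damping parameters added.
        have e1 : ∀ ξ, a z.1 ξ * starRingEnd ℂ (a z.2 ξ) =
            damp ν ((t - z.1) - (t - z.2)) ((t - z.1) + (t - z.2)) ξ *
              ((∫ x, chr x ξ * starRingEnd ℂ (f (z.2, x))) * ∫ y, chr y (-ξ) * f (z.1, y)) := by
          intro ξ
          have e2 : starRingEnd ℂ (sliceFourier f z.2 (-ξ)) =
              ∫ x, chr x ξ * starRingEnd ℂ (f (z.2, x)) := by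
            rw [sliceFourier, ← integral_conj]
            refine integral_congr_ae (ae_of_all _ fun x => ?_)
            simp only [map_mul, conj_chr]
            simp [chr]
          simp only [ha, Set.indicator_of_mem hz1, Set.indicator_of_mem hz2, one_mul, map_mul]
          rw [← damp_mul_conj_damp, e2, sliceFourier]
          ring
        simp_rw [e1]
        refine key.trans (le_of_eq ?_)
        rw [finrank_euclideanSpace_fin, sub_sub_sub_cancel_left]
        have e3 : eLpNorm (fun x => starRingEnd ℂ (f (z.2, x))) (ENNReal.ofReal p) volume =
            eLpNorm (fun x => f (z.2, x)) (ENNReal.ofReal p) volume :=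
          eLpNorm_congr_norm_ae (ae_of_all _ fun x => RCLike.norm_conj _)
        rw [e3]
        ring

end Endpoint

/-! ### The endpoint: summation over the dyadic pieces -/

section EndpointSum

open Complex

variable {n : ℕ}

lemma rpow_half_sq (a : ℝ≥0∞) : (a ^ (1 / 2 : ℝ)) ^ (2 : ℝ) = a := by
  rw [← ENNReal.rpow_mul]; norm_num

lemma sq_rpow_half (a : ℝ≥0∞) : (a ^ (2 : ℝ)) ^ (1 / 2 : ℝ) = a := by
  rw [← ENNReal.rpow_mul]; norm_num

lemma mixedNorm_two_eq {F : Type*} [NormedAddCommGroup F] (p : ℝ≥0∞) (f : SpaceTime n → F) :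
    mixedNorm 2 p f = (∫⁻ t, eLpNorm (fun x => f (t, x)) p volume ^ (2 : ℝ)) ^ (1 / 2 : ℝ) :=
  eLpNorm_two_eq _

/-- Both times of a dyadic window differ by less than its length, and the singularity
`|s - s'|^{-1/2}` is integrable there. -/
lemma lintegral_dyad_window_le (j : ℤ) {φ : ℝ → ℝ≥0∞} (hφ : Measurable φ) :
    ∫⁻ t, ∫⁻ z : ℝ × ℝ, (dyad j).indicator (fun _ => (1 : ℝ≥0∞)) (t - z.1) *
        (dyad j).indicator (fun _ => (1 : ℝ≥0∞)) (t - z.2) *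
        (ENNReal.ofReal |z.2 - z.1| ^ (-(1 / 2 : ℝ)) * (φ z.1 * φ z.2)) ≤
      4 * (2 : ℝ≥0∞) ^ ((j : ℝ) * (3 / 2)) * ∫⁻ t, φ t ^ (2 : ℝ) := by
  have hD := measurableSet_dyad j
  -- `k` is the singularity, restricted to the interval `(-2^j, 2^j)`.
  set kp : ℝ → ℝ≥0∞ :=
    (Set.Ioo 0 ((2 : ℝ) ^ j)).indicator (fun u => ENNReal.ofReal u ^ (-(1 / 2 : ℝ))) with hkp
  have hkpm : Measurable kp := by
    refine Measurable.indicator ?_ measurableSet_Ioo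
    fun_prop
  set k : ℝ → ℝ≥0∞ := fun u => kp u + kp (-u) with hk
  have hkm : Measurable k := by fun_prop
  have hkint : ∫⁻ u, k u = 4 * (2 : ℝ≥0∞) ^ ((j : ℝ) / 2) := by
    simp only [hk]
    rw [lintegral_add_left hkpm, lintegral_neg_eq_self, lintegral_Ioo_rpow_neg_half]
    ring
  have hwin : ∀ t s s' : ℝ, t - s ∈ dyad j → t - s' ∈ dyad j → s < s' → s' - s < 2 ^ j := by
    intro t s s' h h' hlt
    have h1 := h.2
    have h2 := h'.1
    rw [zpow_add₀ (by norm_num), zpow_one] at h1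
    linarith
  calc _ ≤ ∫⁻ t, ∫⁻ z : ℝ × ℝ, (dyad j).indicator (fun _ => (1 : ℝ≥0∞)) (t - z.1) *
        (k (z.1 - z.2) * (φ z.2 * φ z.1)) := by
        refine lintegral_mono fun t => lintegral_mono_ae ?_
        filter_upwards [ae_times_ne] with z hne
        by_cases h1 : t - z.1 ∈ dyad j
        swap
        · simp [Set.indicator_of_notMem h1]
        by_cases h2 : t - z.2 ∈ dyad j
        swap
        · simp [Set.indicator_of_notMem h2]
        simp only [Set.indicator_of_mem h1, Set.indicator_of_mem h2, one_mul]
        rw [mul_comm (φ z.1)]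
        refine mul_le_mul_left ?_ _
        rcases lt_or_gt_of_ne hne with hlt | hlt
        · refine le_trans (le_of_eq ?_) le_add_self
          have h3 : -(z.1 - z.2) ∈ Set.Ioo (0 : ℝ) (2 ^ j) := by
            have := hwin t _ _ h1 h2 hlt
            constructor <;> linarith
          simp only [hkp, Set.indicator_of_mem h3]
          rw [abs_of_pos (by linarith)]
          congr 2; ring
        · refine le_trans (le_of_eq ?_) le_self_add
          have h3 : z.1 - z.2 ∈ Set.Ioo (0 : ℝ) (2 ^ j) := by
            have := hwin t _ _ h2 h1 hlt
            constructor <;> linarith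
          simp only [hkp, Set.indicator_of_mem h3]
          rw [abs_of_neg (by linarith)]
          congr 2; ring
    _ = ∫⁻ z : ℝ × ℝ, ∫⁻ t, (dyad j).indicator (fun _ => (1 : ℝ≥0∞)) (t - z.1) *
        (k (z.1 - z.2) * (φ z.2 * φ z.1)) := by
        refine lintegral_lintegral_swap (Measurable.aemeasurable ?_)
        have : Measurable fun q : ℝ × (ℝ × ℝ) =>
            (dyad j).indicator (fun _ => (1 : ℝ≥0∞)) (q.1 - q.2.1) *
              (k (q.2.1 - q.2.2) * (φ q.2.2 * φ q.2.1)) := by fun_prop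
        exact this
    _ = (2 : ℝ≥0∞) ^ (j : ℝ) * ∫⁻ z : ℝ × ℝ, k (z.1 - z.2) * (φ z.2 * φ z.1) := by
        rw [← lintegral_const_mul _ (by fun_prop)]
        refine lintegral_congr fun z => ?_
        rw [lintegral_mul_const _ (by fun_prop),
          lintegral_sub_right_eq_self (fun t => (dyad j).indicator (fun _ => (1 : ℝ≥0∞)) t) z.1]
        have := lintegral_indicator_one (μ := (volume : Measure ℝ)) hD
        rw [volume_dyad] at this
        rw [← this]
        rfl
    _ ≤ (2 : ℝ≥0∞) ^ (j : ℝ) * ((∫⁻ w, k w) * eLpNorm φ 2 volume * eLpNorm φ 2 volume) := by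
        gcongr
        exact lintegral_convolution_le hkm hφ hφ
    _ = _ := by
        have e1 : eLpNorm φ 2 volume * eLpNorm φ 2 volume = ∫⁻ t, φ t ^ (2 : ℝ) := by
          rw [eLpNorm_two_eq, ← ENNReal.rpow_add_of_nonneg _ _ (by norm_num) (by norm_num)]
          norm_num
        have e2 : (2 : ℝ≥0∞) ^ ((j : ℝ) * (3 / 2)) =
            (2 : ℝ≥0∞) ^ (j : ℝ) * (2 : ℝ≥0∞) ^ ((j : ℝ) / 2) := by
          rw [← ENNReal.rpow_add _ _ (by simp) (by simp)]
          congr 1; ring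
        rw [hkint, e2, mul_assoc (4 * _), e1]
        ring

/-- The estimate of a dyadic piece with only one of the two functions measured in `L²`, by the
`T*T` method. -/
lemma exists_evol_dyad_le_left {p : ℝ} (hp₁ : 1 ≤ p) (hp₂ : p ≤ 2)
    (hp : (n : ℝ) * (1 / p - 1 / 2) = 1 / 2) :
    ∃ C : ℝ≥0∞, C ≠ ∞ ∧ ∀ j : ℤ, ∀ ν : Space n, ν ≠ 0 → ∀ ε : ℝ, 0 < ε →
      ∀ f g : SpaceTime n → ℂ, Nice volume f → Nice volume g →
        ‖evol (dyad j) ν ε f g‖ₑ ≤ C * (2 : ℝ≥0∞) ^ ((j : ℝ) * (3 / 4)) *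
          mixedNorm 2 (ENNReal.ofReal p) f * mixedNorm 2 2 g := by
  obtain ⟨C, hC, h⟩ := lintegral_dyadAmp_sq_le (n := n) hp₁ hp₂
  rw [hp] at h
  set B : ℝ≥0∞ := ENNReal.ofReal ((2 * Real.pi) ^ (n : ℝ)) with hB
  refine ⟨(B * (C * 4)) ^ (1 / 2 : ℝ), ?_, fun j ν hν ε hε f g hf hg => ?_⟩
  · exact ENNReal.rpow_ne_top_of_nonneg (by norm_num)
      (ENNReal.mul_ne_top ENNReal.ofReal_ne_top (ENNReal.mul_ne_top hC (by simp)))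
  have hfm := hf.meas
  have hgm := hg.meas
  have hD := measurableSet_dyad j
  set φ : ℝ → ℝ≥0∞ := fun t => eLpNorm (fun x => f (t, x)) (ENNReal.ofReal p) volume with hφ
  have hφm : Measurable φ := measurable_eLpNorm_slice hfm.enorm _
  set ψ : ℝ → ℝ≥0∞ := fun t => eLpNorm (fun x => g (t, x)) 2 volume with hψ
  have hψm : Measurable ψ := measurable_eLpNorm_slice hgm.enorm _
  set K : ℝ → ℝ≥0∞ := fun t => ∫⁻ z : ℝ × ℝ, (dyad j).indicator (fun _ => (1 : ℝ≥0∞)) (t - z.1) *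
        (dyad j).indicator (fun _ => (1 : ℝ≥0∞)) (t - z.2) *
        (ENNReal.ofReal |z.2 - z.1| ^ (-(1 / 2 : ℝ)) * (φ z.1 * φ z.2)) with hK
  have hKm : Measurable K := by
    have : Measurable fun q : ℝ × (ℝ × ℝ) =>
        (dyad j).indicator (fun _ => (1 : ℝ≥0∞)) (q.1 - q.2.1) *
        (dyad j).indicator (fun _ => (1 : ℝ≥0∞)) (q.1 - q.2.2) *
        (ENNReal.ofReal |q.2.2 - q.2.1| ^ (-(1 / 2 : ℝ)) * (φ q.2.1 * φ q.2.2)) := by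
      have h1 : Measurable fun q : ℝ × (ℝ × ℝ) => φ q.2.1 := by fun_prop
      have h2 : Measurable fun q : ℝ × (ℝ × ℝ) => φ q.2.2 := by fun_prop
      have h3 : Measurable fun q : ℝ × (ℝ × ℝ) =>
        ENNReal.ofReal |q.2.2 - q.2.1| ^ (-(1 / 2 : ℝ)) := by fun_prop
      exact ((measurable_indicator_one_comp hD (by fun_prop)).mul
        (measurable_indicator_one_comp hD (by fun_prop))).mul (h3.mul (h1.mul h2))
    exact this.lintegral_prod_right'
  calc _ ≤ _ := enorm_evol_dyad_le_amp j ν hε hf hg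
    _ ≤ ∫⁻ t, (B * ψ t ^ 2) ^ (1 / 2 : ℝ) * (C * K t) ^ (1 / 2 : ℝ) := by
        refine lintegral_mono_ae ?_
        filter_upwards [hg.ae_slice] with t hgt
        have hm1 : Measurable fun ξ => ‖sliceFourier g t ξ‖ₑ := by fun_prop
        have hm2 : Measurable fun ξ => ‖dyadAmp j ν f t ξ‖ₑ :=
          ((measurable_dyadAmp_uncurry j ν hfm).comp measurable_prodMk_left).enorm
        refine (lintegral_weight_mul_le (by fun_prop) hm1 hm2).trans ?_
        gcongr
        · have := lintegral_gauss_fourier_le hε hgt.meas hgt.int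
          rwa [finrank_euclideanSpace_fin] at this
        · exact h j ν hν ε hε f hf t
    _ ≤ _ := lintegral_mul_le_two (by fun_prop) (by fun_prop)
    _ = (B * ∫⁻ t, ψ t ^ (2 : ℝ)) ^ (1 / 2 : ℝ) * (C * ∫⁻ t, K t) ^ (1 / 2 : ℝ) := by
        rw [eLpNorm_two_eq, eLpNorm_two_eq]
        simp_rw [rpow_half_sq]
        rw [lintegral_const_mul _ (by fun_prop), lintegral_const_mul _ hKm]
        simp
    _ ≤ (B * ∫⁻ t, ψ t ^ (2 : ℝ)) ^ (1 / 2 : ℝ) *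
        (C * (4 * (2 : ℝ≥0∞) ^ ((j : ℝ) * (3 / 2)) * ∫⁻ t, φ t ^ (2 : ℝ))) ^ (1 / 2 : ℝ) := by
        gcongr
        exact lintegral_dyad_window_le j hφm
    _ = _ := by
        rw [mixedNorm_two_eq, mixedNorm_two_eq]
        simp only [ENNReal.mul_rpow_of_nonneg _ _ (show (0 : ℝ) ≤ 1 / 2 by norm_num)]
        rw [← ENNReal.rpow_mul 2]
        have : (j : ℝ) * (3 / 2) * (1 / 2) = j * (3 / 4) := by ring
        rw [this]
        ring

/-- Reversal of space-time exchanges the two arguments of the form. -/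
lemma evol_reverse (D : Set ℝ) (ν : Space n) (ε : ℝ) (f g : SpaceTime n → ℂ) :
    evol D ν ε f g = evol D ν ε (fun z => g (-z)) (fun z => f (-z)) := by
  set e : (ℝ × ℝ) × (Space n × Space n) ≃ᵐ (ℝ × ℝ) × (Space n × Space n) :=
    (MeasurableEquiv.prodComm.prodCongr MeasurableEquiv.prodComm).trans (MeasurableEquiv.neg _)
    with he
  have hmp : MeasurePreserving e := by
    refine MeasurePreserving.comp (g := fun w : (ℝ × ℝ) × (Space n × Space n) => -w)
      (f := Prod.map Prod.swap Prod.swap) (μb := volume) ?_ ?_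
    · rw [Measure.volume_eq_prod (ℝ × ℝ)]
      exact ((Measure.measurePreserving_neg (volume : Measure ℝ)).prod
        (Measure.measurePreserving_neg (volume : Measure ℝ))).prod
        ((Measure.measurePreserving_neg (volume : Measure (Space n))).prod
          (Measure.measurePreserving_neg (volume : Measure (Space n))))
    · exact (Measure.measurePreserving_swap (μ := (volume : Measure ℝ)) (ν := volume)).prod
        (Measure.measurePreserving_swap (μ := (volume : Measure (Space n))) (ν := volume))
  rw [evol, ← hmp.integral_comp', evol]
  refine integral_congr_ae (ae_of_all _ fun w => ?_)
  have h1 : (e w).1.1 = -w.1.2 := rfl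
  have h2 : (e w).1.2 = -w.1.1 := rfl
  have h3 : (e w).2.1 = -w.2.2 := rfl
  have h4 : (e w).2.2 = -w.2.1 := rfl
  simp only [h1, h2, h3, h4, neg_sub_neg, Prod.neg_mk]
  rw [mul_comm (f _)]

lemma mixedNorm_neg (q r : ℝ≥0∞) {f : SpaceTime n → ℂ} (hf : Measurable f) :
    mixedNorm q r (fun z => f (-z)) = mixedNorm q r f := by
  have h1 : ∀ t, eLpNorm (fun x : Space n => f (-(t, x))) r volume =
      eLpNorm (fun x : Space n => f (-t, x)) r volume := fun t =>
    eLpNorm_comp_measurePreserving (g := fun x => f (-t, x)) (f := fun x : Space n => -x)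
      (hf.comp measurable_prodMk_left).aestronglyMeasurable (Measure.measurePreserving_neg volume)
  rw [mixedNorm]
  simp_rw [h1]
  exact eLpNorm_comp_measurePreserving
    (g := fun t => eLpNorm (fun x : Space n => f (t, x)) r volume) (f := fun t : ℝ => -t)
    (measurable_eLpNorm_slice hf.enorm r).aestronglyMeasurable
    (Measure.measurePreserving_neg volume)

lemma Nice.comp_neg {f : SpaceTime n → ℂ} (hf : Nice volume f) :
    Nice volume fun z => f (-z) := by
  obtain ⟨M, hM⟩ := hf.bdd
  refine ⟨hf.meas.comp measurable_neg, ?_, M, fun z => hM _⟩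
  have h : MeasurePreserving (fun z : SpaceTime n => -z) volume volume :=
    (Measure.measurePreserving_neg (volume : Measure ℝ)).prod
        (Measure.measurePreserving_neg (volume : Measure (Space n)))
  exact (h.integrable_comp hf.meas.aestronglyMeasurable).2 hf.int

/-- The estimate of a dyadic piece by the dispersive bound and by the length of the dyadic interval.
-/
lemma exists_evol_dyad_le_one :
    ∃ C : ℝ≥0∞, C ≠ ∞ ∧ ∀ j : ℤ, ∀ ν : Space n, ν ≠ 0 → ∀ ε : ℝ, 0 < ε →
      ∀ f g : SpaceTime n → ℂ, Nice volume f → Nice volume g →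
        ‖evol (dyad j) ν ε f g‖ₑ ≤ C * (2 : ℝ≥0∞) ^ ((j : ℝ) * (1 - n / 2)) *
          mixedNorm 2 1 f * mixedNorm 2 1 g := by
  obtain ⟨C, hC, h⟩ := enorm_evol_le_lintegral (n := n) le_rfl one_le_two
  refine ⟨C, hC, fun j ν hν ε hε f g hf hg => ?_⟩
  have hφ := measurable_eLpNorm_slice hf.meas.enorm 1
  have hψ := measurable_eLpNorm_slice hg.meas.enorm 1
  have e1 : (n : ℝ) * (1 / 1 - 1 / 2) = n / 2 := by ring
  refine (h _ (measurableSet_dyad j) (fun _ => pos_of_mem_dyad) ν hν ε hε f g hf hg).trans ?_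
  rw [e1, ENNReal.ofReal_one, mul_assoc C, mul_assoc C]
  refine mul_le_mul_right ?_ _
  calc _ ≤ ∫⁻ z : ℝ × ℝ, (2 : ℝ≥0∞) ^ (-((j : ℝ) * (n / 2))) * ((dyad j).indicator 1 (z.1 - z.2) *
        (eLpNorm (fun x => f (z.2, x)) 1 volume * eLpNorm (fun x => g (z.1, x)) 1 volume)) := by
        refine lintegral_mono fun z => ?_
        by_cases hz : z.1 - z.2 ∈ dyad j
        · simp only [Set.indicator_of_mem hz, one_mul, Pi.one_apply]
          gcongr
          exact ofReal_rpow_neg_le_of_mem_dyad (by positivity) hz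
        · simp [Set.indicator_of_notMem hz]
    _ = (2 : ℝ≥0∞) ^ (-((j : ℝ) * (n / 2))) * dyadForm j
        (fun s => eLpNorm (fun x => f (s, x)) 1 volume)
        (fun t => eLpNorm (fun x => g (t, x)) 1 volume) := by
        rw [lintegral_const_mul' _ _ (by simp)]
        rfl
    _ ≤ _ := by
        refine (mul_le_mul_right (dyadForm_le_two_two j hφ hψ) _).trans (le_of_eq ?_)
        have : (2 : ℝ≥0∞) ^ ((j : ℝ) * (1 - n / 2)) =
            (2 : ℝ≥0∞) ^ (-((j : ℝ) * (n / 2))) * (2 : ℝ≥0∞) ^ (j : ℝ) := by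
          rw [← ENNReal.rpow_add _ _ (by simp) (by simp)]
          congr 1; ring
        rw [this, mixedNorm, mixedNorm]
        ring

/-- The `k`-th level set of `f`, the heights being measured at each time in units of the norm of
the slice. -/
def sliceBand (r : ℝ) (f : SpaceTime n → ℂ) (k : ℤ) : Set (SpaceTime n) :=
  band (fun z => ‖f z‖ₑ) (fun z => eLpNorm (fun x => f (z.1, x)) (ENNReal.ofReal r) volume) k

/-- The `L²` norm in time of the coefficients of the slices. -/
def bandNorm (r : ℝ) (f : SpaceTime n → ℂ) (k : ℤ) : ℝ≥0∞ :=
  eLpNorm (fun t => bandCoeff volume r (fun x => ‖f (t, x)‖ₑ)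
    (eLpNorm (fun x => f (t, x)) (ENNReal.ofReal r) volume) k) 2 volume

lemma measurableSet_sliceBand (r : ℝ) {f : SpaceTime n → ℂ} (hf : Measurable f) (k : ℤ) :
    MeasurableSet (sliceBand r f k) :=
  measurableSet_band hf.enorm ((measurable_eLpNorm_slice hf.enorm _).comp measurable_fst) k

lemma mixedNorm_sliceBand_le {r p₁ : ℝ} (hr : 0 < r) (h₁ : 1 ≤ p₁) (h₂ : p₁ ≤ 2)
    {f : SpaceTime n → ℂ} (hf : Measurable f) (k : ℤ) :
    mixedNorm 2 (ENNReal.ofReal p₁) ((sliceBand r f k).indicator f) ≤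
      2 * (2 : ℝ≥0∞) ^ ((k : ℝ) * (1 - r / p₁)) * bandNorm r f k := by
  have hc : 2 * (2 : ℝ≥0∞) ^ ((k : ℝ) * (1 - r / p₁)) ≠ ∞ := ENNReal.mul_ne_top (by simp) (by simp)
  rw [mixedNorm_two_eq, bandNorm, eLpNorm_two_eq]
  have e1 : ∀ a b : ℝ≥0∞, a * b ^ (1 / 2 : ℝ) = (a ^ (2 : ℝ) * b) ^ (1 / 2 : ℝ) := fun a b => by
    rw [ENNReal.mul_rpow_of_nonneg _ _ (by norm_num), sq_rpow_half]
  rw [e1, ← lintegral_const_mul' _ _ (ENNReal.rpow_ne_top_of_nonneg (by norm_num) hc)]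
  gcongr with t
  rw [← ENNReal.mul_rpow_of_nonneg _ _ (by norm_num)]
  gcongr
  exact eLpNorm_band_indicator_le (f := fun x => f (t, x)) hr h₁ h₂
    (hf.comp measurable_prodMk_left).enorm (lintegral_enorm_rpow_eq_eLpNorm hr _).le k

lemma tsum_bandNorm_sq_le {r : ℝ} (hr : 0 < r) {f : SpaceTime n → ℂ} (hf : Measurable f) :
    ∑' k, bandNorm r f k ^ (2 : ℝ) ≤ mixedNorm 2 (ENNReal.ofReal r) f ^ (2 : ℝ) := by
  simp_rw [bandNorm, eLpNorm_two_eq, rpow_half_sq]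
  rw [← lintegral_tsum, mixedNorm_two_eq, rpow_half_sq]
  · refine lintegral_mono fun t => ?_
    exact tsum_bandCoeff_sq_le hr (hf.comp measurable_prodMk_left).enorm
      (lintegral_enorm_rpow_eq_eLpNorm hr _).le
  · intro k
    have h1 := measurable_eLpNorm_slice hf.enorm (ENNReal.ofReal r)
    have h2 : Measurable fun t => volume (Prod.mk t ⁻¹' sliceBand r f k) :=
      measurable_measure_prodMk_left (measurableSet_sliceBand r hf k)
    exact ((h1.mul ((h2.const_mul _).pow_const _)).pow_const _).aemeasurable

/-- The endpoint estimate, by summing the three estimates of the dyadic pieces over the dyadic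
scales of the time difference and of the two functions. -/
theorem exists_evol_le_endpoint (hn : 3 ≤ n) {r : ℝ} (hr : 1 / r = 1 / 2 + 1 / (n : ℝ)) :
    ∃ C : ℝ≥0∞, C ≠ ∞ ∧ ∀ ν : Space n, ν ≠ 0 → ∀ ε : ℝ, 0 < ε → ∀ f g : SpaceTime n → ℂ,
      Nice volume f → Nice volume g → ‖evol (Set.Ioi 0) ν ε f g‖ₑ ≤
        C * mixedNorm 2 (ENNReal.ofReal r) f * mixedNorm 2 (ENNReal.ofReal r) g := by
  have hn3 : (3 : ℝ) ≤ n := by exact_mod_cast hn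
  have hn0 : (0 : ℝ) < n := by linarith
  -- `h` is half the distance of `1 / r` from `1 / 2`. The exponent with `1 / p = 1 / 2 + h` is the
  -- one for which the fixed-time decay is `|t| ^ (-1 / 2)`.
  set h : ℝ := 1 / (2 * n) with hh
  have hh0 : 0 < h := by positivity
  have hh6 : h ≤ 1 / 6 := by
    rw [hh]; exact one_div_le_one_div_of_le (by norm_num) (by linarith)
  have hnh : (n : ℝ) * h = 1 / 2 := by rw [hh]; field_simp
  have hrh : 1 / r = 1 / 2 + 2 * h := by rw [hr, hh]; field_simp
  have hr0 : 0 < r := by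
    have : 0 < 1 / r := by rw [hrh]; positivity
    exact one_div_pos.1 this
  have hr1 : r * (1 / 2 + 2 * h) = 1 := by rw [← hrh]; field_simp
  have hr1' : 1 ≤ r := by nlinarith
  have hr2 : r ≤ 2 := by nlinarith
  set p : ℝ := 1 / (1 / 2 + h) with hp
  have hp0 : 0 < p := by positivity
  have hpi : 1 / p = 1 / 2 + h := by rw [hp, one_div_one_div]
  have hp1 : 1 ≤ p := by rw [hp, le_div_iff₀ (by positivity)]; linarith
  have hp2 : p ≤ 2 := by rw [hp, div_le_iff₀ (by positivity)]; linarith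
  have hγ : (n : ℝ) * (1 / p - 1 / 2) = 1 / 2 := by rw [hpi]; linarith
  obtain ⟨C₁, hC₁, h₁⟩ := exists_evol_dyad_le_one (n := n)
  obtain ⟨C₂, hC₂, h₂⟩ := exists_evol_dyad_le_left (n := n) hp1 hp2 hγ
  obtain ⟨D, hD, hDs⟩ := exists_tsum_dyadic_le (ε := h / 6) (p := r) (s := n / 2)
    (by positivity) hr0 (by positivity)
  set C := C₁ + C₂ with hC
  refine ⟨4 * C * D, ENNReal.mul_ne_top (ENNReal.mul_ne_top (by simp)
    (ENNReal.add_ne_top.2 ⟨hC₁, hC₂⟩)) hD, fun ν hν ε hε f g hf hg => ?_⟩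
  have hfm := hf.meas
  have hgm := hg.meas
  have hp' : ENNReal.ofReal r ≠ 0 := by simpa using hr0
  have key : ∀ j k l : ℤ,
      ‖evol (dyad j) ν ε ((sliceBand r f k).indicator f) ((sliceBand r g l).indicator g)‖ₑ ≤
        4 * C * ((2 : ℝ≥0∞) ^ (-(h / 6) * (|k * r + j * (n / 2)| + |l * r + j * (n / 2)|)) *
          bandNorm r f k * bandNorm r g l) := by
    intro j k l
    have hfk := hf.indicator (measurableSet_sliceBand r hfm k)
    have hgl := hg.indicator (measurableSet_sliceBand r hgm l)
    set X : ℝ := k * r + j * (n / 2) with hX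
    set Y : ℝ := l * r + j * (n / 2) with hY
    -- All three estimates have the same shape, with a power `δ` of the length of the time interval
    -- and exponents `p₁` and `p₂` for the two functions.
    have comb : ∀ (C' : ℝ≥0∞) (p₁ p₂ δ : ℝ), C' ≤ C → 1 ≤ p₁ → p₁ ≤ 2 → 1 ≤ p₂ → p₂ ≤ 2 →
        ‖evol (dyad j) ν ε ((sliceBand r f k).indicator f) ((sliceBand r g l).indicator g)‖ₑ ≤
          C' * (2 : ℝ≥0∞) ^ ((j : ℝ) * δ) *
            mixedNorm 2 (ENNReal.ofReal p₁) ((sliceBand r f k).indicator f) *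
            mixedNorm 2 (ENNReal.ofReal p₂) ((sliceBand r g l).indicator g) →
        j * δ + k * (1 - r / p₁) + l * (1 - r / p₂) ≤ -(h / 6) * (|X| + |Y|) →
        ‖evol (dyad j) ν ε ((sliceBand r f k).indicator f) ((sliceBand r g l).indicator g)‖ₑ ≤
        4 * C * ((2 : ℝ≥0∞) ^ (-(h / 6) * (|X| + |Y|)) * bandNorm r f k * bandNorm r g l) := by
      intro C' p₁ p₂ δ hC' h1 h1' h2 h2' hb he
      have i1 := mixedNorm_sliceBand_le hr0 h1 h1' hfm k
      have i2 := mixedNorm_sliceBand_le hr0 h2 h2' hgm l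
      calc _ ≤ _ := hb
        _ ≤ C * (2 : ℝ≥0∞) ^ ((j : ℝ) * δ) *
            (2 * (2 : ℝ≥0∞) ^ ((k : ℝ) * (1 - r / p₁)) * bandNorm r f k) *
            (2 * (2 : ℝ≥0∞) ^ ((l : ℝ) * (1 - r / p₂)) * bandNorm r g l) := by
            exact mul_le_mul' (mul_le_mul' (mul_le_mul_left hC' _) i1) i2
        _ = 4 * C * ((2 : ℝ≥0∞) ^ (j * δ + k * (1 - r / p₁) + l * (1 - r / p₂)) *
            bandNorm r f k * bandNorm r g l) := by
            rw [ENNReal.rpow_add _ _ (by simp) (by simp), ENNReal.rpow_add _ _ (by simp) (by simp)]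
            ring
        _ ≤ _ := by
            refine mul_le_mul_right (mul_le_mul_left (mul_le_mul_left ?_ _) _) _
            exact ENNReal.rpow_le_rpow_of_exponent_le (by norm_num) he
    have e1 : 1 - r / 1 = -(1 / 2 - 2 * h) * r := by linarith
    have e2 : 1 - r / 2 = 2 * h * r := by linarith
    have e3 : 1 - r / p = h * r := by
      rw [div_eq_mul_one_div, hpi]; linarith
    have e4 : (n : ℝ) / 2 * h = 1 / 4 := by linarith
    -- the total exponents of `2` in the three estimates, in terms of `X` and `Y`
    have f1 : (j : ℝ) * (1 - n / 2) + k * (1 - r / 1) + l * (1 - r / 1) =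
        -(1 / 2 - 2 * h) * (X + Y) := by
      rw [e1, hX, hY]
      linear_combination (-4 * (j : ℝ)) * e4
    have f2 : (j : ℝ) * (3 / 4) + k * (1 - r / p) + l * (1 - r / 2) = h * (X + 2 * Y) := by
      rw [e2, e3, hX, hY]
      linear_combination (-3 * (j : ℝ)) * e4
    have f3 : (j : ℝ) * (3 / 4) + k * (1 - r / 2) + l * (1 - r / p) = h * (2 * X + Y) := by
      rw [e2, e3, hX, hY]
      linear_combination (-3 * (j : ℝ)) * e4
    -- For any signs of `X` and `Y` one of the three exponents is sufficiently negative.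
    have hcases : -(1 / 2 - 2 * h) * (X + Y) ≤ -(h / 6) * (|X| + |Y|) ∨
        h * (X + 2 * Y) ≤ -(h / 6) * (|X| + |Y|) ∨ h * (2 * X + Y) ≤ -(h / 6) * (|X| + |Y|) := by
      have g1 : 0 ≤ X + Y → -(1 / 2 - 2 * h) * (X + Y) ≤ -h * (X + Y) := fun hXY =>
        mul_le_mul_of_nonneg_right (by linarith) hXY
      have red : ∀ a b : ℝ, a ≤ -(1 / 6) * b → h * a ≤ -(h / 6) * b := fun a b hab => by
        have := mul_le_mul_of_nonneg_left hab hh0.le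
        linarith
      by_cases c1 : X + 2 * Y ≤ -(1 / 6) * (|X| + |Y|)
      · exact Or.inr (Or.inl (red _ _ c1))
      by_cases c2 : 2 * X + Y ≤ -(1 / 6) * (|X| + |Y|)
      · exact Or.inr (Or.inr (red _ _ c2))
      left
      push Not at c1 c2
      have c3 : -(X + Y) ≤ -(1 / 6) * (|X| + |Y|) := by
        rcases abs_cases X with ⟨hx, _⟩ | ⟨hx, _⟩ <;> rcases abs_cases Y with ⟨hy, _⟩ | ⟨hy, _⟩ <;>
          rw [hx, hy] at c1 c2 ⊢ <;> linarith
      have c4 : 0 ≤ X + Y := by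
        have := abs_nonneg X; have := abs_nonneg Y; linarith
      refine (g1 c4).trans ?_
      have := red _ _ c3
      linarith
    rcases hcases with hc | hc | hc
    · refine comb C₁ 1 1 (1 - n / 2) le_self_add le_rfl one_le_two le_rfl one_le_two ?_
        (f1.trans_le hc)
      rw [ENNReal.ofReal_one]
      exact h₁ j ν hν ε hε _ _ hfk hgl
    · refine comb C₂ p 2 (3 / 4) le_add_self hp1 hp2 one_le_two le_rfl ?_ (f2.trans_le hc)
      rw [ENNReal.ofReal_ofNat]
      exact h₂ j ν hν ε hε _ _ hfk hgl
    -- The third estimate is the second one after reversal of time and exchange of the functions.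
    · refine comb C₂ 2 p (3 / 4) le_add_self one_le_two le_rfl hp1 hp2 ?_ (f3.trans_le hc)
      rw [ENNReal.ofReal_ofNat, evol_reverse]
      refine (h₂ j ν hν ε hε _ _ hgl.comp_neg hfk.comp_neg).trans (le_of_eq ?_)
      rw [mixedNorm_neg _ _ hgl.meas, mixedNorm_neg _ _ hfk.meas]
      ring
  -- `A (j, k, l)`: the time difference has size `2 ^ j`, and the values of `f` and `g` have sizes
  -- `2 ^ k` and `2 ^ l` relative to the norms of the time slices.
  set A : ℤ × ℤ × ℤ → Set ((ℝ × ℝ) × (Space n × Space n)) := fun i =>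
    {w | w.1.1 - w.1.2 ∈ dyad i.1 ∧ (w.1.2, w.2.2) ∈ sliceBand r f i.2.1 ∧
      (w.1.1, w.2.1) ∈ sliceBand r g i.2.2} with hA
  have hu1 : Measurable fun w : (ℝ × ℝ) × (Space n × Space n) => w.1.1 - w.1.2 := by fun_prop
  have hu2 : Measurable fun w : (ℝ × ℝ) × (Space n × Space n) => (w.1.2, w.2.2) := by fun_prop
  have hu3 : Measurable fun w : (ℝ × ℝ) × (Space n × Space n) => (w.1.1, w.2.1) := by fun_prop
  have hAm : ∀ i, MeasurableSet (A i) := fun i =>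
    (hu1 (measurableSet_dyad i.1)).inter ((hu2 (measurableSet_sliceBand r hfm i.2.1)).inter
      (hu3 (measurableSet_sliceBand r hgm i.2.2)))
  have hpart := enorm_integral_le_tsum
    (integrable_evol measurableSet_Ioi (fun t ht => ht) ν hε hf hg) hAm ?_ ?_
  · have hpiece : ∀ i : ℤ × ℤ × ℤ, ∫ w in A i, (Set.Ioi 0).indicator (fun _ => (1 : ℂ))
        (w.1.1 - w.1.2) * (kern ν ε (w.1.1 - w.1.2) (w.1.1 - w.1.2) (w.2.1 - w.2.2) *
          (f (w.1.2, w.2.2) * g (w.1.1, w.2.1))) =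
        evol (dyad i.1) ν ε ((sliceBand r f i.2.1).indicator f)
          ((sliceBand r g i.2.2).indicator g) := by
      intro i
      rw [← integral_indicator (hAm i), evol]
      refine integral_congr_ae (ae_of_all _ fun w => ?_)
      simp only
      by_cases w1 : w.1.1 - w.1.2 ∈ dyad i.1
      swap
      · rw [Set.indicator_of_notMem (fun hw => w1 hw.1), Set.indicator_of_notMem w1, zero_mul]
      by_cases w2 : (w.1.2, w.2.2) ∈ sliceBand r f i.2.1
      swap
      · rw [Set.indicator_of_notMem (fun hw => w2 hw.2.1), Set.indicator_of_notMem w2]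
        simp
      by_cases w3 : (w.1.1, w.2.1) ∈ sliceBand r g i.2.2
      swap
      · rw [Set.indicator_of_notMem (fun hw => w3 hw.2.2), Set.indicator_of_notMem w3]
        simp
      rw [Set.indicator_of_mem (show w ∈ A i from ⟨w1, w2, w3⟩), Set.indicator_of_mem w1,
        Set.indicator_of_mem w2, Set.indicator_of_mem w3,
        Set.indicator_of_mem (show w.1.1 - w.1.2 ∈ Set.Ioi (0 : ℝ) from pos_of_mem_dyad w1)]
    simp_rw [hpiece] at hpart
    refine hpart.trans ?_
    calc _ ≤ ∑' i : ℤ × ℤ × ℤ, 4 * C * ((2 : ℝ≥0∞) ^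
          (-(h / 6) * (|i.2.1 * r + i.1 * (n / 2)| + |i.2.2 * r + i.1 * (n / 2)|)) *
          bandNorm r f i.2.1 * bandNorm r g i.2.2) :=
          ENNReal.tsum_le_tsum fun i => key i.1 i.2.1 i.2.2
      _ ≤ 4 * C * (D * (mixedNorm 2 (ENNReal.ofReal r) f ^ (2 : ℝ)) ^ (1 / 2 : ℝ) *
          (mixedNorm 2 (ENNReal.ofReal r) g ^ (2 : ℝ)) ^ (1 / 2 : ℝ)) := by
          rw [ENNReal.tsum_mul_left]
          refine mul_le_mul_right ((hDs _ _).trans ?_) _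
          gcongr
          · exact tsum_bandNorm_sq_le hr0 hfm
          · exact tsum_bandNorm_sq_le hr0 hgm
      _ = _ := by
          rw [sq_rpow_half, sq_rpow_half]
          ring
  · rintro ⟨j, k, l⟩ ⟨j', k', l'⟩ hne
    refine Set.disjoint_left.2 fun w hw hw' => hne ?_
    have e1 : j = j' := by
      by_contra hne
      exact Set.disjoint_left.1 (pairwise_disjoint_dyad hne) hw.1 hw'.1
    have e2 : k = k' := by
      by_contra hne
      exact Set.disjoint_left.1 (pairwise_disjoint_band _ _ hne) hw.2.1 hw'.2.1
    have e3 : l = l' := by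
      by_contra hne
      exact Set.disjoint_left.1 (pairwise_disjoint_band _ _ hne) hw.2.2 hw'.2.2
    rw [e1, e2, e3]
  · have hcov : ∀ {f : SpaceTime n → ℂ}, Nice volume f → ∀ᵐ t : ℝ, ∀ᵐ x : Space n,
        f (t, x) ≠ 0 → ∃ k, (t, x) ∈ sliceBand r f k := by
      intro f hf
      filter_upwards [hf.ae_slice] with t ht
      have hfin := (ht.memLp (p := ENNReal.ofReal r) (by simpa using hr1')).eLpNorm_ne_top
      by_cases h0 : eLpNorm (fun x => f (t, x)) (ENNReal.ofReal r) volume = 0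
      · filter_upwards [(eLpNorm_eq_zero_iff ht.meas.aestronglyMeasurable hp').1 h0] with x hx hx'
        exact absurd hx hx'
      · exact ae_of_all _ fun x hx => exists_mem_band (by simpa using hx) (by simp) h0 hfin
    have hae : ∀ᵐ p : ℝ × ℝ, ∀ᵐ z : Space n × Space n,
        (g (p.1, z.1) ≠ 0 → ∃ k, (p.1, z.1) ∈ sliceBand r g k) ∧
        (f (p.2, z.2) ≠ 0 → ∃ k, (p.2, z.2) ∈ sliceBand r f k) := by
      filter_upwards [ae_pair_of_ae (hcov hg) (hcov hf)] with p hp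
      exact (Measure.quasiMeasurePreserving_fst.ae hp.1).and
        (Measure.quasiMeasurePreserving_snd.ae hp.2)
    have hset : MeasurableSet {w : (ℝ × ℝ) × (Space n × Space n) |
        (g (w.1.1, w.2.1) ≠ 0 → ∃ k, (w.1.1, w.2.1) ∈ sliceBand r g k) ∧
        (f (w.1.2, w.2.2) ≠ 0 → ∃ k, (w.1.2, w.2.2) ∈ sliceBand r f k)} := by
      have hs : ∀ {f : SpaceTime n → ℂ}, Measurable f →
          MeasurableSet {z | f z ≠ 0 → ∃ k, z ∈ sliceBand r f k} := by
        intro f hf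
        have : {z | f z ≠ 0 → ∃ k, z ∈ sliceBand r f k} =
            (f ⁻¹' {0}) ∪ ⋃ k, sliceBand r f k := by
          ext z
          simp only [Set.mem_ofPred_eq, Set.mem_union, Set.mem_preimage, Set.mem_singleton_iff,
            Set.mem_iUnion]
          tauto
        rw [this]
        exact (hf (measurableSet_singleton 0)).union
          (MeasurableSet.iUnion fun k => measurableSet_sliceBand r hf k)
      exact (hu3 (hs hgm)).inter (hu2 (hs hfm))
    have hall := (Measure.ae_prod_iff_ae_ae (μ := (volume : Measure (ℝ × ℝ)))
      (ν := (volume : Measure (Space n × Space n))) hset).2 hae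
    filter_upwards [hall] with w hw hne
    by_cases hpos : w.1.1 - w.1.2 ∈ Set.Ioi (0 : ℝ)
    swap
    · simp [Set.indicator_of_notMem hpos] at hne
    obtain ⟨j, hj⟩ := exists_mem_dyad hpos
    have hgw : g (w.1.1, w.2.1) ≠ 0 := fun h0 => hne (by simp [h0])
    have hfw : f (w.1.2, w.2.2) ≠ 0 := fun h0 => hne (by simp [h0])
    obtain ⟨k, hk⟩ := hw.2 hfw
    obtain ⟨l, hl⟩ := hw.1 hgw
    exact ⟨(j, k, l), hj, hk, hl⟩

/-- The Strichartz estimate in bilinear form, uniform in `ν` and in the cut-off. -/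
theorem exists_evol_le {q r : ℝ} (hq₁ : 1 ≤ q) (hq₂ : q ≤ 2) (hr₁ : 1 ≤ r) (hr₂ : r ≤ 2)
    (hqr : (n : ℝ) * (1 / r - 1 / 2) = 2 - 2 / q) (hend : q = 2 → 3 ≤ n) :
    ∃ C : ℝ≥0∞, C ≠ ∞ ∧ ∀ ν : Space n, ν ≠ 0 → ∀ ε : ℝ, 0 < ε → ∀ f g : SpaceTime n → ℂ,
      Nice volume f → Nice volume g → ‖evol (Set.Ioi 0) ν ε f g‖ₑ ≤
        C * mixedNorm (ENNReal.ofReal q) (ENNReal.ofReal r) f *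
          mixedNorm (ENNReal.ofReal q) (ENNReal.ofReal r) g := by
  rcases eq_or_lt_of_le hq₂ with rfl | hq
  · have hn := hend rfl
    have hn0 : (n : ℝ) ≠ 0 := by positivity
    rw [ENNReal.ofReal_ofNat]
    refine exists_evol_le_endpoint hn ?_
    have : (n : ℝ) * (1 / r - 1 / 2) = 1 := by rw [hqr]; norm_num
    field_simp at this ⊢
    linarith
  · exact exists_evol_le_of_lt hq₁ hq hr₁ hr₂ hqr

end EndpointSum

/-! ### Gaussian regularisation on the real line -/

section GaussHat

open Complex

/-- The Fourier transform of the Gaussian `e^{-ετ²}` on the line, a positive Gaussian. -/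
def gaussHat (ε x : ℝ) : ℂ := ∫ τ : ℝ, (Real.exp (-ε * ‖τ‖ ^ 2) : ℂ) * chr x τ

@[fun_prop]
lemma measurable_gaussHat (ε : ℝ) : Measurable (gaussHat ε) := by
  have : Measurable fun p : ℝ × ℝ => (Real.exp (-ε * ‖p.2‖ ^ 2) : ℂ) * chr p.1 p.2 := by fun_prop
  exact (this.stronglyMeasurable.integral_prod_right (ν := volume)).measurable

lemma lintegral_gaussHat {ε : ℝ} (hε : 0 < ε) :
    ∫⁻ x, ‖gaussHat ε x‖ₑ = ENNReal.ofReal (2 * Real.pi) := by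
  have := lintegral_gauss (E := ℝ) hε
  simpa [gaussHat] using this

lemma integrable_gaussHat {ε : ℝ} (hε : 0 < ε) : Integrable (gaussHat ε) := by
  refine ⟨(measurable_gaussHat ε).aestronglyMeasurable, ?_⟩
  rw [hasFiniteIntegral_iff_enorm, lintegral_gaussHat hε]
  exact ENNReal.ofReal_lt_top

lemma norm_gaussHat_le {ε : ℝ} (x : ℝ) :
    ‖gaussHat ε x‖ ≤ ∫ τ : ℝ, Real.exp (-ε * ‖τ‖ ^ 2) := by
  refine (norm_integral_le_integral_norm _).trans (le_of_eq ?_)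
  refine integral_congr_ae (ae_of_all _ fun τ => ?_)
  simp only [norm_mul, norm_chr, mul_one, norm_real, Real.norm_of_nonneg (Real.exp_pos _).le]

/-- Fubini's theorem for a superposition of phases; the Gaussian replaces their integral over all
frequencies by `gaussHat`, an approximation of `2πδ`. -/
lemma integral_gauss_mul_phase {Q : Type*} [MeasurableSpace Q] {μ : Measure Q} [SFinite μ] {ε : ℝ}
    (hε : 0 < ε) {φ : Q → ℝ} (hφ : Measurable φ) {h : Q → ℂ} (hh : Integrable h μ) :
    ∫ τ : ℝ, (Real.exp (-ε * ‖τ‖ ^ 2) : ℂ) * ∫ q, chr (φ q) τ * h q ∂μ =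
      ∫ q, gaussHat ε (φ q) * h q ∂μ := by
  have hbig : Integrable (fun p : ℝ × Q => (Real.exp (-ε * ‖p.1‖ ^ 2) : ℂ) *
      (chr (φ p.2) p.1 * h p.2)) (volume.prod μ) := by
    have h0 : Integrable (fun p : ℝ × Q => (Real.exp (-ε * ‖p.1‖ ^ 2) : ℂ) * h p.2)
        (volume.prod μ) :=
      Integrable.mul_prod (f := fun τ : ℝ => (Real.exp (-ε * ‖τ‖ ^ 2) : ℂ))
        (integrable_gauss hε).ofReal hh
    have hm : Measurable fun p : ℝ × Q => chr (φ p.2) p.1 := by fun_prop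
    refine (h0.bdd_mul (c := 1) hm.aestronglyMeasurable
      (ae_of_all _ fun p => (norm_chr _ _).le)).congr (ae_of_all _ fun p => ?_)
    simp only; ring
  calc _ = ∫ τ : ℝ, ∫ q, (Real.exp (-ε * ‖τ‖ ^ 2) : ℂ) * (chr (φ q) τ * h q) ∂μ := by
        simp_rw [integral_const_mul]
    _ = ∫ q, (∫ τ : ℝ, (Real.exp (-ε * ‖τ‖ ^ 2) : ℂ) * (chr (φ q) τ * h q)) ∂μ :=
        integral_integral_swap hbig
    _ = _ := by
        refine integral_congr_ae (ae_of_all _ fun q => ?_)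
        simp only [gaussHat]
        rw [← integral_mul_const]
        refine integral_congr_ae (ae_of_all _ fun τ => ?_)
        simp only; ring

lemma chr_neg_left {E : Type*} [NormedAddCommGroup E] [InnerProductSpace ℝ E] (x ξ : E) :
    chr (-x) ξ = chr x (-ξ) := by
  simp [chr]

/-- A regularised trilinear Parseval identity on the line. -/
lemma integral_gauss_fourier_three {ε : ℝ} (hε : 0 < ε) {k a b : ℝ → ℂ} (hk : Integrable k)
    (ha : Integrable a) (hb : Integrable b) :
    ∫ τ : ℝ, (Real.exp (-ε * ‖τ‖ ^ 2) : ℂ) * ((∫ u, chr u (-τ) * k u) *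
        ((∫ s, chr s (-τ) * a s) * ∫ t, chr t τ * b t)) =
      ∫ p : ℝ × ℝ, (∫ v, k (p.1 - p.2 - v) * gaussHat ε v) * (a p.2 * b p.1) := by
  have hab : Integrable (fun p : ℝ × ℝ => a p.2 * b p.1) := by
    rw [Measure.volume_eq_prod]
    simpa [mul_comm] using hb.mul_prod ha
  have hkab : Integrable (fun q : ℝ × (ℝ × ℝ) => k q.1 * (a q.2.2 * b q.2.1))
      (volume.prod volume) := Integrable.mul_prod (g := fun p : ℝ × ℝ => a p.2 * b p.1) hk hab
  have h1 : ∀ τ : ℝ, (∫ u, chr u (-τ) * k u) * ((∫ s, chr s (-τ) * a s) * ∫ t, chr t τ * b t) =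
      ∫ q : ℝ × (ℝ × ℝ), chr (q.2.1 - q.2.2 - q.1) τ * (k q.1 * (a q.2.2 * b q.2.1))
        ∂(volume.prod volume) := by
    intro τ
    rw [mul_comm (∫ s, chr s (-τ) * a s),
      ← integral_prod_mul (fun t => chr t τ * b t) (fun s => chr s (-τ) * a s),
      ← integral_prod_mul (fun u => chr u (-τ) * k u)
        (fun z : ℝ × ℝ => chr z.1 τ * b z.1 * (chr z.2 (-τ) * a z.2))]
    refine integral_congr_ae (ae_of_all _ fun q => ?_)
    simp only [chr_sub, chr_neg_left]
    ring
  simp_rw [h1]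
  rw [integral_gauss_mul_phase hε (by fun_prop) hkab]
  have hg : Integrable (fun q : ℝ × (ℝ × ℝ) => gaussHat ε (q.2.1 - q.2.2 - q.1) *
      (k q.1 * (a q.2.2 * b q.2.1))) (volume.prod volume) :=
    hkab.bdd_mul (Measurable.aestronglyMeasurable (by fun_prop))
      (ae_of_all _ fun q => norm_gaussHat_le _)
  rw [integral_prod_symm _ hg]
  refine integral_congr_ae (ae_of_all _ fun p => ?_)
  simp only
  rw [← integral_sub_left_eq_self (fun v => k (p.1 - p.2 - v) * gaussHat ε v) volume (p.1 - p.2),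
    ← integral_mul_const]
  refine integral_congr_ae (ae_of_all _ fun u => ?_)
  simp only [sub_sub_cancel]
  ring

/-- A product of two Fourier transforms is, after regularisation, bounded by the `L¹` norm of one
factor and the supremum of the other. -/
lemma norm_integral_gauss_fourier_two_le {ε : ℝ} (hε : 0 < ε) (x : ℝ) {k l : ℝ → ℂ}
    (hk : Integrable k) (hl : Integrable l) (hl1 : ∀ v, ‖l v‖ ≤ 1) :
    ‖∫ τ : ℝ, (Real.exp (-ε * ‖τ‖ ^ 2) : ℂ) * (chr x τ * ((∫ u, chr u (-τ) * k u) *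
        ∫ v, chr v (-τ) * l v))‖ ≤ 2 * Real.pi * ∫ u, ‖k u‖ := by
  have hkl : Integrable (fun p : ℝ × ℝ => k p.1 * l p.2) (volume.prod volume) := hk.mul_prod hl
  have h1 : ∀ τ : ℝ, chr x τ * ((∫ u, chr u (-τ) * k u) * ∫ v, chr v (-τ) * l v) =
      ∫ q : ℝ × ℝ, chr (x - q.1 - q.2) τ * (k q.1 * l q.2) ∂(volume.prod volume) := by
    intro τ
    rw [← integral_prod_mul (fun t => chr t (-τ) * k t) (fun s => chr s (-τ) * l s),
      ← integral_const_mul]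
    refine integral_congr_ae (ae_of_all _ fun q => ?_)
    simp only [chr_sub, chr_neg_left]
    ring
  simp_rw [h1]
  rw [integral_gauss_mul_phase hε (by fun_prop) hkl]
  have hb : Integrable (fun q : ℝ × ℝ => gaussHat ε (x - q.1 - q.2) * (k q.1 * l q.2))
      (volume.prod volume) :=
    hkl.bdd_mul (Measurable.aestronglyMeasurable (by fun_prop))
      (ae_of_all _ fun q => norm_gaussHat_le _)
  have hG : ∫ x, ‖gaussHat ε x‖ = 2 * Real.pi := by
    rw [integral_norm_eq_lintegral_enorm (measurable_gaussHat ε).aestronglyMeasurable,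
      lintegral_gaussHat hε, ENNReal.toReal_ofReal (by positivity)]
  rw [integral_prod _ hb, ← integral_const_mul]
  refine norm_integral_le_of_norm_le (hk.norm.const_mul _) (ae_of_all _ fun u => ?_)
  have hi : Integrable fun v => gaussHat ε (x - u - v) :=
    (integrable_comp_sub_left (gaussHat ε) (x - u)).2 (integrable_gaussHat hε)
  calc _ ≤ ∫ v, ‖k u‖ * ‖gaussHat ε (x - u - v)‖ := by
        refine norm_integral_le_of_norm_le (hi.norm.const_mul _) (ae_of_all _ fun v => ?_)
        rw [norm_mul, norm_mul, mul_comm, mul_assoc]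
        refine mul_le_mul_of_nonneg_left ?_ (norm_nonneg _)
        exact mul_le_of_le_one_left (norm_nonneg _) (hl1 v)
    _ = _ := by
        rw [integral_const_mul, integral_sub_left_eq_self (fun v => ‖gaussHat ε v‖), hG, mul_comm]

end GaussHat

/-! ### The space-time Fourier transform and the symbol -/

section SpaceTimeFourier

open Complex

variable {n : ℕ}

/-- The space-time Fourier transform `∫ e^{i(tτ + x·ξ)} f(t, x) d(t, x)`. -/
def stFourier (f : SpaceTime n → ℂ) (ζ : SpaceTime n) : ℂ :=
  ∫ z : SpaceTime n, chr z.1 ζ.1 * chr z.2 ζ.2 * f z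

lemma norm_stFourier_le (f : SpaceTime n → ℂ) (ζ : SpaceTime n) :
    ‖stFourier f ζ‖ ≤ ∫ z, ‖f z‖ := by
  refine (norm_integral_le_integral_norm _).trans (le_of_eq ?_)
  simp [norm_chr]

lemma measurable_stFourier {f : SpaceTime n → ℂ} (hf : Measurable f) :
    Measurable (stFourier f) := by
  have : Measurable fun p : SpaceTime n × SpaceTime n =>
    chr p.2.1 p.1.1 * chr p.2.2 p.1.2 * f p.2 := by fun_prop
  exact (this.stronglyMeasurable.integral_prod_right (ν := volume)).measurable

lemma stFourier_eq {f : SpaceTime n → ℂ} (hf : Nice volume f) (ζ : SpaceTime n) :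
    stFourier f ζ = ∫ t, chr t ζ.1 * sliceFourier f t ζ.2 := by
  have hm : Measurable fun z : SpaceTime n => chr z.1 ζ.1 * chr z.2 ζ.2 := by fun_prop
  have hi : Integrable (fun z : SpaceTime n => chr z.1 ζ.1 * chr z.2 ζ.2 * f z)
      (volume.prod volume) := by
    refine Integrable.bdd_mul (c := 1) hf.int hm.aestronglyMeasurable (ae_of_all _ fun z => ?_)
    simp [norm_chr]
  rw [stFourier, Measure.volume_eq_prod, integral_prod _ hi]
  refine integral_congr_ae (ae_of_all _ fun t => ?_)
  simp only [sliceFourier]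
  rw [← integral_const_mul]
  simp only [mul_assoc]

lemma conj_stFourier (f : SpaceTime n → ℂ) (ζ : SpaceTime n) :
    starRingEnd ℂ (stFourier f ζ) = stFourier (fun z => starRingEnd ℂ (f z)) (-ζ) := by
  rw [stFourier, ← integral_conj]
  refine integral_congr_ae (ae_of_all _ fun z => ?_)
  simp only [map_mul, conj_chr, chr_neg_left, Prod.fst_neg, Prod.snd_neg]

@[fun_prop]
lemma measurable_symbol (ν : Space n) : Measurable (symbol ν) := by
  unfold symbol
  fun_prop

lemma symbol_re (ν : Space n) (ζ : SpaceTime n) : (symbol ν ζ).re = -(ζ.1 + ‖ζ.2‖ ^ 2) := by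
  rw [symbol]
  simp only [add_re, sub_re, neg_re, ofReal_re, mul_re, re_ofNat, im_ofNat, I_re, I_im, ofReal_im,
    mul_im]
  ring

lemma symbol_im (ν : Space n) (ζ : SpaceTime n) : (symbol ν ζ).im = 2 * inner ℝ ν ζ.2 := by
  rw [symbol]
  simp only [add_im, sub_im, neg_im, ofReal_re, mul_re, re_ofNat, im_ofNat, I_re, I_im, ofReal_im,
    mul_im]
  ring

lemma conj_symbol (ν : Space n) (ζ : SpaceTime n) :
    starRingEnd ℂ (symbol ν ζ) = symbol (-ν) ζ :=
  Complex.ext (by simp [symbol_re]) (by simp [symbol_im])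

lemma norm_symbol_inv_le (ν : Space n) {τ : ℝ} {ξ : Space n} (hξ : inner ℝ ν ξ ≠ 0)
    (hτ : τ + ‖ξ‖ ^ 2 ≠ 0) :
    ‖(symbol ν (τ, ξ))⁻¹‖ ≤ |τ + ‖ξ‖ ^ 2| ^ (-(1 / 2) : ℝ) *
      |2 * inner ℝ ν ξ| ^ (-(1 / 2) : ℝ) := by
  have h1 := abs_re_le_norm (symbol ν (τ, ξ))
  have h2 := abs_im_le_norm (symbol ν (τ, ξ))
  rw [symbol_re, abs_neg] at h1
  rw [symbol_im] at h2
  set A := |τ + ‖ξ‖ ^ 2|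
  set B := |2 * inner ℝ ν ξ|
  have hA : 0 < A := abs_pos.2 hτ
  have hB : 0 < B := abs_pos.2 (mul_ne_zero two_ne_zero hξ)
  have hP : 0 < ‖symbol ν (τ, ξ)‖ := hA.trans_le h1
  rw [norm_inv, Real.rpow_neg hA.le, Real.rpow_neg hB.le, ← mul_inv]
  refine inv_anti₀ (by positivity) ?_
  calc A ^ (1 / 2 : ℝ) * B ^ (1 / 2 : ℝ) ≤ ‖symbol ν (τ, ξ)‖ ^ (1 / 2 : ℝ) *
        ‖symbol ν (τ, ξ)‖ ^ (1 / 2 : ℝ) := by gcongr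
    _ = _ := by rw [← Real.rpow_add hP]; norm_num

/-- On the half-space `ν·ξ > 0`, the reciprocal of the symbol is a Fourier transform in time of
the damped evolution. -/
lemma symbol_inv_eq (ν : Space n) (τ : ℝ) {ξ : Space n} (hξ : 0 < inner ℝ ν ξ) :
    (symbol ν (τ, ξ))⁻¹ =
      -I * ∫ u : ℝ, chr u (-τ) * (Set.Ioi 0).indicator (fun u => damp ν u u ξ) u := by
  set a : ℂ := -(((2 * inner ℝ ν ξ : ℝ) : ℂ) + ((τ + ‖ξ‖ ^ 2 : ℝ) : ℂ) * I) with ha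
  have hare : a.re < 0 := by
    have : a.re = -(2 * inner ℝ ν ξ) := by
      rw [ha, neg_re, add_re, ofReal_re, re_ofReal_mul, I_re, mul_zero, add_zero]
    rw [this]
    linarith
  have h1 : ∀ u : ℝ, chr u (-τ) * (Set.Ioi 0).indicator (fun u => damp ν u u ξ) u =
      (Set.Ioi (0 : ℝ)).indicator (fun u => cexp (a * u)) u := by
    intro u
    by_cases hu : u ∈ Set.Ioi (0 : ℝ)
    · rw [Set.indicator_of_mem hu, Set.indicator_of_mem hu, damp,
        Set.indicator_of_mem (show ξ ∈ {ξ : Space n | 0 < inner ℝ ν ξ} from hξ), chr]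
      simp only [ofReal_exp, ← exp_add]
      congr 1
      simp [ha]
      ring
    · simp [Set.indicator_of_notMem hu]
  simp_rw [h1]
  rw [integral_indicator measurableSet_Ioi, integral_exp_mul_complex_Ioi hare]
  have ha0 : a ≠ 0 := fun h => by rw [h] at hare; simp at hare
  have hs : symbol ν (τ, ξ) = -I * a := by
    rw [ha, symbol]
    push_cast
    linear_combination (-(τ : ℂ) - (‖ξ‖ : ℂ) ^ 2) * I_sq
  rw [hs, mul_inv]
  simp
  rw [mul_comm, div_eq_mul_inv]
  ring

end SpaceTimeFourier

/-! ### Integrability of the reciprocal of the symbol -/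

section Reciprocal

open Complex

variable {n : ℕ}

/-- The singularity `|τ + c| ^ (-1 / 2)` is integrable uniformly in its location. -/
lemma exists_lintegral_rpow_neg_half_le :
    ∃ C : ℝ≥0∞, C ≠ ∞ ∧ ∀ c : ℝ, ∫⁻ τ : ℝ, ENNReal.ofReal ((1 + τ ^ 2)⁻¹) *
      ENNReal.ofReal (|τ + c| ^ (-(1 / 2) : ℝ)) ≤ C := by
  set kp : ℝ → ℝ≥0∞ := (Set.Ioo 0 ((2 : ℝ) ^ (0 : ℤ))).indicator
    (fun u => ENNReal.ofReal u ^ (-(1 / 2 : ℝ))) with hkp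
  have hkpm : Measurable kp := by
    refine Measurable.indicator ?_ measurableSet_Ioo
    fun_prop
  refine ⟨4 + ∫⁻ τ : ℝ, ENNReal.ofReal ((1 + τ ^ 2)⁻¹), ENNReal.add_ne_top.2 ⟨by simp, ?_⟩,
    fun c => ?_⟩
  · exact (integrable_inv_one_add_sq.lintegral_lt_top).ne
  calc _ ≤ ∫⁻ τ : ℝ, ((kp (τ + c) + kp (-(τ + c))) + ENNReal.ofReal ((1 + τ ^ 2)⁻¹)) := by
        refine lintegral_mono_ae ?_
        filter_upwards [Measure.ae_ne volume (-c)] with τ hτ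
        have h0 : 0 < |τ + c| := abs_pos.2 (by intro h; exact hτ (by linarith))
        have hle : ENNReal.ofReal ((1 + τ ^ 2)⁻¹) ≤ 1 := by
          refine ENNReal.ofReal_le_one.2 (inv_le_one_of_one_le₀ ?_)
          nlinarith [sq_nonneg τ]
        rcases lt_or_ge |τ + c| 1 with h1 | h1
        · refine le_trans (le_trans (mul_le_of_le_one_left zero_le hle) ?_) le_self_add
          rw [← ENNReal.ofReal_rpow_of_pos h0]
          rcases abs_cases (τ + c) with ⟨h2, _⟩ | ⟨h2, _⟩
          · refine le_trans (le_of_eq ?_) le_self_add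
            rw [h2] at h0 h1 ⊢
            rw [hkp, Set.indicator_of_mem (by simpa using ⟨h0, h1⟩)]
          · refine le_trans (le_of_eq ?_) le_add_self
            rw [h2] at h0 h1 ⊢
            rw [hkp, Set.indicator_of_mem (show -(τ + c) ∈ Set.Ioo (0 : ℝ) (2 ^ (0 : ℤ)) from
              ⟨h0, by simpa using h1⟩)]
        · refine le_trans (mul_le_of_le_one_right zero_le ?_) le_add_self
          refine ENNReal.ofReal_le_one.2 ?_
          exact Real.rpow_le_one_of_one_le_of_nonpos h1 (by norm_num)
    _ = _ := by
        rw [lintegral_add_left (by fun_prop), lintegral_add_left (by fun_prop),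
          lintegral_add_right_eq_self kp c,
          lintegral_add_right_eq_self (fun u => kp (-u)) c, lintegral_neg_eq_self, hkp,
          lintegral_Ioo_rpow_neg_half]
        norm_num

/-- A weight on frequency space, decaying fast enough to make the reciprocal of the symbol
integrable. -/
def decayWeight (n : ℕ) (ζ : SpaceTime n) : ℝ :=
  (1 + ζ.1 ^ 2)⁻¹ * ((1 + ‖ζ.2‖ ^ 2) ^ (n + 1))⁻¹

lemma decayWeight_nonneg (ζ : SpaceTime n) : 0 ≤ decayWeight n ζ := by
  unfold decayWeight; positivity

/-- The singularities of the reciprocal of the symbol are integrable: `|p_ν| ^ 2` is at least `|τ +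
|ξ|²| |2ν·ξ|`, so that `1 / |p_ν|` is at most a product of two inverse square roots. The first is
integrated over `τ`, uniformly in `ξ`, and the second over the coordinate along `ν`. -/
lemma integrable_decayWeight_mul_symbol_inv {ν : Space n} (hν : ν ≠ 0) :
    Integrable fun ζ : SpaceTime n => (decayWeight n ζ : ℂ) * (symbol ν ζ)⁻¹ := by
  have hm : Measurable fun ζ : SpaceTime n => (decayWeight n ζ : ℂ) * (symbol ν ζ)⁻¹ := by
    unfold decayWeight; fun_prop
  obtain ⟨C, hC, hCb⟩ := exists_lintegral_rpow_neg_half_le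
  refine ⟨hm.aestronglyMeasurable, ?_⟩
  have hν0 : 0 < ‖ν‖ := norm_pos_iff.2 hν
  set ω : Space n := ‖ν‖⁻¹ • ν with hω'
  have hω : ‖ω‖ = 1 := norm_smul_inv_norm hν
  have hνω : ν = ‖ν‖ • ω := by rw [hω', smul_smul, mul_inv_cancel₀ hν0.ne', one_smul]
  have hinner : ∀ p, inner ℝ ν (lineEquiv ω hω p) = ‖ν‖ * p.1 := fun p => by
    nth_rewrite 1 [hνω]
    rw [inner_smul_left, inner_smul_lineEquiv]
    simp
  set A : ℝ≥0∞ := ENNReal.ofReal ((2 * ‖ν‖) ^ (-(1 / 2) : ℝ)) with hA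
  have hfin : (Module.finrank ℝ (ℝ ∙ ω)ᗮ : ℝ) < 2 * n := by
    have h1 := Submodule.finrank_add_finrank_orthogonal (ℝ ∙ ω)
    have h2 : Module.finrank ℝ (ℝ ∙ ω) = 1 := finrank_span_singleton (by
      intro h; rw [h] at hω; simp at hω)
    rw [h2, finrank_euclideanSpace_fin] at h1
    have : (1 : ℝ) + Module.finrank ℝ (ℝ ∙ ω)ᗮ = n := by exact_mod_cast h1
    have h3 : (0 : ℝ) ≤ n := by positivity
    linarith
  have hY : ∫⁻ y : (ℝ ∙ ω)ᗮ, ENNReal.ofReal (((1 + ‖y‖ ^ 2) ^ n)⁻¹) < ∞ := by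
    have := (integrable_rpow_neg_one_add_norm_sq (E := (ℝ ∙ ω)ᗮ) (μ := volume)
      hfin).lintegral_lt_top
    refine lt_of_le_of_lt (lintegral_mono fun y => ?_) this
    refine ENNReal.ofReal_le_ofReal (le_of_eq ?_)
    have h : -(2 * (n : ℝ)) / 2 = -(n : ℝ) := by ring
    rw [h, Real.rpow_neg (by positivity), Real.rpow_natCast]
  rw [hasFiniteIntegral_iff_enorm, Measure.volume_eq_prod,
    lintegral_prod_symm _ hm.enorm.aemeasurable,
    ← (measurePreserving_lineEquiv ω hω).lintegral_comp_emb (lineEquiv ω hω).measurableEmbedding]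
  calc _ ≤ ∫⁻ p : ℝ × (ℝ ∙ ω)ᗮ, C * A * ((ENNReal.ofReal ((1 + p.1 ^ 2)⁻¹) *
        ENNReal.ofReal (|p.1 + 0| ^ (-(1 / 2) : ℝ))) *
          ENNReal.ofReal (((1 + ‖p.2‖ ^ 2) ^ n)⁻¹)) := by
        have hne : ∀ᵐ p : ℝ × (ℝ ∙ ω)ᗮ, p.1 ≠ 0 :=
          Measure.quasiMeasurePreserving_fst.ae (Measure.ae_ne volume (0 : ℝ))
        refine lintegral_mono_ae ?_
        filter_upwards [hne] with p hp
        have hip : inner ℝ ν (lineEquiv ω hω p) ≠ 0 := by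
          rw [hinner]; exact mul_ne_zero hν0.ne' hp
        have hwt : ((1 + ‖lineEquiv ω hω p‖ ^ 2) ^ (n + 1))⁻¹ ≤
            (1 + p.1 ^ 2)⁻¹ * ((1 + ‖p.2‖ ^ 2) ^ n)⁻¹ := by
          rw [← mul_inv, norm_sq_lineEquiv, pow_succ']
          refine inv_anti₀ (by positivity) ?_
          gcongr
          · nlinarith [sq_nonneg ‖p.2‖]
          · nlinarith [sq_nonneg p.1]
        have habs : |2 * inner ℝ ν (lineEquiv ω hω p)| ^ (-(1 / 2) : ℝ) =
            (2 * ‖ν‖) ^ (-(1 / 2) : ℝ) * |p.1 + 0| ^ (-(1 / 2) : ℝ) := by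
          rw [hinner, ← mul_assoc, abs_mul, abs_of_pos (by positivity : 0 < 2 * ‖ν‖),
            Real.mul_rpow (by positivity) (by positivity), add_zero]
        calc _ ≤ ∫⁻ τ : ℝ, (ENNReal.ofReal ((1 + τ ^ 2)⁻¹) *
              ENNReal.ofReal (|τ + ‖lineEquiv ω hω p‖ ^ 2| ^ (-(1 / 2) : ℝ))) *
                ENNReal.ofReal (((1 + p.1 ^ 2)⁻¹ * ((1 + ‖p.2‖ ^ 2) ^ n)⁻¹) *
                  ((2 * ‖ν‖) ^ (-(1 / 2) : ℝ) * |p.1 + 0| ^ (-(1 / 2) : ℝ))) := by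
              refine lintegral_mono_ae ?_
              filter_upwards [Measure.ae_ne volume (-‖lineEquiv ω hω p‖ ^ 2)] with τ hτ
              have hτ' : τ + ‖lineEquiv ω hω p‖ ^ 2 ≠ 0 := by
                intro h; exact hτ (by linarith)
              rw [← ENNReal.ofReal_mul (by positivity), ← ENNReal.ofReal_mul (by positivity),
                ← ofReal_norm]
              refine ENNReal.ofReal_le_ofReal ?_
              rw [norm_mul, norm_real, Real.norm_of_nonneg (decayWeight_nonneg _), decayWeight]
              have hs := norm_symbol_inv_le ν hip hτ'
              rw [habs] at hs
              simp only
              calc _ ≤ (1 + τ ^ 2)⁻¹ * ((1 + p.1 ^ 2)⁻¹ * ((1 + ‖p.2‖ ^ 2) ^ n)⁻¹) *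
                    (|τ + ‖lineEquiv ω hω p‖ ^ 2| ^ (-(1 / 2) : ℝ) *
                      ((2 * ‖ν‖) ^ (-(1 / 2) : ℝ) * |p.1 + 0| ^ (-(1 / 2) : ℝ))) := by
                    gcongr
                _ = _ := by ring
          _ = (∫⁻ τ : ℝ, ENNReal.ofReal ((1 + τ ^ 2)⁻¹) *
              ENNReal.ofReal (|τ + ‖lineEquiv ω hω p‖ ^ 2| ^ (-(1 / 2) : ℝ))) *
                ENNReal.ofReal (((1 + p.1 ^ 2)⁻¹ * ((1 + ‖p.2‖ ^ 2) ^ n)⁻¹) *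
                  ((2 * ‖ν‖) ^ (-(1 / 2) : ℝ) * |p.1 + 0| ^ (-(1 / 2) : ℝ))) :=
              lintegral_mul_const' _ _ ENNReal.ofReal_ne_top
          _ ≤ C * _ := mul_le_mul_left (hCb _) _
          _ = _ := by
              rw [ENNReal.ofReal_mul (by positivity), ENNReal.ofReal_mul (by positivity),
                ENNReal.ofReal_mul (by positivity)]
              ring
    _ = C * A * ((∫⁻ s : ℝ, ENNReal.ofReal ((1 + s ^ 2)⁻¹) *
        ENNReal.ofReal (|s + 0| ^ (-(1 / 2) : ℝ))) *
          ∫⁻ y : (ℝ ∙ ω)ᗮ, ENNReal.ofReal (((1 + ‖y‖ ^ 2) ^ n)⁻¹)) := by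
        rw [lintegral_const_mul' _ _ (ENNReal.mul_ne_top hC ENNReal.ofReal_ne_top),
          Measure.volume_eq_prod]
        congr 1
        exact lintegral_prod_mul (f := fun s : ℝ => ENNReal.ofReal ((1 + s ^ 2)⁻¹) *
          ENNReal.ofReal (|s + 0| ^ (-(1 / 2) : ℝ)))
          (g := fun y : (ℝ ∙ ω)ᗮ => ENNReal.ofReal (((1 + ‖y‖ ^ 2) ^ n)⁻¹))
          (Measurable.aemeasurable (by fun_prop)) (Measurable.aemeasurable (by fun_prop))
    _ < ∞ := ENNReal.mul_lt_top (ENNReal.mul_lt_top hC.lt_top ENNReal.ofReal_lt_top)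
        (ENNReal.mul_lt_top ((hCb 0).trans_lt hC.lt_top) hY)

/-- A function bounded by the weight is integrable against the reciprocal of the symbol. -/
lemma integrable_symbol_inv_mul {ν : Space n} (hν : ν ≠ 0) {H : SpaceTime n → ℂ}
    (hH : Measurable H) {c : ℝ} (hb : ∀ ζ, ‖H ζ‖ ≤ c * decayWeight n ζ) :
    Integrable fun ζ => (symbol ν ζ)⁻¹ * H ζ := by
  refine ((integrable_decayWeight_mul_symbol_inv hν).norm.const_mul c).mono'
    (Measurable.aestronglyMeasurable (by fun_prop)) (ae_of_all _ fun ζ => ?_)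
  rw [norm_mul, norm_mul, norm_real, Real.norm_of_nonneg (decayWeight_nonneg _)]
  calc _ ≤ ‖(symbol ν ζ)⁻¹‖ * (c * decayWeight n ζ) := by gcongr; exact hb ζ
    _ = _ := by ring

/-- The Gaussian cut-off in frequency. -/
def gaussWeight (ε : ℝ) (ζ : SpaceTime n) : ℂ :=
  (Real.exp (-ε * ‖ζ.1‖ ^ 2) : ℂ) * (Real.exp (-ε * ‖ζ.2‖ ^ 2) : ℂ)

@[fun_prop]
lemma measurable_gaussWeight (ε : ℝ) : Measurable (gaussWeight (n := n) ε) := by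
  unfold gaussWeight; fun_prop

lemma exp_neg_le_inv_pow {ε : ℝ} (hε : 0 < ε) (m : ℕ) {y : ℝ} (hy : 0 ≤ y) :
    Real.exp (-ε * y) ≤ Real.exp ε * m.factorial / ε ^ m * ((1 + y) ^ m)⁻¹ := by
  have h := Real.pow_div_factorial_le_exp (ε * (1 + y)) (by positivity) m
  have h1 : Real.exp (-ε * y) = Real.exp ε * (Real.exp (ε * (1 + y)))⁻¹ := by
    rw [← Real.exp_neg, ← Real.exp_add]; ring_nf
  rw [h1]
  calc _ ≤ Real.exp ε * ((ε * (1 + y)) ^ m / m.factorial)⁻¹ := by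
        gcongr
    _ = _ := by
        rw [mul_pow]
        field_simp

lemma exists_gaussWeight_le {ε : ℝ} (hε : 0 < ε) :
    ∃ c : ℝ, 0 ≤ c ∧ ∀ ζ : SpaceTime n, ‖gaussWeight ε ζ‖ ≤ c * decayWeight n ζ := by
  refine ⟨(Real.exp ε * (1 : ℕ).factorial / ε ^ 1) *
    (Real.exp ε * (n + 1).factorial / ε ^ (n + 1)), by positivity, fun ζ => ?_⟩
  have h1 := exp_neg_le_inv_pow hε 1 (sq_nonneg ‖ζ.1‖)
  have h2 := exp_neg_le_inv_pow hε (n + 1) (sq_nonneg ‖ζ.2‖)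
  rw [gaussWeight, norm_mul, norm_real, norm_real, Real.norm_of_nonneg (Real.exp_pos _).le,
    Real.norm_of_nonneg (Real.exp_pos _).le, decayWeight]
  refine (mul_le_mul h1 h2 (Real.exp_pos _).le (by positivity)).trans (le_of_eq ?_)
  rw [Real.norm_eq_abs, sq_abs, pow_one]
  ring

/-! ### The regularised bilinear form of `S_ν` -/

/-- The integrand of the regularised bilinear form of `S_ν`. -/
def formIntegrand (ν : Space n) (ε : ℝ) (f g : SpaceTime n → ℂ)
    (ζ : SpaceTime n) : ℂ :=
  gaussWeight ε ζ * ((symbol ν ζ)⁻¹ * (stFourier f (-ζ) * stFourier g ζ))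

/-- The bilinear form of `S_ν`, up to a constant, with a Gaussian cut-off in frequency. -/
def form (ν : Space n) (ε : ℝ) (f g : SpaceTime n → ℂ) : ℂ :=
  ∫ ζ, formIntegrand ν ε f g ζ

/-- The part of the form over the half-space `ν·ξ > 0`. -/
def halfForm (ν : Space n) (ε : ℝ) (f g : SpaceTime n → ℂ) : ℂ :=
  ∫ ζ, {ζ : SpaceTime n | 0 < inner ℝ ν ζ.2}.indicator (formIntegrand ν ε f g) ζ

lemma integrable_formIntegrand {ν : Space n} (hν : ν ≠ 0) {ε : ℝ} (hε : 0 < ε)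
    {f g : SpaceTime n → ℂ} (hf : Measurable f) (hg : Measurable g) :
    Integrable (formIntegrand ν ε f g) := by
  have h1 := measurable_stFourier hf
  have h2 := measurable_stFourier hg
  obtain ⟨c, hc0, hc⟩ := exists_gaussWeight_le (n := n) hε
  have := integrable_symbol_inv_mul hν (H := fun ζ => gaussWeight ε ζ *
    (stFourier f (-ζ) * stFourier g ζ)) (c := c * ((∫ z, ‖f z‖) * ∫ z, ‖g z‖)) (by fun_prop) ?_
  · refine this.congr (ae_of_all _ fun ζ => ?_)
    simp only [formIntegrand]; ring
  · intro ζ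
    rw [norm_mul, norm_mul]
    calc _ ≤ (c * decayWeight n ζ) * ((∫ z, ‖f z‖) * ∫ z, ‖g z‖) := by
          have := decayWeight_nonneg ζ
          gcongr
          · exact hc ζ
          · exact norm_stFourier_le _ _
          · exact norm_stFourier_le _ _
      _ = _ := by ring

lemma measurableSet_halfSpace (ν : Space n) :
    MeasurableSet {ζ : SpaceTime n | 0 < inner ℝ ν ζ.2} :=
  measurableSet_lt measurable_const (by fun_prop)

lemma ae_inner_ne_zero {ν : Space n} (hν : ν ≠ 0) : ∀ᵐ ξ : Space n, inner ℝ ν ξ ≠ 0 := by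
  have h : ((ℝ ∙ ν)ᗮ : Submodule ℝ (Space n)) ≠ ⊤ := by
    intro h
    have : ν ∈ (ℝ ∙ ν)ᗮ := by rw [h]; trivial
    rw [Submodule.mem_orthogonal_singleton_iff_inner_right] at this
    exact hν (inner_self_eq_zero.1 this)
  have := Measure.addHaar_submodule (volume : Measure (Space n)) _ h
  rw [ae_iff]
  refine le_antisymm ((measure_mono fun ξ hξ => ?_).trans this.le) zero_le
  simp only [not_not, Set.mem_ofPred_eq] at hξ
  exact Submodule.mem_orthogonal_singleton_iff_inner_right.2 hξ

/-- The part over the other half-space reduces to the first one by conjugation. -/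
lemma form_eq_add {ν : Space n} (hν : ν ≠ 0) {ε : ℝ} (hε : 0 < ε) {f g : SpaceTime n → ℂ}
    (hf : Measurable f) (hg : Measurable g) :
    form ν ε f g = halfForm ν ε f g + starRingEnd ℂ (halfForm (-ν) ε
      (fun z => starRingEnd ℂ (g z)) (fun z => starRingEnd ℂ (f z))) := by
  have hi := integrable_formIntegrand hν hε hf hg
  have hneg : starRingEnd ℂ (halfForm (-ν) ε
      (fun z => starRingEnd ℂ (g z)) (fun z => starRingEnd ℂ (f z))) =
      ∫ ζ, {ζ : SpaceTime n | 0 < inner ℝ (-ν) ζ.2}.indicator (formIntegrand ν ε f g) ζ := by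
    rw [halfForm, ← integral_conj]
    refine integral_congr_ae (ae_of_all _ fun ζ => ?_)
    by_cases h : ζ ∈ {ζ : SpaceTime n | 0 < inner ℝ (-ν) ζ.2}
    · simp only [Set.indicator_of_mem h, formIntegrand, map_mul, map_inv₀, conj_symbol,
        conj_stFourier, neg_neg, gaussWeight, conj_ofReal, Complex.conj_conj]
      ring
    · simp only [Set.indicator_of_notMem h, map_zero]
  rw [hneg, halfForm, ← integral_add (hi.indicator (measurableSet_halfSpace ν))
    (hi.indicator (measurableSet_halfSpace (-ν))), form]
  refine integral_congr_ae ?_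
  have hae : ∀ᵐ ζ : SpaceTime n, inner ℝ ν ζ.2 ≠ 0 :=
    Measure.quasiMeasurePreserving_snd.ae (ae_inner_ne_zero hν)
  filter_upwards [hae] with ζ hζ
  rcases lt_or_gt_of_ne hζ with h | h
  · rw [Set.indicator_of_notMem (show ζ ∉ {ζ : SpaceTime n | 0 < inner ℝ ν ζ.2} from not_lt.2 h.le),
      Set.indicator_of_mem (show ζ ∈ {ζ : SpaceTime n | 0 < inner ℝ (-ν) ζ.2} by
        simpa using h), zero_add]
  · rw [Set.indicator_of_mem (show ζ ∈ {ζ : SpaceTime n | 0 < inner ℝ ν ζ.2} from h),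
      Set.indicator_of_notMem (show ζ ∉ {ζ : SpaceTime n | 0 < inner ℝ (-ν) ζ.2} by
        simpa using h.le), add_zero]

end Reciprocal

/-! ### The form as an average of damped evolutions -/

section FormBound

open Complex

variable {n : ℕ}

/-- The translate of a function in time. -/
def timeShift (w : ℝ) (f : SpaceTime n → ℂ) (z : SpaceTime n) : ℂ := f (z.1 - w, z.2)

lemma measurePreserving_timeShift (w : ℝ) :
    MeasurePreserving fun z : SpaceTime n => (z.1 - w, z.2) :=
  (measurePreserving_sub_right (volume : Measure ℝ) w).prod (MeasurePreserving.id _)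

lemma Nice.timeShift {f : SpaceTime n → ℂ} (hf : Nice volume f) (w : ℝ) :
    Nice volume (timeShift w f) := by
  obtain ⟨M, hM⟩ := hf.bdd
  refine ⟨hf.meas.comp (by fun_prop), ?_, M, fun z => hM _⟩
  exact ((measurePreserving_timeShift w).integrable_comp hf.meas.aestronglyMeasurable).2 hf.int

lemma mixedNorm_timeShift (q r : ℝ≥0∞) {f : SpaceTime n → ℂ} (hf : Measurable f) (w : ℝ) :
    mixedNorm q r (timeShift w f) = mixedNorm q r f :=
  eLpNorm_comp_measurePreserving
    (g := fun t => eLpNorm (fun x : Space n => f (t, x)) r volume) (f := fun t : ℝ => t - w)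
    (measurable_eLpNorm_slice hf.enorm r).aestronglyMeasurable
    (measurePreserving_sub_right volume w)

lemma evol_eq_fourier {D : Set ℝ} (hD : MeasurableSet D) (hD0 : ∀ t ∈ D, 0 < t) (ν : Space n)
    {ε : ℝ} (hε : 0 < ε) {f g : SpaceTime n → ℂ} (hf : Nice volume f) (hg : Nice volume g) :
    evol D ν ε f g = ∫ p : ℝ × ℝ, ∫ ξ, D.indicator (fun _ => (1 : ℂ)) (p.1 - p.2) *
      ((Real.exp (-ε * ‖ξ‖ ^ 2) : ℂ) * (damp ν (p.1 - p.2) (p.1 - p.2) ξ *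
        (sliceFourier g p.1 ξ * sliceFourier f p.2 (-ξ)))) := by
  rw [evol_eq hD hD0 ν hε hf hg]
  refine integral_congr_ae ?_
  filter_upwards [ae_pair_of_ae hg.ae_slice hf.ae_slice] with p ⟨hgp, hfp⟩
  rw [integral_const_mul]
  by_cases hp : p.1 - p.2 ∈ D
  · rw [integral_kern_mul_eq ν hε (hD0 _ hp).le hfp.int hgp.int]
    rfl
  · simp [Set.indicator_of_notMem hp]

lemma indicator_damp_eq (ν ξ : Space n) (u : ℝ) :
    (Set.Ioi 0).indicator (fun u => damp ν u u ξ) u =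
      (Set.Ioi 0).indicator (fun _ => (1 : ℂ)) u * damp ν u u ξ := by
  by_cases hu : u ∈ Set.Ioi (0 : ℝ) <;> simp [Set.indicator, hu]

lemma norm_indicator_damp_le (ν ξ : Space n) (u : ℝ) :
    ‖(Set.Ioi 0).indicator (fun u => damp ν u u ξ) u‖ ≤ 1 := by
  by_cases hu : u ∈ Set.Ioi (0 : ℝ)
  · rw [Set.indicator_of_mem hu]
    exact norm_damp_le ν u (le_of_lt hu) ξ
  · simp [Set.indicator_of_notMem hu]

lemma integrable_indicator_damp (ν ξ : Space n) :
    Integrable fun u : ℝ => (Set.Ioi 0).indicator (fun u => damp ν u u ξ) u := by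
  by_cases hξ : 0 < inner ℝ ν ξ
  · refine (integrable_indicator_iff measurableSet_Ioi).2 ?_
    refine (integrableOn_exp_mul_Ioi (a := -(2 * inner ℝ ν ξ)) (by linarith) 0).mono'
      (Measurable.aestronglyMeasurable (by fun_prop)) (ae_of_all _ fun u => le_of_eq ?_)
    rw [damp, Set.indicator_of_mem (show ξ ∈ {ξ : Space n | 0 < inner ℝ ν ξ} from hξ), norm_mul,
      norm_exp_ofReal_mul_I, one_mul, norm_real, Real.norm_of_nonneg (Real.exp_pos _).le]
    ring_nf
  · have : ∀ u, damp ν u u ξ = 0 := fun u =>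
      Set.indicator_of_notMem (s := {ξ : Space n | 0 < inner ℝ ν ξ}) hξ _
    simp [this]

lemma Nice.integrable_sliceFourier {f : SpaceTime n → ℂ} (hf : Nice volume f) (ξ : Space n) :
    Integrable fun t => sliceFourier f t ξ := by
  have hfm := hf.meas
  exact hf.integrable_slice_norm.mono' (Measurable.aestronglyMeasurable (by fun_prop))
    (ae_of_all _ fun t => norm_sliceFourier_le f t ξ)

/-- The part of the form over a half-space is an average of time translates of the form of the
damped evolution. The integrals over the two frequencies have to be treated one at a time, because
the damping is not integrable over the half-space. -/
lemma enorm_halfForm_le {ν : Space n} (hν : ν ≠ 0) {ε : ℝ} (hε : 0 < ε) {f g : SpaceTime n → ℂ}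
    (hf : Nice volume f) (hg : Nice volume g) :
    ‖halfForm ν ε f g‖ₑ ≤
      ∫⁻ w, ‖gaussHat ε w‖ₑ * ‖evol (Set.Ioi 0) ν ε (timeShift w f) g‖ₑ := by
  have hfm := hf.meas
  have hgm := hg.meas
  have hD : MeasurableSet (Set.Ioi (0 : ℝ)) := measurableSet_Ioi
  -- `L` is the common integrand of both sides; it is integrable over all variables.
  set L : Space n × ((ℝ × ℝ) × ℝ) → ℂ := fun x => (Real.exp (-ε * ‖x.1‖ ^ 2) : ℂ) *
    (((Set.Ioi 0).indicator (fun _ => (1 : ℂ)) (x.2.1.1 - x.2.1.2 - x.2.2) *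
      damp ν (x.2.1.1 - x.2.1.2 - x.2.2) (x.2.1.1 - x.2.1.2 - x.2.2) x.1 * gaussHat ε x.2.2) *
        (sliceFourier f x.2.1.2 (-x.1) * sliceFourier g x.2.1.1 x.1)) with hL
  have hLm : Measurable L := by
    simp only [hL]
    fun_prop
  have hLi : Integrable L (volume.prod (volume.prod volume)) := by
    have h00 : Integrable (fun z : ℝ × ℝ => (∫ x, ‖g (z.1, x)‖) * ∫ x, ‖f (z.2, x)‖) volume :=
      hg.integrable_slice_norm.mul_prod hf.integrable_slice_norm
    have h01 : Integrable (fun y : (ℝ × ℝ) × ℝ =>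
        ((∫ x, ‖g (y.1.1, x)‖) * ∫ x, ‖f (y.1.2, x)‖) * ‖gaussHat ε y.2‖) (volume.prod volume) :=
      Integrable.mul_prod (f := fun z : ℝ × ℝ => (∫ x, ‖g (z.1, x)‖) * ∫ x, ‖f (z.2, x)‖)
        (g := fun v => ‖gaussHat ε v‖) h00 (integrable_gaussHat hε).norm
    have h0 : Integrable (fun x : Space n × ((ℝ × ℝ) × ℝ) => Real.exp (-ε * ‖x.1‖ ^ 2) *
        (((∫ y, ‖g (x.2.1.1, y)‖) * ∫ y, ‖f (x.2.1.2, y)‖) * ‖gaussHat ε x.2.2‖))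
        (volume.prod (volume.prod volume)) :=
      Integrable.mul_prod (f := fun ξ : Space n => Real.exp (-ε * ‖ξ‖ ^ 2))
        (g := fun y : (ℝ × ℝ) × ℝ =>
          ((∫ x, ‖g (y.1.1, x)‖) * ∫ x, ‖f (y.1.2, x)‖) * ‖gaussHat ε y.2‖)
        (integrable_gauss hε) h01
    refine h0.mono' hLm.aestronglyMeasurable (ae_of_all _ fun x => ?_)
    have h1 := norm_indicator_damp_le ν x.1 (x.2.1.1 - x.2.1.2 - x.2.2)
    rw [indicator_damp_eq] at h1
    simp only [hL]
    rw [norm_mul, norm_mul, norm_mul _ (gaussHat ε _), norm_mul (sliceFourier f _ _), norm_real,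
      Real.norm_of_nonneg (Real.exp_pos _).le]
    refine mul_le_mul_of_nonneg_left ?_ (Real.exp_pos _).le
    rw [mul_comm]
    refine mul_le_mul ?_ (mul_le_of_le_one_left (norm_nonneg _) h1) (by positivity) (by positivity)
    rw [mul_comm]
    gcongr
    · exact norm_sliceFourier_le g _ _
    · exact norm_sliceFourier_le f _ _
  -- the integral over `τ` at a fixed `ξ`, by the trilinear Parseval identity
  have h1 : halfForm ν ε f g = ∫ ξ, -I * ∫ y, L (ξ, y) ∂(volume.prod volume) := by
    have hi := (integrable_formIntegrand hν hε hfm hgm).indicator (measurableSet_halfSpace ν)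
    rw [Measure.volume_eq_prod] at hi
    rw [halfForm, Measure.volume_eq_prod, integral_prod_symm _ hi]
    refine integral_congr_ae ?_
    filter_upwards [hLi.prod_right_ae] with ξ hξi
    rw [integral_prod _ hξi]
    by_cases hξ : 0 < inner ℝ ν ξ
    · have e1 := integral_gauss_fourier_three hε (integrable_indicator_damp ν ξ)
        (hf.integrable_sliceFourier (-ξ)) (hg.integrable_sliceFourier ξ)
      have e2 : ∀ τ : ℝ, {ζ : SpaceTime n | 0 < inner ℝ ν ζ.2}.indicator
          (formIntegrand ν ε f g) (τ, ξ) = (-I * (Real.exp (-ε * ‖ξ‖ ^ 2) : ℂ)) *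
          ((Real.exp (-ε * ‖τ‖ ^ 2) : ℂ) *
            ((∫ u : ℝ, chr u (-τ) * (Set.Ioi 0).indicator (fun u => damp ν u u ξ) u) *
            ((∫ s, chr s (-τ) * sliceFourier f s (-ξ)) * ∫ t, chr t τ * sliceFourier g t ξ))) := by
        intro τ
        rw [Set.indicator_of_mem (show (τ, ξ) ∈ {ζ : SpaceTime n | 0 < inner ℝ ν ζ.2} from hξ),
          formIntegrand, symbol_inv_eq ν τ hξ, stFourier_eq hf, stFourier_eq hg, gaussWeight]
        simp only [Prod.fst_neg, Prod.snd_neg]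
        ring
      simp_rw [e2]
      rw [integral_const_mul, e1, mul_assoc, ← integral_const_mul]
      congr 1
      refine integral_congr_ae (ae_of_all _ fun p => ?_)
      simp only [hL]
      rw [integral_const_mul, integral_mul_const]
      simp only [indicator_damp_eq]
    · have hd : ∀ u, damp ν u u ξ = 0 := fun u =>
        Set.indicator_of_notMem (s := {ξ : Space n | 0 < inner ℝ ν ξ}) hξ _
      have e2 : ∀ τ : ℝ, {ζ : SpaceTime n | 0 < inner ℝ ν ζ.2}.indicator
          (formIntegrand ν ε f g) (τ, ξ) = 0 := fun τ =>
        Set.indicator_of_notMem (s := {ζ : SpaceTime n | 0 < inner ℝ ν ζ.2}) hξ _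
      simp [e2, hL, hd]
  have h2 : ∫ ξ, -I * ∫ y, L (ξ, y) ∂(volume.prod volume) =
      -I * ∫ v, ∫ p : ℝ × ℝ, ∫ ξ, L (ξ, (p, v)) := by
    rw [integral_const_mul]
    congr 1
    rw [integral_integral_swap (f := fun ξ y => L (ξ, y)) hLi]
    exact integral_prod_symm _ hLi.integral_prod_right
  rw [h1, h2, enorm_mul]
  have hI : ‖-I‖ₑ = 1 := by simp [← ofReal_norm]
  rw [hI, one_mul]
  refine (enorm_integral_le_lintegral_enorm _).trans (lintegral_mono fun v => le_of_eq ?_)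
  simp only
  rw [← enorm_mul, evol_eq_fourier hD (fun t ht => ht) ν hε (hf.timeShift v) hg,
    ← integral_const_mul]
  -- The variable `v` becomes a translation in time of `f`.
  conv_rhs => rw [← integral_add_right_eq_self (μ := (volume : Measure (ℝ × ℝ))) _ ((0 : ℝ), v)]
  congr 1
  refine integral_congr_ae (ae_of_all _ fun p => ?_)
  simp only
  rw [← integral_const_mul]
  refine integral_congr_ae (ae_of_all _ fun ξ => ?_)
  have e1 : sliceFourier (timeShift v f) (p.2 + v) (-ξ) = sliceFourier f p.2 (-ξ) := by
    simp [sliceFourier, timeShift]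
  simp only [hL, Prod.fst_add, Prod.snd_add, add_zero, e1, sub_add_eq_sub_sub]
  ring

/-- The bound of the regularised form by mixed norms, uniform in `ν` and in the cut-off. -/
theorem exists_form_le {q r : ℝ} (hq₁ : 1 ≤ q) (hq₂ : q ≤ 2) (hr₁ : 1 ≤ r) (hr₂ : r ≤ 2)
    (hqr : (n : ℝ) * (1 / r - 1 / 2) = 2 - 2 / q) (hend : q = 2 → 3 ≤ n) :
    ∃ C : ℝ≥0∞, C ≠ ∞ ∧ ∀ ν : Space n, ν ≠ 0 → ∀ ε : ℝ, 0 < ε → ∀ f g : SpaceTime n → ℂ,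
      Nice volume f → Nice volume g → ‖form ν ε f g‖ₑ ≤
        C * mixedNorm (ENNReal.ofReal q) (ENNReal.ofReal r) f *
          mixedNorm (ENNReal.ofReal q) (ENNReal.ofReal r) g := by
  obtain ⟨C, hC, h⟩ := exists_evol_le hq₁ hq₂ hr₁ hr₂ hqr hend
  set G := ENNReal.ofReal (2 * Real.pi)
  set N : (SpaceTime n → ℂ) → ℝ≥0∞ := mixedNorm (ENNReal.ofReal q) (ENNReal.ofReal r) with hN
  have half : ∀ ν : Space n, ν ≠ 0 → ∀ ε : ℝ, 0 < ε → ∀ f g : SpaceTime n → ℂ,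
      Nice volume f → Nice volume g → ‖halfForm ν ε f g‖ₑ ≤ G * (C * N f * N g) := by
    intro ν hν ε hε f g hf hg
    refine (enorm_halfForm_le hν hε hf hg).trans ?_
    calc _ ≤ ∫⁻ w, ‖gaussHat ε w‖ₑ * (C * N f * N g) := by
          refine lintegral_mono fun w => mul_le_mul_right ?_ _
          refine (h ν hν ε hε _ g (hf.timeShift w) hg).trans (le_of_eq ?_)
          rw [hN, mixedNorm_timeShift _ _ hf.meas]
      _ = _ := by
          rw [lintegral_mul_const _ (by fun_prop), lintegral_gaussHat hε]
  have hNc : ∀ f : SpaceTime n → ℂ, N (fun z => starRingEnd ℂ (f z)) = N f := fun f =>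
    mixedNorm_congr_ae (ae_of_all _ fun z => RCLike.norm_conj _)
  refine ⟨2 * G * C, ENNReal.mul_ne_top (ENNReal.mul_ne_top (by simp) ENNReal.ofReal_ne_top) hC,
    fun ν hν ε hε f g hf hg => ?_⟩
  rw [form_eq_add hν hε hf.meas hg.meas]
  refine (enorm_add_le _ _).trans ?_
  have h1 := half ν hν ε hε f g hf hg
  have h2 := half (-ν) (neg_ne_zero.2 hν) ε hε _ _ hg.conj hf.conj
  rw [hNc, hNc] at h2
  have h3 : ‖starRingEnd ℂ (halfForm (-ν) ε (fun z => starRingEnd ℂ (g z))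
      (fun z => starRingEnd ℂ (f z)))‖ₑ = ‖halfForm (-ν) ε (fun z => starRingEnd ℂ (g z))
      (fun z => starRingEnd ℂ (f z))‖ₑ := by
    rw [← ofReal_norm, ← ofReal_norm, RCLike.norm_conj]
  rw [h3]
  refine (add_le_add h1 h2).trans (le_of_eq ?_)
  ring

end FormBound

/-! ### Decay of the form in `ν`, in norms that are integrated over parallel hyperplanes -/

section Roots

open Complex

/-- The reciprocal of `z + ir` is the Fourier transform of an exponential on a half-line. -/
lemma exists_fourier_eq_inv {z : ℂ} (hz : z.re ≠ 0) :
    ∃ k : ℝ → ℂ, Integrable k ∧ (∀ u, ‖k u‖ ≤ 1) ∧ ∫ u, ‖k u‖ ≤ |z.re|⁻¹ ∧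
      ∀ r : ℝ, ∫ u, chr u (-r) * k u = (z + r * I)⁻¹ := by
  have pos : ∀ z : ℂ, 0 < z.re → ∃ k : ℝ → ℂ, Integrable k ∧ (∀ u, ‖k u‖ ≤ 1) ∧
      ∫ u, ‖k u‖ ≤ |z.re|⁻¹ ∧ ∀ r : ℝ, ∫ u, chr u (-r) * k u = (z + r * I)⁻¹ := by
    intro z hz
    have hre : (-z).re < 0 := by simpa using hz
    have hnorm : ∀ u : ℝ, ‖(Set.Ioi (0 : ℝ)).indicator (fun u : ℝ => cexp (-z * u)) u‖ =
        (Set.Ioi (0 : ℝ)).indicator (fun u : ℝ => Real.exp (-z.re * u)) u := by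
      intro u
      rw [norm_indicator_eq_indicator_norm]
      simp [norm_exp]
    refine ⟨(Set.Ioi 0).indicator fun u : ℝ => cexp (-z * u),
      (integrable_indicator_iff measurableSet_Ioi).2 (integrableOn_exp_mul_complex_Ioi hre 0),
      fun u => ?_, ?_, fun r => ?_⟩
    · rw [hnorm]
      refine Set.indicator_le' (fun u hu => ?_) (fun _ _ => zero_le_one) u
      have hu : 0 < u := hu
      exact Real.exp_le_one_iff.2 (by nlinarith)
    · simp_rw [hnorm]
      rw [integral_indicator measurableSet_Ioi, integral_exp_mul_Ioi (by linarith), abs_of_pos hz]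
      simp
    · have h1 : ∀ u : ℝ, chr u (-r) * (Set.Ioi (0 : ℝ)).indicator (fun u : ℝ => cexp (-z * u)) u =
          (Set.Ioi (0 : ℝ)).indicator (fun u : ℝ => cexp (-(z + r * I) * u)) u := by
        intro u
        by_cases hu : u ∈ Set.Ioi (0 : ℝ)
        · rw [Set.indicator_of_mem hu, Set.indicator_of_mem hu, chr, ← exp_add]
          congr 1
          simp
          ring
        · simp [Set.indicator_of_notMem hu]
      simp_rw [h1]
      rw [integral_indicator measurableSet_Ioi, integral_exp_mul_complex_Ioi (by simpa using hz)]
      simp [div_eq_mul_inv, ← inv_neg]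
  rcases lt_or_gt_of_ne hz with h | h
  · obtain ⟨k, hk, hk1, hk2, hk3⟩ := pos (-z) (by simpa using h)
    refine ⟨fun u => -k (-u), hk.comp_neg.neg, fun u => by simpa using hk1 (-u), ?_, fun r => ?_⟩
    · simp_rw [norm_neg]
      rw [integral_neg_eq_self (fun u => ‖k u‖)]
      simpa using hk2
    · rw [← integral_neg_eq_self]
      have := hk3 (-r)
      simp only [neg_neg, mul_neg, chr_neg_left] at this ⊢
      rw [integral_neg, this, ← inv_neg]
      push_cast
      congr 1
      ring
  · exact pos z h

/-- The one-dimensional factor of the form: although the symbol is a quadratic polynomial with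
roots that may come close to the real line, one of its roots is always at distance at least `a`. -/
lemma norm_integral_gauss_quadratic_le {ε a c : ℝ} (hε : 0 < ε) (ha : 0 < a) (hc : c ≠ 0)
    {A B : ℝ → ℂ} (hA : Integrable A) (hB : Integrable B) :
    ‖∫ r : ℝ, (Real.exp (-ε * ‖r‖ ^ 2) : ℂ) * ((-((r ^ 2 + c : ℝ) : ℂ) + 2 * a * r * I)⁻¹ *
      ((∫ s, chr s (-r) * A s) * ∫ s, chr s r * B s))‖ ≤
      2 * Real.pi / a * ((∫ s, ‖A s‖) * ∫ s, ‖B s‖) := by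
  -- `r ^ 2 + c - 2iar` has the roots `i(a ± κ)`. Since `Re κ ≥ 0`, the root `i(a + κ)` is at
  -- distance at least `a` from the real line. The other one must only not be real, which is `c ≠
  -- 0`.
  obtain ⟨κ, hκ, hκ0, hκa⟩ : ∃ κ : ℂ, κ ^ 2 = ((a ^ 2 + c : ℝ) : ℂ) ∧ 0 ≤ κ.re ∧ κ.re ≠ a := by
    rcases le_or_gt 0 (a ^ 2 + c) with h | h
    · refine ⟨(Real.sqrt (a ^ 2 + c) : ℂ), ?_, ?_, ?_⟩
      · rw [← ofReal_pow, Real.sq_sqrt h]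
      · rw [ofReal_re]; exact Real.sqrt_nonneg _
      · rw [ofReal_re]
        intro h1
        have := Real.sq_sqrt h
        rw [h1] at this
        exact hc (by linarith)
    · refine ⟨(Real.sqrt (-(a ^ 2 + c)) : ℂ) * I, ?_, ?_, ?_⟩
      · rw [mul_pow, I_sq, ← ofReal_pow, Real.sq_sqrt (by linarith)]
        push_cast; ring
      · simp
      · simp [ha.ne]
  obtain ⟨k, hk, -, hk2, hk3⟩ := exists_fourier_eq_inv (z := a + κ) (by
    rw [add_re, ofReal_re]; positivity)
  obtain ⟨l, hl, hl1, -, hl3⟩ := exists_fourier_eq_inv (z := a - κ) (by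
    rw [sub_re, ofReal_re]; intro h; exact hκa (by linarith))
  have hk2' : ∫ u, ‖k u‖ ≤ a⁻¹ := by
    refine hk2.trans (inv_anti₀ ha ?_)
    rw [add_re, ofReal_re, abs_of_pos (by positivity)]
    linarith
  have hfac : ∀ r : ℝ, (-((r ^ 2 + c : ℝ) : ℂ) + 2 * a * r * I)⁻¹ =
      (∫ u, chr u (-r) * k u) * ∫ v, chr v (-r) * l v := by
    intro r
    rw [hk3, hl3, ← mul_inv]
    congr 1
    push_cast at hκ ⊢
    linear_combination hκ - (r : ℂ) ^ 2 * I_sq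
  have hKm : Measurable fun r : ℝ => (-((r ^ 2 + c : ℝ) : ℂ) + 2 * a * r * I)⁻¹ := by fun_prop
  have hKb : ∀ r : ℝ, ‖(-((r ^ 2 + c : ℝ) : ℂ) + 2 * a * r * I)⁻¹‖ ≤
      (∫ u, ‖k u‖) * ∫ v, ‖l v‖ := by
    intro r
    have hb : ∀ h : ℝ → ℂ, ‖∫ u, chr u (-r) * h u‖ ≤ ∫ u, ‖h u‖ := fun h => by
      refine (norm_integral_le_integral_norm _).trans (le_of_eq ?_)
      simp [norm_chr]
    rw [hfac, norm_mul]
    exact mul_le_mul (hb k) (hb l) (norm_nonneg _) (by positivity)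
  have hAB : Integrable (fun q : ℝ × ℝ => A q.1 * B q.2) (volume.prod volume) := hA.mul_prod hB
  have hbig : Integrable (fun p : ℝ × (ℝ × ℝ) => ((Real.exp (-ε * ‖p.1‖ ^ 2) : ℂ) *
      (chr (p.2.2 - p.2.1) p.1 * (-((p.1 ^ 2 + c : ℝ) : ℂ) + 2 * a * p.1 * I)⁻¹)) *
      (A p.2.1 * B p.2.2)) (volume.prod (volume.prod volume)) := by
    have h0 : Integrable (fun p : ℝ × (ℝ × ℝ) => (Real.exp (-ε * ‖p.1‖ ^ 2) : ℂ) *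
        (A p.2.1 * B p.2.2)) (volume.prod (volume.prod volume)) :=
      Integrable.mul_prod (f := fun r : ℝ => (Real.exp (-ε * ‖r‖ ^ 2) : ℂ))
        (g := fun q : ℝ × ℝ => A q.1 * B q.2) (integrable_gauss hε).ofReal hAB
    have hm : Measurable fun p : ℝ × (ℝ × ℝ) => chr (p.2.2 - p.2.1) p.1 *
      (-((p.1 ^ 2 + c : ℝ) : ℂ) + 2 * a * p.1 * I)⁻¹ := by fun_prop
    refine (h0.bdd_mul (c := (∫ u, ‖k u‖) * ∫ v, ‖l v‖) hm.aestronglyMeasurable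
      (ae_of_all _ fun p => ?_)).congr (ae_of_all _ fun p => ?_)
    · rw [norm_mul, norm_chr, one_mul]
      exact hKb _
    · simp only; ring
  have hid : ∫ r : ℝ, (Real.exp (-ε * ‖r‖ ^ 2) : ℂ) * ((-((r ^ 2 + c : ℝ) : ℂ) + 2 * a * r * I)⁻¹ *
      ((∫ s, chr s (-r) * A s) * ∫ s, chr s r * B s)) =
      ∫ q : ℝ × ℝ, (∫ r : ℝ, (Real.exp (-ε * ‖r‖ ^ 2) : ℂ) *
        (chr (q.2 - q.1) r * (-((r ^ 2 + c : ℝ) : ℂ) + 2 * a * r * I)⁻¹)) * (A q.1 * B q.2)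
          ∂(volume.prod volume) := by
    calc _ = ∫ r : ℝ, ∫ q : ℝ × ℝ, ((Real.exp (-ε * ‖r‖ ^ 2) : ℂ) *
      (chr (q.2 - q.1) r * (-((r ^ 2 + c : ℝ) : ℂ) + 2 * a * r * I)⁻¹)) *
      (A q.1 * B q.2) ∂(volume.prod volume) := by
          refine integral_congr_ae (ae_of_all _ fun r => ?_)
          simp only
          rw [← integral_prod_mul (fun s => chr s (-r) * A s) (fun s => chr s r * B s),
            ← integral_const_mul, ← integral_const_mul]
          refine integral_congr_ae (ae_of_all _ fun q => ?_)
          simp only [chr_sub, chr_neg_left]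
          ring
      _ = _ := by
          rw [integral_integral_swap (f := fun (r : ℝ) (q : ℝ × ℝ) =>
            ((Real.exp (-ε * ‖r‖ ^ 2) : ℂ) *
              (chr (q.2 - q.1) r * (-((r ^ 2 + c : ℝ) : ℂ) + 2 * a * r * I)⁻¹)) *
              (A q.1 * B q.2)) hbig]
          refine integral_congr_ae (ae_of_all _ fun q => ?_)
          simp only
          rw [integral_mul_const]
  have hin : ∀ x : ℝ, ‖∫ r : ℝ, (Real.exp (-ε * ‖r‖ ^ 2) : ℂ) *
        (chr x r * (-((r ^ 2 + c : ℝ) : ℂ) + 2 * a * r * I)⁻¹)‖ ≤ 2 * Real.pi / a := by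
    intro x
    simp_rw [hfac]
    refine (norm_integral_gauss_fourier_two_le hε x hk hl hl1).trans ?_
    rw [div_eq_mul_inv]
    exact mul_le_mul_of_nonneg_left hk2' (by positivity)
  rw [hid, ← integral_prod_mul (fun s => ‖A s‖) (fun s => ‖B s‖), ← integral_const_mul]
  refine norm_integral_le_of_norm_le ((hA.norm.mul_prod hB.norm).const_mul _)
    (ae_of_all _ fun q => ?_)
  rw [norm_mul, norm_mul (A _)]
  exact mul_le_mul_of_nonneg_right (hin _) (by positivity)

end Roots

section Hyperplane

open Complex

variable {n : ℕ} (ω : Space n)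

/-- The coordinates `((t, y), s) ↦ (t, s ω + y)` on space-time, with `y ⟂ ω`. -/
def waveEquiv (hω : ‖ω‖ = 1) : (ℝ × (ℝ ∙ ω)ᗮ) × ℝ ≃ᵐ SpaceTime n :=
  MeasurableEquiv.prodAssoc.trans
    ((MeasurableEquiv.refl ℝ).prodCongr (MeasurableEquiv.prodComm.trans (lineEquiv ω hω)))

lemma waveEquiv_apply (hω : ‖ω‖ = 1) (p : (ℝ × (ℝ ∙ ω)ᗮ) × ℝ) :
    waveEquiv ω hω p = (p.1.1, p.2 • ω + p.1.2) := by
  have : waveEquiv ω hω p = (p.1.1, lineEquiv ω hω (p.2, p.1.2)) := rfl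
  rw [this, lineEquiv_apply]

lemma measurePreserving_waveEquiv (hω : ‖ω‖ = 1) : MeasurePreserving (waveEquiv ω hω) := by
  have h1 : MeasurePreserving (fun p : (ℝ ∙ ω)ᗮ × ℝ => lineEquiv ω hω p.swap)
      (volume.prod volume) volume :=
    (measurePreserving_lineEquiv ω hω).comp Measure.measurePreserving_swap
  exact ((MeasurePreserving.id (volume : Measure ℝ)).prod h1).comp
    (measurePreserving_prodAssoc volume volume volume)

/-- The slice of a function over the hyperplane at height `s`. -/
def waveSlice (f : SpaceTime n → ℂ) (s : ℝ) (q : ℝ × (ℝ ∙ ω)ᗮ) : ℂ := f (q.1, s • ω + q.2)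

/-- The integral of the `L²` norms over the hyperplanes with normal `ω`. -/
def waveNorm (f : SpaceTime n → ℂ) : ℝ≥0∞ :=
  ∫⁻ s, eLpNorm (waveSlice ω f s) 2 volume

lemma measurable_waveSlice_uncurry {f : SpaceTime n → ℂ} (hf : Measurable f) :
    Measurable fun p : ℝ × (ℝ × (ℝ ∙ ω)ᗮ) => waveSlice ω f p.1 p.2 := by
  unfold waveSlice
  fun_prop

lemma integrable_wave (hω : ‖ω‖ = 1) {f : SpaceTime n → ℂ} (hf : Integrable f) :
    Integrable (fun p : (ℝ × (ℝ ∙ ω)ᗮ) × ℝ => waveSlice ω f p.2 p.1) (volume.prod volume) := by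
  have := (measurePreserving_waveEquiv ω hω).integrable_comp_emb
    (waveEquiv ω hω).measurableEmbedding |>.2 hf
  refine this.congr (ae_of_all _ fun p => ?_)
  simp [waveSlice, waveEquiv_apply]

/-- The Fourier transform of the slice over the hyperplane at height `s`. -/
def waveFourier (f : SpaceTime n → ℂ) (s : ℝ) (η : ℝ × (ℝ ∙ ω)ᗮ) : ℂ :=
  ∫ q : ℝ × (ℝ ∙ ω)ᗮ, chr q.1 η.1 * chr q.2 η.2 * waveSlice ω f s q

lemma measurable_waveFourier_uncurry {f : SpaceTime n → ℂ} (hf : Measurable f) :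
    Measurable fun p : ℝ × (ℝ × (ℝ ∙ ω)ᗮ) => waveFourier ω f p.1 p.2 := by
  have : Measurable fun p : (ℝ × (ℝ × (ℝ ∙ ω)ᗮ)) × (ℝ × (ℝ ∙ ω)ᗮ) =>
      chr p.2.1 p.1.2.1 * chr p.2.2 p.1.2.2 * waveSlice ω f p.1.1 p.2 := by
    unfold waveSlice
    fun_prop
  exact (this.stronglyMeasurable.integral_prod_right (ν := volume)).measurable

lemma norm_waveFourier_le (f : SpaceTime n → ℂ) (s : ℝ) (η : ℝ × (ℝ ∙ ω)ᗮ) :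
    ‖waveFourier ω f s η‖ ≤ ∫ q, ‖waveSlice ω f s q‖ := by
  refine (norm_integral_le_integral_norm _).trans (le_of_eq ?_)
  simp [norm_chr]

lemma integrable_waveFourier (hω : ‖ω‖ = 1) {f : SpaceTime n → ℂ} (hf : Measurable f)
    (hfi : Integrable f) (η : ℝ × (ℝ ∙ ω)ᗮ) : Integrable fun s => waveFourier ω f s η := by
  refine ((integrable_wave ω hω hfi).integral_norm_prod_right).mono'
    ((measurable_waveFourier_uncurry ω hf).comp measurable_prodMk_right).aestronglyMeasurable
    (ae_of_all _ fun s => norm_waveFourier_le ω f s η)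

lemma chr_line (hω : ‖ω‖ = 1) (s r : ℝ) (x y : (ℝ ∙ ω)ᗮ) :
    chr (s • ω + x : Space n) (r • ω + y) = chr s r * chr x y := by
  have h1 : inner ℝ ω (y : Space n) = 0 := inner_self_orthogonal_eq_zero ω y
  have h2 : inner ℝ (x : Space n) ω = 0 := by
    rw [real_inner_comm]; exact inner_self_orthogonal_eq_zero ω x
  have h : inner ℝ (s • ω + x : Space n) (r • ω + y) = inner ℝ s r + inner ℝ x y := by
    rw [inner_add_left, inner_add_right, inner_add_right, inner_smul_left, inner_smul_left,
      inner_smul_right, inner_smul_right, h1, h2, real_inner_self_eq_norm_sq, hω]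
    simp [mul_comm]
  rw [chr, chr, chr, h, ← Complex.exp_add]
  push_cast
  ring_nf

/-- The Fourier transform may be taken over the hyperplanes first. -/
lemma stFourier_waveEquiv (hω : ‖ω‖ = 1) {f : SpaceTime n → ℂ} (hfi : Integrable f)
    (η : ℝ × (ℝ ∙ ω)ᗮ) (r : ℝ) :
    stFourier f (η.1, r • ω + η.2) = ∫ s, chr s r * waveFourier ω f s η := by
  have hm : Measurable fun p : (ℝ × (ℝ ∙ ω)ᗮ) × ℝ =>
      chr p.2 r * (chr p.1.1 η.1 * chr p.1.2 η.2) := by fun_prop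
  have hi : Integrable (fun p : (ℝ × (ℝ ∙ ω)ᗮ) × ℝ => chr p.2 r * (chr p.1.1 η.1 * chr p.1.2 η.2) *
      waveSlice ω f p.2 p.1) (volume.prod volume) := by
    refine (integrable_wave ω hω hfi).bdd_mul (c := 1) hm.aestronglyMeasurable
      (ae_of_all _ fun p => ?_)
    simp [norm_chr]
  rw [stFourier, ← (measurePreserving_waveEquiv ω hω).integral_comp
    (waveEquiv ω hω).measurableEmbedding]
  calc _ = ∫ p : (ℝ × (ℝ ∙ ω)ᗮ) × ℝ, chr p.2 r * (chr p.1.1 η.1 * chr p.1.2 η.2) *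
      waveSlice ω f p.2 p.1 ∂(volume.prod volume) := by
        refine integral_congr_ae (ae_of_all _ fun p => ?_)
        simp only [waveEquiv_apply, chr_line ω hω, waveSlice]
        ring
    _ = _ := by
        rw [integral_prod_symm _ hi]
        refine integral_congr_ae (ae_of_all _ fun s => ?_)
        simp only [waveFourier]
        rw [← integral_const_mul]
        simp only [mul_assoc]

/-- The Gaussian weight on the frequencies of a hyperplane. -/
def waveWeight (ε : ℝ) (η : ℝ × (ℝ ∙ ω)ᗮ) : ℝ :=
  Real.exp (-ε * ‖η.1‖ ^ 2) * Real.exp (-ε * ‖η.2‖ ^ 2)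

lemma integrable_waveWeight {ε : ℝ} (hε : 0 < ε) :
    Integrable (waveWeight ω ε) (volume.prod volume) :=
  Integrable.mul_prod (f := fun t : ℝ => Real.exp (-ε * ‖t‖ ^ 2))
    (g := fun y : (ℝ ∙ ω)ᗮ => Real.exp (-ε * ‖y‖ ^ 2)) (integrable_gauss hε) (integrable_gauss hε)

lemma waveWeight_nonneg (ε : ℝ) (η : ℝ × (ℝ ∙ ω)ᗮ) : 0 ≤ waveWeight ω ε η := by
  unfold waveWeight; positivity

lemma measurable_waveWeight (ε : ℝ) : Measurable (waveWeight ω ε) := by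
  unfold waveWeight; fun_prop

lemma finrank_orthogonal_add_one (hω : ‖ω‖ = 1) : Module.finrank ℝ (ℝ ∙ ω)ᗮ + 1 = n := by
  have h1 := Submodule.finrank_add_finrank_orthogonal (ℝ ∙ ω)
  have h2 : Module.finrank ℝ (ℝ ∙ ω) = 1 := finrank_span_singleton (by
    intro h; rw [h] at hω; simp at hω)
  rw [h2, finrank_euclideanSpace_fin] at h1
  omega

/-- The Fourier transform of the Gaussian weight has an `L¹` norm independent of `ε`. -/
lemma lintegral_waveWeight_hat (hω : ‖ω‖ = 1) {ε : ℝ} (hε : 0 < ε) :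
    ∫⁻ q : ℝ × (ℝ ∙ ω)ᗮ, ‖∫ η : ℝ × (ℝ ∙ ω)ᗮ, (waveWeight ω ε η : ℂ) *
      (chr q.1 η.1 * chr q.2 η.2)‖ₑ = ENNReal.ofReal ((2 * Real.pi) ^ n) := by
  have h1 : ∀ q : ℝ × (ℝ ∙ ω)ᗮ, ∫ η : ℝ × (ℝ ∙ ω)ᗮ, (waveWeight ω ε η : ℂ) *
      (chr q.1 η.1 * chr q.2 η.2) = (∫ τ : ℝ, (Real.exp (-ε * ‖τ‖ ^ 2) : ℂ) * chr q.1 τ) *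
        ∫ y : (ℝ ∙ ω)ᗮ, (Real.exp (-ε * ‖y‖ ^ 2) : ℂ) * chr q.2 y := by
    intro q
    rw [← integral_prod_mul, Measure.volume_eq_prod]
    refine integral_congr_ae (ae_of_all _ fun η => ?_)
    simp only [waveWeight, ofReal_mul]
    ring
  have hm : ∀ {E : Type} [NormedAddCommGroup E] [InnerProductSpace ℝ E] [FiniteDimensional ℝ E]
      [MeasurableSpace E] [BorelSpace E], Measurable fun x : E =>
        ‖∫ y : E, (Real.exp (-ε * ‖y‖ ^ 2) : ℂ) * chr x y‖ₑ := by
    intro E _ _ _ _ _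
    have : Measurable fun p : E × E => (Real.exp (-ε * ‖p.2‖ ^ 2) : ℂ) * chr p.1 p.2 := by fun_prop
    exact (this.stronglyMeasurable.integral_prod_right (ν := volume)).measurable.enorm
  simp_rw [h1, enorm_mul]
  rw [Measure.volume_eq_prod, lintegral_prod_mul hm.aemeasurable hm.aemeasurable,
    lintegral_gauss hε, lintegral_gauss hε, ← ENNReal.ofReal_mul (by positivity)]
  congr 1
  have h2 := finrank_orthogonal_add_one ω hω
  rw [Module.finrank_self, ← Real.rpow_add (by positivity), ← Real.rpow_natCast]
  congr 1
  have h3 : ((Module.finrank ℝ (ℝ ∙ ω)ᗮ : ℕ) : ℝ) + 1 = n := by exact_mod_cast h2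
  push_cast
  linarith

/-- The Bessel inequality over a hyperplane. -/
lemma lintegral_waveFourier_sq_le (hω : ‖ω‖ = 1) {ε : ℝ} (hε : 0 < ε) {f : SpaceTime n → ℂ}
    (hf : Measurable f) {s : ℝ} (hs : Integrable (waveSlice ω f s)) :
    ∫⁻ η, ENNReal.ofReal (waveWeight ω ε η) * ‖waveFourier ω f s η‖ₑ ^ 2 ≤
      ENNReal.ofReal ((2 * Real.pi) ^ n) * eLpNorm (waveSlice ω f s) 2 volume ^ 2 := by
  have e1 : ∀ x y : ℝ × (ℝ ∙ ω)ᗮ, ∫ η : ℝ × (ℝ ∙ ω)ᗮ, (waveWeight ω ε η : ℂ) *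
      ((chr y.1 η.1 * chr y.2 η.2) * starRingEnd ℂ (chr x.1 η.1 * chr x.2 η.2)) =
      ∫ η : ℝ × (ℝ ∙ ω)ᗮ, (waveWeight ω ε η : ℂ) *
        (chr (y - x).1 η.1 * chr (y - x).2 η.2) := by
    intro x y
    refine integral_congr_ae (ae_of_all _ fun η => ?_)
    simp only [map_mul, conj_chr, Prod.fst_sub, Prod.snd_sub, chr_sub]
    ring
  have hI : (volume : Measure (ℝ × (ℝ ∙ ω)ᗮ)).IsAddLeftInvariant :=
    inferInstanceAs (((volume : Measure ℝ).prod
      (volume : Measure (ℝ ∙ ω)ᗮ)).IsAddLeftInvariant)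
  have hN : (volume : Measure (ℝ × (ℝ ∙ ω)ᗮ)).IsNegInvariant :=
    ((Measure.measurePreserving_neg (volume : Measure ℝ)).prod
      (Measure.measurePreserving_neg (volume : Measure (ℝ ∙ ω)ᗮ))).map_eq |>
        Measure.IsNegInvariant.mk
  refine lintegral_bessel_le (e := fun q η : ℝ × (ℝ ∙ ω)ᗮ => chr q.1 η.1 * chr q.2 η.2)
    ?_ (fun x ξ => ?_) (measurable_waveWeight ω ε) (waveWeight_nonneg ω ε)
    (integrable_waveWeight ω hε) (fun y => ?_) (fun x => ?_)
    ((measurable_waveSlice_uncurry ω hf).comp measurable_prodMk_left) hs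
  · have : Measurable fun p : (ℝ × (ℝ ∙ ω)ᗮ) × (ℝ × (ℝ ∙ ω)ᗮ) =>
      chr p.1.1 p.2.1 * chr p.1.2 p.2.2 := by fun_prop
    exact this
  · simp [norm_chr]
  · refine le_of_eq ((lintegral_congr fun x => congrArg enorm (e1 x y)).trans ?_)
    rw [lintegral_sub_left_eq_self (fun q : ℝ × (ℝ ∙ ω)ᗮ => ‖∫ η : ℝ × (ℝ ∙ ω)ᗮ,
      (waveWeight ω ε η : ℂ) * (chr q.1 η.1 * chr q.2 η.2)‖ₑ), lintegral_waveWeight_hat ω hω hε]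
  · refine le_of_eq ((lintegral_congr fun y => congrArg enorm (e1 x y)).trans ?_)
    rw [lintegral_sub_right_eq_self (fun q : ℝ × (ℝ ∙ ω)ᗮ => ‖∫ η : ℝ × (ℝ ∙ ω)ᗮ,
      (waveWeight ω ε η : ℂ) * (chr q.1 η.1 * chr q.2 η.2)‖ₑ), lintegral_waveWeight_hat ω hω hε]

lemma ae_add_norm_sq_ne_zero {W : Type*} [NormedAddCommGroup W] [InnerProductSpace ℝ W]
    [FiniteDimensional ℝ W] [MeasurableSpace W] [BorelSpace W] :
    ∀ᵐ η : ℝ × W, η.1 + ‖η.2‖ ^ 2 ≠ 0 := by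
  have hm : MeasurableSet {η : ℝ × W | η.1 + ‖η.2‖ ^ 2 ≠ 0} :=
    (measurableSet_eq_fun (by fun_prop) measurable_const).compl
  have hm' : MeasurableSet {p : W × ℝ | p.2 + ‖p.1‖ ^ 2 ≠ 0} :=
    (measurableSet_eq_fun (by fun_prop) measurable_const).compl
  have h : ∀ᵐ p : W × ℝ, p.2 + ‖p.1‖ ^ 2 ≠ 0 := by
    rw [Measure.volume_eq_prod, Measure.ae_prod_iff_ae_ae hm']
    refine ae_of_all _ fun y => ?_
    filter_upwards [Measure.ae_ne volume (-‖y‖ ^ 2)] with t ht h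
    exact ht (by linarith)
  have hs : MeasurePreserving (Prod.swap : ℝ × W → W × ℝ) volume volume :=
    Measure.measurePreserving_swap
  exact hs.quasiMeasurePreserving.ae h

/-- The bound of the regularised form that decays in `ν`. -/
theorem enorm_form_le_waveNorm {a : ℝ} (ha : 0 < a) (hω : ‖ω‖ = 1) {ε : ℝ} (hε : 0 < ε)
    {f g : SpaceTime n → ℂ} (hf : Measurable f) (hfi : Integrable f) (hg : Measurable g)
    (hgi : Integrable g) :
    ‖form (a • ω) ε f g‖ₑ ≤ ENNReal.ofReal ((2 * Real.pi) ^ (n + 1) / a) *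
      waveNorm ω f * waveNorm ω g := by
  have hω0 : ω ≠ 0 := by intro h; rw [h] at hω; simp at hω
  have hν : a • ω ≠ 0 := smul_ne_zero ha.ne' hω0
  have hi := (measurePreserving_waveEquiv ω hω).integrable_comp_emb
    (waveEquiv ω hω).measurableEmbedding |>.2 (integrable_formIntegrand hν hε hf hg)
  have hPf : ∀ η : ℝ × (ℝ ∙ ω)ᗮ, Measurable fun s => ‖waveFourier ω f s η‖ₑ := fun η =>
    ((measurable_waveFourier_uncurry ω hf).comp measurable_prodMk_right).enorm
  have hPg : ∀ η : ℝ × (ℝ ∙ ω)ᗮ, Measurable fun s => ‖waveFourier ω g s η‖ₑ := fun η =>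
    ((measurable_waveFourier_uncurry ω hg).comp measurable_prodMk_right).enorm
  -- the integrand in the coordinates along and orthogonal to `ω`
  have hval : ∀ η : ℝ × (ℝ ∙ ω)ᗮ, ∀ r : ℝ,
      formIntegrand (a • ω) ε f g (waveEquiv ω hω (η, r)) = (waveWeight ω ε η : ℂ) *
        ((Real.exp (-ε * ‖r‖ ^ 2) : ℂ) *
          ((-((r ^ 2 + (η.1 + ‖η.2‖ ^ 2) : ℝ) : ℂ) + 2 * a * r * I)⁻¹ *
          ((∫ s, chr s (-r) * waveFourier ω f s (-η)) *
            ∫ s, chr s r * waveFourier ω g s η))) := by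
    intro η r
    have hn : ‖(r • ω + η.2 : Space n)‖ ^ 2 = r ^ 2 + ‖η.2‖ ^ 2 := by
      have := norm_sq_lineEquiv ω hω (r, η.2)
      rwa [lineEquiv_apply] at this
    have hin : inner ℝ (a • ω) (r • ω + η.2 : Space n) = a * r := by
      have := inner_smul_lineEquiv ω hω (r, η.2)
      rw [lineEquiv_apply] at this
      rw [inner_smul_left, this]
      simp
    have hsym : symbol (a • ω) (η.1, (r • ω + η.2 : Space n)) =
        -((r ^ 2 + (η.1 + ‖η.2‖ ^ 2) : ℝ) : ℂ) + 2 * a * r * I := by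
      rw [symbol, hn, hin]
      push_cast
      ring
    have hgw : gaussWeight ε (η.1, (r • ω + η.2 : Space n)) =
        (waveWeight ω ε η : ℂ) * (Real.exp (-ε * ‖r‖ ^ 2) : ℂ) := by
      rw [gaussWeight, waveWeight, hn]
      rw [Real.norm_eq_abs r, sq_abs]
      push_cast
      rw [mul_add, Complex.exp_add]
      ring
    have hneg : -(η.1, (r • ω + η.2 : Space n)) =
        ((-η).1, ((-r) • ω + ((-η).2 : (ℝ ∙ ω)ᗮ) : Space n)) := by
      simp [add_comm]
    rw [waveEquiv_apply, formIntegrand, hsym, hgw, hneg, stFourier_waveEquiv ω hω hfi,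
      stFourier_waveEquiv ω hω hgi]
    ring
  have h1 : form (a • ω) ε f g = ∫ η : ℝ × (ℝ ∙ ω)ᗮ, ∫ r : ℝ,
      formIntegrand (a • ω) ε f g (waveEquiv ω hω (η, r)) := by
    rw [form, ← (measurePreserving_waveEquiv ω hω).integral_comp
      (waveEquiv ω hω).measurableEmbedding, Measure.volume_eq_prod (ℝ × (ℝ ∙ ω)ᗮ)]
    rw [Measure.volume_eq_prod (ℝ × (ℝ ∙ ω)ᗮ)] at hi
    exact integral_prod _ hi
  set c : ℝ≥0∞ := ENNReal.ofReal (2 * Real.pi / a) with hc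
  -- the one-dimensional bound in the frequency along `ω`
  have h2 : ‖form (a • ω) ε f g‖ₑ ≤ ∫⁻ η : ℝ × (ℝ ∙ ω)ᗮ, ENNReal.ofReal (waveWeight ω ε η) *
      (c * ((∫⁻ s, ‖waveFourier ω f s (-η)‖ₑ) * ∫⁻ s, ‖waveFourier ω g s η‖ₑ)) := by
    rw [h1]
    refine (enorm_integral_le_lintegral_enorm _).trans (lintegral_mono_ae ?_)
    filter_upwards [ae_add_norm_sq_ne_zero (W := (ℝ ∙ ω)ᗮ)] with η hη
    simp_rw [hval]
    rw [integral_const_mul, enorm_mul]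
    have e1 : ‖(waveWeight ω ε η : ℂ)‖ₑ = ENNReal.ofReal (waveWeight ω ε η) := by
      rw [← ofReal_norm, norm_real, Real.norm_of_nonneg (waveWeight_nonneg ω ε η)]
    rw [e1]
    refine mul_le_mul_right ?_ _
    have hA := integrable_waveFourier ω hω hf hfi (-η)
    have hB := integrable_waveFourier ω hω hg hgi η
    have := ENNReal.ofReal_le_ofReal (norm_integral_gauss_quadratic_le hε ha hη hA hB)
    rw [ofReal_norm, ENNReal.ofReal_mul (by positivity), ENNReal.ofReal_mul (by positivity),
      ofReal_integral_norm_eq_lintegral_enorm hA,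
      ofReal_integral_norm_eq_lintegral_enorm hB] at this
    exact this
  set G : ℝ≥0∞ := ENNReal.ofReal ((2 * Real.pi) ^ n) with hG
  have hwm : Measurable fun η => ENNReal.ofReal (waveWeight ω ε η) :=
    (measurable_waveWeight ω ε).ennreal_ofReal
  have hslice : ∀ {f : SpaceTime n → ℂ}, Integrable f → ∀ᵐ s : ℝ, Integrable (waveSlice ω f s) :=
    fun hf => (integrable_wave ω hω hf).prod_left_ae
  have hms : ∀ {f : SpaceTime n → ℂ}, Measurable f →
      Measurable fun s => eLpNorm (waveSlice ω f s) 2 volume := by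
    intro f hf
    have := measurable_eLpNorm_prod (μ := (volume : Measure (ℝ × (ℝ ∙ ω)ᗮ)))
      (measurable_waveSlice_uncurry ω hf).enorm 2
    simpa only [eLpNorm_enorm] using this
  -- Cauchy–Schwarz in the frequencies of the hyperplanes, and the Bessel inequality for each factor
  have h3 : ∀ᵐ p : ℝ × ℝ, ∫⁻ η : ℝ × (ℝ ∙ ω)ᗮ, ENNReal.ofReal (waveWeight ω ε η) *
      (‖waveFourier ω f p.1 (-η)‖ₑ * ‖waveFourier ω g p.2 η‖ₑ) ≤
      G * (eLpNorm (waveSlice ω f p.1) 2 volume * eLpNorm (waveSlice ω g p.2) 2 volume) := by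
    filter_upwards [ae_pair_of_ae (hslice hfi) (hslice hgi)] with p ⟨hp1, hp2⟩
    have m1 : Measurable fun η => ‖waveFourier ω f p.1 η‖ₑ :=
      ((measurable_waveFourier_uncurry ω hf).comp measurable_prodMk_left).enorm
    have m2 : Measurable fun η => ‖waveFourier ω g p.2 η‖ₑ :=
      ((measurable_waveFourier_uncurry ω hg).comp measurable_prodMk_left).enorm
    have hneg : ∀ u : ℝ × (ℝ ∙ ω)ᗮ → ℝ≥0∞, Measurable u → ∫⁻ η, u (-η) = ∫⁻ η, u η := fun u hu =>
      MeasurePreserving.lintegral_comp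
        ((Measure.measurePreserving_neg (volume : Measure ℝ)).prod
          (Measure.measurePreserving_neg (volume : Measure (ℝ ∙ ω)ᗮ))) hu
    have b1 : ∫⁻ η, ENNReal.ofReal (waveWeight ω ε η) * ‖waveFourier ω f p.1 (-η)‖ₑ ^ 2 ≤
        G * eLpNorm (waveSlice ω f p.1) 2 volume ^ 2 := by
      refine le_trans (le_of_eq ?_) (lintegral_waveFourier_sq_le ω hω hε hf hp1)
      have h4 := hneg (fun η => ENNReal.ofReal (waveWeight ω ε η) * ‖waveFourier ω f p.1 η‖ₑ ^ 2)
        (hwm.mul (m1.pow_const _))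
      rw [← h4]
      refine lintegral_congr fun η => ?_
      simp [waveWeight]
    refine (lintegral_weight_mul_le hwm (m1.comp measurable_neg) m2).trans ?_
    calc _ ≤ (G * eLpNorm (waveSlice ω f p.1) 2 volume ^ 2) ^ (1 / 2 : ℝ) *
          (G * eLpNorm (waveSlice ω g p.2) 2 volume ^ 2) ^ (1 / 2 : ℝ) := by
          gcongr
          · exact b1
          · exact lintegral_waveFourier_sq_le ω hω hε hg hp2
      _ = _ := by
          rw [ENNReal.mul_rpow_of_nonneg _ _ (by norm_num),
            ENNReal.mul_rpow_of_nonneg _ _ (by norm_num)]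
          have h2 : G = G ^ (1 / 2 : ℝ) * G ^ (1 / 2 : ℝ) := by
            rw [← ENNReal.rpow_add_of_nonneg _ _ (by norm_num) (by norm_num)]; norm_num
          have h3 : ∀ a : ℝ≥0∞, (a ^ 2) ^ (1 / 2 : ℝ) = a := fun a => by
            rw [← ENNReal.rpow_natCast, ← ENNReal.rpow_mul]; norm_num
          rw [h3, h3]
          nth_rewrite 3 [h2]
          ring
  refine h2.trans ?_
  have hmF : Measurable fun x : (ℝ × (ℝ ∙ ω)ᗮ) × (ℝ × ℝ) => ‖waveFourier ω f x.2.1 (-x.1)‖ₑ :=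
    ((measurable_waveFourier_uncurry ω hf).comp (by fun_prop :
      Measurable fun x : (ℝ × (ℝ ∙ ω)ᗮ) × (ℝ × ℝ) => (x.2.1, -x.1))).enorm
  have hmG : Measurable fun x : (ℝ × (ℝ ∙ ω)ᗮ) × (ℝ × ℝ) => ‖waveFourier ω g x.2.2 x.1‖ₑ :=
    ((measurable_waveFourier_uncurry ω hg).comp (by fun_prop :
      Measurable fun x : (ℝ × (ℝ ∙ ω)ᗮ) × (ℝ × ℝ) => (x.2.2, x.1))).enorm
  calc _ = ∫⁻ η : ℝ × (ℝ ∙ ω)ᗮ, ∫⁻ p : ℝ × ℝ, c * (ENNReal.ofReal (waveWeight ω ε η) *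
        (‖waveFourier ω f p.1 (-η)‖ₑ * ‖waveFourier ω g p.2 η‖ₑ)) := by
        refine lintegral_congr fun η => ?_
        have hm12 : Measurable fun p : ℝ × ℝ =>
            ‖waveFourier ω f p.1 (-η)‖ₑ * ‖waveFourier ω g p.2 η‖ₑ :=
          ((hPf (-η)).comp measurable_fst).mul ((hPg η).comp measurable_snd)
        rw [lintegral_const_mul' _ _ ENNReal.ofReal_ne_top,
          lintegral_const_mul' _ _ ENNReal.ofReal_ne_top, Measure.volume_eq_prod,
          lintegral_prod_mul (hPf (-η)).aemeasurable (hPg η).aemeasurable]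
        ring
    _ = ∫⁻ p : ℝ × ℝ, ∫⁻ η : ℝ × (ℝ ∙ ω)ᗮ, c * (ENNReal.ofReal (waveWeight ω ε η) *
        (‖waveFourier ω f p.1 (-η)‖ₑ * ‖waveFourier ω g p.2 η‖ₑ)) := by
        refine lintegral_lintegral_swap (Measurable.aemeasurable ?_)
        exact ((hwm.comp measurable_fst).mul (hmF.mul hmG)).const_mul c
    _ ≤ ∫⁻ p : ℝ × ℝ, c * (G * (eLpNorm (waveSlice ω f p.1) 2 volume *
        eLpNorm (waveSlice ω g p.2) 2 volume)) := by
        refine lintegral_mono_ae ?_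
        filter_upwards [h3] with p hp
        rw [lintegral_const_mul' _ _ ENNReal.ofReal_ne_top]
        exact mul_le_mul_right hp _
    _ = _ := by
        rw [lintegral_const_mul' _ _ ENNReal.ofReal_ne_top,
          lintegral_const_mul' _ _ ENNReal.ofReal_ne_top, Measure.volume_eq_prod,
          lintegral_prod_mul (hms hf).aemeasurable (hms hg).aemeasurable]
        have hcG : c * G = ENNReal.ofReal ((2 * Real.pi) ^ (n + 1) / a) := by
          rw [hc, hG, ← ENNReal.ofReal_mul (by positivity)]
          congr 1
          ring
        rw [← hcG, waveNorm, waveNorm]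
        ring

end Hyperplane

/-! ### The multiplier on Schwartz functions as a limit of regularised forms -/

section MultiplierForm

open Complex

variable {n : ℕ}

instance isAddHaarMeasure_volume_spaceTime :
    (volume : Measure (SpaceTime n)).IsAddHaarMeasure :=
  inferInstanceAs ((volume : Measure ℝ).prod (volume : Measure (Space n))).IsAddHaarMeasure

/-- The pairing `tτ + x·ξ` on `ℝ × ℝⁿ`. -/
def stPairing (n : ℕ) : SpaceTime n →L[ℝ] SpaceTime n →L[ℝ] ℝ :=
  (innerSL ℝ : ℝ →L[ℝ] ℝ →L[ℝ] ℝ).bilinearComp (ContinuousLinearMap.fst ℝ ℝ (Space n))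
    (ContinuousLinearMap.fst ℝ ℝ (Space n)) +
  (innerSL ℝ : Space n →L[ℝ] Space n →L[ℝ] ℝ).bilinearComp (ContinuousLinearMap.snd ℝ ℝ (Space n))
    (ContinuousLinearMap.snd ℝ ℝ (Space n))

lemma stPairing_apply (v w : SpaceTime n) :
    stPairing n v w = v.1 * w.1 + inner ℝ v.2 w.2 := by
  simp [stPairing, mul_comm]

lemma stFourier_eq_fourierIntegral (f : SpaceTime n → ℂ) (ζ : SpaceTime n) :
    stFourier f ζ = VectorFourier.fourierIntegral Real.fourierChar volume
      (stPairing n).toLinearMap₁₂ f (-(2 * Real.pi)⁻¹ • ζ) := by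
  rw [VectorFourier.fourierIntegral, stFourier]
  refine integral_congr_ae (ae_of_all _ fun v => ?_)
  have h : (stPairing n).toLinearMap₁₂ v (-(2 * Real.pi)⁻¹ • ζ) =
      -(2 * Real.pi)⁻¹ * (v.1 * ζ.1 + inner ℝ v.2 ζ.2) := by
    change stPairing n v _ = _
    rw [map_smul, stPairing_apply, smul_eq_mul]
  simp only [h]
  rw [Circle.smul_def, Real.fourierChar_apply, smul_eq_mul, chr, chr, ← Complex.exp_add]
  congr 2
  have hpi : (Real.pi : ℂ) ≠ 0 := by exact_mod_cast Real.pi_ne_zero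
  simp only [RCLike.inner_apply, conj_trivial]
  push_cast
  field_simp

/-- Rapid decay of the Fourier transform of a Schwartz function. -/
lemma exists_norm_stFourier_le (f : 𝓢(SpaceTime n, ℂ)) :
    ∃ c : ℝ, 0 ≤ c ∧ ∀ ζ, ‖stFourier f ζ‖ ≤ c * decayWeight n ζ := by
  set m := 2 * (n + 2) with hm
  have key : ∀ N : ℕ, ∃ c : ℝ, 0 ≤ c ∧ ∀ v ζ : SpaceTime n, ‖v‖ ≤ 1 →
      |v.1 * ζ.1 + inner ℝ v.2 ζ.2| ^ N * ‖stFourier f ζ‖ ≤ c := by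
    intro N
    refine ⟨(2 * Real.pi) ^ N * (2 ^ N * ∑ p ∈ Finset.range (0 + 1) ×ˢ Finset.range (N + 1),
      ∫ v, ‖v‖ ^ p.1 * ‖iteratedFDeriv ℝ p.2 f v‖),
      mul_nonneg (by positivity) (mul_nonneg (by positivity) (Finset.sum_nonneg fun _ _ =>
        integral_nonneg fun _ => by positivity)), fun v ζ hv => ?_⟩
    have h := VectorFourier.pow_mul_norm_iteratedFDeriv_fourierIntegral_le (stPairing n)
      (μ := volume) (K := 0) (N := N) (f := f) (f.smooth _)
      (fun k l _ _ => f.integrable_pow_mul_iteratedFDeriv volume k l) (k := 0) (n := N) le_rfl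
      le_rfl
      v (-(2 * Real.pi)⁻¹ • ζ)
    rw [norm_iteratedFDeriv_zero, ← stFourier_eq_fourierIntegral, map_smul, stPairing_apply,
      smul_eq_mul, abs_mul, abs_neg, abs_of_pos (by positivity : 0 < (2 * Real.pi)⁻¹), mul_pow] at h
    simp only [pow_zero, mul_one, Nat.cast_zero, mul_zero, zero_add, Finset.range_one] at h ⊢
    have h2 : ‖v‖ ^ N ≤ 1 := pow_le_one₀ (norm_nonneg _) hv
    set S₀ := ∑ p ∈ ({0} : Finset ℕ) ×ˢ Finset.range (N + 1),
      ∫ v, ‖v‖ ^ p.1 * ‖iteratedFDeriv ℝ p.2 f v‖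
    have hS : 0 ≤ S₀ := Finset.sum_nonneg fun _ _ => integral_nonneg fun _ => by positivity
    calc _ = (2 * Real.pi) ^ N * ((2 * Real.pi)⁻¹ ^ N * |v.1 * ζ.1 + inner ℝ v.2 ζ.2| ^ N *
          ‖stFourier f ζ‖) := by
            rw [← mul_assoc, ← mul_assoc, ← mul_pow, mul_inv_cancel₀ (by positivity), one_pow,
              one_mul]
      _ ≤ (2 * Real.pi) ^ N * (‖v‖ ^ N * 2 ^ N * S₀) := by gcongr
      _ ≤ (2 * Real.pi) ^ N * (1 * 2 ^ N * S₀) := by gcongr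
      _ = _ := by ring
  obtain ⟨c₀, hc₀, h₀⟩ := key 0
  obtain ⟨c₁, hc₁, h₁⟩ := key m
  refine ⟨2 ^ (n + 2) * (2 * (c₀ + c₁)), by positivity, fun ζ => ?_⟩
  have g₀ := h₀ 0 ζ (by simp)
  -- The directions `(1, 0)` and `(0, ξ / |ξ|)` give decay in `τ` and in `ξ`; for `ξ = 0` the second
  -- one is `0`.
  have g₁ := h₁ (1, 0) ζ (by simp [Prod.norm_def])
  have g₂ := h₁ (0, ‖ζ.2‖⁻¹ • ζ.2) ζ (by
    rw [Prod.norm_def, max_le_iff]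
    refine ⟨by simp, ?_⟩
    simp only [norm_smul, norm_inv, norm_norm]
    exact inv_mul_le_one)
  have e₂ : inner ℝ (‖ζ.2‖⁻¹ • ζ.2) ζ.2 = ‖ζ.2‖ := by
    rw [real_inner_smul_left, real_inner_self_eq_norm_sq]
    rcases eq_or_ne ‖ζ.2‖ 0 with h | h
    · simp [h]
    · field_simp
  simp only [pow_zero, one_mul, inner_zero_left, add_zero, zero_mul, zero_add, e₂, abs_norm]
    at g₀ g₁ g₂
  have hsum : ∀ x : ℝ, (1 + x ^ 2) ^ (n + 2) ≤ 2 ^ (n + 2) * (1 + |x| ^ m) := by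
    intro x
    have h := add_pow_le (zero_le_one (α := ℝ)) (sq_nonneg x) (n + 2)
    refine h.trans ?_
    rw [one_pow, ← sq_abs x, ← pow_mul, ← hm]
    gcongr
    · norm_num
    · omega
  set A := 1 + ζ.1 ^ 2 with hA
  set B := 1 + ‖ζ.2‖ ^ 2 with hB
  have hA1 : 1 ≤ A := by rw [hA]; nlinarith [sq_nonneg ζ.1]
  have hB1 : 1 ≤ B := by rw [hB]; nlinarith [sq_nonneg ‖ζ.2‖]
  have hAB : A * B ^ (n + 1) ≤ A ^ (n + 2) + B ^ (n + 2) := by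
    rcases le_total A B with h | h
    · calc _ ≤ B * B ^ (n + 1) := by gcongr
        _ = B ^ (n + 2) := by ring
        _ ≤ _ := le_add_of_nonneg_left (by positivity)
    · calc _ ≤ A * A ^ (n + 1) := by gcongr
        _ = A ^ (n + 2) := by ring
        _ ≤ _ := le_add_of_nonneg_right (by positivity)
  have hs1 := hsum ζ.1
  have hs2 := hsum ‖ζ.2‖
  rw [abs_norm] at hs2
  rw [decayWeight, ← hA, ← hB, ← mul_inv, ← div_eq_mul_inv, le_div_iff₀ (by positivity)]
  calc ‖stFourier f ζ‖ * (A * B ^ (n + 1)) ≤ ‖stFourier f ζ‖ *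
        (2 ^ (n + 2) * (1 + |ζ.1| ^ m) + 2 ^ (n + 2) * (1 + ‖ζ.2‖ ^ m)) := by
          gcongr
          exact hAB.trans (add_le_add hs1 hs2)
    _ = 2 ^ (n + 2) * (‖stFourier f ζ‖ + |ζ.1| ^ m * ‖stFourier f ζ‖ +
        (‖stFourier f ζ‖ + ‖ζ.2‖ ^ m * ‖stFourier f ζ‖)) := by ring
    _ ≤ 2 ^ (n + 2) * (c₀ + c₁ + (c₀ + c₁)) := by gcongr
    _ = _ := by ring

/-- The Fourier side of `S_ν f`, up to the factor `(2π)^{-(n+1)}`. -/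
def multiplied (ν : Space n) (f : 𝓢(SpaceTime n, ℂ)) (ζ : SpaceTime n) : ℂ :=
  (symbol ν ζ)⁻¹ * stFourier f (-ζ)

lemma fourier_eq (f : SpaceTime n → ℂ) (ζ : SpaceTime n) :
    fourier f ζ = (((2 * Real.pi) ^ (-((n : ℝ) + 1) / 2) : ℝ) : ℂ) * stFourier f (-ζ) := by
  rw [fourier, stFourier]
  congr 1
  refine integral_congr_ae (ae_of_all _ fun z => ?_)
  simp only [chr, ← Complex.exp_add]
  congr 2
  simp only [RCLike.inner_apply, conj_trivial, Prod.fst_neg, Prod.snd_neg, inner_neg_right]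
  push_cast
  ring

/-- Both normalising factors of the Fourier transform are collected. -/
lemma schwartzS_eq (ν : Space n) (f : 𝓢(SpaceTime n, ℂ)) (z : SpaceTime n) :
    schwartzS ν f z = (((2 * Real.pi) ^ (-((n : ℝ) + 1)) : ℝ) : ℂ) *
      stFourier (multiplied ν f) z := by
  have h2 : (((2 * Real.pi) ^ (-((n : ℝ) + 1)) : ℝ) : ℂ) =
      (((2 * Real.pi) ^ (-((n : ℝ) + 1) / 2) : ℝ) : ℂ) *
        (((2 * Real.pi) ^ (-((n : ℝ) + 1) / 2) : ℝ) : ℂ) := by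
    rw [← ofReal_mul, ← Real.rpow_add (by positivity)]
    congr 2
    ring
  rw [schwartzS, h2, mul_assoc]
  congr 1
  rw [stFourier, ← integral_const_mul]
  refine integral_congr_ae (ae_of_all _ fun ζ => ?_)
  simp only [fourier_eq, multiplied, chr]
  rw [real_inner_comm ζ.2 z.2, ← Complex.exp_add]
  have : Complex.exp (Complex.I * ((z.1 * ζ.1 + inner ℝ ζ.2 z.2 : ℝ) : ℂ)) =
      Complex.exp ((inner ℝ ζ.1 z.1 : ℝ) * I + (inner ℝ ζ.2 z.2 : ℝ) * I) := by
    congr 1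
    simp only [RCLike.inner_apply, conj_trivial]
    push_cast
    ring
  rw [this]
  ring

lemma measurable_multiplied (ν : Space n) (f : 𝓢(SpaceTime n, ℂ)) :
    Measurable (multiplied ν f) := by
  have h := measurable_stFourier (f := f) f.continuous.measurable
  unfold multiplied
  fun_prop

lemma decayWeight_neg (ζ : SpaceTime n) : decayWeight n (-ζ) = decayWeight n ζ := by
  simp [decayWeight]

lemma integrable_multiplied {ν : Space n} (hν : ν ≠ 0) (f : 𝓢(SpaceTime n, ℂ)) :
    Integrable (multiplied ν f) := by
  obtain ⟨c, -, hc⟩ := exists_norm_stFourier_le f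
  have h := measurable_stFourier (f := f) f.continuous.measurable
  refine integrable_symbol_inv_mul hν (by fun_prop) (c := c) fun ζ => ?_
  rw [← decayWeight_neg]
  exact hc _

lemma measurable_schwartzS (ν : Space n) (f : 𝓢(SpaceTime n, ℂ)) :
    Measurable (schwartzS ν f) := by
  have h := measurable_stFourier (measurable_multiplied ν f)
  have e : schwartzS ν f = fun z => _ := funext (schwartzS_eq ν f)
  rw [e]
  fun_prop

lemma exists_norm_schwartzS_le (ν : Space n) (f : 𝓢(SpaceTime n, ℂ)) :
    ∃ M : ℝ, ∀ z, ‖schwartzS ν f z‖ ≤ M := by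
  refine ⟨‖(((2 * Real.pi) ^ (-((n : ℝ) + 1)) : ℝ) : ℂ)‖ * ∫ ζ, ‖multiplied ν f ζ‖, fun z => ?_⟩
  rw [schwartzS_eq, norm_mul]
  gcongr
  exact norm_stFourier_le _ _

/-- The multiplication formula for the Fourier transform. -/
lemma integral_stFourier_mul {h g : SpaceTime n → ℂ} (hh : Integrable h) (hg : Integrable g) :
    ∫ z, stFourier h z * g z = ∫ ζ, h ζ * stFourier g ζ := by
  have h1 : ∀ z, stFourier h z * g z =
      ∫ ζ : SpaceTime n, chr ζ.1 z.1 * chr ζ.2 z.2 * (h ζ * g z) := by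
    intro z
    rw [stFourier, ← integral_mul_const]
    refine integral_congr_ae (ae_of_all _ fun ζ => ?_)
    simp only
    ring
  have h2 : ∀ ζ, h ζ * stFourier g ζ =
      ∫ z : SpaceTime n, chr ζ.1 z.1 * chr ζ.2 z.2 * (h ζ * g z) := by
    intro z
    rw [stFourier, ← integral_const_mul]
    refine integral_congr_ae (ae_of_all _ fun ζ => ?_)
    simp only [chr]
    rw [real_inner_comm z.2, real_inner_comm z.1]
    ring
  simp_rw [h1, h2]
  rw [integral_integral_swap]
  have hp : Integrable (fun p : SpaceTime n × SpaceTime n => h p.2 * g p.1)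
      (volume.prod volume) := by
    have := (Integrable.mul_prod (f := g) (g := h) (μ := volume) (ν := volume) hg hh)
    refine this.congr (ae_of_all _ fun p => mul_comm _ _)
  refine hp.bdd_mul (c := 1) (Measurable.aestronglyMeasurable (by fun_prop))
    (ae_of_all _ fun p => ?_)
  simp [norm_chr]

lemma norm_gaussWeight_le {ε : ℝ} (hε : 0 ≤ ε) (ζ : SpaceTime n) : ‖gaussWeight ε ζ‖ ≤ 1 := by
  rw [gaussWeight, norm_mul, norm_real, norm_real, Real.norm_of_nonneg (Real.exp_pos _).le,
    Real.norm_of_nonneg (Real.exp_pos _).le, ← Real.exp_add]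
  refine Real.exp_le_one_iff.2 ?_
  nlinarith [mul_nonneg hε (sq_nonneg ‖ζ.1‖), mul_nonneg hε (sq_nonneg ‖ζ.2‖)]

/-- The cut-off is removed by dominated convergence. -/
lemma tendsto_form {ν : Space n} (hν : ν ≠ 0) (f : 𝓢(SpaceTime n, ℂ)) {g : SpaceTime n → ℂ}
    (hg : Measurable g) :
    Tendsto (fun ε => form ν ε f g) (𝓝[>] 0) (𝓝 (∫ ζ, multiplied ν f ζ * stFourier g ζ)) := by
  have hF := measurable_stFourier (f := f) f.continuous.measurable
  have hG := measurable_stFourier hg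
  have hM := measurable_multiplied ν f
  refine tendsto_integral_filter_of_dominated_convergence
    (fun ζ => ‖multiplied ν f ζ‖ * ∫ z, ‖g z‖) ?_ ?_ ((integrable_multiplied hν f).norm.mul_const _)
    (ae_of_all _ fun ζ => ?_)
  · refine Eventually.of_forall fun ε => Measurable.aestronglyMeasurable ?_
    unfold formIntegrand
    fun_prop
  · filter_upwards [self_mem_nhdsWithin] with ε hε
    refine ae_of_all _ fun ζ => ?_
    rw [formIntegrand, ← mul_assoc (symbol ν ζ)⁻¹, norm_mul, norm_mul]
    calc _ ≤ 1 * (‖multiplied ν f ζ‖ * ∫ z, ‖g z‖) := by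
          gcongr
          · exact norm_gaussWeight_le (le_of_lt hε) ζ
          · exact le_rfl
          · exact norm_stFourier_le _ _
      _ = _ := one_mul _
  · have : Continuous fun ε : ℝ => formIntegrand ν ε f g ζ := by
      unfold formIntegrand gaussWeight
      fun_prop
    have h0 := this.tendsto 0
    have e : formIntegrand ν 0 f g ζ = multiplied ν f ζ * stFourier g ζ := by
      simp [formIntegrand, gaussWeight, multiplied, mul_assoc]
    rw [e] at h0
    exact h0.mono_left nhdsWithin_le_nhds

/-- Bounds of the regularised forms pass to the bilinear form of `S_ν`. -/
lemma enorm_integral_schwartzS_mul_le {ν : Space n} (hν : ν ≠ 0) (f : 𝓢(SpaceTime n, ℂ))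
    {g : SpaceTime n → ℂ} (hg : Measurable g) (hgi : Integrable g) {K : ℝ≥0∞}
    (hK : ∀ ε : ℝ, 0 < ε → ‖form ν ε f g‖ₑ ≤ K) :
    ‖∫ z, schwartzS ν f z * g z‖ₑ ≤ K := by
  have h1 : ‖∫ ζ, multiplied ν f ζ * stFourier g ζ‖ₑ ≤ K := by
    refine le_of_tendsto (tendsto_form hν f hg).enorm ?_
    filter_upwards [self_mem_nhdsWithin] with ε hε using hK ε hε
  simp_rw [schwartzS_eq, mul_assoc]
  rw [integral_const_mul, integral_stFourier_mul (integrable_multiplied hν f) hgi, enorm_mul]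
  have h2 : ‖(((2 * Real.pi) ^ (-((n : ℝ) + 1)) : ℝ) : ℂ)‖ₑ ≤ 1 := by
    rw [← ofReal_norm, norm_real, Real.norm_of_nonneg (by positivity)]
    refine ENNReal.ofReal_le_one.2 (Real.rpow_le_one_of_one_le_of_nonpos ?_ ?_)
    · nlinarith [Real.pi_gt_three]
    · have : (0 : ℝ) ≤ n := n.cast_nonneg
      linarith
  calc _ ≤ 1 * K := mul_le_mul' h2 h1
    _ = K := one_mul K

lemma Nice.schwartz (f : 𝓢(SpaceTime n, ℂ)) : Nice volume (f : SpaceTime n → ℂ) where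
  meas := f.continuous.measurable
  int := f.integrable
  bdd := by
    obtain ⟨C, -, hC⟩ := f.decay 0 0
    exact ⟨C, fun x => by simpa using hC x⟩

end MultiplierForm

variable {n : ℕ}

/-! ### Analysis in mixed norms -/

section Scalar

variable {α : Type*} [MeasurableSpace α] {μ : Measure α}

/-- Hölder's inequality for functions with values in `[0, ∞]`. -/
lemma eLpNorm_mul_le_of_holderTriple {p q r : ℝ≥0∞} [hpqr : ENNReal.HolderTriple p q r]
    {φ ψ : α → ℝ≥0∞} (hφ : Measurable φ) (hψ : Measurable ψ) :
    eLpNorm (fun x => φ x * ψ x) r μ ≤ eLpNorm φ p μ * eLpNorm ψ q μ := by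
  have htop : ∀ {s : ℝ≥0∞} {φ ψ : α → ℝ≥0∞}, Measurable φ → Measurable ψ →
      eLpNorm (fun x => φ x * ψ x) s μ ≤ eLpNorm φ ∞ μ * eLpNorm ψ s μ := by
    intro s φ ψ hφ hψ
    rcases eq_or_ne s 0 with rfl | hs0
    · simp
    rcases eq_or_ne s ∞ with rfl | hst
    · simp only [eLpNorm_exponent_top, eLpNormEssSup, enorm_eq_self]
      exact ENNReal.essSup_mul_le φ ψ
    have hs : 0 < s.toReal := ENNReal.toReal_pos hs0 hst
    rw [eLpNorm_eq_lintegral_rpow_enorm_toReal hs0 hst,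
      eLpNorm_eq_lintegral_rpow_enorm_toReal hs0 hst, one_div, ENNReal.rpow_inv_le_iff hs,
      ENNReal.mul_rpow_of_nonneg _ _ hs.le, ENNReal.rpow_inv_rpow hs.ne']
    simp only [enorm_eq_self]
    rw [← lintegral_const_mul _ (by fun_prop)]
    refine lintegral_mono_ae ?_
    filter_upwards [ENNReal.ae_le_essSup (μ := μ) φ] with x hx
    rw [ENNReal.mul_rpow_of_nonneg _ _ hs.le]
    gcongr
    simpa [eLpNorm_exponent_top, eLpNormEssSup] using hx
  have hpqr' := hpqr.one_div_eq
  obtain (rfl | rfl | hp) := ENNReal.trichotomy p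
  · simp_all
  · have : r = q := by simpa using hpqr'
    exact this ▸ htop hφ hψ
  obtain (rfl | rfl | hq) := ENNReal.trichotomy q
  · simp_all
  · have : r = p := by simpa using hpqr'
    subst this
    simp_rw [mul_comm (φ _), mul_comm (eLpNorm φ _ _)]
    exact htop hψ hφ
  obtain ⟨hp₁, hp₂⟩ := ENNReal.toReal_pos_iff.mp hp
  obtain ⟨hq₁, hq₂⟩ := ENNReal.toReal_pos_iff.mp hq
  have h := (ENNReal.HolderTriple.toReal r hp hq)
  have hr := h.pos'
  obtain ⟨hr₁, hr₂⟩ := ENNReal.toReal_pos_iff.mp hr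
  rw [eLpNorm_eq_lintegral_rpow_enorm_toReal hr₁.ne' hr₂.ne,
    eLpNorm_eq_lintegral_rpow_enorm_toReal hp₁.ne' hp₂.ne,
    eLpNorm_eq_lintegral_rpow_enorm_toReal hq₁.ne' hq₂.ne]
  simp only [enorm_eq_self]
  have hinv := h.inv_add_inv_eq_inv
  refine ENNReal.lintegral_Lp_mul_le_Lq_mul_Lr hr ?_ ?_ μ hφ.aemeasurable hψ.aemeasurable
  · refine lt_of_one_div_lt_one_div hp ?_
    simp only [one_div]
    rw [← hinv]
    exact lt_add_of_pos_right _ (inv_pos.2 hq)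
  · simp only [one_div]
    exact hinv.symm

lemma eLpNorm_liminf_le {p : ℝ≥0∞} {φ : ℕ → α → ℝ≥0∞} (hφ : ∀ k, Measurable (φ k)) :
    eLpNorm (fun x => liminf (fun k => φ k x) atTop) p μ ≤
      liminf (fun k => eLpNorm (φ k) p μ) atTop := by
  rcases eq_or_ne p 0 with rfl | h0
  · simp
  rcases eq_or_ne p ∞ with rfl | ht
  · simp only [eLpNorm_exponent_top, eLpNormEssSup, enorm_eq_self]
    exact ENNReal.essSup_liminf_le _
  have hp : 0 < p.toReal := ENNReal.toReal_pos h0 ht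
  have hl : ∀ u : ℕ → ℝ≥0∞, (liminf u atTop) ^ p.toReal =
      liminf (fun k => u k ^ p.toReal) atTop := by
    intro u
    refine ((ENNReal.strictMono_rpow_of_pos hp).orderIsoOfSurjective _
      (ENNReal.rpow_left_bijective hp.ne').2).liminf_apply ?_ ?_ ?_ ?_
    all_goals isBoundedDefault
  simp_rw [eLpNorm_eq_lintegral_rpow_enorm_toReal h0 ht, enorm_eq_self]
  rw [one_div, ENNReal.rpow_inv_le_iff hp, hl]
  simp_rw [hl, ENNReal.rpow_inv_rpow hp.ne']
  exact lintegral_liminf_le fun k => (hφ k).pow_const _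

lemma tendsto_eLpNorm_zero_of_dominated {p : ℝ≥0∞} (hp : p ≠ ∞) {φ : ℕ → α → ℝ≥0∞}
    (hφ : ∀ k, AEMeasurable (φ k) μ) {Φ : α → ℝ≥0∞} (hΦ : eLpNorm Φ p μ ≠ ∞)
    (hle : ∀ k, ∀ᵐ x ∂μ, φ k x ≤ Φ x) (hlim : ∀ᵐ x ∂μ, Tendsto (fun k => φ k x) atTop (𝓝 0)) :
    Tendsto (fun k => eLpNorm (φ k) p μ) atTop (𝓝 0) := by
  rcases eq_or_ne p 0 with rfl | h0
  · simp
  have hp' : 0 < p.toReal := ENNReal.toReal_pos h0 hp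
  have hfin : ∫⁻ x, Φ x ^ p.toReal ∂μ ≠ ∞ := by
    intro h
    rw [eLpNorm_eq_lintegral_rpow_enorm_toReal h0 hp] at hΦ
    simp only [enorm_eq_self, h] at hΦ
    rw [ENNReal.top_rpow_of_pos (by positivity)] at hΦ
    exact hΦ rfl
  have h := tendsto_lintegral_of_dominated_convergence' (μ := μ) (F := fun k x => φ k x ^ p.toReal)
    (f := fun _ => 0) (fun x => Φ x ^ p.toReal) (fun k => (hφ k).pow_const _)
    (fun k => by filter_upwards [hle k] with x hx; gcongr) hfin ?_
  · simp_rw [eLpNorm_eq_lintegral_rpow_enorm_toReal h0 hp, enorm_eq_self]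
    have h2 := (ENNReal.continuous_rpow_const (y := 1 / p.toReal)).tendsto _ |>.comp h
    simpa [ENNReal.zero_rpow_of_pos, hp', Function.comp_def] using h2
  · filter_upwards [hlim] with x hx
    have h2 := (ENNReal.continuous_rpow_const (y := p.toReal)).tendsto _ |>.comp hx
    simpa [ENNReal.zero_rpow_of_pos, hp', Function.comp_def] using h2

end Scalar

/-- The mixed norm of a function with values in `[0, ∞]`. -/
def mixedE (q r : ℝ≥0∞) (φ : SpaceTime n → ℝ≥0∞) : ℝ≥0∞ :=
  eLpNorm (fun t : ℝ => eLpNorm (fun x : Space n => φ (t, x)) r volume) q volume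

section MixedE

variable {q r : ℝ≥0∞} {φ ψ : SpaceTime n → ℝ≥0∞}

lemma mixedNorm_eq_mixedE {F : Type*} [NormedAddCommGroup F] (f : SpaceTime n → F) :
    mixedNorm q r f = mixedE q r fun z => ‖f z‖ₑ := by
  simp only [mixedNorm, mixedE, eLpNorm_enorm]

lemma measurable_slice_norm (hφ : Measurable φ) (r : ℝ≥0∞) :
    Measurable fun t => eLpNorm (fun x : Space n => φ (t, x)) r volume :=
  measurable_eLpNorm_prod hφ r

lemma mixedE_mono_ae (h : ∀ᵐ z : SpaceTime n, φ z ≤ ψ z) : mixedE q r φ ≤ mixedE q r ψ := by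
  refine eLpNorm_mono_enorm_ae ?_
  filter_upwards [ae_slice_of_ae h] with t ht
  exact eLpNorm_mono_enorm_ae ht

lemma mixedE_mono (h : ∀ z, φ z ≤ ψ z) : mixedE q r φ ≤ mixedE q r ψ :=
  mixedE_mono_ae (ae_of_all _ h)

lemma mixedE_congr_ae (h : φ =ᵐ[volume] ψ) : mixedE q r φ = mixedE q r ψ :=
  le_antisymm (mixedE_mono_ae h.le) (mixedE_mono_ae h.symm.le)

lemma mixedE_add_le (hq : 1 ≤ q) (hr : 1 ≤ r) (hφ : Measurable φ) (hψ : Measurable ψ) :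
    mixedE q r (fun z => φ z + ψ z) ≤ mixedE q r φ + mixedE q r ψ := by
  refine (eLpNorm_mono_enorm fun t => ?_).trans (eLpNorm_add_le
    (measurable_slice_norm hφ r).aestronglyMeasurable
    (measurable_slice_norm hψ r).aestronglyMeasurable hq)
  exact eLpNorm_add_le (hφ.comp measurable_prodMk_left).aestronglyMeasurable
    (hψ.comp measurable_prodMk_left).aestronglyMeasurable hr

/-- Hölder's inequality in mixed norms. -/
lemma mixedE_mul_le {q₁ q₂ r₁ r₂ : ℝ≥0∞} [ENNReal.HolderTriple q₁ q₂ q]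
    [ENNReal.HolderTriple r₁ r₂ r] (hφ : Measurable φ) (hψ : Measurable ψ) :
    mixedE q r (fun z => φ z * ψ z) ≤ mixedE q₁ r₁ φ * mixedE q₂ r₂ ψ := by
  refine (eLpNorm_mono_enorm fun t => ?_).trans (eLpNorm_mul_le_of_holderTriple
    (measurable_slice_norm hφ r₁) (measurable_slice_norm hψ r₂))
  exact eLpNorm_mul_le_of_holderTriple (hφ.comp measurable_prodMk_left)
    (hψ.comp measurable_prodMk_left)

lemma mixedE_one_one (hφ : Measurable φ) : mixedE 1 1 φ = ∫⁻ z, φ z := by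
  simp only [mixedE, eLpNorm_one_eq_lintegral_enorm, enorm_eq_self]
  rw [Measure.volume_eq_prod, lintegral_prod _ hφ.aemeasurable]

/-- The mixed norm with both exponents equal to `2` is the `L²` norm. -/
lemma mixedE_two_two (hφ : Measurable φ) : mixedE 2 2 φ = eLpNorm φ 2 volume := by
  simp only [mixedE]
  rw [eLpNorm_two_eq, eLpNorm_two_eq]
  congr 1
  rw [Measure.volume_eq_prod, lintegral_prod _ (by fun_prop)]
  refine lintegral_congr fun t => ?_
  rw [eLpNorm_two_eq, ← ENNReal.rpow_mul]
  norm_num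

lemma mixedE_mul_left {c : ℝ≥0∞} (hc : c ≠ ∞) (φ : SpaceTime n → ℝ≥0∞) :
    mixedE q r (fun z => c * φ z) = c * mixedE q r φ := by
  lift c to NNReal using hc
  have h : ∀ {α : Type} [MeasurableSpace α] (μ : Measure α) (p : ℝ≥0∞) (u : α → ℝ≥0∞),
      eLpNorm (fun x => (c : ℝ≥0∞) * u x) p μ = c * eLpNorm u p μ := by
    intro α _ μ p u
    rcases eq_or_ne p 0 with rfl | h0
    · simp
    rcases eq_or_ne p ∞ with rfl | ht
    · simp only [eLpNorm_exponent_top, eLpNormEssSup, enorm_eq_self]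
      exact ENNReal.essSup_const_mul
    have hp : 0 < p.toReal := ENNReal.toReal_pos h0 ht
    simp_rw [eLpNorm_eq_lintegral_rpow_enorm_toReal h0 ht, enorm_eq_self,
      ENNReal.mul_rpow_of_nonneg _ _ hp.le]
    rw [lintegral_const_mul' _ _ (by finiteness), ENNReal.mul_rpow_of_nonneg _ _ (by positivity),
      ← ENNReal.rpow_mul, mul_one_div_cancel hp.ne', ENNReal.rpow_one]
  simp only [mixedE, h]

/-- Fatou's lemma in mixed norms. -/
lemma mixedE_liminf_le {φ : ℕ → SpaceTime n → ℝ≥0∞} (hφ : ∀ k, Measurable (φ k)) :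
    mixedE q r (fun z => liminf (fun k => φ k z) atTop) ≤
      liminf (fun k => mixedE q r (φ k)) atTop := by
  refine (eLpNorm_mono_enorm fun t => ?_).trans
    (eLpNorm_liminf_le fun k => measurable_slice_norm (hφ k) r)
  exact eLpNorm_liminf_le fun k => (hφ k).comp measurable_prodMk_left

/-- Dominated convergence in mixed norms. For `r = ∞` the hypothesis says that the slices are
eventually null. -/
lemma tendsto_mixedE_zero {φ : ℕ → SpaceTime n → ℝ≥0∞} (hφ : ∀ k, Measurable (φ k)) (hq : q ≠ ∞)
    {Φ : SpaceTime n → ℝ≥0∞} (hΦm : Measurable Φ) (hΦ : mixedE q r Φ ≠ ∞)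
    (hle : ∀ k z, φ k z ≤ Φ z) (hq1 : q ≠ 0)
    (hlim : ∀ᵐ t : ℝ, eLpNorm (fun x : Space n => Φ (t, x)) r volume ≠ ∞ →
      Tendsto (fun k => eLpNorm (fun x => φ k (t, x)) r volume) atTop (𝓝 0)) :
    Tendsto (fun k => mixedE q r (φ k)) atTop (𝓝 0) := by
  refine tendsto_eLpNorm_zero_of_dominated hq
    (fun k => (measurable_slice_norm (hφ k) r).aemeasurable) hΦ
    (fun k => ae_of_all _ fun t => eLpNorm_mono_enorm fun x => hle k _) ?_
  have hfin : ∀ᵐ t : ℝ, eLpNorm (fun x : Space n => Φ (t, x)) r volume < ∞ := by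
    have hp' : 0 < q.toReal := ENNReal.toReal_pos hq1 hq
    have h : ∫⁻ t : ℝ, eLpNorm (fun x : Space n => Φ (t, x)) r volume ^ q.toReal ≠ ∞ := by
      intro h
      rw [mixedE, eLpNorm_eq_lintegral_rpow_enorm_toReal hq1 hq] at hΦ
      simp only [enorm_eq_self, h] at hΦ
      rw [ENNReal.top_rpow_of_pos (by positivity)] at hΦ
      exact hΦ rfl
    filter_upwards [ae_lt_top ((measurable_slice_norm hΦm r).pow_const _) h] with t ht
    by_contra hc
    rw [not_lt, top_le_iff] at hc
    rw [hc, ENNReal.top_rpow_of_pos hp'] at ht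
    exact lt_irrefl _ ht
  filter_upwards [hlim, hfin] with t h1 h2 using h1 h2.ne

lemma ae_eq_zero_of_mixedE (hq : q ≠ 0) (hr : r ≠ 0) (hφ : Measurable φ)
    (h : mixedE q r φ = 0) : φ =ᵐ[volume] 0 := by
  have h1 := (eLpNorm_eq_zero_iff (measurable_slice_norm hφ r).aestronglyMeasurable hq).1 h
  have hm : MeasurableSet {z : SpaceTime n | φ z = 0} := measurableSet_eq_fun hφ measurable_const
  have : ∀ᵐ z : SpaceTime n, φ z = 0 := by
    rw [Measure.volume_eq_prod, Measure.ae_prod_iff_ae_ae hm]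
    filter_upwards [h1] with t ht
    exact (eLpNorm_eq_zero_iff (hφ.comp measurable_prodMk_left).aestronglyMeasurable hr).1 ht
  exact this

/-- The balls of the maximum norm on `ℝ × ℝⁿ`, which are products of balls. -/
lemma mixedE_indicator_ball_lt_top (q r : ℝ≥0∞) {c : ℝ≥0∞} (hc : c ≠ ∞) (ρ : ℝ) :
    mixedE q r ((Metric.closedBall (0 : SpaceTime n) ρ).indicator fun _ => c) < ∞ := by
  set C := eLpNorm ((Metric.closedBall (0 : Space n) ρ).indicator fun _ => c) r volume with hC
  have hCt : C < ∞ := by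
    refine (eLpNorm_indicator_const_le _ r).trans_lt ?_
    refine ENNReal.mul_lt_top hc.lt_top (ENNReal.rpow_lt_top_of_nonneg (by positivity) ?_)
    exact (isCompact_closedBall _ _).measure_lt_top.ne
  have h : ∀ t : ℝ, eLpNorm (fun x : Space n =>
      (Metric.closedBall (0 : SpaceTime n) ρ).indicator (fun _ => c) (t, x)) r volume ≤
      (Metric.closedBall (0 : ℝ) ρ).indicator (fun _ => C) t := by
    intro t
    by_cases ht : t ∈ Metric.closedBall (0 : ℝ) ρ
    · rw [Set.indicator_of_mem ht]
      refine eLpNorm_mono_enorm fun x => ?_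
      rw [enorm_eq_self, enorm_eq_self]
      by_cases hx : (t, x) ∈ Metric.closedBall (0 : SpaceTime n) ρ
      · rw [Set.indicator_of_mem hx, Set.indicator_of_mem]
        simp only [mem_closedBall_zero_iff, Prod.norm_def, max_le_iff] at hx ⊢
        exact hx.2
      · rw [Set.indicator_of_notMem hx]
        exact zero_le
    · rw [Set.indicator_of_notMem ht]
      have : (fun x : Space n => (Metric.closedBall (0 : SpaceTime n) ρ).indicator
          (fun _ => c) (t, x)) = fun _ => 0 := by
        funext x
        refine Set.indicator_of_notMem (fun hx => ht ?_) _
        simp only [mem_closedBall_zero_iff, Prod.norm_def, max_le_iff] at hx ⊢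
        exact hx.1
      rw [this]
      simp
  refine (eLpNorm_mono_enorm (g := (Metric.closedBall (0 : ℝ) ρ).indicator fun _ => C)
    h).trans_lt ((eLpNorm_indicator_const_le _ q).trans_lt ?_)
  refine ENNReal.mul_lt_top hCt (ENNReal.rpow_lt_top_of_nonneg (by positivity) ?_)
  exact (isCompact_closedBall _ _).measure_lt_top.ne

end MixedE

/-! ### Duality of mixed norms -/

/-- Almost extremal functions for Hölder's inequality, depending measurably on a parameter. For
`r = 1` they are concentrated where the given function is close to its essential supremum. -/
lemma exists_normalizer {α β : Type*} [MeasurableSpace α] [MeasurableSpace β] (μ : Measure β)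
    [SigmaFinite μ] {r r' : ℝ≥0∞} [hrr : ENNReal.HolderConjugate r r'] (hr : r ≠ ∞)
    {h : α × β → ℝ≥0∞} (hh : Measurable h) {θ : ℝ≥0∞} (hθ : θ < 1) :
    ∃ g : α × β → ℝ≥0∞, Measurable g ∧ (∀ a, eLpNorm (fun x => g (a, x)) r μ ≤ 1) ∧
      ∀ a, eLpNorm (fun x => h (a, x)) r' μ ≠ ∞ →
        θ * eLpNorm (fun x => h (a, x)) r' μ ≤ ∫⁻ x, h (a, x) * g (a, x) ∂μ := by
  set φ : α → ℝ≥0∞ := fun a => eLpNorm (fun x => h (a, x)) r' μ with hφ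
  have hφm : Measurable φ := measurable_eLpNorm_prod hh r'
  rcases eq_or_ne r' ∞ with rfl | hr'
  · have hr1 : r = 1 := by simpa using hrr.inv_add_inv_eq_inv
    subst hr1
    -- For `r = 1` take a positive integrable weight `w`, restricted to the set `A` where `h`
    -- exceeds `θ` times its essential supremum, and normalise it.
    obtain ⟨w, hw0, hwm, hwi⟩ := exists_pos_lintegral_lt_of_sigmaFinite μ one_ne_zero
    set A : Set (α × β) := {p | θ * φ p.1 < h p} with hA
    have hAm : MeasurableSet A := measurableSet_lt (by fun_prop) hh
    set k : α × β → ℝ≥0∞ := A.indicator fun p => (w p.2 : ℝ≥0∞) with hk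
    have hkm : Measurable k := Measurable.indicator (by fun_prop) hAm
    have hks : ∀ a, Measurable fun x => k (a, x) := fun a => hkm.comp measurable_prodMk_left
    set m : α → ℝ≥0∞ := fun a => ∫⁻ x, k (a, x) ∂μ with hm
    have hmm : Measurable m := hkm.lintegral_prod_right'
    refine ⟨fun p => k p * (m p.1)⁻¹, by fun_prop, fun a => ?_, fun a hfin => ?_⟩
    · rw [eLpNorm_one_eq_lintegral_enorm]
      simp only [enorm_eq_self]
      rw [lintegral_mul_const _ (hks a)]
      exact ENNReal.mul_inv_le_one _
    · change θ * φ a ≤ _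
      change φ a ≠ ∞ at hfin
      rcases eq_or_ne (φ a) 0 with h0 | h0
      · simp [h0]
      have hlt : θ * φ a < φ a := by
        calc θ * φ a < 1 * φ a := by
              rw [mul_comm, mul_comm 1]
              exact ENNReal.mul_lt_mul_right h0 hfin hθ
          _ = φ a := one_mul _
      have hma : m a ≠ 0 := by
        intro hma
        rw [hm, lintegral_eq_zero_iff (hks a)] at hma
        have hle : φ a ≤ θ * φ a := by
          refine essSup_le_of_ae_le _ ?_
          filter_upwards [hma] with x hx
          by_contra hc
          have hmem : (a, x) ∈ A := not_le.1 hc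
          simp only [hk, Set.indicator_of_mem hmem, Pi.zero_apply, ENNReal.coe_eq_zero] at hx
          exact (hw0 x).ne' hx
        exact absurd hlt (not_lt.2 hle)
      have hmt : m a ≠ ∞ := by
        refine ((lintegral_mono fun x => ?_).trans_lt (hwi.trans ENNReal.one_lt_top)).ne
        exact Set.indicator_le_self _ _ _
      calc θ * φ a = θ * φ a * (m a * (m a)⁻¹) := by rw [ENNReal.mul_inv_cancel hma hmt, mul_one]
        _ = ∫⁻ x, θ * φ a * (k (a, x) * (m a)⁻¹) ∂μ := by
          rw [lintegral_const_mul _ ((hks a).mul_const _), lintegral_mul_const _ (hks a)]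
        _ ≤ _ := by
          refine lintegral_mono fun x => ?_
          by_cases hx : (a, x) ∈ A
          · gcongr
            exact le_of_lt hx
          · simp [hk, Set.indicator_of_notMem hx]
  · have hc := ENNReal.HolderConjugate.toReal_of_ne_top (p := r) (q := r') hr hr'
    -- For `r > 1` take the power `h ^ (s - 1)` of the normalised function.
    set s := r'.toReal with hs
    set p := r.toReal with hp
    have hr0 : r ≠ 0 := (ENNReal.HolderConjugate.pos r r').ne'
    have hr'0 : r' ≠ 0 := (ENNReal.HolderConjugate.pos r' r).ne'
    have hs0 : 0 < s := hc.symm.pos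
    have hp0 : 0 < p := hc.pos
    have hsp : (s - 1) * p = s := hc.symm.sub_one_mul_conj
    have hs1 : 0 < s - 1 := hc.symm.sub_one_pos
    have hφs : ∀ a, ∫⁻ x, h (a, x) ^ s ∂μ = φ a ^ s := by
      intro a
      simp only [hφ]
      rw [eLpNorm_eq_lintegral_rpow_enorm_toReal hr'0 hr', ← ENNReal.rpow_mul,
        one_div_mul_cancel hs0.ne', ENNReal.rpow_one]
      simp only [enorm_eq_self, ← hs]
    have hhs : ∀ a, Measurable fun x => h (a, x) := fun a => hh.comp measurable_prodMk_left
    refine ⟨fun z => (h z * (φ z.1)⁻¹) ^ (s - 1), by fun_prop, fun a => ?_, fun a hfin => ?_⟩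
    · rw [eLpNorm_eq_lintegral_rpow_enorm_toReal hr0 hr, ← hp]
      simp only [enorm_eq_self, ← ENNReal.rpow_mul, hsp, ENNReal.mul_rpow_of_nonneg _ _ hs0.le]
      rw [lintegral_mul_const _ (by fun_prop), hφs, ← ENNReal.mul_rpow_of_nonneg _ _ hs0.le,
        ← ENNReal.rpow_mul]
      exact ENNReal.rpow_le_one (ENNReal.mul_inv_le_one _) (by positivity)
    · change θ * φ a ≤ _
      change φ a ≠ ∞ at hfin
      rcases eq_or_ne (φ a) 0 with h0 | h0
      · simp [h0]
      have e : ∀ x, h (a, x) * (h (a, x) * (φ a)⁻¹) ^ (s - 1) =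
          h (a, x) ^ s * (φ a)⁻¹ ^ (s - 1) := by
        intro x
        rw [ENNReal.mul_rpow_of_nonneg _ _ hs1.le, ← mul_assoc]
        congr 1
        nth_rewrite 1 [← ENNReal.rpow_one (h (a, x))]
        rw [← ENNReal.rpow_add_of_nonneg _ _ zero_le_one hs1.le]
        ring_nf
      simp only [e]
      rw [lintegral_mul_const _ (by fun_prop), hφs]
      have : φ a ^ s * (φ a)⁻¹ ^ (s - 1) = φ a := by
        rw [ENNReal.inv_rpow, ← ENNReal.rpow_neg, ← ENNReal.rpow_add _ _ h0 hfin]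
        ring_nf
        exact ENNReal.rpow_one _
      rw [this]
      exact mul_le_of_le_one_left' hθ.le

/-- The mixed norm is attained up to a factor `θ ^ 2 < 1` on a product of an almost extremal
function in space, depending on time, and of one in time. -/
lemma mixedE_le_of_forall_lintegral_mul_le {q r q' r' : ℝ≥0∞} [ENNReal.HolderConjugate q q']
    [ENNReal.HolderConjugate r r'] (hq : q ≠ ∞) (hr : r ≠ ∞) {h : SpaceTime n → ℝ≥0∞}
    (hh : Measurable h) (hfin : ∀ t, eLpNorm (fun x : Space n => h (t, x)) r' volume ≠ ∞)
    (hN : mixedE q' r' h ≠ ∞) {K : ℝ≥0∞}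
    (H : ∀ g : SpaceTime n → ℝ≥0∞, Measurable g → ∫⁻ z, h z * g z ≤ K * mixedE q r g) :
    mixedE q' r' h ≤ K := by
  have key : ∀ θ < (1 : ℝ≥0∞), θ * (θ * mixedE q' r' h) ≤ K := by
    intro θ hθ
    obtain ⟨g, hgm, hg1, hg2⟩ := exists_normalizer (volume : Measure (Space n)) (r' := r') hr hh hθ
    set Φ : ℝ → ℝ≥0∞ := fun t => eLpNorm (fun x : Space n => h (t, x)) r' volume with hΦ
    have hΦm : Measurable Φ := measurable_slice_norm hh r'
    obtain ⟨ψ, hψm, hψ1, hψ2⟩ := exists_normalizer (α := Unit) (volume : Measure ℝ) (r' := q') hq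
      (h := fun p => Φ p.2) (by fun_prop) hθ
    have hψm' : Measurable fun t => ψ ((), t) := hψm.comp measurable_prodMk_left
    have hgs : ∀ t, Measurable fun x : Space n => g (t, x) := fun t =>
      hgm.comp measurable_prodMk_left
    have hhs : ∀ t, Measurable fun x : Space n => h (t, x) := fun t =>
      hh.comp measurable_prodMk_left
    have hG : mixedE q r (fun z => g z * ψ ((), z.1)) ≤ 1 := by
      refine (eLpNorm_mono_enorm fun t => ?_).trans (hψ1 ())
      simp only [enorm_eq_self]
      refine (eLpNorm_mul_le_of_holderTriple (p := r) (q := ∞) (hgs t) measurable_const).trans ?_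
      refine (mul_le_mul' (hg1 t) (essSup_le_of_ae_le (ψ ((), t)) (ae_of_all _ fun x => ?_))).trans
        (one_mul _).le
      exact le_rfl
    have h1 := H _ (hgm.mul (hψm'.comp measurable_fst))
    have h2 : θ * (θ * mixedE q' r' h) ≤ ∫⁻ z : SpaceTime n, h z * (g z * ψ ((), z.1)) := by
      rw [Measure.volume_eq_prod, lintegral_prod _ (Measurable.aemeasurable (by fun_prop))]
      calc θ * (θ * mixedE q' r' h) ≤ θ * ∫⁻ t, Φ t * ψ ((), t) := by
            gcongr
            exact hψ2 () hN
        _ = ∫⁻ t, θ * (Φ t * ψ ((), t)) := (lintegral_const_mul _ (hΦm.mul hψm')).symm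
        _ ≤ _ := by
          refine lintegral_mono fun t => ?_
          simp only
          simp_rw [← mul_assoc]
          rw [lintegral_mul_const (f := fun x => h (t, x) * g (t, x)) _ ((hhs t).mul (hgs t))]
          gcongr
          exact hg2 t (hfin t)
    exact h2.trans (h1.trans ((mul_le_mul_right hG K).trans (mul_one K).le))
  have h1 : ∀ θ < (1 : ℝ≥0∞), θ * mixedE q' r' h ≤ K := by
    intro θ hθ
    rw [← one_mul (θ * _)]
    refine ENNReal.mul_le_of_forall_lt fun a ha b hb => ?_
    calc a * b ≤ max a θ * (max a θ * mixedE q' r' h) := by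
          gcongr
          · exact le_max_left _ _
          · exact hb.le.trans (by gcongr; exact le_max_right _ _)
      _ ≤ K := key _ (max_lt ha hθ)
  rw [← one_mul (mixedE q' r' h)]
  exact ENNReal.mul_le_of_forall_lt fun a ha b hb => (mul_le_mul_right hb.le a).trans (h1 a ha)

/-- A bounded function is controlled in the dual mixed norm by its pairings with test functions. -/
theorem mixedNorm_le_of_forall_nice {q r q' r' : ℝ≥0∞} [ENNReal.HolderConjugate q q']
    [ENNReal.HolderConjugate r r'] (hq : q ≠ ∞) (hr : r ≠ ∞) {h : SpaceTime n → ℂ}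
    (hh : Measurable h) {M : ℝ} (hM : ∀ z, ‖h z‖ ≤ M) {K : ℝ≥0∞}
    (H : ∀ g : SpaceTime n → ℂ, Nice volume g → ‖∫ z, h z * g z‖ₑ ≤ K * mixedNorm q r g) :
    mixedNorm q' r' h ≤ K := by
  -- The function is restricted to balls, where its mixed norm is finite; the restriction is removed
  -- at the end by Fatou's lemma.
  set A : ℕ → Set (SpaceTime n) := fun k => Metric.closedBall 0 k with hA
  have hAm : ∀ k, MeasurableSet (A k) := fun k => measurableSet_closedBall
  set φ : ℕ → SpaceTime n → ℝ≥0∞ := fun k => (A k).indicator fun z => ‖h z‖ₑ with hφ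
  have hφm : ∀ k, Measurable (φ k) := fun k => hh.enorm.indicator (hAm k)
  have hMe : ∀ z, ‖h z‖ₑ ≤ ENNReal.ofReal M := fun z => by
    rw [← ofReal_norm]; exact ENNReal.ofReal_le_ofReal (hM z)
  have hφle : ∀ k z, φ k z ≤ (A k).indicator (fun _ => ENNReal.ofReal M) z := fun k z =>
    Set.indicator_le_indicator (hMe z)
  have hk : ∀ k, mixedE q' r' (φ k) ≤ K := by
    intro k
    refine mixedE_le_of_forall_lintegral_mul_le hq hr (hφm k) (fun t => ?_) ?_ fun g hg => ?_
    · have hAs : MeasurableSet {x : Space n | ‖x‖ ≤ k} :=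
        measurableSet_le (by fun_prop) (by fun_prop)
      refine ((eLpNorm_mono_enorm (g := (Metric.closedBall (0 : Space n) k).indicator
        fun _ => ENNReal.ofReal M) fun x => ?_).trans_lt
        ((eLpNorm_indicator_const_le _ r').trans_lt (ENNReal.mul_lt_top ENNReal.ofReal_lt_top
          (ENNReal.rpow_lt_top_of_nonneg (by positivity)
            (isCompact_closedBall _ _).measure_lt_top.ne)))).ne
      rw [enorm_eq_self, enorm_eq_self]
      refine (hφle k _).trans ?_
      by_cases hx : (t, x) ∈ A k
      · rw [Set.indicator_of_mem hx, Set.indicator_of_mem]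
        simp only [hA, mem_closedBall_zero_iff, Prod.norm_def, max_le_iff] at hx ⊢
        exact hx.2
      · rw [Set.indicator_of_notMem hx]
        exact zero_le
    · exact ((mixedE_mono (hφle k)).trans_lt
        (mixedE_indicator_ball_lt_top q' r' ENNReal.ofReal_ne_top k)).ne
    · -- truncate the weight `g` and give it the phase of the conjugate of `h`
      have trunc : ∀ m : ℕ, ∫⁻ z, φ k z * min (g z) m ≤ K * mixedE q r g := by
        intro m
        set ρ : SpaceTime n → ℝ := (A k).indicator fun z => (min (g z) m).toReal with hρ
        have hρm : Measurable ρ := Measurable.indicator (by fun_prop) (hAm k)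
        have hmt : ∀ z, min (g z) (m : ℝ≥0∞) ≠ ∞ := fun z =>
          (min_le_right _ _).trans_lt (ENNReal.natCast_lt_top m) |>.ne
        have hρ0 : ∀ z, 0 ≤ ρ z := Set.indicator_nonneg fun _ _ => ENNReal.toReal_nonneg
        have hρle : ∀ z, ρ z ≤ m := by
          intro z
          refine Set.indicator_apply_le' (fun _ => ?_) fun _ => by positivity
          exact ENNReal.toReal_le_of_le_ofReal (by positivity) (by simp)
        set s : SpaceTime n → ℂ := fun z => starRingEnd ℂ (h z) / ‖h z‖ with hs
        have hsm : Measurable s := by simp only [hs]; fun_prop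
        have hs1 : ∀ z, ‖s z‖ ≤ 1 := fun z => by simp [hs, div_self_le_one]
        have hhs : ∀ z, h z * s z = (‖h z‖ : ℂ) := by
          intro z
          simp only [hs]
          rw [← mul_div_assoc, Complex.mul_conj, Complex.normSq_eq_norm_sq]
          push_cast
          rcases eq_or_ne (‖h z‖ : ℂ) 0 with h0 | h0
          · simp [h0]
          · field_simp
        set G : SpaceTime n → ℂ := fun z => s z * ρ z with hG
        have hGm : Measurable G := by simp only [hG]; fun_prop
        have hGn : ∀ z, ‖G z‖ ≤ ρ z := fun z => by
          simp only [hG, norm_mul, Complex.norm_real, Real.norm_of_nonneg (hρ0 z)]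
          exact mul_le_of_le_one_left (hρ0 z) (hs1 z)
        have hρi : Integrable ρ := by
          rw [hρ, integrable_indicator_iff (hAm k)]
          refine Measure.integrableOn_of_bounded (M := m)
            (isCompact_closedBall _ _).measure_lt_top.ne
            (Measurable.aestronglyMeasurable (by fun_prop)) (ae_of_all _ fun z => ?_)
          rw [Real.norm_of_nonneg ENNReal.toReal_nonneg]
          exact ENNReal.toReal_le_of_le_ofReal (by positivity) (by simp)
        have hGnice : Nice volume G := ⟨hGm, hρi.mono' hGm.aestronglyMeasurable
          (ae_of_all _ hGn), m, fun z => (hGn z).trans (hρle z)⟩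
        have e1 : ∀ z, h z * G z = ((‖h z‖ * ρ z : ℝ) : ℂ) := by
          intro z
          simp only [hG]
          rw [← mul_assoc, hhs]
          push_cast
          rfl
        have e2 : ∀ z, ‖h z * G z‖ₑ = φ k z * min (g z) m := by
          intro z
          rw [e1, ← ofReal_norm, Complex.norm_real, norm_mul, norm_norm,
            Real.norm_of_nonneg (hρ0 z), ENNReal.ofReal_mul (norm_nonneg _), ofReal_norm]
          by_cases hz : z ∈ A k
          · simp only [hφ, hρ, Set.indicator_of_mem hz]
            rw [ENNReal.ofReal_toReal (hmt z)]
          · simp only [hφ, hρ, Set.indicator_of_notMem hz]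
            simp
        have hi : Integrable fun z => h z * G z :=
          hGnice.int.bdd_mul (c := M) hh.aestronglyMeasurable (ae_of_all _ hM)
        have e3 : ‖∫ z, h z * G z‖ₑ = ∫⁻ z, φ k z * min (g z) m := by
          have e4 : ∫ z, h z * G z = ((∫ z, ‖h z * G z‖ : ℝ) : ℂ) := by
            rw [← integral_complex_ofReal]
            refine integral_congr_ae (ae_of_all _ fun z => ?_)
            simp only
            rw [e1, Complex.norm_real, Real.norm_of_nonneg (mul_nonneg (norm_nonneg _) (hρ0 z))]
          rw [e4, ← ofReal_norm, Complex.norm_real,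
            Real.norm_of_nonneg (integral_nonneg fun _ => norm_nonneg _),
            ofReal_integral_norm_eq_lintegral_enorm hi]
          exact lintegral_congr e2
        rw [← e3]
        refine (H G hGnice).trans ?_
        rw [mixedNorm_eq_mixedE]
        refine mul_le_mul_right (mixedE_mono fun z => ?_) K
        calc ‖G z‖ₑ = ENNReal.ofReal ‖G z‖ := (ofReal_norm _).symm
          _ ≤ ENNReal.ofReal (ρ z) := ENNReal.ofReal_le_ofReal (hGn z)
          _ ≤ g z := by
            by_cases hz : z ∈ A k
            · simp only [hρ, Set.indicator_of_mem hz]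
              rw [ENNReal.ofReal_toReal (hmt z)]
              exact min_le_left _ _
            · simp [hρ, Set.indicator_of_notMem hz]
      have hlim : ∀ z, Tendsto (fun m : ℕ => φ k z * min (g z) m) atTop (𝓝 (φ k z * g z)) := by
        intro z
        have h1 : Tendsto (fun m : ℕ => min (g z) (m : ℝ≥0∞)) atTop (𝓝 (g z)) := by
          have := (tendsto_const_nhds (x := g z)).min ENNReal.tendsto_nat_nhds_top
          simpa using this
        refine ENNReal.Tendsto.const_mul h1 (Or.inr ?_)
        exact ((hφle k z).trans (Set.indicator_le_self _ _ _)).trans_lt ENNReal.ofReal_lt_top |>.ne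
      calc ∫⁻ z, φ k z * g z = ∫⁻ z, liminf (fun m : ℕ => φ k z * min (g z) m) atTop :=
            lintegral_congr fun z => ((hlim z).liminf_eq).symm
        _ ≤ liminf (fun m : ℕ => ∫⁻ z, φ k z * min (g z) m) atTop :=
            lintegral_liminf_le fun m => (hφm k).mul (hg.min measurable_const)
        _ ≤ K * mixedE q r g := liminf_le_of_frequently_le' (Frequently.of_forall trunc)
  rw [mixedNorm_eq_mixedE]
  have hlim : ∀ z, liminf (fun k => φ k z) atTop = ‖h z‖ₑ := by
    intro z
    refine Tendsto.liminf_eq (tendsto_const_nhds.congr' ?_)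
    filter_upwards [eventually_ge_atTop ⌈‖z‖⌉₊] with k hk
    refine (Set.indicator_of_mem (s := A k) (f := fun z => ‖h z‖ₑ) ?_).symm
    rw [hA, mem_closedBall_zero_iff]
    exact (Nat.le_ceil _).trans (by exact_mod_cast hk)
  calc mixedE q' r' (fun z => ‖h z‖ₑ) = mixedE q' r' (fun z => liminf (fun k => φ k z) atTop) := by
        simp only [hlim]
    _ ≤ liminf (fun k => mixedE q' r' (φ k)) atTop := mixedE_liminf_le hφm
    _ ≤ K := liminf_le_of_frequently_le' (Frequently.of_forall hk)

/-! ### Density of Schwartz functions in mixed norms -/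

section Density

variable {q r : ℝ≥0∞}

lemma tendsto_mixedE_indicator_compl (hq : q ≠ ∞) (hr : r ≠ ∞) (hq0 : q ≠ 0)
    {φ : SpaceTime n → ℝ≥0∞} (hφ : Measurable φ) (hN : mixedE q r φ ≠ ∞)
    {A : ℕ → Set (SpaceTime n)} (hA : ∀ k, MeasurableSet (A k))
    (hlim : ∀ z, ∀ᶠ k in atTop, z ∈ A k) :
    Tendsto (fun k => mixedE q r ((A k)ᶜ.indicator φ)) atTop (𝓝 0) := by
  have hm : ∀ k, Measurable ((A k)ᶜ.indicator φ) := fun k => hφ.indicator (hA k).compl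
  refine tendsto_mixedE_zero hm hq hφ hN (fun k z => Set.indicator_le_self _ _ _) hq0
    (ae_of_all _ fun t ht => ?_)
  refine tendsto_eLpNorm_zero_of_dominated hr
    (fun k => ((hm k).comp measurable_prodMk_left).aemeasurable) ht
    (fun k => ae_of_all _ fun x => Set.indicator_le_self _ _ _) (ae_of_all _ fun x => ?_)
  refine tendsto_const_nhds.congr' ?_
  filter_upwards [hlim (t, x)] with k hk
  exact (Set.indicator_of_notMem (by simpa using hk) _).symm

/-- The truncation of a function to a ball and to bounded values. -/
def truncate (F : SpaceTime n → ℂ) (k : ℕ) : SpaceTime n → ℂ :=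
  {z | ‖z‖ ≤ k ∧ ‖F z‖ ≤ k}.indicator F

lemma measurableSet_truncate {F : SpaceTime n → ℂ} (hF : Measurable F) (k : ℕ) :
    MeasurableSet {z | ‖z‖ ≤ k ∧ ‖F z‖ ≤ k} :=
  (measurableSet_le measurable_norm measurable_const).inter
    (measurableSet_le hF.norm measurable_const)

lemma measurable_truncate {F : SpaceTime n → ℂ} (hF : Measurable F) (k : ℕ) :
    Measurable (truncate F k) :=
  hF.indicator (measurableSet_truncate hF k)

lemma norm_truncate_le (F : SpaceTime n → ℂ) (k : ℕ) (z : SpaceTime n) :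
    ‖truncate F k z‖ ≤ ‖F z‖ := norm_indicator_le_norm_self _ _

lemma norm_truncate_le_indicator (F : SpaceTime n → ℂ) (k : ℕ) (z : SpaceTime n) :
    ‖truncate F k z‖ ≤ (Metric.closedBall (0 : SpaceTime n) k).indicator (fun _ => (k : ℝ)) z := by
  by_cases hz : ‖z‖ ≤ k ∧ ‖F z‖ ≤ k
  · rw [truncate, Set.indicator_of_mem (by exact hz),
      Set.indicator_of_mem (by simpa using hz.1)]
    exact hz.2
  · rw [truncate, Set.indicator_of_notMem (by exact hz), norm_zero]
    exact Set.indicator_nonneg (fun _ _ => by positivity) _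

lemma Nice.truncate {F : SpaceTime n → ℂ} (hF : Measurable F) (k : ℕ) :
    Nice volume (truncate F k) := by
  refine ⟨measurable_truncate hF k, ?_, k, fun z => (norm_truncate_le_indicator F k z).trans
    (Set.indicator_le_self' (fun _ _ => by positivity) _)⟩
  refine Integrable.mono' (g := (Metric.closedBall (0 : SpaceTime n) k).indicator
    fun _ => (k : ℝ)) ?_ (measurable_truncate hF k).aestronglyMeasurable
    (ae_of_all _ (norm_truncate_le_indicator F k))
  exact (integrable_indicator_iff measurableSet_closedBall).2
    (integrableOn_const (isCompact_closedBall _ _).measure_lt_top.ne)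

lemma tendsto_mixedNorm_sub_truncate (hq : q ≠ ∞) (hr : r ≠ ∞) (hq0 : q ≠ 0)
    {F : SpaceTime n → ℂ} (hF : Measurable F) (hN : mixedNorm q r F ≠ ∞) :
    Tendsto (fun k => mixedNorm q r (fun z => F z - truncate F k z)) atTop (𝓝 0) := by
  rw [mixedNorm_eq_mixedE] at hN
  refine (tendsto_mixedE_indicator_compl hq hr hq0 hF.enorm hN (measurableSet_truncate hF)
    fun z => ?_).congr fun k => ?_
  · obtain ⟨k₁, hk₁⟩ := exists_nat_ge ‖z‖
    obtain ⟨k₂, hk₂⟩ := exists_nat_ge ‖F z‖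
    filter_upwards [eventually_ge_atTop (max k₁ k₂)] with k hk
    exact ⟨hk₁.trans (by exact_mod_cast (le_max_left _ _).trans hk),
      hk₂.trans (by exact_mod_cast (le_max_right _ _).trans hk)⟩
  · rw [mixedNorm_eq_mixedE]
    congr 1
    funext z
    by_cases hz : z ∈ {z | ‖z‖ ≤ k ∧ ‖F z‖ ≤ k}
    · rw [Set.indicator_of_notMem (by simpa using hz), BirmanSchwinger.truncate,
        Set.indicator_of_mem hz]
      simp
    · rw [Set.indicator_of_mem (by simpa using hz), BirmanSchwinger.truncate,
        Set.indicator_of_notMem hz]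
      simp

lemma mixedNorm_add_le (hq : 1 ≤ q) (hr : 1 ≤ r) {f g : SpaceTime n → ℂ}
    (hf : AEStronglyMeasurable f volume) (hg : AEStronglyMeasurable g volume) :
    mixedNorm q r (fun z => f z + g z) ≤ mixedNorm q r f + mixedNorm q r g := by
  have e : (fun z => f z + g z) =ᵐ[volume] fun z => hf.mk f z + hg.mk g z := by
    filter_upwards [hf.ae_eq_mk, hg.ae_eq_mk] with z h1 h2
    rw [h1, h2]
  have hf' := hf.stronglyMeasurable_mk.measurable
  have hg' := hg.stronglyMeasurable_mk.measurable
  rw [mixedNorm_congr_ae (e.mono fun z hz => congrArg norm hz),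
    mixedNorm_congr_ae (hf.ae_eq_mk.mono fun z hz => congrArg norm hz),
    mixedNorm_congr_ae (hg.ae_eq_mk.mono fun z hz => congrArg norm hz)]
  simp_rw [mixedNorm_eq_mixedE]
  exact (mixedE_mono fun z => enorm_add_le _ _).trans (mixedE_add_le hq hr hf'.enorm hg'.enorm)

lemma mixedNorm_mul_left (c : ℂ) (f : SpaceTime n → ℂ) :
    mixedNorm q r (fun z => c * f z) = ‖c‖ₑ * mixedNorm q r f := by
  simp_rw [mixedNorm_eq_mixedE, enorm_mul]
  exact mixedE_mul_left enorm_ne_top _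

lemma mixedNorm_sub_comm (f g : SpaceTime n → ℂ) :
    mixedNorm q r (fun z => f z - g z) = mixedNorm q r (fun z => g z - f z) :=
  mixedNorm_congr_ae (ae_of_all _ fun _ => norm_sub_rev _ _)

/-- Hölder's inequality in mixed norms. -/
lemma mixedNorm_mul_le {q₁ q₂ r₁ r₂ : ℝ≥0∞} [ENNReal.HolderTriple q₁ q₂ q]
    [ENNReal.HolderTriple r₁ r₂ r] {f g : SpaceTime n → ℂ}
    (hf : AEStronglyMeasurable f volume) (hg : AEStronglyMeasurable g volume) :
    mixedNorm q r (fun z => f z * g z) ≤ mixedNorm q₁ r₁ f * mixedNorm q₂ r₂ g := by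
  have e : (fun z => f z * g z) =ᵐ[volume] fun z => hf.mk f z * hg.mk g z := by
    filter_upwards [hf.ae_eq_mk, hg.ae_eq_mk] with z h1 h2
    rw [h1, h2]
  have hf' := hf.stronglyMeasurable_mk.measurable
  have hg' := hg.stronglyMeasurable_mk.measurable
  rw [mixedNorm_congr_ae (e.mono fun z hz => congrArg norm hz),
    mixedNorm_congr_ae (hf.ae_eq_mk.mono fun z hz => congrArg norm hz),
    mixedNorm_congr_ae (hg.ae_eq_mk.mono fun z hz => congrArg norm hz)]
  simp_rw [mixedNorm_eq_mixedE, enorm_mul]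
  exact mixedE_mul_le hf'.enorm hg'.enorm

lemma mixedNorm_two_two {f : SpaceTime n → ℂ} (hf : AEStronglyMeasurable f volume) :
    mixedNorm 2 2 f = eLpNorm f 2 volume := by
  rw [mixedNorm_congr_ae (hf.ae_eq_mk.mono fun z hz => congrArg norm hz),
    eLpNorm_congr_ae hf.ae_eq_mk, mixedNorm_eq_mixedE,
    mixedE_two_two hf.stronglyMeasurable_mk.measurable.enorm, eLpNorm_enorm]

lemma mixedNorm_one_one {f : SpaceTime n → ℂ} (hf : AEStronglyMeasurable f volume) :
    mixedNorm 1 1 f = ∫⁻ z, ‖f z‖ₑ := by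
  rw [mixedNorm_congr_ae (hf.ae_eq_mk.mono fun z hz => congrArg norm hz), mixedNorm_eq_mixedE,
    mixedE_one_one hf.stronglyMeasurable_mk.measurable.enorm]
  refine lintegral_congr_ae ?_
  filter_upwards [hf.ae_eq_mk] with z hz
  rw [hz]

/-- Schwartz functions approximate truncations: approximate in `L²` by smooth functions, and cut
off, which turns the `L²` error into an error in the mixed norm by Hölder's inequality. -/
lemma exists_schwartz_sub_truncate_le {q₁ r₁ : ℝ≥0∞} [ENNReal.HolderTriple q₁ 2 q]
    [ENNReal.HolderTriple r₁ 2 r] {F : SpaceTime n → ℂ} (hF : Measurable F) (k : ℕ) {δ : ℝ≥0∞}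
    (hδ : δ ≠ 0) :
    ∃ f : 𝓢(SpaceTime n, ℂ), mixedNorm q r (fun z => f z - truncate F k z) ≤ δ := by
  -- `χ = 1` on a neighbourhood of the support of the truncation, and `χ = 0` outside `B`.
  set χ : ContDiffBump (0 : SpaceTime n) := ⟨(k : ℝ) + 1, k + 2, by positivity, by linarith⟩
  set B := (Metric.closedBall (0 : SpaceTime n) (k + 2)).indicator fun _ => (1 : ℂ) with hB
  have hBm : Measurable B := measurable_const.indicator measurableSet_closedBall
  set c := mixedNorm q₁ r₁ B with hc
  have hct : c < ∞ := by
    rw [hc, mixedNorm_eq_mixedE]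
    refine lt_of_le_of_lt (mixedE_mono fun z => ?_)
      (mixedE_indicator_ball_lt_top q₁ r₁ ENNReal.one_ne_top (k + 2))
    rw [hB, enorm_indicator_eq_indicator_enorm]
    simp
  have hδ' : 0 < δ / (c + 1) := ENNReal.div_pos hδ (by finiteness)
  obtain ⟨ε, hε0, hε⟩ : ∃ ε : ℝ, 0 < ε ∧ ENNReal.ofReal ε ≤ δ / (c + 1) := by
    refine ⟨(min (δ / (c + 1)) 1).toReal, ENNReal.toReal_pos ?_ ?_, ?_⟩
    · exact (lt_min hδ' one_pos).ne'
    · exact (min_le_right _ _).trans_lt ENNReal.one_lt_top |>.ne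
    · rw [ENNReal.ofReal_toReal ((min_le_right _ _).trans_lt ENNReal.one_lt_top).ne]
      exact min_le_left _ _
  have hT := Nice.truncate hF k
  obtain ⟨g, hg1, hg2, hg3⟩ := (hT.memLp (p := 2) (by norm_num)).exist_eLpNorm_sub_le
    (by simp) (by norm_num) hε0
  have hs1 : HasCompactSupport fun z => (χ z : ℂ) * g z := hg1.mul_left
  have hs2 : ContDiff ℝ (⊤ : ℕ∞) fun z => (χ z : ℂ) * g z :=
    (Complex.ofRealCLM.contDiff.comp χ.contDiff).mul hg2
  refine ⟨hs1.toSchwartzMap hs2, ?_⟩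
  have hgm : AEStronglyMeasurable g volume := hg2.continuous.aestronglyMeasurable
  have hsub : AEStronglyMeasurable (fun z => truncate F k z - g z) volume :=
    hT.meas.aestronglyMeasurable.sub hgm
  have hle : ∀ z, ‖(hs1.toSchwartzMap hs2) z - truncate F k z‖ ≤
      ‖B z * (truncate F k z - g z)‖ := by
    intro z
    change ‖(χ z : ℂ) * g z - truncate F k z‖ ≤ _
    by_cases hz : ‖z‖ ≤ k
    · have h1 : χ z = 1 := χ.one_of_mem_closedBall (by
        rw [mem_closedBall_zero_iff]; exact hz.trans (by change (k : ℝ) ≤ k + 1; linarith))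
      rw [h1, hB, Set.indicator_of_mem (by rw [mem_closedBall_zero_iff]; linarith)]
      simp [norm_sub_rev]
    · have h0 : truncate F k z = 0 := Set.indicator_of_notMem (fun h => hz h.1) _
      rw [h0]
      by_cases hz2 : ‖z‖ ≤ k + 2
      · rw [hB, Set.indicator_of_mem (by rw [mem_closedBall_zero_iff]; linarith)]
        simp only [sub_zero, zero_sub, one_mul, norm_neg, norm_mul, Complex.norm_real]
        refine mul_le_of_le_one_left (norm_nonneg _) ?_
        rw [Real.norm_of_nonneg χ.nonneg]
        exact χ.le_one
      · have h1 : χ z = 0 := χ.zero_of_le_dist (by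
          rw [dist_zero_right]; exact (not_le.1 hz2).le)
        rw [h1]
        simp only [Complex.ofReal_zero, zero_mul, sub_zero, norm_zero]
        positivity
  calc mixedNorm q r (fun z => (hs1.toSchwartzMap hs2) z - truncate F k z)
      ≤ mixedNorm q r (fun z => B z * (truncate F k z - g z)) := mixedNorm_mono_ae (ae_of_all _ hle)
    _ ≤ c * mixedNorm 2 2 (fun z => truncate F k z - g z) :=
        mixedNorm_mul_le hBm.aestronglyMeasurable hsub
    _ ≤ c * (δ / (c + 1)) := by
        rw [mixedNorm_two_two hsub]
        exact mul_le_mul_right (hg3.trans hε) c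
    _ ≤ (c + 1) * (δ / (c + 1)) := by gcongr; exact le_self_add
    _ ≤ δ := ENNReal.mul_div_le

/-- Schwartz functions are dense in mixed norms. -/
theorem exists_schwartz_sub_le {q₁ r₁ : ℝ≥0∞} [ENNReal.HolderTriple q₁ 2 q]
    [ENNReal.HolderTriple r₁ 2 r] (hq : q ≠ ∞) (hr : r ≠ ∞) (hq1 : 1 ≤ q) (hr1 : 1 ≤ r)
    {F : SpaceTime n → ℂ} (hF : AEStronglyMeasurable F volume) (hN : mixedNorm q r F ≠ ∞)
    {δ : ℝ≥0∞} (hδ : δ ≠ 0) :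
    ∃ f : 𝓢(SpaceTime n, ℂ), mixedNorm q r (fun z => f z - F z) ≤ δ := by
  set F' := hF.mk F with hF'
  have hFm : Measurable F' := hF.stronglyMeasurable_mk.measurable
  have hN' : mixedNorm q r F' ≠ ∞ := by
    rwa [← mixedNorm_congr_ae (hF.ae_eq_mk.mono fun z hz => congrArg norm hz)]
  have hδ2 : 0 < δ / 2 := ENNReal.half_pos hδ
  obtain ⟨k, hk⟩ := ((tendsto_mixedNorm_sub_truncate hq hr (zero_lt_one.trans_le hq1).ne' hFm
    hN').eventually_le_const hδ2).exists
  obtain ⟨f, hf⟩ := exists_schwartz_sub_truncate_le (q := q) (r := r) (q₁ := q₁) (r₁ := r₁) hFm k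
    hδ2.ne'
  refine ⟨f, ?_⟩
  have hT := measurable_truncate hFm k
  calc mixedNorm q r (fun z => f z - F z) =
        mixedNorm q r (fun z => (f z - truncate F' k z) + (truncate F' k z - F' z)) := by
        refine mixedNorm_congr_ae ?_
        filter_upwards [hF.ae_eq_mk] with z hz
        rw [hz, sub_add_sub_cancel]
    _ ≤ δ / 2 + δ / 2 := by
        refine (mixedNorm_add_le hq1 hr1
          (f.continuous.aestronglyMeasurable.sub hT.aestronglyMeasurable)
          (hT.sub hFm).aestronglyMeasurable).trans (add_le_add hf ?_)
        exact (mixedNorm_sub_comm _ _).le.trans hk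
    _ = δ := ENNReal.add_halves δ

end Density

/-! ### Extension of the multiplier to mixed-norm spaces -/

lemma integrable_chr_mul {f : SpaceTime n → ℂ} (hf : Integrable f) (ζ : SpaceTime n) :
    Integrable fun z : SpaceTime n => chr z.1 ζ.1 * chr z.2 ζ.2 * f z :=
  hf.bdd_mul (c := 1) (Measurable.aestronglyMeasurable (by fun_prop))
    (ae_of_all _ fun z => by simp [norm_chr])

lemma stFourier_add_mul {f g : SpaceTime n → ℂ} (hf : Integrable f) (hg : Integrable g) (c : ℂ)
    (ζ : SpaceTime n) :
    stFourier (fun z => f z + c * g z) ζ = stFourier f ζ + c * stFourier g ζ := by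
  simp only [stFourier]
  rw [← integral_const_mul, ← integral_add (integrable_chr_mul hf ζ)
    ((integrable_chr_mul hg ζ).const_mul c)]
  refine integral_congr_ae (ae_of_all _ fun z => ?_)
  simp only
  ring

lemma schwartzS_add_smul {ν : Space n} (hν : ν ≠ 0) (f g : 𝓢(SpaceTime n, ℂ)) (c : ℂ)
    (z : SpaceTime n) :
    schwartzS ν (f + c • g) z = schwartzS ν f z + c * schwartzS ν g z := by
  have h : multiplied ν (f + c • g) = fun ζ => multiplied ν f ζ + c * multiplied ν g ζ := by
    funext ζ
    have := stFourier_add_mul (f := f) (g := g) f.integrable g.integrable c (-ζ)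
    simp only [multiplied]
    change _ * stFourier (fun z => f z + c * g z) _ = _
    rw [this]
    ring
  simp only [schwartzS_eq]
  rw [h, stFourier_add_mul (integrable_multiplied hν f) (integrable_multiplied hν g)]
  ring

lemma form_add_mul {ν : Space n} (hν : ν ≠ 0) {ε : ℝ} (hε : 0 < ε) {f g h : SpaceTime n → ℂ}
    (hf : Nice volume f) (hg : Nice volume g) (hh : Nice volume h) (c : ℂ) :
    form ν ε (fun z => f z + c * g z) h = form ν ε f h + c * form ν ε g h := by
  simp only [form]
  rw [← integral_const_mul, ← integral_add (integrable_formIntegrand hν hε hf.meas hh.meas)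
    ((integrable_formIntegrand hν hε hg.meas hh.meas).const_mul c)]
  refine integral_congr_ae (ae_of_all _ fun ζ => ?_)
  simp only [formIntegrand]
  rw [stFourier_add_mul hf.int hg.int]
  ring

lemma Nice.add_mul {f g : SpaceTime n → ℂ} (hf : Nice volume f) (hg : Nice volume g) (c : ℂ) :
    Nice volume fun z => f z + c * g z := by
  obtain ⟨M, hM⟩ := hf.bdd
  obtain ⟨N, hN⟩ := hg.bdd
  refine ⟨hf.meas.add (hg.meas.const_mul c), hf.int.add (hg.int.const_mul c), M + ‖c‖ * N,
    fun z => (norm_add_le _ _).trans ?_⟩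
  rw [norm_mul]
  gcongr
  · exact hM z
  · exact hN z

/-- The space-time estimate for the regularised forms, with a constant independent of the
regularisation. -/
def FormBound (ν : Space n) (q r C : ℝ≥0∞) : Prop :=
  ∀ ε : ℝ, 0 < ε → ∀ f g : SpaceTime n → ℂ, Nice volume f → Nice volume g →
    ‖form ν ε f g‖ₑ ≤ C * mixedNorm q r f * mixedNorm q r g

section Extension

variable {ν : Space n} {q r C : ℝ≥0∞}

lemma FormBound.mixedNorm_schwartzS_le (hB : FormBound ν q r C) (hν : ν ≠ 0) (hq : q ≠ ∞)
    (hr : r ≠ ∞) (hq1 : 1 ≤ q) (hr1 : 1 ≤ r) (f : 𝓢(SpaceTime n, ℂ)) :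
    mixedNorm q.conjExponent r.conjExponent (schwartzS ν f) ≤ C * mixedNorm q r f := by
  have := ENNReal.HolderConjugate.conjExponent hq1
  have := ENNReal.HolderConjugate.conjExponent hr1
  obtain ⟨M, hM⟩ := exists_norm_schwartzS_le ν f
  refine mixedNorm_le_of_forall_nice (q := q) (r := r) hq hr (measurable_schwartzS ν f) hM
    fun g hg => ?_
  exact enorm_integral_schwartzS_mul_le hν f hg.meas hg.int fun ε hε =>
    hB ε hε f g (Nice.schwartz f) hg

lemma FormBound.mixedNorm_schwartzS_sub_le (hB : FormBound ν q r C) (hν : ν ≠ 0) (hq : q ≠ ∞)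
    (hr : r ≠ ∞) (hq1 : 1 ≤ q) (hr1 : 1 ≤ r) (f g : 𝓢(SpaceTime n, ℂ)) :
    mixedNorm q.conjExponent r.conjExponent (fun z => schwartzS ν f z - schwartzS ν g z) ≤
      C * mixedNorm q r (fun z => f z - g z) := by
  have h := hB.mixedNorm_schwartzS_le hν hq hr hq1 hr1 (f + (-1 : ℂ) • g)
  have e1 : (fun z => schwartzS ν f z - schwartzS ν g z) = schwartzS ν (f + (-1 : ℂ) • g) := by
    funext z
    rw [schwartzS_add_smul hν]
    ring
  have e2 : (fun z => f z - g z) = (f + (-1 : ℂ) • g : 𝓢(SpaceTime n, ℂ)) := by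
    funext z
    simp [sub_eq_add_neg]
  rw [e1, e2]
  exact h

lemma mixedNorm_sub_le_add (hq : 1 ≤ q) (hr : 1 ≤ r) {f g h : SpaceTime n → ℂ}
    (hf : AEStronglyMeasurable f volume) (hg : AEStronglyMeasurable g volume)
    (hh : AEStronglyMeasurable h volume) :
    mixedNorm q r (fun z => f z - h z) ≤
      mixedNorm q r (fun z => f z - g z) + mixedNorm q r (fun z => g z - h z) := by
  refine le_trans (le_of_eq ?_) (mixedNorm_add_le hq hr (hf.sub hg) (hg.sub hh))
  simp only [sub_add_sub_cancel]

lemma one_le_conjExponent (q : ℝ≥0∞) : 1 ≤ q.conjExponent := le_self_add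

/-- A rapidly Cauchy sequence in the mixed norm converges almost everywhere. -/
lemma exists_ae_tendsto_of_mixedNorm_le {Q R : ℝ≥0∞} (hQ : 1 ≤ Q) (hR : 1 ≤ R)
    {h : ℕ → SpaceTime n → ℂ} (hm : ∀ k, Measurable (h k))
    (hsum : ∑' k, mixedNorm Q R (fun z => h (k + 1) z - h k z) ≠ ∞) :
    ∃ G : SpaceTime n → ℂ, Measurable G ∧
      ∀ᵐ z, Tendsto (fun k => h k z) atTop (𝓝 (G z)) := by
  refine measurable_limit_of_tendsto_metrizable_ae (fun k => (hm k).aemeasurable) ?_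
  have := ENNReal.HolderConjugate.conjExponent hQ
  have := ENNReal.HolderConjugate.conjExponent hR
  set B : ℕ → Set (SpaceTime n) := fun m => Metric.closedBall 0 m with hB
  have hBm : ∀ m, MeasurableSet (B m) := fun m => measurableSet_closedBall
  have hd : ∀ k, Measurable fun z => ‖h (k + 1) z - h k z‖ₑ := fun k =>
    ((hm (k + 1)).sub (hm k)).enorm
  -- On a ball the mixed norm dominates the `L¹` norm, so the increments are summable almost
  -- everywhere.
  have hfin : ∀ m, ∫⁻ z in B m, ∑' k, ‖h (k + 1) z - h k z‖ₑ ≠ ∞ := by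
    intro m
    set c := mixedE Q.conjExponent R.conjExponent ((B m).indicator fun _ => (1 : ℝ≥0∞)) with hc
    have hct : c ≠ ∞ := (mixedE_indicator_ball_lt_top _ _ ENNReal.one_ne_top m).ne
    have h1 : ∀ k, ∫⁻ z in B m, ‖h (k + 1) z - h k z‖ₑ ≤
        mixedNorm Q R (fun z => h (k + 1) z - h k z) * c := by
      intro k
      rw [← lintegral_indicator (hBm m), mixedNorm_eq_mixedE]
      have hone : Measurable ((B m).indicator fun _ => (1 : ℝ≥0∞)) :=
        measurable_const.indicator (hBm m)
      have h2 := mixedE_mul_le (q := 1) (r := 1) (q₁ := Q) (r₁ := R) (q₂ := Q.conjExponent)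
        (r₂ := R.conjExponent) (hd k) hone
      rw [mixedE_one_one (by fun_prop)] at h2
      refine (lintegral_mono fun z => ?_).trans h2
      by_cases hz : z ∈ B m
      · simp only [Set.indicator_of_mem hz, mul_one, le_refl]
      · simp only [Set.indicator_of_notMem hz, zero_le]
    rw [lintegral_tsum fun k => (hd k).aemeasurable]
    refine ((ENNReal.tsum_le_tsum h1).trans_lt ?_).ne
    rw [ENNReal.tsum_mul_right]
    exact ENNReal.mul_lt_top hsum.lt_top hct.lt_top
  have hae : ∀ᵐ z : SpaceTime n, ∑' k, ‖h (k + 1) z - h k z‖ₑ < ∞ := by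
    have h1 : ∀ m, ∀ᵐ z : SpaceTime n, z ∈ B m → ∑' k, ‖h (k + 1) z - h k z‖ₑ < ∞ := fun m =>
      (ae_restrict_iff' (hBm m)).1 (ae_lt_top (Measurable.tsum hd) (hfin m))
    filter_upwards [ae_all_iff.2 h1] with z hz
    obtain ⟨m, hm⟩ := exists_nat_ge ‖z‖
    exact hz m (by rw [hB, mem_closedBall_zero_iff]; exact hm)
  filter_upwards [hae] with z hz
  refine cauchySeq_tendsto_of_complete (cauchySeq_of_summable_dist ?_)
  have h1 : Summable fun k => ‖h (k + 1) z - h k z‖₊ := by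
    rw [← ENNReal.tsum_coe_ne_top_iff_summable]
    exact hz.ne
  refine (NNReal.summable_coe.2 h1).congr fun k => ?_
  rw [dist_comm, dist_eq_norm, coe_nnnorm]

/-- The extension of `S_ν` by density is defined on the whole mixed-norm space. -/
theorem FormBound.exists_isS (hB : FormBound ν q r C) (hC : C ≠ ∞) (hν : ν ≠ 0) (hq : q ≠ ∞)
    (hr : r ≠ ∞) (hq1 : 1 ≤ q) (hr1 : 1 ≤ r) {q₁ r₁ : ℝ≥0∞} [ENNReal.HolderTriple q₁ 2 q]
    [ENNReal.HolderTriple r₁ 2 r] {F : SpaceTime n → ℂ} (hF : AEStronglyMeasurable F volume)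
    (hN : mixedNorm q r F ≠ ∞) : ∃ G, IsS ν q r F G := by
  set Q := q.conjExponent
  set R := r.conjExponent
  have hQ : 1 ≤ Q := one_le_conjExponent q
  have hR : 1 ≤ R := one_le_conjExponent r
  have hp : ∀ k : ℕ, (2⁻¹ : ℝ≥0∞) ^ k ≠ 0 := fun k => pow_ne_zero _ (by simp)
  choose f hf using fun k : ℕ =>
    exists_schwartz_sub_le (q₁ := q₁) (r₁ := r₁) hq hr hq1 hr1 hF hN (hp k)
  have hfm : ∀ k, AEStronglyMeasurable (f k) volume := fun k =>
    (f k).continuous.aestronglyMeasurable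
  have hdiff : ∀ k l, mixedNorm Q R (fun z => schwartzS ν (f k) z - schwartzS ν (f l) z) ≤
      C * ((2⁻¹ : ℝ≥0∞) ^ k + (2⁻¹ : ℝ≥0∞) ^ l) := by
    intro k l
    refine (hB.mixedNorm_schwartzS_sub_le hν hq hr hq1 hr1 (f k) (f l)).trans
      (mul_le_mul_right ?_ C)
    refine (mixedNorm_sub_le_add hq1 hr1 (hfm k) hF (hfm l)).trans (add_le_add (hf k) ?_)
    rw [mixedNorm_sub_comm]
    exact hf l
  have hSm : ∀ k, Measurable (schwartzS ν (f k)) := fun k => measurable_schwartzS ν _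
  obtain ⟨G, hGm, hG⟩ := exists_ae_tendsto_of_mixedNorm_le hQ hR hSm (by
    refine ((ENNReal.tsum_le_tsum fun k => hdiff (k + 1) k).trans_lt ?_).ne
    rw [ENNReal.tsum_mul_left, ENNReal.tsum_add]
    refine ENNReal.mul_lt_top hC.lt_top (ENNReal.add_lt_top.2 ⟨?_, ?_⟩)
    · refine lt_of_le_of_lt (b := ∑' k : ℕ, (2⁻¹ : ℝ≥0∞) ^ k) ?_ (by simp [ENNReal.tsum_geometric])
      exact ENNReal.tsum_le_tsum fun k => pow_le_pow_right_of_le_one' (by simp) (Nat.le_succ k)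
    · simp [ENNReal.tsum_geometric])
  have hpow : Tendsto (fun k : ℕ => (2⁻¹ : ℝ≥0∞) ^ k) atTop (𝓝 0) :=
    ENNReal.tendsto_pow_atTop_nhds_zero_of_lt_one (by simp)
  refine ⟨G, hF, hGm.aestronglyMeasurable, f, ?_, ?_⟩
  · exact tendsto_of_tendsto_of_tendsto_of_le_of_le tendsto_const_nhds hpow (fun _ => zero_le) hf
  · have hle : ∀ k, mixedNorm Q R (fun z => schwartzS ν (f k) z - G z) ≤ C * (2⁻¹ : ℝ≥0∞) ^ k := by
      intro k
      have hae : ∀ᵐ z, ‖schwartzS ν (f k) z - G z‖ₑ =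
          liminf (fun l => ‖schwartzS ν (f k) z - schwartzS ν (f l) z‖ₑ) atTop := by
        filter_upwards [hG] with z hz
        exact ((tendsto_const_nhds.sub hz).enorm.liminf_eq).symm
      have hlim : Tendsto (fun l : ℕ => C * ((2⁻¹ : ℝ≥0∞) ^ k + (2⁻¹ : ℝ≥0∞) ^ l)) atTop
          (𝓝 (C * (2⁻¹ : ℝ≥0∞) ^ k)) := by
        have h1 := ENNReal.Tendsto.const_mul ((tendsto_const_nhds (x := (2⁻¹ : ℝ≥0∞) ^ k)).add hpow)
          (Or.inr hC)
        simpa using h1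
      rw [mixedNorm_eq_mixedE]
      calc _ = mixedE Q R (fun z =>
            liminf (fun l => ‖schwartzS ν (f k) z - schwartzS ν (f l) z‖ₑ) atTop) :=
            mixedE_congr_ae hae
        _ ≤ liminf (fun l => mixedE Q R
            (fun z => ‖schwartzS ν (f k) z - schwartzS ν (f l) z‖ₑ)) atTop :=
            mixedE_liminf_le fun l => ((hSm k).sub (hSm l)).enorm
        _ ≤ liminf (fun l : ℕ => C * ((2⁻¹ : ℝ≥0∞) ^ k + (2⁻¹ : ℝ≥0∞) ^ l)) atTop := by
            refine liminf_le_liminf (Eventually.of_forall fun l => ?_)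
            simpa only [mixedNorm_eq_mixedE] using hdiff k l
        _ = _ := hlim.liminf_eq
    refine tendsto_of_tendsto_of_tendsto_of_le_of_le tendsto_const_nhds ?_ (fun _ => zero_le) hle
    simpa using ENNReal.Tendsto.const_mul hpow (Or.inr hC)

lemma IsS.congr {F F' G : SpaceTime n → ℂ} (h : IsS ν q r F G)
    (hF' : AEStronglyMeasurable F' volume) (e : F =ᵐ[volume] F') : IsS ν q r F' G := by
  obtain ⟨h1, h2, f, h3, h4⟩ := h
  refine ⟨hF', h2, f, h3.congr fun k => ?_, h4⟩
  refine mixedNorm_congr_ae ?_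
  filter_upwards [e] with z hz
  rw [hz]

lemma IsS.add_mul (hν : ν ≠ 0) (hq1 : 1 ≤ q) (hr1 : 1 ≤ r) {F₁ F₂ G₁ G₂ : SpaceTime n → ℂ}
    (h₁ : IsS ν q r F₁ G₁) (h₂ : IsS ν q r F₂ G₂) (c : ℂ) :
    IsS ν q r (fun z => F₁ z + c * F₂ z) (fun z => G₁ z + c * G₂ z) := by
  obtain ⟨m₁, l₁, f₁, hf₁, hg₁⟩ := h₁
  obtain ⟨m₂, l₂, f₂, hf₂, hg₂⟩ := h₂
  have key : ∀ {Q R : ℝ≥0∞}, 1 ≤ Q → 1 ≤ R → ∀ {u₁ u₂ : ℕ → SpaceTime n → ℂ}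
      {v₁ v₂ : SpaceTime n → ℂ}, (∀ k, AEStronglyMeasurable (u₁ k) volume) →
      (∀ k, AEStronglyMeasurable (u₂ k) volume) → AEStronglyMeasurable v₁ volume →
      AEStronglyMeasurable v₂ volume →
      Tendsto (fun k => mixedNorm Q R fun z => u₁ k z - v₁ z) atTop (𝓝 0) →
      Tendsto (fun k => mixedNorm Q R fun z => u₂ k z - v₂ z) atTop (𝓝 0) →
      Tendsto (fun k => mixedNorm Q R fun z => (u₁ k z + c * u₂ k z) - (v₁ z + c * v₂ z))
        atTop (𝓝 0) := by
    intro Q R hQ hR u₁ u₂ v₁ v₂ a₁ a₂ b₁ b₂ t₁ t₂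
    have ht : Tendsto (fun k => mixedNorm Q R (fun z => u₁ k z - v₁ z) +
        ‖c‖ₑ * mixedNorm Q R (fun z => u₂ k z - v₂ z)) atTop (𝓝 0) := by
      simpa using t₁.add (ENNReal.Tendsto.const_mul t₂ (Or.inr (enorm_ne_top (x := c))))
    refine tendsto_of_tendsto_of_tendsto_of_le_of_le tendsto_const_nhds ht (fun _ => zero_le)
      fun k => ?_
    simp only
    rw [← mixedNorm_mul_left]
    refine le_trans (le_of_eq ?_) (mixedNorm_add_le hQ hR ((a₁ k).sub b₁)
      (((a₂ k).sub b₂).const_mul c))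
    congr 1
    funext z
    ring
  refine ⟨m₁.add (m₂.const_mul c), l₁.add (l₂.const_mul c), fun k => f₁ k + c • f₂ k, ?_, ?_⟩
  · exact key hq1 hr1 (fun k => (f₁ k).continuous.aestronglyMeasurable)
      (fun k => (f₂ k).continuous.aestronglyMeasurable) m₁ m₂ hf₁ hf₂
  · simp only [schwartzS_add_smul hν]
    exact key (one_le_conjExponent q) (one_le_conjExponent r)
      (fun k => (measurable_schwartzS ν _).aestronglyMeasurable)
      (fun k => (measurable_schwartzS ν _).aestronglyMeasurable) l₁ l₂ hg₁ hg₂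

theorem FormBound.mixedNorm_isS_le (hB : FormBound ν q r C) (hC : C ≠ ∞) (hν : ν ≠ 0) (hq : q ≠ ∞)
    (hr : r ≠ ∞) (hq1 : 1 ≤ q) (hr1 : 1 ≤ r) {F G : SpaceTime n → ℂ} (h : IsS ν q r F G) :
    mixedNorm q.conjExponent r.conjExponent G ≤ C * mixedNorm q r F := by
  obtain ⟨h1, h2, f, h3, h4⟩ := h
  have hlim : Tendsto (fun k => mixedNorm q.conjExponent r.conjExponent
      (fun z => schwartzS ν (f k) z - G z) + C * (mixedNorm q r (fun z => f k z - F z) +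
        mixedNorm q r F)) atTop (𝓝 (0 + C * (0 + mixedNorm q r F))) :=
    h4.add (ENNReal.Tendsto.const_mul (h3.add tendsto_const_nhds) (Or.inr hC))
  rw [zero_add, zero_add] at hlim
  refine ge_of_tendsto' hlim fun k => ?_
  have hS := (measurable_schwartzS ν (f k)).aestronglyMeasurable (μ := volume)
  have hf := (f k).continuous.aestronglyMeasurable (μ := volume)
  calc mixedNorm q.conjExponent r.conjExponent G
      = mixedNorm q.conjExponent r.conjExponent
          (fun z => (G z - schwartzS ν (f k) z) + schwartzS ν (f k) z) := by simp
    _ ≤ mixedNorm q.conjExponent r.conjExponent (fun z => G z - schwartzS ν (f k) z) +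
          mixedNorm q.conjExponent r.conjExponent (schwartzS ν (f k)) :=
        mixedNorm_add_le (one_le_conjExponent q) (one_le_conjExponent r) (h2.sub hS) hS
    _ ≤ _ := by
        rw [mixedNorm_sub_comm]
        refine add_le_add le_rfl ((hB.mixedNorm_schwartzS_le hν hq hr hq1 hr1 (f k)).trans
          (mul_le_mul_right ?_ C))
        calc mixedNorm q r (f k) = mixedNorm q r (fun z => (f k z - F z) + F z) := by simp
          _ ≤ _ := mixedNorm_add_le hq1 hr1 (hf.sub h1) h1

/-- The extension of `S_ν` is well defined. -/
theorem FormBound.isS_unique (hB : FormBound ν q r C) (hC : C ≠ ∞) (hν : ν ≠ 0) (hq : q ≠ ∞)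
    (hr : r ≠ ∞) (hq1 : 1 ≤ q) (hr1 : 1 ≤ r) {F F' G G' : SpaceTime n → ℂ} (h : IsS ν q r F G)
    (h' : IsS ν q r F' G') (e : F =ᵐ[volume] F') : G =ᵐ[volume] G' := by
  have h1 := hB.mixedNorm_isS_le hC hν hq hr hq1 hr1 (h.add_mul hν hq1 hr1 h' (-1))
  have h2 : mixedNorm q r (fun z => F z + -1 * F' z) = 0 := by
    rw [mixedNorm_congr_ae (g := fun _ => (0 : ℂ))]
    · simp [mixedNorm]
    · filter_upwards [e] with z hz
      rw [hz]
      simp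
  rw [h2, mul_zero, nonpos_iff_eq_zero] at h1
  have hm : AEStronglyMeasurable (fun z => G z + -1 * G' z) volume := h.2.1.add (h'.2.1.const_mul _)
  rw [mixedNorm_congr_ae (hm.ae_eq_mk.mono fun z hz => congrArg norm hz), mixedNorm_eq_mixedE] at h1
  have h3 := ae_eq_zero_of_mixedE
    (zero_lt_one.trans_le (one_le_conjExponent q)).ne'
    (zero_lt_one.trans_le (one_le_conjExponent r)).ne'
    hm.stronglyMeasurable_mk.measurable.enorm h1
  filter_upwards [h3, hm.ae_eq_mk] with z hz hz2
  rw [Pi.zero_apply, enorm_eq_zero, ← hz2] at hz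
  linear_combination hz

/-- Hölder's inequality for dual mixed norms. -/
lemma lintegral_enorm_mul_le (hq1 : 1 ≤ q) (hr1 : 1 ≤ r) {G H : SpaceTime n → ℂ}
    (hG : AEStronglyMeasurable G volume) (hH : AEStronglyMeasurable H volume) :
    ∫⁻ z, ‖G z * H z‖ₑ ≤ mixedNorm q.conjExponent r.conjExponent G * mixedNorm q r H := by
  have := (ENNReal.HolderConjugate.conjExponent hq1).symm
  have := (ENNReal.HolderConjugate.conjExponent hr1).symm
  refine (mixedNorm_one_one (f := fun z => G z * H z) (hG.mul hH)).symm.le.trans ?_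
  exact mixedNorm_mul_le hG hH

lemma integrable_mul_of_mixedNorm (hq1 : 1 ≤ q) (hr1 : 1 ≤ r) {G H : SpaceTime n → ℂ}
    (hG : AEStronglyMeasurable G volume) (hH : AEStronglyMeasurable H volume)
    (hGN : mixedNorm q.conjExponent r.conjExponent G ≠ ∞) (hHN : mixedNorm q r H ≠ ∞) :
    Integrable fun z => G z * H z :=
  ⟨hG.mul hH, (lintegral_enorm_mul_le hq1 hr1 hG hH).trans_lt
    (ENNReal.mul_lt_top hGN.lt_top hHN.lt_top)⟩

end Extension

/-! ### The decaying bound of the extended multiplier -/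

lemma waveNorm_mono {ω : Space n} {f g : SpaceTime n → ℂ} (h : ∀ z, ‖f z‖ ≤ ‖g z‖) :
    waveNorm ω f ≤ waveNorm ω g :=
  lintegral_mono fun _ => eLpNorm_mono fun _ => h _

section Wave

variable {ν : Space n} {q r C : ℝ≥0∞}

/-- Transfer of a bound `K` of the regularised forms at `F` to a function `G` in place of `S_ν F`,
with errors measured by a Schwartz approximation `f` of `F`. -/
lemma FormBound.enorm_integral_isS_mul_le_add (hB : FormBound ν q r C) (hν : ν ≠ 0) (hq1 : 1 ≤ q)
    (hr1 : 1 ≤ r) {F G H : SpaceTime n → ℂ} (hF : Nice volume F) (hH : Nice volume H) {K : ℝ≥0∞}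
    (hK : ∀ ε : ℝ, 0 < ε → ‖form ν ε F H‖ₑ ≤ K) {f : 𝓢(SpaceTime n, ℂ)}
    (hG : AEStronglyMeasurable G volume)
    (hGi : Integrable fun z => G z * H z) :
    ‖∫ z, G z * H z‖ₑ ≤ K + C * mixedNorm q r (fun z => f z - F z) * mixedNorm q r H +
      mixedNorm q.conjExponent r.conjExponent (fun z => schwartzS ν f z - G z) *
        mixedNorm q r H := by
  have hS := measurable_schwartzS ν f
  have hd : Nice volume fun z => f z + (-1 : ℂ) * F z := (Nice.schwartz f).add_mul hF (-1)
  have hform : ∀ ε : ℝ, 0 < ε → ‖form ν ε f H‖ₑ ≤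
      K + C * mixedNorm q r (fun z => f z - F z) * mixedNorm q r H := by
    intro ε hε
    have e1 : (f : SpaceTime n → ℂ) = fun z => F z + 1 * (f z + (-1 : ℂ) * F z) := by
      funext z; ring
    have e2 : (fun z => f z - F z) = fun z => f z + (-1 : ℂ) * F z := by
      funext z; ring
    rw [e1, form_add_mul hν hε hF hd hH, one_mul, ← e1, e2]
    exact (enorm_add_le _ _).trans (add_le_add (hK ε hε) (hB ε hε _ _ hd hH))
  obtain ⟨M, hM⟩ := exists_norm_schwartzS_le ν f
  have hSi : Integrable fun z => schwartzS ν f z * H z :=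
    hH.int.bdd_mul (c := M) hS.aestronglyMeasurable (ae_of_all _ hM)
  have e3 : ∫ z, G z * H z = (∫ z, schwartzS ν f z * H z) -
      ∫ z, (schwartzS ν f z - G z) * H z := by
    rw [← integral_sub hSi ((hSi.sub hGi).congr (ae_of_all _ fun z => (sub_mul _ _ _).symm))]
    refine integral_congr_ae (ae_of_all _ fun z => ?_)
    simp only
    ring
  rw [e3]
  refine (enorm_sub_le).trans (add_le_add
    (enorm_integral_schwartzS_mul_le hν f hH.meas hH.int hform) ?_)
  exact (enorm_integral_le_lintegral_enorm _).trans
    (lintegral_enorm_mul_le hq1 hr1 (hS.aestronglyMeasurable.sub hG) hH.meas.aestronglyMeasurable)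

/-- The bilinear form of the extended multiplier satisfies the bound that decays in `ν`. -/
theorem FormBound.enorm_integral_isS_mul_le_waveNorm {a : ℝ} {ω : Space n} (ha : 0 < a)
    (hω : ‖ω‖ = 1) (hB : FormBound (a • ω) q r C) (hC : C ≠ ∞) (hq : q ≠ ∞) (hr : r ≠ ∞)
    (hq1 : 1 ≤ q) (hr1 : 1 ≤ r) {q₁ r₁ : ℝ≥0∞} [ENNReal.HolderTriple q₁ 2 q]
    [ENNReal.HolderTriple r₁ 2 r] {F G H : SpaceTime n → ℂ} (h : IsS (a • ω) q r F G)
    (hF : Measurable F) (hH : Measurable H) (hFN : mixedNorm q r F ≠ ∞)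
    (hHN : mixedNorm q r H ≠ ∞) :
    ‖∫ z, G z * H z‖ₑ ≤ ENNReal.ofReal ((2 * Real.pi) ^ (n + 1) / a) *
      waveNorm ω F * waveNorm ω H := by
  have hω0 : ω ≠ 0 := by intro h; rw [h] at hω; simp at hω
  have hν : a • ω ≠ 0 := smul_ne_zero ha.ne' hω0
  set K := ENNReal.ofReal ((2 * Real.pi) ^ (n + 1) / a) * waveNorm ω F * waveNorm ω H with hK
  have hq0 : q ≠ 0 := (zero_lt_one.trans_le hq1).ne'
  -- The bound is proved for truncations first; these are integrable and bounded.
  have nice : ∀ k l, ∀ G', IsS (a • ω) q r (truncate F k) G' →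
      ‖∫ z, G' z * truncate H l z‖ₑ ≤ K := by
    intro k l G' hG'
    have hFk := Nice.truncate hF k
    have hHl := Nice.truncate hH l
    have hmono : ∀ {f : SpaceTime n → ℂ} (k : ℕ), mixedNorm q r f ≠ ∞ →
        mixedNorm q r (truncate f k) ≠ ∞ := fun k hf =>
      ((mixedNorm_mono_ae (ae_of_all _ (norm_truncate_le _ k))).trans_lt hf.lt_top).ne
    have hG'N := (hB.mixedNorm_isS_le hC hν hq hr hq1 hr1 hG').trans_lt
      (ENNReal.mul_lt_top hC.lt_top (hmono k hFN).lt_top)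
    have hi := integrable_mul_of_mixedNorm hq1 hr1 hG'.2.1 hHl.meas.aestronglyMeasurable hG'N.ne
      (hmono l hHN)
    have hform : ∀ ε : ℝ, 0 < ε → ‖form (a • ω) ε (truncate F k) (truncate H l)‖ₑ ≤ K := by
      intro ε hε
      refine (enorm_form_le_waveNorm ω ha hω hε hFk.meas hFk.int hHl.meas hHl.int).trans ?_
      rw [hK]
      gcongr
      · exact waveNorm_mono (norm_truncate_le F k)
      · exact waveNorm_mono (norm_truncate_le H l)
    obtain ⟨-, hGm, f, h3, h4⟩ := hG'
    have hlim : Tendsto (fun m => K + C * mixedNorm q r (fun z => f m z - truncate F k z) *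
        mixedNorm q r (truncate H l) + mixedNorm q.conjExponent r.conjExponent
          (fun z => schwartzS (a • ω) (f m) z - G' z) * mixedNorm q r (truncate H l)) atTop
        (𝓝 (K + C * 0 * mixedNorm q r (truncate H l) + 0 * mixedNorm q r (truncate H l))) := by
      refine (tendsto_const_nhds.add ?_).add ?_
      · exact ENNReal.Tendsto.mul_const (ENNReal.Tendsto.const_mul h3 (Or.inr hC))
          (Or.inr (hmono l hHN))
      · exact ENNReal.Tendsto.mul_const h4 (Or.inr (hmono l hHN))
    simp only [mul_zero, zero_mul, add_zero] at hlim
    exact ge_of_tendsto' hlim fun m =>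
      hB.enorm_integral_isS_mul_le_add hν hq1 hr1 hFk hHl hform hGm hi
  have hFt := tendsto_mixedNorm_sub_truncate hq hr hq0 hF hFN
  have hHt := tendsto_mixedNorm_sub_truncate hq hr hq0 hH hHN
  have hGN := (hB.mixedNorm_isS_le hC hν hq hr hq1 hr1 h).trans_lt
      (ENNReal.mul_lt_top hC.lt_top hFN.lt_top)
  set NG := mixedNorm q.conjExponent r.conjExponent G with hNG
  have hlim : Tendsto (fun k => K + C * mixedNorm q r (fun z => F z - truncate F k z) *
      mixedNorm q r H + NG * mixedNorm q r (fun z => H z - truncate H k z)) atTop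
      (𝓝 (K + C * 0 * mixedNorm q r H + NG * 0)) := by
    refine (tendsto_const_nhds.add ?_).add ?_
    · exact ENNReal.Tendsto.mul_const (ENNReal.Tendsto.const_mul hFt (Or.inr hC)) (Or.inr hHN)
    · exact ENNReal.Tendsto.const_mul hHt (Or.inr hGN.ne)
  simp only [mul_zero, zero_mul, add_zero] at hlim
  refine ge_of_tendsto' hlim fun k => ?_
  have hFk := Nice.truncate hF k
  have hHk := Nice.truncate hH k
  have hFkN : mixedNorm q r (truncate F k) ≠ ∞ :=
    ((mixedNorm_mono_ae (ae_of_all _ (norm_truncate_le _ k))).trans_lt hFN.lt_top).ne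
  have hHkN : mixedNorm q r (truncate H k) ≤ mixedNorm q r H :=
    mixedNorm_mono_ae (ae_of_all _ (norm_truncate_le _ k))
  obtain ⟨G', hG'⟩ := hB.exists_isS (q₁ := q₁) (r₁ := r₁) hC hν hq hr hq1 hr1
    hFk.meas.aestronglyMeasurable hFkN
  have hdiff := hB.mixedNorm_isS_le hC hν hq hr hq1 hr1 (h.add_mul hν hq1 hr1 hG' (-1))
  have e1 : (fun z => F z + -1 * truncate F k z) = fun z => F z - truncate F k z := by
    funext z; ring
  have hG'N := (hB.mixedNorm_isS_le hC hν hq hr hq1 hr1 hG').trans_lt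
      (ENNReal.mul_lt_top hC.lt_top hFkN.lt_top)
  rw [e1] at hdiff
  have hDm : AEStronglyMeasurable (fun z => G z + -1 * G' z) volume :=
    h.2.1.add (hG'.2.1.const_mul _)
  have hHs : AEStronglyMeasurable (fun z => H z - truncate H k z) volume :=
    (hH.sub hHk.meas).aestronglyMeasurable
  have hsubN : mixedNorm q r (fun z => H z - truncate H k z) ≠ ∞ := by
    refine ((mixedNorm_mono_ae (g := H) (ae_of_all _ fun z => ?_)).trans_lt hHN.lt_top).ne
    by_cases hz : z ∈ {z | ‖z‖ ≤ k ∧ ‖H z‖ ≤ k}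
    · simp [truncate, Set.indicator_of_mem hz]
    · simp [truncate, Set.indicator_of_notMem hz]
  have i1 := integrable_mul_of_mixedNorm hq1 hr1 hG'.2.1 hHk.meas.aestronglyMeasurable hG'N.ne
    (hHkN.trans_lt hHN.lt_top).ne
  have i2 := integrable_mul_of_mixedNorm hq1 hr1 hDm hHk.meas.aestronglyMeasurable
    (hdiff.trans_lt (ENNReal.mul_lt_top hC.lt_top (by
      refine (mixedNorm_mono_ae (g := F) (ae_of_all _ fun z => ?_)).trans_lt hFN.lt_top
      by_cases hz : z ∈ {z | ‖z‖ ≤ k ∧ ‖F z‖ ≤ k}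
      · simp [truncate, Set.indicator_of_mem hz]
      · simp [truncate, Set.indicator_of_notMem hz]))).ne (hHkN.trans_lt hHN.lt_top).ne
  have i3 := integrable_mul_of_mixedNorm hq1 hr1 h.2.1 hHs hGN.ne hsubN
  have e2 : ∫ z, G z * H z = (∫ z, G' z * truncate H k z) +
      (∫ z, (G z + -1 * G' z) * truncate H k z) + ∫ z, G z * (H z - truncate H k z) := by
    have i12 : Integrable fun z => G' z * truncate H k z + (G z + -1 * G' z) * truncate H k z :=
      i1.add i2
    rw [← integral_add i1 i2, ← integral_add i12 i3]
    refine integral_congr_ae (ae_of_all _ fun z => ?_)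
    simp only
    ring
  rw [e2]
  refine (enorm_add_le _ _).trans (add_le_add ((enorm_add_le _ _).trans
    (add_le_add (nice k k G' hG') ?_)) ?_)
  · exact (enorm_integral_le_lintegral_enorm _).trans ((lintegral_enorm_mul_le hq1 hr1 hDm
      hHk.meas.aestronglyMeasurable).trans (mul_le_mul' hdiff hHkN))
  · exact (enorm_integral_le_lintegral_enorm _).trans (lintegral_enorm_mul_le hq1 hr1 h.2.1 hHs)

end Wave

/-! ### Slices over hyperplanes -/

section Slices

variable (ω : Space n)

/-- The integral of the squares of the suprema over the hyperplanes with normal `ω`. -/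
def waveSup (f : SpaceTime n → ℂ) : ℝ≥0∞ :=
  ∫⁻ s, eLpNorm (waveSlice ω f s) ∞ volume ^ (2 : ℝ)

lemma measurable_eLpNorm_waveSlice {f : SpaceTime n → ℂ} (hf : Measurable f) (p : ℝ≥0∞) :
    Measurable fun s => eLpNorm (waveSlice ω f s) p volume := by
  have := measurable_eLpNorm_prod (μ := (volume.prod volume : Measure (ℝ × (ℝ ∙ ω)ᗮ)))
    (measurable_waveSlice_uncurry ω hf).enorm p
  simp only [eLpNorm_enorm] at this
  exact this

lemma lintegral_eLpNorm_waveSlice_sq (hω : ‖ω‖ = 1) {f : SpaceTime n → ℂ} (hf : Measurable f) :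
    ∫⁻ s, eLpNorm (waveSlice ω f s) 2 volume ^ (2 : ℝ) = eLpNorm f 2 volume ^ (2 : ℝ) := by
  have h2 : ∀ {α : Type} [MeasurableSpace α] (μ : Measure α) (u : α → ℂ),
      eLpNorm u 2 μ ^ (2 : ℝ) = ∫⁻ x, ‖u x‖ₑ ^ (2 : ℝ) ∂μ := by
    intro α _ μ u
    rw [lintegral_enorm_rpow_eq_eLpNorm two_pos]
    norm_num
  simp only [h2]
  have hm : Measurable fun p : (ℝ × (ℝ ∙ ω)ᗮ) × ℝ => ‖waveSlice ω f p.2 p.1‖ₑ ^ (2 : ℝ) :=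
    (((measurable_waveSlice_uncurry ω hf).comp measurable_swap).enorm).pow_const _
  calc _ = ∫⁻ p : (ℝ × (ℝ ∙ ω)ᗮ) × ℝ, ‖waveSlice ω f p.2 p.1‖ₑ ^ (2 : ℝ) :=
        (lintegral_prod_symm _ hm.aemeasurable).symm
    _ = ∫⁻ p : (ℝ × (ℝ ∙ ω)ᗮ) × ℝ, ‖f (waveEquiv ω hω p)‖ₑ ^ (2 : ℝ) := by
        simp only [waveSlice, waveEquiv_apply]
    _ = _ := (measurePreserving_waveEquiv ω hω).lintegral_comp
        (f := fun z => ‖f z‖ₑ ^ (2 : ℝ)) (by fun_prop)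

lemma waveNorm_mul_le (hω : ‖ω‖ = 1) {V u : SpaceTime n → ℂ} (hV : Measurable V)
    (hu : Measurable u) :
    waveNorm ω (fun z => V z * u z) ≤ waveSup ω V ^ (1 / 2 : ℝ) * eLpNorm u 2 volume := by
  have h1 : ∀ s, eLpNorm (waveSlice ω (fun z => V z * u z) s) 2 volume ≤
      eLpNorm (waveSlice ω V s) ∞ volume * eLpNorm (waveSlice ω u s) 2 volume := by
    intro s
    have hm : ∀ {f : SpaceTime n → ℂ}, Measurable f → Measurable fun q => ‖waveSlice ω f s q‖ₑ :=
      fun hf => ((measurable_waveSlice_uncurry ω hf).comp measurable_prodMk_left).enorm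
    have h := eLpNorm_mul_le_of_holderTriple (μ := (volume : Measure (ℝ × (ℝ ∙ ω)ᗮ)))
      (p := ∞) (q := 2) (r := 2) (hm hV) (hm hu)
    simp_rw [← enorm_mul, eLpNorm_enorm] at h
    exact h
  refine (lintegral_mono h1).trans ((lintegral_mul_le_two
    (measurable_eLpNorm_waveSlice ω hV ∞).aemeasurable
    (measurable_eLpNorm_waveSlice ω hu 2).aemeasurable).trans (le_of_eq ?_))
  rw [eLpNorm_two_eq, eLpNorm_two_eq, lintegral_eLpNorm_waveSlice_sq ω hω hu, ← ENNReal.rpow_mul]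
  norm_num [waveSup]

lemma eLpNorm_top_sq {α : Type*} [MeasurableSpace α] {μ : Measure α} (f : α → ℂ) :
    eLpNorm (fun x => ‖f x‖ ^ 2) ∞ μ = eLpNorm f ∞ μ ^ (2 : ℝ) := by
  have h := eLpNorm_norm_rpow (p := ∞) (μ := μ) f two_pos
  rw [ENNReal.top_mul (by simp)] at h
  rw [← h]
  simp

lemma prod_hyperplaneMeasure (s : ℝ) :
    (volume : Measure ℝ).prod (hyperplaneMeasure ω s) =
      (volume : Measure (ℝ × (ℝ ∙ ω)ᗮ)).map fun q => (q.1, (q.2 : Space n) + s • ω) := by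
  have h := Measure.map_prod_map (volume : Measure ℝ) (volume : Measure (ℝ ∙ ω)ᗮ) measurable_id
    (g := fun y : (ℝ ∙ ω)ᗮ => (y : Space n) + s • ω) (by fun_prop)
  rw [Measure.map_id] at h
  rw [hyperplaneMeasure, h]
  rfl

lemma eLpNorm_hyperplane {f : SpaceTime n → ℂ} (hf : Measurable f) (s : ℝ) :
    eLpNorm (fun z => ‖f z‖ ^ 2) ∞ ((volume : Measure ℝ).prod (hyperplaneMeasure ω s)) =
      eLpNorm (waveSlice ω f s) ∞ volume ^ (2 : ℝ) := by
  rw [eLpNorm_top_sq, prod_hyperplaneMeasure,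
    eLpNorm_map_measure hf.aestronglyMeasurable (Measurable.aemeasurable (by fun_prop))]
  congr 2
  funext q
  simp [waveSlice, add_comm]

lemma ae_ae_hyperplane (hω : ‖ω‖ = 1) {P : SpaceTime n → Prop} (h : ∀ᵐ z : SpaceTime n, P z) :
    ∀ᵐ s : ℝ, ∀ᵐ z ∂(volume : Measure ℝ).prod (hyperplaneMeasure ω s), P z := by
  obtain ⟨N, hN, hNm, hN0⟩ := exists_measurable_superset_of_null (ae_iff.1 h)
  have h1 : ∀ᵐ z : SpaceTime n, z ∉ N := by
    rw [ae_iff]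
    simpa using hN0
  have h2 : ∀ᵐ p : (ℝ × (ℝ ∙ ω)ᗮ) × ℝ, waveEquiv ω hω p ∉ N :=
    (measurePreserving_waveEquiv ω hω).quasiMeasurePreserving.ae h1
  have h3 : ∀ᵐ p : ℝ × (ℝ × (ℝ ∙ ω)ᗮ), waveEquiv ω hω p.swap ∉ N :=
    Measure.measurePreserving_swap.quasiMeasurePreserving.ae h2
  filter_upwards [Measure.ae_ae_of_ae_prod h3] with s hs
  rw [prod_hyperplaneMeasure]
  have h4 : ∀ᵐ z ∂(volume : Measure (ℝ × (ℝ ∙ ω)ᗮ)).map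
      (fun q => (q.1, (q.2 : Space n) + s • ω)), z ∉ N := by
    rw [ae_map_iff (Measurable.aemeasurable (by fun_prop)) hNm.compl]
    filter_upwards [hs] with q hq
    simpa [waveEquiv_apply, add_comm] using hq
  filter_upwards [h4] with z hz
  by_contra hc
  exact hz (hN hc)

end Slices

/-! ### Exponents -/

section Exponents

variable {a b : ℝ≥0∞}

lemma inv_lowerExponent (a : ℝ≥0∞) : (lowerExponent a)⁻¹ = (1 + a⁻¹) / 2 := by
  rw [lowerExponent, ENNReal.inv_div (by simp) (by simp)]

/-- Since `|W|² ∈ L^a` means `W ∈ L^{2a}`, multiplication by `W` maps `L²` to `L^q`. -/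
lemma holderTriple_lowerExponent (a : ℝ≥0∞) :
    ENNReal.HolderTriple (a * 2) 2 (lowerExponent a) := by
  rw [ENNReal.holderTriple_iff, inv_lowerExponent, ENNReal.mul_inv (by simp) (by simp),
    ENNReal.div_eq_inv_mul, mul_add, mul_one, add_comm, mul_comm]

lemma one_le_lowerExponent (ha : 1 ≤ a) : 1 ≤ lowerExponent a := by
  rw [← ENNReal.inv_le_one, inv_lowerExponent]
  refine ENNReal.div_le_of_le_mul ?_
  rw [one_mul, ← one_add_one_eq_two]
  gcongr
  exact ENNReal.inv_le_one.2 ha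

lemma lowerExponent_le_two (a : ℝ≥0∞) : lowerExponent a ≤ 2 := by
  rw [lowerExponent]
  refine ENNReal.div_le_of_le_mul ?_
  rw [mul_add, mul_one]
  exact le_self_add

lemma lowerExponent_ne_top (a : ℝ≥0∞) : lowerExponent a ≠ ∞ :=
  ((lowerExponent_le_two a).trans_lt (by simp)).ne

/-- Dually, multiplication by `W ∈ L^{2a}` maps the dual space of `L^q` to `L²`. -/
lemma holderTriple_conjExponent (ha : 1 ≤ a) :
    ENNReal.HolderTriple (a * 2) (lowerExponent a).conjExponent 2 := by
  have h1 := (holderTriple_lowerExponent a).inv_add_inv_eq_inv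
  have h2 := (ENNReal.HolderConjugate.conjExponent
    (one_le_lowerExponent ha)).inv_add_inv_eq_inv
  rw [ENNReal.holderTriple_iff]
  rw [← h1, inv_one, add_right_comm, ← ENNReal.inv_two_add_inv_two] at h2
  exact (ENNReal.add_left_inj (by simp)).1 h2

lemma toReal_inv_le_one (ha : 1 ≤ a) : (a⁻¹).toReal ≤ 1 := by
  rw [← ENNReal.toReal_one]
  exact ENNReal.toReal_mono ENNReal.one_ne_top (ENNReal.inv_le_one.2 ha)

lemma inv_toReal_lowerExponent (ha : 1 ≤ a) :
    1 / (lowerExponent a).toReal = (1 + (a⁻¹).toReal) / 2 := by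
  rw [one_div, ← ENNReal.toReal_inv, inv_lowerExponent, ENNReal.toReal_div,
    ENNReal.toReal_add (by simp) ((ENNReal.inv_le_one.2 ha).trans_lt ENNReal.one_lt_top).ne]
  simp

lemma real_scaling_of_scaling (ha : 1 ≤ a) (hab : 2 - 2 / a = (n : ℝ≥0∞) / b) :
    2 - 2 * (a⁻¹).toReal = n * (b⁻¹).toReal := by
  have h := congrArg ENNReal.toReal hab
  have hle : 2 / a ≤ 2 := by
    rw [div_eq_mul_inv]
    exact mul_le_of_le_one_right' (ENNReal.inv_le_one.2 ha)
  rw [ENNReal.toReal_sub_of_le hle (by simp), div_eq_mul_inv, div_eq_mul_inv, ENNReal.toReal_mul,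
    ENNReal.toReal_mul] at h
  simpa using h

/-- The endpoint `a = ∞` occurs only in dimension at least three. -/
lemma three_le_of_scaling (hb : 1 ≤ b) (hab : 2 - 2 / a = (n : ℝ≥0∞) / b)
    (hend : ¬ (n = 2 ∧ a = ∞ ∧ b = 1)) (ha : a = ∞) : 3 ≤ n := by
  have h := real_scaling_of_scaling (by simp [ha]) hab
  have hb1 := toReal_inv_le_one hb
  rw [ha] at h
  simp only [ENNReal.inv_top, ENNReal.toReal_zero, mul_zero, sub_zero] at h
  by_contra hn
  have hn' : n ≤ 2 := by omega
  have hn2 : (n : ℝ) ≤ 2 := by exact_mod_cast hn'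
  have hb0 : 0 ≤ (b⁻¹).toReal := ENNReal.toReal_nonneg
  have hb2 : (b⁻¹).toReal = 1 := by nlinarith
  have h3 : (n : ℝ) = 2 := by rw [hb2] at h; linarith
  refine hend ⟨by exact_mod_cast h3, ha, ?_⟩
  rw [ENNReal.toReal_eq_one_iff] at hb2
  simpa using hb2

lemma eq_half_of_scaling (hn : n ≠ 0) (hab : 2 - 2 / a = (n : ℝ≥0∞) / b) (ha : a = ∞) :
    b = (n : ℝ≥0∞) / 2 := by
  have h := hab
  rw [ha, ENNReal.div_top, tsub_zero] at h
  have hb0 : b ≠ 0 := by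
    rintro rfl
    rw [ENNReal.div_zero (by exact_mod_cast hn)] at h
    exact absurd h (by simp)
  have hbt : b ≠ ∞ := by
    rintro rfl
    simp at h
  rw [ENNReal.eq_div_iff hb0 hbt] at h
  rw [ENNReal.eq_div_iff (by simp) (by simp), mul_comm]
  exact h

/-- The space-time estimate, in terms of the exponents of the potentials. -/
lemma exists_formBound (ha : 1 ≤ a) (hb : 1 ≤ b) (hab : 2 - 2 / a = (n : ℝ≥0∞) / b)
    (hend : ¬ (n = 2 ∧ a = ∞ ∧ b = 1)) :
    ∃ C : ℝ≥0∞, C ≠ ∞ ∧ ∀ ν : Space n, ν ≠ 0 →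
      FormBound ν (lowerExponent a) (lowerExponent b) C := by
  have hqa := inv_toReal_lowerExponent ha
  have hqb := inv_toReal_lowerExponent hb
  have hs := real_scaling_of_scaling ha hab
  have h1 : ∀ {c : ℝ≥0∞}, 1 ≤ c → 1 ≤ (lowerExponent c).toReal := fun hc => by
    rw [← ENNReal.toReal_one]
    exact ENNReal.toReal_mono (lowerExponent_ne_top _) (one_le_lowerExponent hc)
  have h2 : ∀ c : ℝ≥0∞, (lowerExponent c).toReal ≤ 2 := fun c => by
    have := ENNReal.toReal_mono (by simp) (lowerExponent_le_two c)
    simpa using this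
  obtain ⟨C, hC, h⟩ := exists_form_le (n := n) (h1 ha) (h2 a) (h1 hb) (h2 b) (by
    rw [hqb, div_eq_mul_one_div 2, hqa]
    linear_combination -hs / 2) (fun h => by
    refine three_le_of_scaling hb hab hend ?_
    rw [h] at hqa
    have h0 : (a⁻¹).toReal = 0 := by linarith
    rcases (ENNReal.toReal_eq_zero_iff _).1 h0 with h | h
    · simpa using h
    · rw [ENNReal.inv_eq_top] at h
      rw [h] at ha
      simp at ha)
  rw [ENNReal.ofReal_toReal (lowerExponent_ne_top a),
    ENNReal.ofReal_toReal (lowerExponent_ne_top b)] at h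
  exact ⟨C, hC, fun ν hν => h ν hν⟩

end Exponents

/-! ### Splitting of the potentials -/

section Splitting

/-- The part of a potential in a cylinder around the time axis where it is large. -/
def highPart (R M : ℝ) (W : SpaceTime n → ℂ) : SpaceTime n → ℂ :=
  {z | ‖z.2‖ ≤ R ∧ M < ‖W z‖}.indicator W

/-- The rest of the potential. -/
def lowPart (R M : ℝ) (W : SpaceTime n → ℂ) : SpaceTime n → ℂ :=
  {z | ‖z.2‖ ≤ R ∧ M < ‖W z‖}ᶜ.indicator W

variable {W : SpaceTime n → ℂ} {R : ℝ}

lemma measurableSet_highPart (hW : Measurable W) (R M : ℝ) :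
    MeasurableSet {z : SpaceTime n | ‖z.2‖ ≤ R ∧ M < ‖W z‖} :=
  (measurableSet_le (f := fun z : SpaceTime n => ‖z.2‖) (by fun_prop) measurable_const).inter
    (measurableSet_lt measurable_const hW.norm)

lemma lowPart_add_highPart (R M : ℝ) (W : SpaceTime n → ℂ) (z : SpaceTime n) :
    lowPart R M W z + highPart R M W z = W z :=
  congrFun (Set.indicator_compl_add_self _ W) z

/-- The low part is a superposition of a part far from the time axis, controlled by the decay
hypothesis, and of a bounded part that meets only the hyperplanes of height at most `R`. -/
lemma waveSup_lowPart_le {ω : Space n} (hω : ‖ω‖ = 1) (hW : Measurable W) (M : ℝ) :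
    waveSup ω (lowPart R M W) ≤
      decayQuantity R W + ENNReal.ofReal M ^ (2 : ℝ) * ENNReal.ofReal (2 * R) := by
  set A : SpaceTime n → ℂ := {z : SpaceTime n | R < ‖z.2‖}.indicator W with hA
  have hAm : Measurable A := hW.indicator (measurableSet_lt measurable_const (by fun_prop))
  have hs : ∀ s, eLpNorm (waveSlice ω (lowPart R M W) s) ∞ volume ^ (2 : ℝ) ≤
      eLpNorm (waveSlice ω A s) ∞ volume ^ (2 : ℝ) +
        (Set.Icc (-R) R).indicator (fun _ => ENNReal.ofReal M ^ (2 : ℝ)) s := by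
    intro s
    have hle : eLpNorm (waveSlice ω (lowPart R M W) s) ∞ volume ≤
        max (eLpNorm (waveSlice ω A s) ∞ volume)
          ((Set.Icc (-R) R).indicator (fun _ => ENNReal.ofReal M) s) := by
      rw [eLpNorm_exponent_top, eLpNorm_exponent_top]
      refine essSup_le_of_ae_le _ ?_
      filter_upwards [enorm_ae_le_eLpNormEssSup (waveSlice ω A s) volume] with q hq
      set x : Space n := s • ω + q.2 with hx
      change ‖lowPart R M W (q.1, x)‖ₑ ≤ _
      change ‖A (q.1, x)‖ₑ ≤ _ at hq
      by_cases hxR : R < ‖x‖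
      · refine le_trans (le_of_eq ?_) (hq.trans (le_max_left _ _))
        rw [lowPart, hA, Set.indicator_of_mem (by simpa using fun h => absurd h (not_le.2 hxR)),
          Set.indicator_of_mem (by simpa using hxR)]
      · refine le_trans ?_ (le_max_right _ _)
        -- The hyperplane at height `s` meets the ball `|x| ≤ R` only if `|s| ≤ R`.
        have hsR : s ∈ Set.Icc (-R) R := by
          rw [Set.mem_Icc, ← abs_le]
          have h1 : inner ℝ ω x = s := by
            rw [hx, inner_add_right, inner_smul_right, inner_self_orthogonal_eq_zero,
              real_inner_self_eq_norm_sq, hω]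
            simp
          have h2 := abs_real_inner_le_norm ω x
          rw [h1, hω, one_mul] at h2
          exact h2.trans (not_lt.1 hxR)
        rw [Set.indicator_of_mem hsR, lowPart]
        by_cases hz : ‖x‖ ≤ R ∧ M < ‖W (q.1, x)‖
        · rw [Set.indicator_of_notMem (by simpa using hz)]
          simp
        · rw [Set.indicator_of_mem (by exact hz), ← ofReal_norm]
          refine ENNReal.ofReal_le_ofReal ?_
          by_contra hc
          exact hz ⟨not_lt.1 hxR, not_le.1 hc⟩
    refine (ENNReal.rpow_le_rpow hle two_pos.le).trans ?_
    rw [(ENNReal.monotone_rpow_of_nonneg two_pos.le).map_max]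
    refine max_le le_self_add (le_trans (le_of_eq ?_) le_add_self)
    by_cases h : s ∈ Set.Icc (-R) R
    · rw [Set.indicator_of_mem h, Set.indicator_of_mem h]
    · rw [Set.indicator_of_notMem h, Set.indicator_of_notMem h, ENNReal.zero_rpow_of_pos two_pos]
  have hd : ∫⁻ s, eLpNorm (waveSlice ω A s) ∞ volume ^ (2 : ℝ) ≤ decayQuantity R W := by
    refine le_trans (le_of_eq ?_) (le_iSup (fun ω : Metric.sphere (0 : Space n) 1 => ∫⁻ s : ℝ,
      eLpNorm ({z : SpaceTime n | R < ‖z.2‖}.indicator (fun z => ‖W z‖ ^ 2)) ∞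
        ((volume : Measure ℝ).prod (hyperplaneMeasure (ω : Space n) s))) ⟨ω, by simpa using hω⟩)
    refine lintegral_congr fun s => ?_
    rw [← eLpNorm_hyperplane ω hAm]
    congr 1
    funext z
    by_cases hz : z ∈ {z : SpaceTime n | R < ‖z.2‖}
    · rw [hA, Set.indicator_of_mem hz, Set.indicator_of_mem hz]
    · rw [hA, Set.indicator_of_notMem hz, Set.indicator_of_notMem hz]
      simp
  refine (lintegral_mono hs).trans ?_
  rw [lintegral_add_left ((measurable_eLpNorm_waveSlice ω hAm ∞).pow_const _),
    lintegral_indicator_const measurableSet_Icc, Real.volume_Icc]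
  refine add_le_add hd (le_of_eq ?_)
  ring_nf

lemma mixedNorm_norm_sq (a b : ℝ≥0∞) (f : SpaceTime n → ℂ) :
    mixedNorm a b (fun z => ‖f z‖ ^ 2) = mixedNorm (a * 2) (b * 2) f ^ (2 : ℝ) := by
  have h : ∀ t, eLpNorm (fun x : Space n => ‖f (t, x)‖ ^ 2) b volume =
      eLpNorm (fun x => f (t, x)) (b * 2) volume ^ (2 : ℝ) := by
    intro t
    have := eLpNorm_norm_rpow (p := b) (μ := volume) (fun x : Space n => f (t, x)) two_pos
    simpa using this
  simp only [mixedNorm, h]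
  have := eLpNorm_enorm_rpow (p := a) (μ := volume)
    (fun t : ℝ => eLpNorm (fun x : Space n => f (t, x)) (b * 2) volume) two_pos
  simpa using this

lemma decayQuantity_congr {W' : SpaceTime n → ℂ} (h : W =ᵐ[volume] W') :
    decayQuantity R W = decayQuantity R W' := by
  refine iSup_congr fun ω => lintegral_congr_ae ?_
  filter_upwards [ae_ae_hyperplane (ω : Space n) (by simp) h] with s hs
  refine eLpNorm_congr_ae ?_
  filter_upwards [hs] with z hz
  simp only [Set.indicator, hz]

lemma ContinuousInTime.congr {p : ℝ≥0∞} {W' : SpaceTime n → ℂ} (hW : ContinuousInTime p R W)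
    (h : W =ᵐ[volume] W') : ContinuousInTime p R W' := by
  obtain ⟨g, h1, h2, h3⟩ := hW
  refine ⟨g, h1, h2, ?_⟩
  filter_upwards [h3, ae_slice_of_ae h] with t ht ht'
  refine EventuallyEq.trans ?_ ht
  filter_upwards [ht'] with x hx
  simp only [Set.indicator, hx]

/-- Away from the endpoint, the high part is small by dominated convergence. -/
lemma tendsto_mixedNorm_highPart {q r : ℝ≥0∞} (hq : q ≠ ∞) (hq0 : q ≠ 0) (hW : Measurable W)
    (hN : mixedNorm q r W ≠ ∞) :
    Tendsto (fun k : ℕ => mixedNorm q r (highPart R k W)) atTop (𝓝 0) := by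
  have hm : ∀ k : ℕ, Measurable (highPart R k W) := fun k =>
    hW.indicator (measurableSet_highPart hW R k)
  simp_rw [mixedNorm_eq_mixedE] at hN ⊢
  have hzero : ∀ (k : ℕ) z, ‖W z‖ ≤ k → ‖highPart R k W z‖ₑ = 0 := by
    intro k z hz
    rw [highPart, Set.indicator_of_notMem (fun h => absurd h.2 (not_lt.2 hz)), enorm_zero]
  have hle : ∀ (k : ℕ) z, ‖highPart R k W z‖ₑ ≤ ‖W z‖ₑ := fun k z => by
    rw [highPart, enorm_indicator_eq_indicator_enorm]
    exact Set.indicator_le_self _ _ _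
  refine tendsto_mixedE_zero (fun k => (hm k).enorm) hq hW.enorm hN hle hq0
    (ae_of_all _ fun t ht => ?_)
  -- For `r = ∞` almost every slice is bounded, so that its high part vanishes for large `k`.
  rcases eq_or_ne r ∞ with rfl | hr
  · refine tendsto_const_nhds.congr' ?_
    obtain ⟨k₀, hk₀⟩ := exists_nat_ge
      (eLpNorm (fun x : Space n => ‖W (t, x)‖ₑ) ∞ volume).toReal
    filter_upwards [eventually_ge_atTop k₀] with k hk
    refine Eq.symm ?_
    rw [eLpNorm_congr_ae (g := fun _ => (0 : ℝ≥0∞)), eLpNorm_zero']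
    filter_upwards [enorm_ae_le_eLpNormEssSup (fun x : Space n => ‖W (t, x)‖ₑ) volume] with x hx
    refine hzero k _ ?_
    rw [eLpNorm_exponent_top] at hk₀ ht
    rw [enorm_eq_self] at hx
    have h1 := ENNReal.toReal_mono ht hx
    rw [toReal_enorm] at h1
    exact h1.trans (hk₀.trans (by exact_mod_cast hk))
  · refine tendsto_eLpNorm_zero_of_dominated hr
      (fun k => ((hm k).enorm.comp measurable_prodMk_left).aemeasurable) ht
      (fun k => ae_of_all _ fun x => hle k _) (ae_of_all _ fun x => ?_)
    refine tendsto_const_nhds.congr' ?_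
    obtain ⟨k₀, hk₀⟩ := exists_nat_ge ‖W (t, x)‖
    filter_upwards [eventually_ge_atTop k₀] with k hk
    exact (hzero k _ (hk₀.trans (by exact_mod_cast hk))).symm

/-- The excess over a level of a continuous family of `L^p` functions is uniformly small on compact
intervals. -/
lemma exists_forall_eLpNorm_excess_le {p : ℝ≥0∞} (hp : p ≠ ∞) (hp1 : 1 ≤ p)
    {g : ℝ → Space n → ℂ} (hg : ∀ t, MemLp (g t) p volume)
    (hc : ∀ t, Tendsto (fun s => eLpNorm (g s - g t) p volume) (𝓝 t) (𝓝 0)) (S T : ℝ)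
    {δ : ℝ≥0∞} (hδ : δ ≠ 0) :
    ∃ m₀ : ℕ, ∀ m ≥ m₀, ∀ t ∈ Set.Icc S T,
      eLpNorm (fun x => max (‖g t x‖ - m) 0) p volume ≤ δ := by
  have hmeas : ∀ (m : ℕ) t, AEStronglyMeasurable (fun x => max (‖g t x‖ - m) 0) volume := by
    intro m t
    have := (hg t).aestronglyMeasurable.norm.aemeasurable
    exact AEMeasurable.aestronglyMeasurable (by fun_prop)
  have hδ2 : 0 < δ / 2 := ENNReal.half_pos hδ
  have hzero : ∀ t, Tendsto (fun m : ℕ => eLpNorm (fun x => max (‖g t x‖ - m) 0) p volume)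
      atTop (𝓝 0) := by
    intro t
    have h := tendsto_eLpNorm_zero_of_dominated (μ := (volume : Measure (Space n))) hp
      (φ := fun (m : ℕ) x => ‖max (‖g t x‖ - m) 0‖ₑ) (Φ := fun x => ‖g t x‖ₑ)
      (fun m => (hmeas m t).enorm) (by rw [eLpNorm_enorm]; exact (hg t).eLpNorm_ne_top)
      (fun m => ae_of_all _ fun x => ?_) (ae_of_all _ fun x => ?_)
    · simpa only [eLpNorm_enorm] using h
    · rw [← ofReal_norm, ← ofReal_norm]
      refine ENNReal.ofReal_le_ofReal ?_
      rw [Real.norm_of_nonneg (le_max_right _ _)]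
      refine max_le ?_ (norm_nonneg _)
      have : (0 : ℝ) ≤ m := m.cast_nonneg
      linarith
    · refine tendsto_const_nhds.congr' ?_
      obtain ⟨k₀, hk₀⟩ := exists_nat_ge ‖g t x‖
      filter_upwards [eventually_ge_atTop k₀] with k hk
      have h1 : ‖g t x‖ ≤ k := hk₀.trans (by exact_mod_cast hk)
      rw [max_eq_right (by linarith), enorm_zero]
  -- The truncation is nonexpansive, so a level good at time `t` is good in a neighbourhood of `t`.
  refine isCompact_Icc.induction_on (p := fun s : Set ℝ => ∃ m₀ : ℕ, ∀ m ≥ m₀, ∀ t ∈ s,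
      eLpNorm (fun x => max (‖g t x‖ - m) 0) p volume ≤ δ) ?_ ?_ ?_ ?_
  · exact ⟨0, fun _ _ t ht => absurd ht (Set.notMem_empty t)⟩
  · rintro s t hst ⟨m₀, h⟩
    exact ⟨m₀, fun m hm u hu => h m hm u (hst hu)⟩
  · rintro s t ⟨m₀, h⟩ ⟨m₁, h'⟩
    refine ⟨max m₀ m₁, fun m hm u hu => ?_⟩
    rcases hu with hu | hu
    · exact h m ((le_max_left _ _).trans hm) u hu
    · exact h' m ((le_max_right _ _).trans hm) u hu
  · intro t _
    obtain ⟨m₀, hm₀⟩ := eventually_atTop.1 ((hzero t).eventually_le_const hδ2)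
    refine ⟨{s | eLpNorm (g s - g t) p volume ≤ δ / 2},
      mem_nhdsWithin_of_mem_nhds ((hc t).eventually_le_const hδ2), m₀, fun m hm s hs => ?_⟩
    have hsub : AEStronglyMeasurable (fun x => ‖(g s - g t) x‖) volume :=
      ((hg s).sub (hg t)).aestronglyMeasurable.norm
    calc eLpNorm (fun x => max (‖g s x‖ - m) 0) p volume
        ≤ eLpNorm ((fun x => max (‖g t x‖ - m) 0) + fun x => ‖(g s - g t) x‖) p volume := by
          refine eLpNorm_mono_real fun x => ?_
          rw [Real.norm_of_nonneg (le_max_right _ _)]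
          have h1 : ‖g s x‖ ≤ ‖g t x‖ + ‖(g s - g t) x‖ := by
            have := norm_add_le (g t x) (g s x - g t x)
            simpa using this
          simp only [Pi.add_apply]
          refine max_le ?_ (by positivity)
          have := le_max_left (‖g t x‖ - m) 0
          linarith
      _ ≤ eLpNorm (fun x => max (‖g t x‖ - m) 0) p volume +
            eLpNorm (fun x => ‖(g s - g t) x‖) p volume := eLpNorm_add_le (hmeas m t) hsub hp1
      _ ≤ δ / 2 + δ / 2 := by
          rw [eLpNorm_norm]
          exact add_le_add (hm₀ m hm) hs
      _ = δ := ENNReal.add_halves δ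

/-- At the endpoint, the high part is small by continuity in time. -/
lemma exists_mixedNorm_highPart_le_of_continuous {p : ℝ≥0∞} (hp : p ≠ ∞) (hp1 : 1 ≤ p) {S T : ℝ}
    (hsupp : ∀ᵐ z : SpaceTime n, z.1 ∉ Set.Icc S T → W z = 0) (hcont : ContinuousInTime p R W)
    {δ : ℝ≥0∞} (hδ : δ ≠ 0) : ∃ M : ℝ, mixedNorm ∞ p (highPart R M W) ≤ δ := by
  obtain ⟨g, hg, hc, hW⟩ := hcont
  obtain ⟨m, hm⟩ := exists_forall_eLpNorm_excess_le hp hp1 hg hc S T (ENNReal.half_pos hδ).ne'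
  -- Where `|W| > 2m`, one has `|W| ≤ 2(|W| - m)`.
  refine ⟨2 * m, ?_⟩
  rw [mixedNorm, eLpNorm_exponent_top]
  refine essSup_le_of_ae_le _ ?_
  filter_upwards [hW, ae_slice_of_ae hsupp] with t ht hst
  rw [enorm_eq_self]
  by_cases htI : t ∈ Set.Icc S T
  · have hle : eLpNorm (fun x => highPart R (2 * m) W (t, x)) p volume ≤
        eLpNorm ((2 : ℝ) • fun x => max (‖g t x‖ - m) 0) p volume := by
      refine eLpNorm_mono_ae_real ?_
      filter_upwards [ht] with x hx
      have h0 : 0 ≤ max (‖g t x‖ - m) 0 := le_max_right _ _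
      by_cases hz : ‖x‖ ≤ R ∧ 2 * (m : ℝ) < ‖W (t, x)‖
      · rw [highPart, Set.indicator_of_mem (by exact hz)]
        rw [Set.indicator_of_mem (by exact hz.1)] at hx
        have h1 := le_max_left (‖g t x‖ - m) 0
        have h2 := hz.2
        rw [hx] at h2 ⊢
        simp only [Pi.smul_apply, smul_eq_mul]
        linarith
      · rw [highPart, Set.indicator_of_notMem (by exact hz), norm_zero]
        simp only [Pi.smul_apply, smul_eq_mul]
        positivity
    refine hle.trans ?_
    rw [eLpNorm_const_smul]
    calc _ ≤ 2 * (δ / 2) := by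
          refine mul_le_mul' (le_of_eq ?_) (hm m le_rfl t htI)
          rw [← ofReal_norm]
          norm_num
      _ = δ := ENNReal.mul_div_cancel (by simp) (by simp)
  · rw [eLpNorm_congr_ae (g := fun _ => (0 : ℂ)), eLpNorm_zero']
    · exact zero_le
    · filter_upwards [hst] with x hx
      have := hx htI
      rw [highPart, Set.indicator_apply_eq_zero]
      exact fun _ => this

end Splitting

/-- A potential is the sum of a part that is small in its mixed norm and of a part whose suprema
over parallel hyperplanes are square integrable, uniformly in the direction. -/
theorem exists_splitting {a b : ℝ≥0∞} (hn : 1 ≤ n) (ha : 1 ≤ a) (hb : 1 ≤ b)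
    (hab : 2 - 2 / a = (n : ℝ≥0∞) / b) (hend : ¬ (n = 2 ∧ a = ∞ ∧ b = 1)) {S T R : ℝ}
    {W : SpaceTime n → ℂ} (hmeas : AEStronglyMeasurable W volume)
    (hsupp : ∀ᵐ z : SpaceTime n, z.1 ∉ Set.Icc S T → W z = 0)
    (hN : mixedNorm (a * 2) (b * 2) W ≠ ∞) (hdecay : decayQuantity R W < ∞)
    (hcont : 3 ≤ n → a = ∞ → b = (n : ℝ≥0∞) / 2 → ContinuousInTime (n : ℝ≥0∞) R W)
    {δ : ℝ≥0∞} (hδ : δ ≠ 0) :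
    ∃ (V Z : SpaceTime n → ℂ) (D : ℝ≥0∞), Measurable V ∧ Measurable Z ∧
      (W =ᵐ[volume] fun z => V z + Z z) ∧
      mixedNorm (a * 2) (b * 2) V ≤ mixedNorm (a * 2) (b * 2) W ∧
      mixedNorm (a * 2) (b * 2) Z ≤ δ ∧ D ≠ ∞ ∧
      ∀ ω : Space n, ‖ω‖ = 1 → waveSup ω V ≤ D := by
  set W' := hmeas.mk W with hW'
  have hWm : Measurable W' := hmeas.stronglyMeasurable_mk.measurable
  have he : W =ᵐ[volume] W' := hmeas.ae_eq_mk
  have hN' : mixedNorm (a * 2) (b * 2) W' = mixedNorm (a * 2) (b * 2) W :=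
    mixedNorm_congr_ae (he.symm.mono fun z hz => congrArg norm hz)
  have hsupp' : ∀ᵐ z : SpaceTime n, z.1 ∉ Set.Icc S T → W' z = 0 := by
    filter_upwards [hsupp, he] with z h1 h2 h3
    rw [← h2]
    exact h1 h3
  obtain ⟨M, hM⟩ : ∃ M : ℝ, mixedNorm (a * 2) (b * 2) (highPart R M W') ≤ δ := by
    rcases eq_or_ne a ∞ with hat | hat
    · have h3 := three_le_of_scaling hb hab hend hat
      have hb2 := eq_half_of_scaling (by omega) hab hat
      have hb3 : b * 2 = n := by
        rw [hb2]
        exact ENNReal.div_mul_cancel (by simp) (by simp)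
      rw [hb3, hat, ENNReal.top_mul (by simp)]
      exact exists_mixedNorm_highPart_le_of_continuous (by simp) (by exact_mod_cast hn) hsupp'
        ((hcont h3 hat hb2).congr he) hδ
    · have ha0 : a ≠ 0 := (zero_lt_one.trans_le ha).ne'
      obtain ⟨k, hk⟩ := ((tendsto_mixedNorm_highPart (R := R) (q := a * 2) (r := b * 2)
        (ENNReal.mul_ne_top hat (by simp)) (by simpa using ha0) hWm
        (by rwa [hN'])).eventually_le_const (pos_iff_ne_zero.2 hδ)).exists
      exact ⟨k, hk⟩
  have hms := measurableSet_highPart hWm R M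
  refine ⟨lowPart R M W', highPart R M W',
    decayQuantity R W' + ENNReal.ofReal M ^ (2 : ℝ) * ENNReal.ofReal (2 * R),
    hWm.indicator hms.compl, hWm.indicator hms, ?_, ?_, hM, ?_, fun ω hω =>
      waveSup_lowPart_le hω hWm M⟩
  · filter_upwards [he] with z hz
    rw [hz, lowPart_add_highPart]
  · rw [← hN']
    exact mixedNorm_mono_ae (ae_of_all _ fun z => norm_indicator_le_norm_self _ _)
  · rw [← decayQuantity_congr he]
    exact ENNReal.add_ne_top.2 ⟨hdecay.ne, ENNReal.mul_ne_top
      (ENNReal.rpow_ne_top_of_nonneg two_pos.le ENNReal.ofReal_ne_top) ENNReal.ofReal_ne_top⟩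

/-! ### The sandwiched operator -/

section Operator

variable {a b C : ℝ≥0∞} {ν : Space n} {W₁ W₂ : SpaceTime n → ℂ}

lemma mixedNorm_potential_mul_le (a b : ℝ≥0∞) {W u : SpaceTime n → ℂ}
    (hW : AEStronglyMeasurable W volume) (hu : AEStronglyMeasurable u volume) :
    mixedNorm (lowerExponent a) (lowerExponent b) (fun z => W z * u z) ≤
      mixedNorm (a * 2) (b * 2) W * eLpNorm u 2 volume := by
  have := holderTriple_lowerExponent a
  have := holderTriple_lowerExponent b
  rw [← mixedNorm_two_two hu]
  exact mixedNorm_mul_le hW hu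

lemma eLpNorm_potential_mul_le (ha : 1 ≤ a) (hb : 1 ≤ b) {W G : SpaceTime n → ℂ}
    (hW : AEStronglyMeasurable W volume) (hG : AEStronglyMeasurable G volume) :
    eLpNorm (fun z => W z * G z) 2 volume ≤ mixedNorm (a * 2) (b * 2) W *
      mixedNorm (lowerExponent a).conjExponent (lowerExponent b).conjExponent G := by
  have := holderTriple_conjExponent ha
  have := holderTriple_conjExponent hb
  exact (mixedNorm_two_two (f := fun z => W z * G z) (hW.mul hG)).symm.le.trans
    (mixedNorm_mul_le hW hG)

lemma FormBound.exists_isS_potential_mul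
    (hB : FormBound ν (lowerExponent a) (lowerExponent b) C) (hC : C ≠ ∞) (hν : ν ≠ 0)
    (ha : 1 ≤ a) (hb : 1 ≤ b) {W u : SpaceTime n → ℂ} (hW : AEStronglyMeasurable W volume)
    (hN : mixedNorm (a * 2) (b * 2) W ≠ ∞) (hu : MemLp u 2 volume) :
    ∃ G, IsS ν (lowerExponent a) (lowerExponent b) (fun z => W z * u z) G := by
  have := holderTriple_lowerExponent a
  have := holderTriple_lowerExponent b
  exact hB.exists_isS (q₁ := a * 2) (r₁ := b * 2) hC hν (lowerExponent_ne_top a)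
    (lowerExponent_ne_top b) (one_le_lowerExponent ha) (one_le_lowerExponent hb)
    (hW.mul hu.aestronglyMeasurable)
    ((mixedNorm_potential_mul_le a b hW hu.aestronglyMeasurable).trans_lt
      (ENNReal.mul_lt_top hN.lt_top hu.2)).ne

lemma FormBound.mixedNorm_isS_potential_le
    (hB : FormBound ν (lowerExponent a) (lowerExponent b) C) (hC : C ≠ ∞) (hν : ν ≠ 0)
    (ha : 1 ≤ a) (hb : 1 ≤ b) {W u G : SpaceTime n → ℂ} (hW : AEStronglyMeasurable W volume)
    (hu : MemLp u 2 volume)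
    (hG : IsS ν (lowerExponent a) (lowerExponent b) (fun z => W z * u z) G) :
    mixedNorm (lowerExponent a).conjExponent (lowerExponent b).conjExponent G ≤
      C * mixedNorm (a * 2) (b * 2) W * eLpNorm u 2 volume := by
  rw [mul_assoc]
  exact (hB.mixedNorm_isS_le hC hν (lowerExponent_ne_top a)
    (lowerExponent_ne_top b) (one_le_lowerExponent ha) (one_le_lowerExponent hb) hG).trans
      (mul_le_mul_right (mixedNorm_potential_mul_le a b hW hu.aestronglyMeasurable) C)

/-- The operator `M_{W₁} ∘ S_ν ∘ M_{W₂}` is well defined and bounded. -/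
theorem FormBound.exists_isMSM
    (hB : FormBound ν (lowerExponent a) (lowerExponent b) C) (hC : C ≠ ∞) (hν : ν ≠ 0)
    (ha : 1 ≤ a) (hb : 1 ≤ b) (hW₁ : AEStronglyMeasurable W₁ volume)
    (hW₂ : AEStronglyMeasurable W₂ volume) (hN₁ : mixedNorm (a * 2) (b * 2) W₁ ≠ ∞)
    (hN₂ : mixedNorm (a * 2) (b * 2) W₂ ≠ ∞) :
    ∃ B : Lp ℂ 2 (volume : Measure (SpaceTime n)) →L[ℂ] Lp ℂ 2 (volume : Measure (SpaceTime n)),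
      IsMSM a b W₁ W₂ ν B := by
  have hu : ∀ u : Lp ℂ 2 (volume : Measure (SpaceTime n)), MemLp u 2 volume := fun u => Lp.memLp u
  choose G hG using fun u : Lp ℂ 2 (volume : Measure (SpaceTime n)) =>
    hB.exists_isS_potential_mul hC hν ha hb hW₂ hN₂ (hu u)
  set m₁ := mixedNorm (a * 2) (b * 2) W₁
  set m₂ := mixedNorm (a * 2) (b * 2) W₂
  have hbound : ∀ u, eLpNorm (fun z => W₁ z * G u z) 2 volume ≤
      m₁ * (C * m₂) * eLpNorm u 2 volume := by
    intro u
    rw [mul_assoc]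
    exact (eLpNorm_potential_mul_le ha hb hW₁ (hG u).2.1).trans (mul_le_mul_right
      (hB.mixedNorm_isS_potential_le hC hν ha hb hW₂ (hu u) (hG u)) m₁)
  have hconst : m₁ * (C * m₂) ≠ ∞ := ENNReal.mul_ne_top hN₁ (ENNReal.mul_ne_top hC hN₂)
  have hmem : ∀ u, MemLp (fun z => W₁ z * G u z) 2 volume := fun u =>
    ⟨hW₁.mul (hG u).2.1, (hbound u).trans_lt (ENNReal.mul_lt_top hconst.lt_top (hu u).2)⟩
  have huniq : ∀ {F F' H H' : SpaceTime n → ℂ}, IsS ν (lowerExponent a) (lowerExponent b) F H →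
      IsS ν (lowerExponent a) (lowerExponent b) F' H' → F =ᵐ[volume] F' → H =ᵐ[volume] H' :=
    fun h h' e => hB.isS_unique hC hν (lowerExponent_ne_top a) (lowerExponent_ne_top b)
      (one_le_lowerExponent ha) (one_le_lowerExponent hb) h h' e
  -- Linearity follows from uniqueness of the extension of `S_ν`.
  have hlin : ∀ (u v w : Lp ℂ 2 (volume : Measure (SpaceTime n))) (c : ℂ), w = u + c • v →
      G w =ᵐ[volume] fun z => G u z + c * G v z := by
    intro u v w c hw
    refine huniq (hG w) ((hG u).add_mul hν (one_le_lowerExponent ha) (one_le_lowerExponent hb)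
      (hG v) c) ?_
    filter_upwards [Lp.coeFn_add u (c • v), Lp.coeFn_smul c v] with z h1 h2
    rw [hw, h1, Pi.add_apply, h2, Pi.smul_apply, smul_eq_mul]
    ring
  set L : Lp ℂ 2 (volume : Measure (SpaceTime n)) →ₗ[ℂ] Lp ℂ 2 (volume : Measure (SpaceTime n)) :=
    { toFun := fun u => (hmem u).toLp _
      map_add' := fun u v => by
        rw [← MemLp.toLp_add]
        refine MemLp.toLp_congr _ _ ?_
        filter_upwards [hlin u v (u + v) 1 (by rw [one_smul])] with z hz
        rw [hz, Pi.add_apply]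
        ring
      map_smul' := fun c v => by
        rw [RingHom.id_apply, ← MemLp.toLp_const_smul]
        refine MemLp.toLp_congr _ _ ?_
        filter_upwards [hlin 0 v (c • v) c (by rw [zero_add]),
          hlin v v 0 (-1) (by simp)] with z hz hz0
        rw [hz, hz0, Pi.smul_apply, smul_eq_mul]
        ring } with hL
  refine ⟨L.mkContinuous (m₁ * (C * m₂)).toReal fun u => ?_, fun u => ⟨⟨G u, hG u⟩,
    fun G' hG' => ?_⟩⟩
  · change ‖(hmem u).toLp _‖ ≤ _
    rw [Lp.norm_toLp, Lp.norm_def, ← ENNReal.toReal_mul]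
    exact ENNReal.toReal_mono (ENNReal.mul_ne_top hconst (hu u).2.ne) (hbound u)
  · change ((hmem u).toLp _ : Lp ℂ 2 (volume : Measure (SpaceTime n))) =ᵐ[volume] _
    refine (hmem u).coeFn_toLp.trans ?_
    filter_upwards [huniq (hG u) hG' (ae_eq_refl _)] with z hz
    rw [hz]

/-- The norm of the sandwiched operator is controlled by its bilinear form. -/
lemma IsMSM.enorm_le
    {B : Lp ℂ 2 (volume : Measure (SpaceTime n)) →L[ℂ] Lp ℂ 2 (volume : Measure (SpaceTime n))}
    (hB : IsMSM a b W₁ W₂ ν B) {η : ℝ≥0∞} (hη : η ≠ ∞)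
    (h : ∀ u v G : SpaceTime n → ℂ, MemLp u 2 volume → MemLp v 2 volume →
      IsS ν (lowerExponent a) (lowerExponent b) (fun z => W₂ z * u z) G →
      ‖∫ z, G z * (W₁ z * v z)‖ₑ ≤ η * eLpNorm u 2 volume * eLpNorm v 2 volume) :
    ‖B‖ₑ ≤ η := by
  have key : ∀ u : Lp ℂ 2 (volume : Measure (SpaceTime n)),
      eLpNorm (B u) 2 volume ≤ η * eLpNorm u 2 volume := by
    intro u
    obtain ⟨⟨G, hG⟩, hBu⟩ := hB u
    have hBG := hBu G hG
    set w : SpaceTime n → ℂ := ⇑(B u) with hw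
    have hwm : MemLp w 2 volume := Lp.memLp (B u)
    -- The form is tested with the conjugate of `B u`.
    have hv : MemLp (fun z => starRingEnd ℂ (w z)) 2 volume := hwm.star
    have hvn : eLpNorm (fun z => starRingEnd ℂ (w z)) 2 volume = eLpNorm w 2 volume :=
      eLpNorm_congr_norm_ae (ae_of_all _ fun z => by simp)
    have h1 := h u _ G (Lp.memLp u) hv hG
    have h2 : ∫ z, G z * (W₁ z * starRingEnd ℂ (w z)) = ((∫ z, ‖w z‖ ^ 2 : ℝ) : ℂ) := by
      rw [← integral_complex_ofReal]
      refine integral_congr_ae ?_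
      filter_upwards [hBG] with z hz
      have h3 : G z * (W₁ z * starRingEnd ℂ (w z)) = w z * starRingEnd ℂ (w z) := by
        rw [show w z = W₁ z * G z from hz]
        ring
      rw [h3, Complex.mul_conj, Complex.normSq_eq_norm_sq]
    have hi : Integrable fun z => ‖w z‖ ^ 2 := (memLp_two_iff_integrable_sq_norm hwm.1).1 hwm
    have h4 : ‖∫ z, G z * (W₁ z * starRingEnd ℂ (w z))‖ₑ = eLpNorm w 2 volume ^ 2 := by
      rw [h2, ← ofReal_norm, Complex.norm_real,
        Real.norm_of_nonneg (integral_nonneg fun _ => by positivity),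
        ofReal_integral_eq_lintegral_ofReal hi (ae_of_all _ fun _ => by positivity)]
      have h5 := lintegral_enorm_rpow_eq_eLpNorm (μ := volume) two_pos w
      simp only [ENNReal.rpow_two, ENNReal.ofReal_ofNat] at h5
      rw [← h5]
      refine lintegral_congr fun z => ?_
      rw [ENNReal.ofReal_pow (norm_nonneg _), ofReal_norm]
    rw [h4, hvn, pow_two] at h1
    rcases eq_or_ne (eLpNorm w 2 volume) 0 with h0 | h0
    · rw [h0]; exact zero_le
    · exact (ENNReal.mul_le_mul_iff_left h0 hwm.2.ne).1 h1
  have h1 : ‖B‖ ≤ η.toReal := by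
    refine B.opNorm_le_bound ENNReal.toReal_nonneg fun u => ?_
    rw [Lp.norm_def, Lp.norm_def, ← ENNReal.toReal_mul]
    exact ENNReal.toReal_mono (ENNReal.mul_ne_top hη (Lp.eLpNorm_ne_top u)) (key u)
  rw [← ofReal_norm]
  exact ENNReal.ofReal_le_of_le_toReal h1

/-- The bilinear form of the sandwiched operator, for split potentials: the parts with small mixed
norms are estimated uniformly in `ν`, and the remaining parts with a factor `1 / |ν|`. -/
lemma FormBound.enorm_integral_split_le {α : ℝ} {ω : Space n} (hα : 0 < α) (hω : ‖ω‖ = 1)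
    (hB : FormBound (α • ω) (lowerExponent a) (lowerExponent b) C) (hC : C ≠ ∞)
    (ha : 1 ≤ a) (hb : 1 ≤ b) {V₁ Z₁ V₂ Z₂ : SpaceTime n → ℂ} (hV₁ : Measurable V₁)
    (hZ₁ : Measurable Z₁) (hV₂ : Measurable V₂) (hZ₂ : Measurable Z₂)
    (e₁ : W₁ =ᵐ[volume] fun z => V₁ z + Z₁ z) (e₂ : W₂ =ᵐ[volume] fun z => V₂ z + Z₂ z)
    {m₁ m₂ κ D₁ D₂ : ℝ≥0∞} (hm₁ : m₁ ≠ ∞) (hm₂ : m₂ ≠ ∞) (hκ : κ ≠ ∞)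
    (hVN₁ : mixedNorm (a * 2) (b * 2) V₁ ≤ m₁) (hVN₂ : mixedNorm (a * 2) (b * 2) V₂ ≤ m₂)
    (hZN₁ : mixedNorm (a * 2) (b * 2) Z₁ ≤ κ) (hZN₂ : mixedNorm (a * 2) (b * 2) Z₂ ≤ κ)
    (hD₁ : waveSup ω V₁ ≤ D₁) (hD₂ : waveSup ω V₂ ≤ D₂) {u v G : SpaceTime n → ℂ}
    (hu : MemLp u 2 volume) (hv : MemLp v 2 volume)
    (hG : IsS (α • ω) (lowerExponent a) (lowerExponent b) (fun z => W₂ z * u z) G) :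
    ‖∫ z, G z * (W₁ z * v z)‖ₑ ≤ (C * (m₂ * κ + κ * m₁ + κ * κ) +
      ENNReal.ofReal ((2 * Real.pi) ^ (n + 1) / α) * (D₂ ^ (1 / 2 : ℝ) * D₁ ^ (1 / 2 : ℝ))) *
        eLpNorm u 2 volume * eLpNorm v 2 volume := by
  -- pass to measurable representatives of `u` and `v`
  wlog hum : Measurable u generalizing u
  · have he := hu.1.ae_eq_mk
    have hu' : MemLp (hu.1.mk u) 2 volume := hu.ae_eq he
    have h := this hu' (hG.congr (hG.1.congr (he.mono fun z hz => by simp only [hz]))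
      (he.mono fun z hz => by simp only [hz])) hu.1.stronglyMeasurable_mk.measurable
    rwa [← eLpNorm_congr_ae he] at h
  wlog hvm : Measurable v generalizing v
  · have he := hv.1.ae_eq_mk
    have hv' : MemLp (hv.1.mk v) 2 volume := hv.ae_eq he
    have h := this hv' hv.1.stronglyMeasurable_mk.measurable
    rw [← eLpNorm_congr_ae he] at h
    refine le_trans (le_of_eq (congrArg enorm (integral_congr_ae ?_))) h
    filter_upwards [he] with z hz
    rw [hz]
  have hω0 : ω ≠ 0 := by intro h; rw [h] at hω; simp at hω
  have hν : α • ω ≠ 0 := smul_ne_zero hα.ne' hω0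
  have i1 := holderTriple_lowerExponent a
  have i2 := holderTriple_lowerExponent b
  have hq1 := one_le_lowerExponent ha
  have hr1 := one_le_lowerExponent hb
  set E := eLpNorm u 2 volume
  set E' := eLpNorm v 2 volume
  obtain ⟨GV, hGV⟩ := hB.exists_isS_potential_mul hC hν ha hb hV₂.aestronglyMeasurable
    (hVN₂.trans_lt hm₂.lt_top).ne hu
  obtain ⟨GZ, hGZ⟩ := hB.exists_isS_potential_mul hC hν ha hb hZ₂.aestronglyMeasurable
    (hZN₂.trans_lt hκ.lt_top).ne hu
  have hGe : G =ᵐ[volume] fun z => GV z + 1 * GZ z := by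
    refine hB.isS_unique hC hν (lowerExponent_ne_top a) (lowerExponent_ne_top b) hq1 hr1 hG
      (hGV.add_mul hν hq1 hr1 hGZ 1) ?_
    filter_upwards [e₂] with z hz
    rw [hz]
    ring
  have hpot : ∀ {P Q H : SpaceTime n → ℂ} {p s : ℝ≥0∞}, Measurable P → Measurable Q → p ≠ ∞ →
      s ≠ ∞ → mixedNorm (a * 2) (b * 2) P ≤ p → mixedNorm (a * 2) (b * 2) Q ≤ s →
      IsS (α • ω) (lowerExponent a) (lowerExponent b) (fun z => P z * u z) H →
      Integrable (fun z => H z * (Q z * v z)) ∧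
        ‖∫ z, H z * (Q z * v z)‖ₑ ≤ C * (p * s) * E * E' := by
    intro P Q H p s hP hQ hp hs hPp hQs hH
    have hQv : AEStronglyMeasurable (fun z => Q z * v z) volume :=
      (hQ.mul hvm).aestronglyMeasurable
    have h1 : mixedNorm (lowerExponent a).conjExponent (lowerExponent b).conjExponent H ≤
        C * p * E := (hB.mixedNorm_isS_potential_le hC hν ha hb hP.aestronglyMeasurable hu hH).trans
      (by gcongr)
    have h2 : mixedNorm (lowerExponent a) (lowerExponent b) (fun z => Q z * v z) ≤ s * E' :=
      (mixedNorm_potential_mul_le a b hQ.aestronglyMeasurable hv.1).trans (by gcongr)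
    refine ⟨integrable_mul_of_mixedNorm hq1 hr1 hH.2.1 hQv
      (h1.trans_lt (ENNReal.mul_lt_top (ENNReal.mul_lt_top hC.lt_top hp.lt_top) hu.2)).ne
      (h2.trans_lt (ENNReal.mul_lt_top hs.lt_top hv.2)).ne,
      (enorm_integral_le_lintegral_enorm _).trans ((lintegral_enorm_mul_le hq1 hr1 hH.2.1
        hQv).trans ((mul_le_mul' h1 h2).trans (le_of_eq (by ring))))⟩
  -- Of the four terms only the one with `V₂` and `V₁` uses the bound that decays in `ν`.
  obtain ⟨j1, -⟩ := hpot hV₂ hV₁ hm₂ hm₁ hVN₂ hVN₁ hGV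
  obtain ⟨j2, b2⟩ := hpot hV₂ hZ₁ hm₂ hκ hVN₂ hZN₁ hGV
  obtain ⟨j3, b3⟩ := hpot hZ₂ hV₁ hκ hm₁ hZN₂ hVN₁ hGZ
  obtain ⟨j4, b4⟩ := hpot hZ₂ hZ₁ hκ hκ hZN₂ hZN₁ hGZ
  have b1 : ‖∫ z, GV z * (V₁ z * v z)‖ₑ ≤ ENNReal.ofReal ((2 * Real.pi) ^ (n + 1) / α) *
      (D₂ ^ (1 / 2 : ℝ) * D₁ ^ (1 / 2 : ℝ)) * E * E' := by
    refine (hB.enorm_integral_isS_mul_le_waveNorm (q₁ := a * 2) (r₁ := b * 2) hα hω hC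
      (lowerExponent_ne_top a) (lowerExponent_ne_top b) hq1 hr1 hGV (hV₂.mul hum) (hV₁.mul hvm)
      ((mixedNorm_potential_mul_le a b hV₂.aestronglyMeasurable hu.1).trans_lt
        (ENNReal.mul_lt_top (hVN₂.trans_lt hm₂.lt_top) hu.2)).ne
      ((mixedNorm_potential_mul_le a b hV₁.aestronglyMeasurable hv.1).trans_lt
        (ENNReal.mul_lt_top (hVN₁.trans_lt hm₁.lt_top) hv.2)).ne).trans ?_
    calc _ ≤ ENNReal.ofReal ((2 * Real.pi) ^ (n + 1) / α) * (D₂ ^ (1 / 2 : ℝ) * E) *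
          (D₁ ^ (1 / 2 : ℝ) * E') := by
          gcongr
          · exact (waveNorm_mul_le ω hω hV₂ hum).trans (by gcongr)
          · exact (waveNorm_mul_le ω hω hV₁ hvm).trans (by gcongr)
      _ = _ := by ring
  have hsum : ∫ z, G z * (W₁ z * v z) = ((∫ z, GV z * (V₁ z * v z)) +
      (∫ z, GV z * (Z₁ z * v z))) + ((∫ z, GZ z * (V₁ z * v z)) +
      (∫ z, GZ z * (Z₁ z * v z))) := by
    have j12 : Integrable fun z => GV z * (V₁ z * v z) + GV z * (Z₁ z * v z) := j1.add j2
    have j34 : Integrable fun z => GZ z * (V₁ z * v z) + GZ z * (Z₁ z * v z) := j3.add j4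
    rw [← integral_add j1 j2, ← integral_add j3 j4, ← integral_add j12 j34]
    refine integral_congr_ae ?_
    filter_upwards [hGe, e₁] with z h1 h2
    rw [h1, h2]
    ring
  rw [hsum]
  refine (enorm_add_le _ _).trans ((add_le_add ((enorm_add_le _ _).trans (add_le_add b1 b2))
    ((enorm_add_le _ _).trans (add_le_add b3 b4))).trans (le_of_eq ?_))
  ring

end Operator

/-! ### The limit of large `ν` -/

lemma mixedNorm_ne_top_of_memMixed {a b : ℝ≥0∞} {W : SpaceTime n → ℂ}
    (h : MemMixed a b fun z => ‖W z‖ ^ 2) : mixedNorm (a * 2) (b * 2) W ≠ ∞ := by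
  intro ht
  have h2 := h.2
  rw [mixedNorm_norm_sq, ht, ENNReal.top_rpow_of_pos two_pos] at h2
  exact lt_irrefl _ h2

lemma exists_small_factor {C m₁ m₂ e : ℝ≥0∞} (hC : C ≠ ∞) (hm₁ : m₁ ≠ ∞) (hm₂ : m₂ ≠ ∞)
    (he : e ≠ 0) : ∃ κ : ℝ≥0∞, κ ≠ 0 ∧ κ ≠ ∞ ∧ C * (m₂ * κ + κ * m₁ + κ * κ) ≤ e := by
  set A := C * (m₂ + m₁ + 1) with hA
  have hAt : A ≠ ∞ := ENNReal.mul_ne_top hC (by simp [hm₁, hm₂])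
  obtain ⟨κ, h0, hκ⟩ : ∃ κ : ℝ≥0∞, 0 < κ ∧ κ < min 1 (e / (A + 1)) :=
    exists_between (lt_min zero_lt_one
      (ENNReal.div_pos he (ENNReal.add_ne_top.2 ⟨hAt, ENNReal.one_ne_top⟩)))
  have h1 : κ ≤ 1 := hκ.le.trans (min_le_left _ _)
  refine ⟨κ, h0.ne', (h1.trans_lt ENNReal.one_lt_top).ne, ?_⟩
  calc C * (m₂ * κ + κ * m₁ + κ * κ) ≤ C * (m₂ * κ + κ * m₁ + κ * 1) := by gcongr
    _ = κ * A := by rw [hA]; ring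
    _ ≤ κ * (A + 1) := by gcongr; exact le_self_add
    _ ≤ e := ENNReal.mul_le_of_le_div (hκ.le.trans (min_le_right _ _))

lemma eventually_ofReal_div_norm_mul_le (c : ℝ) {D e : ℝ≥0∞} (hD : D ≠ ∞) (he : e ≠ 0) :
    ∀ᶠ ν : Space n in Bornology.cobounded (Space n), ENNReal.ofReal (c / ‖ν‖) * D ≤ e := by
  have h1 : Tendsto (fun ν : Space n => c / ‖ν‖) (Bornology.cobounded (Space n)) (𝓝 0) :=
    tendsto_norm_cobounded_atTop.const_div_atTop c
  have h2 := ENNReal.Tendsto.mul_const (b := D) (ENNReal.tendsto_ofReal h1) (Or.inr hD)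
  rw [ENNReal.ofReal_zero, zero_mul] at h2
  exact h2.eventually_le_const (pos_iff_ne_zero.2 he)

end BirmanSchwinger

end

open BirmanSchwinger

theorem mainTheorem4 (n : ℕ) (hn : 1 ≤ n) (a b : ℝ≥0∞) (ha : 1 ≤ a) (hb : 1 ≤ b)
    (hab : 2 - 2 / a = (n : ℝ≥0∞) / b) (hend : ¬ (n = 2 ∧ a = ∞ ∧ b = 1))
    (S T : ℝ) (hST : S < T)
    (W₁ W₂ : BirmanSchwinger.SpaceTime n → ℂ)
    (hmeas₁ : AEStronglyMeasurable W₁ volume) (hmeas₂ : AEStronglyMeasurable W₂ volume)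
    (hsupp₁ : ∀ᵐ z : BirmanSchwinger.SpaceTime n, z.1 ∉ Set.Icc S T → W₁ z = 0)
    (hsupp₂ : ∀ᵐ z : BirmanSchwinger.SpaceTime n, z.1 ∉ Set.Icc S T → W₂ z = 0)
    (hmem₁ : BirmanSchwinger.MemMixed a b (fun z => ‖W₁ z‖ ^ 2))
    (hmem₂ : BirmanSchwinger.MemMixed a b (fun z => ‖W₂ z‖ ^ 2))
    (R₁ R₂ : ℝ) (hR₁ : 0 < R₁) (hR₂ : 0 < R₂)
    (hdecay₁ : BirmanSchwinger.decayQuantity R₁ W₁ < ∞)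
    (hdecay₂ : BirmanSchwinger.decayQuantity R₂ W₂ < ∞)
    (hcont₁ : 3 ≤ n → a = ∞ → b = (n : ℝ≥0∞) / 2 →
      BirmanSchwinger.ContinuousInTime (n : ℝ≥0∞) R₁ W₁)
    (hcont₂ : 3 ≤ n → a = ∞ → b = (n : ℝ≥0∞) / 2 →
      BirmanSchwinger.ContinuousInTime (n : ℝ≥0∞) R₂ W₂) :
    ∃ B : BirmanSchwinger.Space n →
        (Lp ℂ 2 (volume : Measure (BirmanSchwinger.SpaceTime n)) →L[ℂ]
          Lp ℂ 2 (volume : Measure (BirmanSchwinger.SpaceTime n))),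
      (∀ ν, ν ≠ 0 → BirmanSchwinger.IsMSM a b W₁ W₂ ν (B ν)) ∧
      Tendsto (fun ν => ‖B ν‖) (Bornology.cobounded (BirmanSchwinger.Space n)) (𝓝 0) := by
  obtain ⟨C, hC, hform⟩ := exists_formBound ha hb hab hend
  have hN₁ := mixedNorm_ne_top_of_memMixed hmem₁
  have hN₂ := mixedNorm_ne_top_of_memMixed hmem₂
  have hex : ∀ ν : Space n, ∃ B : Lp ℂ 2 (volume : Measure (SpaceTime n)) →L[ℂ]
      Lp ℂ 2 (volume : Measure (SpaceTime n)), ν ≠ 0 → IsMSM a b W₁ W₂ ν B := by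
    intro ν
    rcases eq_or_ne ν 0 with h0 | h0
    -- The operator at `ν = 0` is irrelevant.
    · exact ⟨0, fun h => absurd h0 h⟩
    · obtain ⟨B, hB⟩ := (hform ν h0).exists_isMSM hC h0 ha hb hmeas₁ hmeas₂ hN₁ hN₂
      exact ⟨B, fun _ => hB⟩
  choose B hB using hex
  refine ⟨B, hB, ?_⟩
  rw [← tendsto_zero_iff_norm_tendsto_zero, tendsto_zero_iff_enorm_tendsto_zero,
    ENNReal.tendsto_nhds_zero]
  intro e he
  wlog het : e ≠ ∞ generalizing e
  · push Not at het
    exact Eventually.of_forall fun ν => het ▸ le_top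
  have he2 : e / 2 ≠ 0 := (ENNReal.half_pos he.ne').ne'
  -- The splitting makes the uniformly estimated terms at most `e / 2`; it does not depend on `ν`,
  -- so that the remaining term is at most `e / 2` for large `ν`.
  obtain ⟨κ, hκ0, hκ, hsmall⟩ := exists_small_factor hC hN₁ hN₂ he2
  obtain ⟨V₁, Z₁, D₁, hV₁, hZ₁, e₁, hVN₁, hZN₁, hD₁, hw₁⟩ :=
    exists_splitting hn ha hb hab hend hmeas₁ hsupp₁ hN₁ hdecay₁ hcont₁ hκ0
  obtain ⟨V₂, Z₂, D₂, hV₂, hZ₂, e₂, hVN₂, hZN₂, hD₂, hw₂⟩ :=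
    exists_splitting hn ha hb hab hend hmeas₂ hsupp₂ hN₂ hdecay₂ hcont₂ hκ0
  have hD : D₂ ^ (1 / 2 : ℝ) * D₁ ^ (1 / 2 : ℝ) ≠ ∞ := ENNReal.mul_ne_top
    (ENNReal.rpow_ne_top_of_nonneg (by norm_num) hD₂)
    (ENNReal.rpow_ne_top_of_nonneg (by norm_num) hD₁)
  filter_upwards [eventually_ofReal_div_norm_mul_le ((2 * Real.pi) ^ (n + 1)) hD he2,
    eventually_cobounded_le_norm (E := Space n) 1] with ν hν hν1
  have hpos : 0 < ‖ν‖ := zero_lt_one.trans_le hν1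
  have hν0 : ν ≠ 0 := norm_pos_iff.1 hpos
  have hω : ‖‖ν‖⁻¹ • ν‖ = 1 := by
    rw [norm_smul, norm_inv, norm_norm, inv_mul_cancel₀ hpos.ne']
  have hdir : ‖ν‖ • (‖ν‖⁻¹ • ν) = ν := smul_inv_smul₀ hpos.ne' ν
  refine (hB ν hν0).enorm_le het fun u v G hu hv hG => ?_
  have hf := hform ν hν0
  rw [← hdir] at hf hG
  refine (hf.enorm_integral_split_le hpos hω hC ha hb hV₁ hZ₁ hV₂ hZ₂ e₁ e₂ hN₁ hN₂ hκ
    hVN₁ hVN₂ hZN₁ hZN₂ (hw₁ _ hω) (hw₂ _ hω) hu hv hG).trans ?_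
  gcongr
  exact (add_le_add hsmall hν).trans_eq (ENNReal.add_halves e)
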